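/- Let $\tau$ be a complex number with positive imaginary part, $\Lambda=\mathbb Z+\mathbb Z\tau$, let $E=\mathbb C/\Lambda$ and $X=E\setminus\{0\}$, and let $\Gamma_n$ be the coordinate ring of the configuration space $F(X,n)=\{(x_1,\dots,x_n)\in X^n\mid x_i\ne x_j \text{ for } i\ne j\}$, i.e. the ring of regular functions on it in the affine coordinates $(\wp(x_i),\wp'(x_i))_{1\le i\le n}$, with the derivations $\partial_i=\partial/\partial x_i$. Let $V$ be a $\mathbb Z_{\ge 0}$-graded vertex algebra over $\mathbb C$ with products $a_{(m)}b$, fields $Y(a,z)=\sum_m a_{(m)}z^{-m-1}$ and translation operator $T$. Put $$\widetilde C_n=\Gamma_n\otimes V^{\otimes n+1},\qquad C_n=\widetilde C_n\Big/\sum_{i=1}^n(\partial_i+T_i)\widetilde C_n\qquad(n\ge 0),$$ where $T_i$ is $T$ acting on the $i$-th tensor factor. For $n\ge 1$ consider $$d=\sum_{1\le i<j\le n}(-1)^{n-i}d^{(ij)}+\sum_{1\le i\le n}(-1)^{n-i}p^{(i)}:\ \widetilde C_n\to\widetilde C_{n-1},$$ where $$d^{(ij)}(f\,a^1\otimes\cdots\otimes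 a^n\otimes b)=\operatorname{Res}_{x_i=x_j} f\,a^1\otimes\cdots\widehat{a^i}\cdots\otimes Y(a^i,x_i-x_j)a^j\otimes\cdots\otimes a^n\otimes b=\sum_{m\in\mathbb Z}f^{(m)}\,a^1\otimes\cdots\widehat{a^i}\cdots\otimes a^i_{(m)}a^j\otimes\cdots\otimes a^n\otimes b,$$ $$p^{(i)}(f\,a^1\otimes\cdots\otimes a^n\otimes b)=\operatorname{Res}_{x_i=0} f\,a^1\otimes\cdots\widehat{a^i}\cdots\otimes a^n\otimes Y(a^i,x_i)b=\sum_{m\in\mathbb Z}f^{(m)}\,a^1\otimes\cdots\widehat{a^i}\cdots\otimes a^n\otimes a^i_{(m)}b,$$ $f^{(m)}=\frac1{2\pi i}\oint f\,(x_i-c)^{-m-1}dx_i$ (over a small circle around $c$) being the Laurent coefficients of $f$ in $x_i$ at $c=x_j$, respectively $c=0$, as functions of the remaining variables, which are then renumbered $x_1,\dots,x_{n-1}$. Let $\sigma\in\Sigma_n$ act on $\widetilde C_n$, and thereby on $C_n$, by $$\sigma\big(f(x_1,\dots,x_n)\,a^1\otimes\cdots\otimes a^n\otimes b\big)=\operatorname{sgn}(\sigma)\,f(x_{\sigma(1)},\dots,x_{\sigma(n)})\,a^{\sigma^{-1}(1)}\otimes\cdots\otimes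 a^{\sigma^{-1}(n)}\otimes b,$$ and let $Q_n=(C_n)_{\Sigma_n}=C_n/I_n$ be the coinvariants, where $I_n$ is the span of all $A-\sigma(A)$ with $A\in C_n$ and $\sigma\in\Sigma_n$. Then the following holds. For $f\in\Gamma_n$ ($n\ge1$) the integrals defining $f^{(m)}$ do not depend on the radius of the circle when it is small, the functions $f^{(m)}$ lie in $\Gamma_{n-1}$, and $f^{(m)}=0$ for all sufficiently negative $m$. The formula for $d$ determines a unique linear map $\widetilde C_n\to\widetilde C_{n-1}$ for every $n\ge 1$. These maps descend to linear maps $d:C_n\to C_{n-1}$ with $d\circ d=0$, and the latter descend further to linear maps $d:Q_n\to Q_{n-1}$ with $d\circ d=0$. In other words, the spaces $Q_n$ with the differential induced from $C_\bullet$ form a complex. -/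

import Mathlib

open scoped TensorProduct UpperHalfPlane Topology

noncomputable section

namespace ChiralHomology

/-! ### Vertex algebras -/

/-- A vertex algebra over `ℂ`: `prod n a b` is the `n`-th product `a_(n) b`. The sums over `j` have
finitely many nonzero terms by `field_property`. -/
structure VertexAlgebra (V : Type*) [AddCommGroup V] [Module ℂ V] where
  prod : ℤ → V →ₗ[ℂ] V →ₗ[ℂ] V
  vac : V
  vac_ne_zero : vac ≠ 0
  field_property : ∀ a b : V, ∃ N : ℤ, ∀ n : ℤ, N ≤ n → prod n a b = 0
  vac_prod : ∀ (n : ℤ) (a : V), prod n vac a = if n = -1 then a else 0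
  prod_vac_of_nonneg : ∀ (n : ℤ) (a : V), 0 ≤ n → prod n a vac = 0
  prod_vac : ∀ a : V, prod (-1) a vac = a
  borcherds : ∀ (a b c : V) (m n k : ℤ),
    (∑ᶠ j : ℕ, (Ring.choose m j : ℤ) • prod (m + k - j) (prod (n + j) a b) c) =
      ∑ᶠ j : ℕ, ((-1 : ℤ) ^ j * Ring.choose n j) •
        (prod (n + m - j) a (prod (k + j) b c) -
          (-1 : ℂ) ^ n • prod (n + k - j) b (prod (m + j) a c))

/-- The translation operator `T a = a_(-2) 1`. -/
def VertexAlgebra.translation {V : Type*} [AddCommGroup V] [Module ℂ V] (𝒱 : VertexAlgebra V) :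
    V →ₗ[ℂ] V :=
  (𝒱.prod (-2)).flip 𝒱.vac

/-- A graded vertex algebra: a vertex algebra with a direct sum decomposition `V = ⨁ Vₚ` over
`p ∈ ℕ`, such that `1 ∈ V₀`, `T Vₚ ⊆ Vₚ₊₁`, and `a_(n) b` has degree `p + q - n - 1` for `a ∈ Vₚ`
and `b ∈ V_q` (so that it is zero when this number is negative). -/
structure GradedVertexAlgebra (V : Type*) [AddCommGroup V] [Module ℂ V]
    extends VertexAlgebra V where
  deg : ℕ → Submodule ℂ V
  isInternal : DirectSum.IsInternal deg
  vac_mem : vac ∈ deg 0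
  translation_mem : ∀ (p : ℕ) (a : V), a ∈ deg p → toVertexAlgebra.translation a ∈ deg (p + 1)
  prod_mem : ∀ (p q r : ℕ) (n : ℤ) (a b : V), a ∈ deg p → b ∈ deg q →
    (r : ℤ) = p + q - n - 1 → prod n a b ∈ deg r
  prod_eq_zero : ∀ (p q : ℕ) (n : ℤ) (a b : V), a ∈ deg p → b ∈ deg q →
    (p : ℤ) + q - n - 1 < 0 → prod n a b = 0

/-! ### Regular functions on the configuration space of the punctured elliptic curve -/

/-- The periods `1, τ`. -/
def periods (τ : ℍ) : PeriodPair where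
  ω₁ := 1
  ω₂ := τ
  indep := by
    rw [LinearIndependent.pair_iff]
    intro s t h
    have him : t * τ.im = 0 := by simpa using congrArg Complex.im h
    have ht : t = 0 := (mul_eq_zero.mp him).resolve_right τ.im_ne_zero
    subst ht
    exact ⟨by simpa using congrArg Complex.re h, rfl⟩

/-- The preimage in `ℂⁿ` of the configuration space `F(X, n)` of the punctured elliptic curve
`X = (ℂ / Λ) \ {0}`, where `Λ = ℤ + ℤ τ`. -/
def config (τ : ℍ) (n : ℕ) : Set (Fin n → ℂ) :=
  {x | (∀ i, x i ∉ (periods τ).lattice) ∧ ∀ i j, i ≠ j → x i - x j ∉ (periods τ).lattice}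

/-- The affine coordinates `(uᵢ, vᵢ) = (℘(xᵢ), ℘'(xᵢ))` of the `n` points of `X`. -/
def coords (τ : ℍ) {n : ℕ} (x : Fin n → ℂ) : Fin n ⊕ Fin n → ℂ :=
  Sum.elim (fun i => (periods τ).weierstrassP (x i)) (fun i => (periods τ).derivWeierstrassP (x i))

/-- `f` is a regular function on `F(X, n)`, regarded as a locally closed subvariety of affine
space through the coordinates `uᵢ, vᵢ`: near every point it is a quotient of polynomials in the
coordinates, with non-vanishing denominator. -/
def IsRegularFun (τ : ℍ) {n : ℕ} (f : config τ n → ℂ) : Prop :=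
  ∀ x : config τ n, ∃ p q : MvPolynomial (Fin n ⊕ Fin n) ℂ,
    MvPolynomial.eval (coords τ x.1) q ≠ 0 ∧
    ∀ y : config τ n,
      f y * MvPolynomial.eval (coords τ y.1) q = MvPolynomial.eval (coords τ y.1) p

/-- The coordinate ring `Γₙ` of `F(X, n)`. -/
def Gam (τ : ℍ) (n : ℕ) : Subalgebra ℂ (config τ n → ℂ) where
  carrier := {f | IsRegularFun τ f}
  mul_mem' := by
    intro f g hf hg x
    obtain ⟨p, q, hq, h⟩ := hf x
    obtain ⟨p', q', hq', h'⟩ := hg x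
    refine ⟨p * p', q * q', by simpa using ⟨hq, hq'⟩, fun y => ?_⟩
    simp only [Pi.mul_apply, map_mul, ← h, ← h']
    ring
  add_mem' := by
    intro f g hf hg x
    obtain ⟨p, q, hq, h⟩ := hf x
    obtain ⟨p', q', hq', h'⟩ := hg x
    refine ⟨p * q' + p' * q, q * q', by simpa using ⟨hq, hq'⟩, fun y => ?_⟩
    simp only [Pi.add_apply, map_mul, map_add, ← h, ← h']
    ring
  algebraMap_mem' := fun c x => ⟨MvPolynomial.C c, 1, by simp, fun y => by simp⟩

/-! ### The derivations `∂ᵢ` of `Γₙ` -/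

/-- Extension by zero to `ℂⁿ`. -/
def ext (τ : ℍ) {n : ℕ} (f : config τ n → ℂ) : (Fin n → ℂ) → ℂ :=
  Function.extend Subtype.val f 0

lemma ext_apply (τ : ℍ) {n : ℕ} (f : config τ n → ℂ) (x : config τ n) : ext τ f x.1 = f x :=
  Subtype.val_injective.extend_apply f 0 x

/-- The partial derivative `∂f/∂xᵢ`. -/
def pderivFun (τ : ℍ) {n : ℕ} (i : Fin n) (f : config τ n → ℂ) : config τ n → ℂ :=
  fun x => deriv (fun z : ℂ => ext τ f (Function.update x.1 i z)) (x.1 i)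

lemma isOpen_config (τ : ℍ) (n : ℕ) : IsOpen (config τ n) := by
  have h : IsOpen ((periods τ).lattice : Set ℂ)ᶜ := (periods τ).isClosed_lattice.isOpen_compl
  have e : config τ n = (⋂ i, (fun x : Fin n → ℂ => x i) ⁻¹' ((periods τ).lattice : Set ℂ)ᶜ) ∩
      ⋂ i, ⋂ j, ⋂ _ : i ≠ j,
        (fun x : Fin n → ℂ => x i - x j) ⁻¹' ((periods τ).lattice : Set ℂ)ᶜ := by
    ext x
    simp [config]
  rw [e]
  refine (isOpen_iInter_of_finite fun i => h.preimage (continuous_apply i)).inter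
    (isOpen_iInter_of_finite fun i => isOpen_iInter_of_finite fun j =>
      isOpen_iInter_of_finite fun _ =>
        h.preimage ((continuous_apply i).sub (continuous_apply j)))

lemma eventually_update_mem (τ : ℍ) {n : ℕ} (i : Fin n) (x : config τ n) :
    ∀ᶠ z in 𝓝 (x.1 i), Function.update x.1 i z ∈ config τ n := by
  have hc : Continuous fun z : ℂ => Function.update x.1 i z := by fun_prop
  refine hc.continuousAt.eventually_mem ((isOpen_config τ n).mem_nhds ?_)
  simp

lemma hasDerivAt_weierstrassP (τ : ℍ) {z : ℂ} (hz : z ∉ (periods τ).lattice) :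
    HasDerivAt (periods τ).weierstrassP ((periods τ).derivWeierstrassP z) z := by
  have := ((periods τ).analyticOnNhd_weierstrassP z hz).differentiableAt.hasDerivAt
  rwa [(periods τ).deriv_weierstrassP] at this

lemma isPreconnected_compl_lattice (τ : ℍ) :
    IsPreconnected ((periods τ).lattice : Set ℂ)ᶜ := by
  have : Countable (periods τ).lattice :=
    ((periods τ).latticeEquivProd).toEquiv.injective.countable
  exact ((Set.to_countable _).isConnected_compl_of_one_lt_rank
    (by simp [Complex.rank_real_complex])).isPreconnected

/-- `℘'' = 6 ℘² - g₂ / 2`. -/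
lemma hasDerivAt_derivWeierstrassP (τ : ℍ) {z : ℂ} (hz : z ∉ (periods τ).lattice) :
    HasDerivAt (periods τ).derivWeierstrassP
      (6 * (periods τ).weierstrassP z ^ 2 - (periods τ).g₂ / 2) z := by
  set L := periods τ with hL
  have hopen : IsOpen ((L.lattice : Set ℂ)ᶜ) := L.isClosed_lattice.isOpen_compl
  have hP := L.analyticOnNhd_weierstrassP
  have hP' := L.analyticOnNhd_derivWeierstrassP
  have key : ∀ w ∉ L.lattice,
      L.derivWeierstrassP w * (deriv L.derivWeierstrassP w -
        (6 * L.weierstrassP w ^ 2 - L.g₂ / 2)) = 0 := by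
    intro w hw
    have h1 : HasDerivAt (fun w => L.derivWeierstrassP w ^ 2)
        (2 * L.derivWeierstrassP w * deriv L.derivWeierstrassP w) w := by
      simpa using (hP' w hw).differentiableAt.hasDerivAt.fun_pow 2
    have hPw := hasDerivAt_weierstrassP τ hw
    have h2 : HasDerivAt (fun w => 4 * L.weierstrassP w ^ 3 - L.g₂ * L.weierstrassP w - L.g₃)
        (4 * (3 * L.weierstrassP w ^ 2 * L.derivWeierstrassP w) -
          L.g₂ * L.derivWeierstrassP w) w := by
      simpa using (((hPw.fun_pow 3).const_mul 4).fun_sub (hPw.const_mul L.g₂)).sub_const L.g₃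
    have h3 : (fun w => L.derivWeierstrassP w ^ 2) =ᶠ[𝓝 w]
        fun w => 4 * L.weierstrassP w ^ 3 - L.g₂ * L.weierstrassP w - L.g₃ := by
      filter_upwards [hopen.mem_nhds hw] with v hv using L.derivWeierstrassP_sq v hv
    have := h1.unique (h2.congr_of_eventuallyEq h3)
    linear_combination this / 2
  have han : AnalyticOnNhd ℂ (fun w => deriv L.derivWeierstrassP w -
      (6 * L.weierstrassP w ^ 2 - L.g₂ / 2)) (L.lattice : Set ℂ)ᶜ := by
    intro w hw
    have a1 := (hP' w hw).deriv
    have a2 := hP w hw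
    fun_prop
  have hzero : deriv L.derivWeierstrassP z - (6 * L.weierstrassP z ^ 2 - L.g₂ / 2) = 0 := by
    rcases (hP' z hz).eventually_eq_zero_or_eventually_ne_zero with h0 | h0
    · exfalso
      have hz' : Set.EqOn L.derivWeierstrassP 0 (L.lattice : Set ℂ)ᶜ :=
        hP'.eqOn_zero_of_preconnected_of_eventuallyEq_zero
          (isPreconnected_compl_lattice τ) hz h0
      obtain ⟨c, hc⟩ := hopen.exists_is_const_of_deriv_eq_zero
        (isPreconnected_compl_lattice τ) L.differentiableOn_weierstrassP
        (fun w hw => by rw [L.deriv_weierstrassP]; exact hz' hw)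
      have hev : L.weierstrassP =ᶠ[𝓝[≠] 0] fun _ => c := by
        filter_upwards [mem_nhdsWithin_of_mem_nhds (L.compl_lattice_sdiff_singleton_mem_nhds 0),
          self_mem_nhdsWithin] with w hw hw0
        exact hc w fun hw' => hw ⟨hw', hw0⟩
      have hord := L.order_weierstrassP 0 (zero_mem _)
      rw [meromorphicOrderAt_congr hev, meromorphicOrderAt_const] at hord
      split_ifs at hord <;> exact absurd hord (by decide)
    · have h1 : ∀ᶠ w in 𝓝[≠] z, deriv L.derivWeierstrassP w -
          (6 * L.weierstrassP w ^ 2 - L.g₂ / 2) = 0 := by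
        filter_upwards [h0, mem_nhdsWithin_of_mem_nhds (hopen.mem_nhds hz)] with w hw hw'
        exact (mul_eq_zero.mp (key w hw')).resolve_left hw
      have h2 := (han z hz).frequently_zero_iff_eventually_zero.mp h1.frequently
      exact h2.self_of_nhds
  have := (hP' z hz).differentiableAt.hasDerivAt
  rwa [sub_eq_zero.mp hzero] at this

/-- The derivation of the polynomial ring which lifts `∂ᵢ`. -/
def polyDeriv (τ : ℍ) {n : ℕ} (i : Fin n) :
    Derivation ℂ (MvPolynomial (Fin n ⊕ Fin n) ℂ) (MvPolynomial (Fin n ⊕ Fin n) ℂ) :=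
  MvPolynomial.mkDerivation ℂ (Sum.elim
    (fun k => if k = i then MvPolynomial.X (Sum.inr i) else 0)
    (fun k => if k = i then
      6 * MvPolynomial.X (Sum.inl i) ^ 2 - MvPolynomial.C ((periods τ).g₂ / 2) else 0))

lemma hasDerivAt_eval (τ : ℍ) {n : ℕ} (i : Fin n) (y : config τ n)
    (p : MvPolynomial (Fin n ⊕ Fin n) ℂ) :
    HasDerivAt (fun z : ℂ => MvPolynomial.eval (coords τ (Function.update y.1 i z)) p)
      (MvPolynomial.eval (coords τ y.1) (polyDeriv τ i p)) (y.1 i) := by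
  induction p using MvPolynomial.induction_on with
  | C a =>
    have : polyDeriv τ i (MvPolynomial.C a) = 0 := MvPolynomial.derivation_C _ a
    simpa [this] using hasDerivAt_const (y.1 i) a
  | add p q hp hq => simpa using hp.fun_add hq
  | mul_X p k hp =>
    have hX : HasDerivAt
        (fun z : ℂ => MvPolynomial.eval (coords τ (Function.update y.1 i z))
          (MvPolynomial.X k : MvPolynomial (Fin n ⊕ Fin n) ℂ))
        (MvPolynomial.eval (coords τ y.1) (polyDeriv τ i (MvPolynomial.X k))) (y.1 i) := by
      rcases k with k | k
      · by_cases hk : k = i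
        · subst hk
          simpa [polyDeriv, coords, MvPolynomial.mkDerivation_X] using
            hasDerivAt_weierstrassP τ (y.2.1 k)
        · simpa [polyDeriv, coords, MvPolynomial.mkDerivation_X, hk] using
            hasDerivAt_const (y.1 i) _
      · by_cases hk : k = i
        · subst hk
          simpa [polyDeriv, coords, MvPolynomial.mkDerivation_X] using
            hasDerivAt_derivWeierstrassP τ (y.2.1 k)
        · simpa [polyDeriv, coords, MvPolynomial.mkDerivation_X, hk] using
            hasDerivAt_const (y.1 i) _
    have h := hp.fun_mul hX
    simp only [Function.update_eq_self] at h
    simp only [map_mul, Derivation.leibniz, smul_eq_mul, map_add]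
    refine h.congr_deriv ?_
    ring

lemma hasDerivAt_pderivFun (τ : ℍ) {n : ℕ} (i : Fin n) {f : config τ n → ℂ}
    (hf : IsRegularFun τ f) (y : config τ n) :
    HasDerivAt (fun z : ℂ => ext τ f (Function.update y.1 i z)) (pderivFun τ i f y) (y.1 i) := by
  obtain ⟨p, q, hq, h⟩ := hf y
  have hp' := hasDerivAt_eval τ i y p
  have hq' := hasDerivAt_eval τ i y q
  have hne : MvPolynomial.eval (coords τ (Function.update y.1 i (y.1 i))) q ≠ 0 := by
    simpa using hq
  refine DifferentiableAt.hasDerivAt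
    ((hp'.div hq' hne).differentiableAt.congr_of_eventuallyEq ?_)
  filter_upwards [eventually_update_mem τ i y, hq'.continuousAt.eventually_ne hne] with z hz hz'
  have e := h ⟨_, hz⟩
  rw [← ext_apply τ f ⟨_, hz⟩] at e
  exact eq_div_of_mul_eq hz' e

lemma isRegularFun_pderivFun (τ : ℍ) {n : ℕ} (i : Fin n) {f : config τ n → ℂ}
    (hf : IsRegularFun τ f) : IsRegularFun τ (pderivFun τ i f) := by
  intro x
  obtain ⟨p, q, hq, h⟩ := hf x
  refine ⟨polyDeriv τ i p * q - p * polyDeriv τ i q, q * q, by simpa using hq, fun y => ?_⟩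
  have h1 := (hasDerivAt_pderivFun τ i hf y).mul (hasDerivAt_eval τ i y q)
  have h2 := h1.unique ((hasDerivAt_eval τ i y p).congr_of_eventuallyEq (by
    filter_upwards [eventually_update_mem τ i y] with z hz
    simpa [ext_apply τ f ⟨_, hz⟩] using h ⟨_, hz⟩))
  simp only [Function.update_eq_self, ext_apply] at h2
  simp only [map_mul, map_sub, ← h y, ← h2]
  ring

/-- The derivation `∂ᵢ` as a linear endomorphism of `Γₙ`. -/
def pd (τ : ℍ) {n : ℕ} (i : Fin n) : Gam τ n →ₗ[ℂ] Gam τ n where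
  toFun f := ⟨pderivFun τ i f.1, isRegularFun_pderivFun τ i f.2⟩
  map_add' f g := by
    refine Subtype.ext (funext fun y => ?_)
    refine ((hasDerivAt_pderivFun τ i (f + g).2 y).unique
      (((hasDerivAt_pderivFun τ i f.2 y).add
        (hasDerivAt_pderivFun τ i g.2 y)).congr_of_eventuallyEq ?_))
    filter_upwards [eventually_update_mem τ i y] with z hz
    simp [ext_apply τ _ ⟨_, hz⟩]
  map_smul' c f := by
    refine Subtype.ext (funext fun y => ?_)
    refine ((hasDerivAt_pderivFun τ i (c • f).2 y).unique
      (((hasDerivAt_pderivFun τ i f.2 y).const_smul c).congr_of_eventuallyEq ?_))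
    filter_upwards [eventually_update_mem τ i y] with z hz
    simp [ext_apply τ _ ⟨_, hz⟩]

/-! ### Permutation of the variables -/

lemma comp_perm_mem (τ : ℍ) {n : ℕ} (σ : Equiv.Perm (Fin n)) {x : Fin n → ℂ}
    (hx : x ∈ config τ n) : x ∘ σ ∈ config τ n :=
  ⟨fun i => hx.1 (σ i), fun i j hij => hx.2 (σ i) (σ j) (σ.injective.ne hij)⟩

/-- The function `f(x_{σ(1)}, …, x_{σ(n)})`. -/
def permFun (τ : ℍ) {n : ℕ} (σ : Equiv.Perm (Fin n)) (f : config τ n → ℂ) : config τ n → ℂ :=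
  fun x => f ⟨x.1 ∘ σ, comp_perm_mem τ σ x.2⟩

lemma isRegularFun_permFun (τ : ℍ) {n : ℕ} (σ : Equiv.Perm (Fin n)) {f : config τ n → ℂ}
    (hf : IsRegularFun τ f) : IsRegularFun τ (permFun τ σ f) := by
  intro x
  obtain ⟨p, q, hq, h⟩ := hf ⟨x.1 ∘ σ, comp_perm_mem τ σ x.2⟩
  have e : ∀ y : Fin n → ℂ, coords τ (y ∘ σ) = coords τ y ∘ Sum.map σ σ := by
    intro y
    funext k
    rcases k with k | k <;> rfl
  refine ⟨MvPolynomial.rename (Sum.map σ σ) p, MvPolynomial.rename (Sum.map σ σ) q, ?_,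
    fun y => ?_⟩
  · rwa [MvPolynomial.eval_rename, ← e]
  · rw [MvPolynomial.eval_rename, MvPolynomial.eval_rename, ← e]
    exact h _

/-- The substitution `f ↦ f(x_{σ(1)}, …, x_{σ(n)})` as a linear endomorphism of `Γₙ`. -/
def permGam (τ : ℍ) {n : ℕ} (σ : Equiv.Perm (Fin n)) : Gam τ n →ₗ[ℂ] Gam τ n where
  toFun f := ⟨permFun τ σ f.1, isRegularFun_permFun τ σ f.2⟩
  map_add' _ _ := rfl
  map_smul' _ _ := rfl

lemma pd_permGam (τ : ℍ) {n : ℕ} (σ : Equiv.Perm (Fin n)) (i : Fin n) (f : Gam τ n) :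
    permGam τ σ (pd τ i f) = pd τ (σ i) (permGam τ σ f) := by
  refine Subtype.ext (funext fun y => ?_)
  have h := hasDerivAt_pderivFun τ i f.2 ⟨y.1 ∘ σ, comp_perm_mem τ σ y.2⟩
  refine h.unique
    ((hasDerivAt_pderivFun τ (σ i) (permGam τ σ f).2 y).congr_of_eventuallyEq ?_)
  filter_upwards [eventually_update_mem τ (σ i) y] with z hz
  have e : Function.update (y.1 ∘ σ) i z = Function.update y.1 (σ i) z ∘ σ := by
    funext k
    by_cases hk : k = i
    · subst hk; simp
    · simp [Function.update_of_ne hk, Function.update_of_ne (σ.injective.ne hk)]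
  change ext τ f.1 (Function.update (y.1 ∘ σ) i z) = _
  rw [e, ext_apply τ f.1 ⟨_, comp_perm_mem τ σ hz⟩, ext_apply τ _ ⟨_, hz⟩]
  rfl

/-! ### The spaces `C̃ₙ`, `Cₙ` and `Qₙ` -/

section Spaces

variable {V : Type*} [AddCommGroup V] [Module ℂ V]

/-- The vector space `V^{⊗ n + 1}`, with the last tensor factor split off. -/
abbrev Tens (V : Type*) [AddCommGroup V] [Module ℂ V] (n : ℕ) : Type _ :=
  (⨂[ℂ] _ : Fin n, V) ⊗[ℂ] V

/-- The vector space `C̃ₙ = Γₙ ⊗ V^{⊗ n + 1}`. -/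
abbrev CTilde (V : Type*) [AddCommGroup V] [Module ℂ V] (τ : ℍ) (n : ℕ) : Type _ :=
  Gam τ n ⊗[ℂ] Tens V n

instance (V : Type*) [AddCommGroup V] [Module ℂ V] (n : ℕ) : AddCommGroup (Tens V n) :=
  TensorProduct.addCommGroup

instance (V : Type*) [AddCommGroup V] [Module ℂ V] (τ : ℍ) (n : ℕ) :
    AddCommGroup (CTilde V τ n) :=
  TensorProduct.addCommGroup

/-- The element `f a¹ ⊗ ⋯ ⊗ aⁿ ⊗ b` of `C̃ₙ`. -/
def elt {τ : ℍ} {n : ℕ} (f : Gam τ n) (a : Fin n → V) (b : V) : CTilde V τ n :=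
  f ⊗ₜ[ℂ] (PiTensorProduct.tprod ℂ a ⊗ₜ[ℂ] b)

lemma hom_ext_elt {τ : ℍ} {n : ℕ} {W : Type*} [AddCommGroup W] [Module ℂ W]
    {A B : CTilde V τ n →ₗ[ℂ] W} (h : ∀ f a b, A (elt f a b) = B (elt f a b)) : A = B := by
  refine TensorProduct.ext (LinearMap.ext fun f => TensorProduct.ext
    (PiTensorProduct.ext (MultilinearMap.ext fun a => LinearMap.ext fun b => h f a b)))

/-- The operator `∂ᵢ + Tᵢ` on `C̃ₙ`. -/
def totalDeriv (𝒱 : GradedVertexAlgebra V) (τ : ℍ) {n : ℕ} (i : Fin n) :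
    CTilde V τ n →ₗ[ℂ] CTilde V τ n :=
  TensorProduct.map (pd τ i) LinearMap.id +
    TensorProduct.map LinearMap.id (TensorProduct.map
      (PiTensorProduct.map (Function.update (fun _ => LinearMap.id) i 𝒱.translation))
      LinearMap.id)

/-- The subspace `∑ᵢ (∂ᵢ + Tᵢ) C̃ₙ`. -/
def totalDerivs (𝒱 : GradedVertexAlgebra V) (τ : ℍ) (n : ℕ) : Submodule ℂ (CTilde V τ n) :=
  ⨆ i, LinearMap.range (totalDeriv 𝒱 τ i)

/-- The space `Cₙ = C̃ₙ / ∑ᵢ (∂ᵢ + Tᵢ) C̃ₙ` of `n`-chains of the ordered chiral complex. -/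
abbrev Chain (𝒱 : GradedVertexAlgebra V) (τ : ℍ) (n : ℕ) : Type _ :=
  CTilde V τ n ⧸ totalDerivs 𝒱 τ n

lemma totalDeriv_elt (𝒱 : GradedVertexAlgebra V) (τ : ℍ) {n : ℕ} (i : Fin n) (f : Gam τ n)
    (a : Fin n → V) (b : V) :
    totalDeriv 𝒱 τ i (elt f a b) =
      elt (pd τ i f) a b + elt f (Function.update a i (𝒱.translation (a i))) b := by
  have e : (fun k => (Function.update (fun _ => LinearMap.id) i 𝒱.translation :
      Fin n → V →ₗ[ℂ] V) k (a k)) = Function.update a i (𝒱.translation (a i)) := by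
    funext k
    by_cases hk : k = i
    · subst hk; simp
    · simp [hk]
  simp [totalDeriv, elt, e]

/-- The signed action of `σ ∈ Σₙ` on `C̃ₙ`: it sends `f(x₁, …, xₙ) a¹ ⊗ ⋯ ⊗ aⁿ ⊗ b` to
`sgn(σ) f(x_{σ(1)}, …, x_{σ(n)}) a^{σ⁻¹(1)} ⊗ ⋯ ⊗ a^{σ⁻¹(n)} ⊗ b`, so that `aⁱ`, which belongs to
the `i`-th variable of `f`, is moved to the tensor factor `σ(i)`. -/
def permTilde (V : Type*) [AddCommGroup V] [Module ℂ V] (τ : ℍ) {n : ℕ}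
    (σ : Equiv.Perm (Fin n)) : CTilde V τ n →ₗ[ℂ] CTilde V τ n :=
  ((Equiv.Perm.sign σ : ℤ) : ℂ) • TensorProduct.map (permGam τ σ)
    (TensorProduct.map (PiTensorProduct.reindex ℂ (fun _ : Fin n => V) σ).toLinearMap
      LinearMap.id)

lemma permTilde_elt (τ : ℍ) {n : ℕ} (σ : Equiv.Perm (Fin n)) (f : Gam τ n) (a : Fin n → V)
    (b : V) : permTilde V τ σ (elt f a b) =
      ((Equiv.Perm.sign σ : ℤ) : ℂ) • elt (permGam τ σ f) (a ∘ σ.symm) b := by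
  simp only [permTilde, elt, LinearMap.smul_apply, TensorProduct.map_tmul,
    LinearEquiv.coe_coe, LinearMap.id_apply]
  rw [PiTensorProduct.reindex_tprod]
  rfl

/-- The signed action as a representation of `Σₙ` on `C̃ₙ`. -/
def repTilde (V : Type*) [AddCommGroup V] [Module ℂ V] (τ : ℍ) (n : ℕ) :
    Representation ℂ (Equiv.Perm (Fin n)) (CTilde V τ n) where
  toFun σ := permTilde V τ σ
  map_one' := by
    refine hom_ext_elt fun f a b => ?_
    rw [permTilde_elt]
    simp only [Equiv.Perm.sign_one, Units.val_one, Int.cast_one, one_smul]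
    rfl
  map_mul' σ ρ := by
    refine hom_ext_elt fun f a b => ?_
    rw [Module.End.mul_apply, permTilde_elt, permTilde_elt, map_smul, permTilde_elt, smul_smul]
    congr 1
    simp [mul_comm]

lemma permTilde_totalDeriv (𝒱 : GradedVertexAlgebra V) (τ : ℍ) {n : ℕ}
    (σ : Equiv.Perm (Fin n)) (i : Fin n) (A : CTilde V τ n) :
    permTilde V τ σ (totalDeriv 𝒱 τ i A) = totalDeriv 𝒱 τ (σ i) (permTilde V τ σ A) := by
  refine LinearMap.congr_fun (f := permTilde V τ σ ∘ₗ totalDeriv 𝒱 τ i)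
    (g := totalDeriv 𝒱 τ (σ i) ∘ₗ permTilde V τ σ) (hom_ext_elt fun f a b => ?_) A
  have e : Function.update a i (𝒱.translation (a i)) ∘ σ.symm =
      Function.update (a ∘ σ.symm) (σ i) (𝒱.translation ((a ∘ σ.symm) (σ i))) := by
    funext k
    by_cases hk : k = σ i
    · subst hk; simp
    · have hk' : σ.symm k ≠ i := fun h => hk (by rw [← h]; simp)
      simp [hk, hk']
  simp only [LinearMap.comp_apply, totalDeriv_elt, permTilde_elt, map_add, map_smul, e,
    pd_permGam, smul_add]

lemma totalDerivs_le_comap (𝒱 : GradedVertexAlgebra V) (τ : ℍ) (n : ℕ)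
    (σ : Equiv.Perm (Fin n)) :
    totalDerivs 𝒱 τ n ≤ (totalDerivs 𝒱 τ n).comap (repTilde V τ n σ) := by
  refine iSup_le fun i => ?_
  rintro _ ⟨A, rfl⟩
  refine Submodule.mem_comap.mpr ?_
  change permTilde V τ σ (totalDeriv 𝒱 τ i A) ∈ _
  rw [permTilde_totalDeriv]
  exact (le_iSup (fun i => LinearMap.range (totalDeriv 𝒱 τ i)) (σ i)) ⟨_, rfl⟩

/-- The signed action of `Σₙ` on `Cₙ`. -/
def rep (𝒱 : GradedVertexAlgebra V) (τ : ℍ) (n : ℕ) :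
    Representation ℂ (Equiv.Perm (Fin n)) (Chain 𝒱 τ n) :=
  (repTilde V τ n).quotient (totalDerivs 𝒱 τ n) (totalDerivs_le_comap 𝒱 τ n)

/-- The space of coinvariants `Qₙ = (Cₙ)_{Σₙ}`. -/
abbrev Unordered (𝒱 : GradedVertexAlgebra V) (τ : ℍ) (n : ℕ) : Type _ :=
  (rep 𝒱 τ n).Coinvariants

end Spaces

/-! ### Residues and the differential -/

/-- The point at which the variable that is integrated out is expanded: the origin (`none`) or the
`k`-th one of the remaining variables (`some k`). -/
def center {n : ℕ} (s : Option (Fin n)) (y : Fin n → ℂ) : ℂ :=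
  s.elim 0 y

/-- The integral `(2πi)⁻¹ ∮ f (xᵢ - c)^{-m-1} dxᵢ` over the circle `|xᵢ - c| = r`, where `c` is the
centre given by `s`, as a function of the remaining variables `y`. -/
def contourIntegral (τ : ℍ) {n : ℕ} (f : config τ (n + 1) → ℂ) (i : Fin (n + 1))
    (s : Option (Fin n)) (m : ℤ) (y : Fin n → ℂ) (r : ℝ) : ℂ :=
  (2 * Real.pi * Complex.I)⁻¹ *
    ∮ z in C(center s y, r), (z - center s y) ^ (-m - 1) * ext τ f (i.insertNth z y)

/-- The Laurent coefficient `f^{(m)}` of `f` at `xᵢ = c`, a function of the remaining variables: the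
common value of the above integrals for all small `r`. -/
def laurentCoeff (τ : ℍ) {n : ℕ} (f : config τ (n + 1) → ℂ) (i : Fin (n + 1))
    (s : Option (Fin n)) (m : ℤ) : config τ n → ℂ :=
  fun y => Filter.limUnder (𝓝[>] (0 : ℝ)) (contourIntegral τ f i s m y.1)

/-- The Laurent expansions of `f ∈ Γₙ₊₁` make sense: the contour integrals do not depend on the
radius when it is small, the coefficients lie in `Γₙ`, and there are finitely many polar terms. -/
def HasLaurentExpansions (τ : ℍ) {n : ℕ} (f : Gam τ (n + 1)) : Prop :=
  ∀ (i : Fin (n + 1)) (s : Option (Fin n)),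
    (∀ (m : ℤ) (y : config τ n), ∀ᶠ r in 𝓝[>] (0 : ℝ),
      contourIntegral τ f.1 i s m y.1 r = laurentCoeff τ f.1 i s m y) ∧
    (∀ m : ℤ, laurentCoeff τ f.1 i s m ∈ Gam τ n) ∧
    ∃ N : ℤ, ∀ m : ℤ, m < N → laurentCoeff τ f.1 i s m = 0

section Differential

variable {V : Type*} [AddCommGroup V] [Module ℂ V]

/-- The inclusion of `C̃ₙ` in the tensor product of the space of all functions with
`V^{⊗ n + 1}`. -/
def incl (V : Type*) [AddCommGroup V] [Module ℂ V] (τ : ℍ) (n : ℕ) :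
    CTilde V τ n →ₗ[ℂ] (config τ n → ℂ) ⊗[ℂ] Tens V n :=
  TensorProduct.map (Gam τ n).val.toLinearMap LinearMap.id

/-- The residue `d^{(ij)} (f a¹ ⊗ ⋯ ⊗ aⁿ⁺¹ ⊗ b)` at `xᵢ = xⱼ`, where `j = i.succAbove k`: the `i`-th
tensor factor is removed, and the factor `aʲ`, which then has index `k`, is replaced by
`Y(aⁱ, xᵢ - xⱼ) aʲ = ∑ₘ (aⁱ_(m) aʲ) (xᵢ - xⱼ)^{-m-1}`. -/
def dTerm (𝒱 : GradedVertexAlgebra V) (τ : ℍ) {n : ℕ} (f : Gam τ (n + 1))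
    (a : Fin (n + 1) → V) (b : V) (i : Fin (n + 1)) (k : Fin n) :
    (config τ n → ℂ) ⊗[ℂ] Tens V n :=
  ∑ᶠ m : ℤ, laurentCoeff τ f.1 i (some k) m ⊗ₜ[ℂ]
    (PiTensorProduct.tprod ℂ
      (Function.update (i.removeNth a) k (𝒱.prod m (a i) (a (i.succAbove k)))) ⊗ₜ[ℂ] b)

/-- The residue `p^{(i)} (f a¹ ⊗ ⋯ ⊗ aⁿ⁺¹ ⊗ b)` at `xᵢ = 0`. -/
def pTerm (𝒱 : GradedVertexAlgebra V) (τ : ℍ) {n : ℕ} (f : Gam τ (n + 1))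
    (a : Fin (n + 1) → V) (b : V) (i : Fin (n + 1)) :
    (config τ n → ℂ) ⊗[ℂ] Tens V n :=
  ∑ᶠ m : ℤ, laurentCoeff τ f.1 i none m ⊗ₜ[ℂ]
    (PiTensorProduct.tprod ℂ (i.removeNth a) ⊗ₜ[ℂ] 𝒱.prod m (a i) b)

/-- `D` is the map `d = ∑_{i<j} (-1)^{N-i} d^{(ij)} + ∑ᵢ (-1)^{N-i} p^{(i)}` from `C̃_N` to `C̃_{N-1}`,
where `N = n + 1`; the indices `i = 1, …, N` correspond to `0, …, n` here. -/
def IsDifferential (𝒱 : GradedVertexAlgebra V) (τ : ℍ) {n : ℕ}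
    (D : CTilde V τ (n + 1) →ₗ[ℂ] CTilde V τ n) : Prop :=
  ∀ (f : Gam τ (n + 1)) (a : Fin (n + 1) → V) (b : V),
    incl V τ n (D (elt f a b)) =
      (∑ i : Fin (n + 1), ∑ k : Fin n with i < i.succAbove k,
        (-1 : ℂ) ^ (n - (i : ℕ)) • dTerm 𝒱 τ f a b i k) +
      ∑ i : Fin (n + 1), (-1 : ℂ) ^ (n - (i : ℕ)) • pTerm 𝒱 τ f a b i

end Differential

end ChiralHomology

end

open scoped TensorProduct UpperHalfPlane Topology

noncomputable section
namespace ChiralHomology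

/-! ### Identities in vertex algebras -/

namespace VertexAlgebra

variable {V : Type*} [AddCommGroup V] [Module ℂ V] (𝒱 : VertexAlgebra V)

/-! Analysis enters only through an explicit description of `Γₙ`. Put φ(x, y) = (℘'(x) + ℘'(y)) /
(2(℘(x) − ℘(y))) = ζ(x − y) − ζ(x) + ζ(y). Then `Γₙ` is generated by the functions ℘(xᵢ), ℘'(xᵢ) and
φ(xᵢ, xⱼ) (`genHom_surjective`): by the Nullstellensatz, the uniformization of the cubic and its
nonsingularity, every character of the generated algebra is evaluation at a configuration, so the
ideal of denominators of a regular function has no zero. The addition theorem `phi_sq` yields the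
derivatives and the Laurent expansions of φ. Hence each generator has an expansion in `xᵢ`, at the
origin or at another point, with coefficients in `Γₙ` of the remaining variables. Sums and products
extend this to ring homomorphisms `expand`, and Cauchy's formula identifies their coefficients with
the contour integrals. All further rules for expansions are checked on generators and propagated by
ring operations.

The differential is a signed sum of residues `resid i s`, where `xᵢ` is integrated around the origin
or around a point with larger index. It descends to `Cₙ` because the residue of a derivative is zero
(`resid_totalDeriv_self`), while the total derivative in a remaining variable passes through a
residue: if that variable is the centre, one uses the simultaneous derivation in it and in `xᵢ`
(`expand_pdCenter`) and that `T` is a derivation of all products.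

The square of `diff` vanishes already on `C̃`. Iterated residues at different centres commute
(`TwoPoints.resid_comm`), because the corresponding double expansions do. At the same centre they
satisfy a Jacobi identity (`TwoPoints.resid_jacobi`). Here the expansions of a function in the
regions |s| < |t|, |t| < |s| and |s − t| < |t| are approximated by those of combinations of
monomials sᵃtᵇ(s − t)ᶜ (`TwoPoints.expandTriple_mem`). For a monomial the identity is the Borcherds
identity (`jacobi_mon`), and the grading makes the pairing insensitive to terms of high total degree
(`jacobi_eq_zero`). Consequently the total contribution of two integrated points does not depend on
their order, whereas its sign does.

For the coinvariants it suffices to treat adjacent transpositions. Such a transposition merely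
relabels the residues, except for the pair of exchanged points: there the residue of `xᵢ` at `xᵢ₊₁`
is replaced by that of `xᵢ₊₁` at `xᵢ`. Up to total derivatives these are opposite
(`mkQ_resid_succ`), by skew-symmetry of the vertex algebra and the corresponding formula
exp(t∂)A(−t) for expansions (`expand_succ_eq_skewSum`). The signs then match
(`toUnordered_diff_swap`). -/

lemma translation_apply (a : V) : 𝒱.translation a = 𝒱.prod (-2) a 𝒱.vac := rfl

lemma choose_neg_two (j : ℕ) : Ring.choose (-2 : ℤ) j = (-1) ^ j * (j + 1) := by
  rw [Ring.choose_neg, Units.smul_def, Int.negOnePow_def]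
  have : (2 + (j : ℤ) - 1) = ((j + 1 : ℕ) : ℤ) := by push_cast; ring
  rw [this, Ring.choose_natCast]
  simp

lemma choose_neg_one (j : ℕ) : Ring.choose (-1 : ℤ) j = (-1) ^ j := by
  rw [Ring.choose_neg, Units.smul_def, Int.negOnePow_def]
  have : (1 + (j : ℤ) - 1) = ((j : ℕ) : ℤ) := by ring
  rw [this, Ring.choose_natCast]
  simp

lemma choose_zero_eq_zero {j : ℕ} (hj : j ≠ 0) : Ring.choose (0 : ℤ) j = 0 := by
  obtain ⟨k, rfl⟩ := Nat.exists_eq_succ_of_ne_zero hj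
  exact Ring.choose_zero_succ ℤ k

/-- `(T a)_(n) = -n a_(n-1)`. -/
lemma prod_translation (n : ℤ) (a c : V) :
    𝒱.prod n (𝒱.translation a) c = (-n : ℂ) • 𝒱.prod (n - 1) a c := by
  -- With `m = 0` the left side is the single term (a_(-2) 1)_(n) c. On the right a product by the
  -- vacuum survives only at index -1, that is, at `j = -1 - n` in the first family or `j = n - 1`
  -- in the second. The sign of `n` decides which one occurs, and neither does for `n = 0`.
  have h := 𝒱.borcherds a 𝒱.vac c 0 (-2) n
  rw [finsum_eq_single _ 0 (fun j hj => by rw [choose_zero_eq_zero hj, zero_smul])] at h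
  simp only [Ring.choose_zero_right, Nat.cast_zero, sub_zero, add_zero, zero_add, one_smul,
    ← translation_apply] at h
  rw [h]
  rcases lt_trichotomy n 0 with hn | rfl | hn
  · obtain ⟨j, rfl⟩ : ∃ j : ℕ, n = -1 - (j : ℤ) := ⟨(-1 - n).toNat, by omega⟩
    rw [finsum_eq_single _ j]
    · rw [choose_neg_two, 𝒱.vac_prod, if_pos (by ring), 𝒱.vac_prod, if_neg (by omega),
        smul_zero, sub_zero, ← mul_assoc, ← pow_add, Even.neg_one_pow ⟨j, rfl⟩, one_mul,
        show (-2 - (j : ℤ)) = -1 - j - 1 by ring, ← Int.cast_smul_eq_zsmul ℂ]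
      congr 1
      push_cast
      ring
    · intro k hk
      rw [𝒱.vac_prod, if_neg (by omega), 𝒱.vac_prod, if_neg (by omega)]
      simp
  · simp only [Int.cast_zero, neg_zero, zero_smul]
    refine finsum_eq_zero_of_forall_eq_zero fun j => ?_
    rw [𝒱.vac_prod, if_neg (by omega), 𝒱.vac_prod, if_neg (by omega)]
    simp
  · obtain ⟨j, rfl⟩ : ∃ j : ℕ, n = 1 + (j : ℤ) := ⟨(n - 1).toNat, by omega⟩
    rw [finsum_eq_single _ j]
    · rw [choose_neg_two, 𝒱.vac_prod, if_neg (by omega), 𝒱.vac_prod, if_pos (by ring),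
        map_zero, zero_sub, ← mul_assoc, ← pow_add, Even.neg_one_pow ⟨j, rfl⟩, one_mul,
        show (1 + (j : ℤ) - 1) = j by ring, ← Int.cast_smul_eq_zsmul ℂ]
      norm_num
      module
    · intro k hk
      rw [𝒱.vac_prod, if_neg (by omega), 𝒱.vac_prod, if_neg (by omega)]
      simp

/-- `T` is a derivation of all products. -/
lemma translation_prod (n : ℤ) (a b : V) :
    𝒱.translation (𝒱.prod n a b) =
      𝒱.prod n (𝒱.translation a) b + 𝒱.prod n a (𝒱.translation b) := by
  -- Nonnegative products into the vacuum vanish. This kills the second family and leaves `j = 0`,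
  -- which gives a_(n) Tb, and `j = 1`, which gives -n a_(n-1) b = (Ta)_(n) b.
  have h := 𝒱.borcherds a b 𝒱.vac 0 n (-2)
  rw [finsum_eq_single _ 0 (fun j hj => by rw [choose_zero_eq_zero hj, zero_smul])] at h
  simp only [Ring.choose_zero_right, Nat.cast_zero, sub_zero, add_zero, zero_add, one_smul,
    ← translation_apply] at h
  rw [h, finsum_eq_sum_of_support_subset (s := Finset.range 2)]
  · rw [Finset.sum_range_succ, Finset.sum_range_one, prod_translation]
    simp [𝒱.prod_vac_of_nonneg, 𝒱.prod_vac, ← translation_apply]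
    rw [← Int.cast_smul_eq_zsmul ℂ]
    module
  · intro j hj
    by_contra hj'
    have hj' : 2 ≤ j := by simpa [Nat.lt_iff_add_one_le] using hj'
    refine hj ?_
    dsimp only
    rw [𝒱.prod_vac_of_nonneg j a (by positivity), 𝒱.prod_vac_of_nonneg _ b (by omega)]
    simp

/-- `a_(-1-j) 1 = T^j a / j!`. -/
lemma prod_vac_neg (j : ℕ) (a : V) :
    𝒱.prod (-1 - j) a 𝒱.vac = ((j.factorial : ℂ)⁻¹) • (𝒱.translation ^ j) a := by
  induction j generalizing a with
  | zero => simp [𝒱.prod_vac]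
  | succ j ih =>
    have h := 𝒱.prod_translation (-1 - j) a 𝒱.vac
    rw [ih] at h
    have h0 : (-((-1 - (j : ℤ) : ℤ) : ℂ)) = (j + 1 : ℂ) := by push_cast; ring
    have h1 : (j + 1 : ℂ) ≠ 0 := by exact_mod_cast Nat.succ_ne_zero j
    rw [h0, ← Module.End.mul_apply, ← pow_succ] at h
    rw [Nat.factorial_succ, Nat.cast_mul, mul_inv, mul_smul, h, smul_smul]
    push_cast
    rw [inv_mul_cancel₀ h1, one_smul, show (-1 - ((j : ℤ) + 1)) = -1 - j - 1 by ring]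

/-- Skew-symmetry. -/
lemma prod_skew (n : ℤ) (a b : V) :
    𝒱.prod n a b = -((-1 : ℂ) ^ n • ∑ᶠ j : ℕ, ((-1 : ℂ) ^ j * (j.factorial : ℂ)⁻¹) •
      (𝒱.translation ^ j) (𝒱.prod (n + j) b a)) := by
  -- On the right only `j = 0` survives and gives a multiple of a_(n) b; on the left the products
  -- x_(-1-j) 1 are divided powers of the translation operator.
  have h := 𝒱.borcherds b a 𝒱.vac (-1) n 0
  have hR : ∀ j : ℕ, ((-1 : ℤ) ^ j * Ring.choose n j) •
        (𝒱.prod (n + -1 - j) b (𝒱.prod (0 + j) a 𝒱.vac) -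
          (-1 : ℂ) ^ n • 𝒱.prod (n + 0 - j) a (𝒱.prod (-1 + j) b 𝒱.vac)) =
      if j = 0 then - ((-1 : ℂ) ^ n • 𝒱.prod n a b) else 0 := by
    intro j
    rw [𝒱.prod_vac_of_nonneg _ a (by positivity)]
    split_ifs with hj
    · subst hj
      simp [𝒱.prod_vac]
    · rw [𝒱.prod_vac_of_nonneg _ b (by omega)]
      simp
  rw [finsum_congr hR, finsum_eq_single _ 0 (fun j hj => if_neg hj), if_pos rfl] at h
  have hL : ∀ j : ℕ, (Ring.choose (-1 : ℤ) j : ℤ) • 𝒱.prod (-1 + 0 - j) (𝒱.prod (n + j) b a) 𝒱.vac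
      = ((-1 : ℂ) ^ j * (j.factorial : ℂ)⁻¹) • (𝒱.translation ^ j) (𝒱.prod (n + j) b a) := by
    intro j
    rw [choose_neg_one, add_zero, prod_vac_neg, ← Int.cast_smul_eq_zsmul ℂ, smul_smul]
    push_cast
    rfl
  rw [finsum_congr hL] at h
  rw [h, smul_neg, neg_neg, smul_smul, ← mul_zpow]
  simp

end VertexAlgebra
end ChiralHomology
namespace ChiralHomology

/-! ### Laurent expansions of functions of one complex variable -/

/-- The Taylor series of `G` at `c`. -/
def taylorSeries (G : ℂ → ℂ) (c : ℂ) : PowerSeries ℂ :=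
  PowerSeries.mk fun n => (n.factorial : ℂ)⁻¹ * iteratedDeriv n G c

lemma taylorSeries_mul {F G : ℂ → ℂ} {c : ℂ} (hF : AnalyticAt ℂ F c) (hG : AnalyticAt ℂ G c) :
    taylorSeries (fun z => F z * G z) c = taylorSeries F c * taylorSeries G c := by
  ext n
  rw [taylorSeries, PowerSeries.coeff_mk, iteratedDeriv_fun_mul hF.contDiffAt hG.contDiffAt,
    PowerSeries.coeff_mul, Finset.Nat.sum_antidiagonal_eq_sum_range_succ_mk, Finset.mul_sum]
  refine Finset.sum_congr rfl fun k hk => ?_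
  have hk : k ≤ n := Nat.lt_succ_iff.mp (Finset.mem_range.mp hk)
  simp only [taylorSeries, PowerSeries.coeff_mk]
  have h1 : (n.factorial : ℂ) ≠ 0 := by exact_mod_cast n.factorial_ne_zero
  have h2 : (k.factorial : ℂ) ≠ 0 := by exact_mod_cast k.factorial_ne_zero
  have h3 : ((n - k).factorial : ℂ) ≠ 0 := by exact_mod_cast (n - k).factorial_ne_zero
  rw [Nat.cast_choose ℂ hk]
  field_simp

lemma taylorSeries_add {F G : ℂ → ℂ} {c : ℂ} (hF : AnalyticAt ℂ F c) (hG : AnalyticAt ℂ G c) :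
    taylorSeries (fun z => F z + G z) c = taylorSeries F c + taylorSeries G c := by
  ext n
  simp [taylorSeries, iteratedDeriv_fun_add hF.contDiffAt hG.contDiffAt, mul_add]

lemma taylorSeries_const (a c : ℂ) : taylorSeries (fun _ => a) c = PowerSeries.C a := by
  ext n
  simp only [taylorSeries, PowerSeries.coeff_mk, iteratedDeriv_const, PowerSeries.coeff_C]
  split_ifs with h <;> simp [h]

lemma taylorSeries_sub_center (c : ℂ) : taylorSeries (fun z => z - c) c = PowerSeries.X := by
  ext n
  rw [taylorSeries, PowerSeries.coeff_mk, PowerSeries.coeff_X]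
  rcases n with _ | _ | n
  · simp
  · simp [iteratedDeriv_one]
  · rw [iteratedDeriv_succ', iteratedDeriv_succ']
    have : deriv (deriv fun z : ℂ => z - c) = fun _ => 0 := by
      have h : deriv (fun z : ℂ => z - c) = fun _ => 1 := by
        funext z; simp
      rw [h]; funext z; simp
    rw [this]
    simp

/-- `g` is meromorphic at `c` with Laurent series `A` in powers of `z - c`. -/
def HasLaurentAt (g : ℂ → ℂ) (c : ℂ) (A : LaurentSeries ℂ) : Prop :=
  ∃ (N : ℕ) (G : ℂ → ℂ), AnalyticAt ℂ G c ∧ (∀ᶠ z in 𝓝[≠] c, (z - c) ^ N * g z = G z) ∧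
    HahnSeries.single (N : ℤ) 1 * A = (taylorSeries G c : LaurentSeries ℂ)

namespace HasLaurentAt

variable {f g : ℂ → ℂ} {c : ℂ} {A B : LaurentSeries ℂ}

lemma congr (h : HasLaurentAt f c A) (e : f =ᶠ[𝓝[≠] c] g) : HasLaurentAt g c A := by
  obtain ⟨N, G, hG, h1, h2⟩ := h
  refine ⟨N, G, hG, ?_, h2⟩
  filter_upwards [h1, e] with z hz hz'
  rw [← hz', hz]

lemma of_analyticAt (h : AnalyticAt ℂ f c) :
    HasLaurentAt f c (taylorSeries f c : LaurentSeries ℂ) :=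
  ⟨0, f, h, by simp, by simp⟩

/-- The exponent clearing the pole is not unique; enlarging it gives two functions a common one, as
sums require. -/
lemma raise {N : ℕ} {G : ℂ → ℂ} (hG : AnalyticAt ℂ G c)
    (h1 : ∀ᶠ z in 𝓝[≠] c, (z - c) ^ N * f z = G z)
    (h2 : HahnSeries.single (N : ℤ) 1 * A = (taylorSeries G c : LaurentSeries ℂ)) (M : ℕ) :
    ∃ G' : ℂ → ℂ, AnalyticAt ℂ G' c ∧ (∀ᶠ z in 𝓝[≠] c, (z - c) ^ (N + M) * f z = G' z) ∧
      HahnSeries.single ((N + M : ℕ) : ℤ) 1 * A = (taylorSeries G' c : LaurentSeries ℂ) := by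
  induction M with
  | zero => exact ⟨G, hG, by simpa using h1, by simpa using h2⟩
  | succ M ih =>
    obtain ⟨G', hG', h1', h2'⟩ := ih
    have hX : AnalyticAt ℂ (fun z : ℂ => z - c) c := by fun_prop
    refine ⟨fun z => (z - c) * G' z, hX.mul hG', ?_, ?_⟩
    · filter_upwards [h1'] with z hz
      rw [← hz]
      ring
    · rw [taylorSeries_mul hX hG', taylorSeries_sub_center, PowerSeries.coe_mul, ← h2',
        PowerSeries.coe_X, ← mul_assoc, HahnSeries.single_mul_single]
      congr 2
      · push_cast; ring_nf
      · simp

lemma add (hf : HasLaurentAt f c A) (hg : HasLaurentAt g c B) :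
    HasLaurentAt (fun z => f z + g z) c (A + B) := by
  obtain ⟨N, F, hF, h1, h2⟩ := hf
  obtain ⟨M, G, hG, h3, h4⟩ := hg
  obtain ⟨F', hF', h1', h2'⟩ := raise hF h1 h2 M
  obtain ⟨G', hG', h3', h4'⟩ := raise hG h3 h4 N
  rw [add_comm M N] at h3' h4'
  refine ⟨N + M, fun z => F' z + G' z, hF'.add hG', ?_, ?_⟩
  · filter_upwards [h1', h3'] with z hz hz'
    rw [mul_add, hz, hz']
  · rw [taylorSeries_add hF' hG', PowerSeries.coe_add, mul_add, h2', h4']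

lemma mul (hf : HasLaurentAt f c A) (hg : HasLaurentAt g c B) :
    HasLaurentAt (fun z => f z * g z) c (A * B) := by
  obtain ⟨N, F, hF, h1, h2⟩ := hf
  obtain ⟨M, G, hG, h3, h4⟩ := hg
  refine ⟨N + M, fun z => F z * G z, hF.mul hG, ?_, ?_⟩
  · filter_upwards [h1, h3] with z hz hz'
    rw [← hz, ← hz']
    ring
  · rw [taylorSeries_mul hF hG, PowerSeries.coe_mul, ← h2, ← h4]
    have : HahnSeries.single ((N + M : ℕ) : ℤ) (1 : ℂ) =
        HahnSeries.single (N : ℤ) 1 * HahnSeries.single (M : ℤ) 1 := by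
      rw [HahnSeries.single_mul_single]; simp
    rw [this]
    ring

lemma const (a : ℂ) : HasLaurentAt (fun _ => a) c (HahnSeries.C a) := by
  simpa [taylorSeries_const] using of_analyticAt (f := fun _ => a) (c := c) analyticAt_const

lemma neg (hf : HasLaurentAt f c A) : HasLaurentAt (fun z => -f z) c (-A) := by
  have h := (const (c := c) (-1)).mul hf
  have e : (HahnSeries.C (-1 : ℂ) : LaurentSeries ℂ) * A = -A := by simp
  rw [e] at h
  simpa using h

lemma sub (hf : HasLaurentAt f c A) (hg : HasLaurentAt g c B) :
    HasLaurentAt (fun z => f z - g z) c (A - B) := by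
  simpa [sub_eq_add_neg] using hf.add hg.neg

lemma inv_sub_center : HasLaurentAt (fun z => (z - c)⁻¹) c (HahnSeries.single (-1) 1) := by
  refine ⟨1, fun _ => 1, analyticAt_const, ?_, ?_⟩
  · filter_upwards [self_mem_nhdsWithin] with z hz
    rw [pow_one, mul_inv_cancel₀ (sub_ne_zero.mpr hz)]
  · rw [taylorSeries_const, HahnSeries.single_mul_single]
    simp

lemma coeff_shift {N : ℕ} {P : PowerSeries ℂ}
    (h : HahnSeries.single (N : ℤ) 1 * A = (P : LaurentSeries ℂ)) (m : ℤ) :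
    A.coeff m = if m + N < 0 then 0 else PowerSeries.coeff (m + N).natAbs P := by
  rw [← PowerSeries.coeff_coe, ← h, HahnSeries.coeff_single_mul]
  simp

/-- The Laurent coefficients are the contour integrals over all small circles. -/
lemma contour (hf : HasLaurentAt f c A) (m : ℤ) : ∀ᶠ r in 𝓝[>] (0 : ℝ),
    (2 * Real.pi * Complex.I)⁻¹ * (∮ z in C(c, r), (z - c) ^ (-m - 1) * f z) = A.coeff m := by
  obtain ⟨N, G, hG, h1, h2⟩ := hf
  have hA := coeff_shift h2 m
  have ev : ∀ᶠ z in 𝓝 c, AnalyticAt ℂ G z ∧ (z ≠ c → (z - c) ^ N * f z = G z) :=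
    hG.eventually_analyticAt.and (eventually_nhdsWithin_iff.mp h1)
  obtain ⟨ε, hε, hb⟩ := Metric.eventually_nhds_iff_ball.mp ev
  filter_upwards [Ioo_mem_nhdsGT hε] with r hr
  have hr0 : 0 < r := hr.1
  have hd : DifferentiableOn ℂ G (Metric.closedBall c r) := fun z hz =>
    (hb z (Metric.closedBall_subset_ball hr.2 hz)).1.differentiableAt.differentiableWithinAt
  have e : (∮ z in C(c, r), (z - c) ^ (-m - 1) * f z) =
      ∮ z in C(c, r), (z - c) ^ (-(m + N) - 1) * G z := by
    refine circleIntegral.integral_congr hr0.le fun z hz => ?_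
    have hz0 : z - c ≠ 0 := by
      intro h
      rw [mem_sphere_iff_norm, h, norm_zero] at hz
      exact hr0.ne hz
    have := (hb z (Metric.closedBall_subset_ball hr.2 (Metric.sphere_subset_closedBall hz))).2
      (sub_ne_zero.mp hz0)
    rw [← this, ← mul_assoc, ← zpow_natCast, ← zpow_add₀ hz0]
    congr 2
    ring
  rw [e, hA]
  have hpi : (2 * Real.pi * Complex.I : ℂ) ≠ 0 := Complex.two_pi_I_ne_zero
  -- Below the pole order the integrand is holomorphic and Cauchy's theorem applies; otherwise this
  -- is Cauchy's formula for a derivative of `G`.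
  split_ifs with hm
  · obtain ⟨k, hk⟩ : ∃ k : ℕ, -(m + N) - 1 = k := ⟨(-(m + N) - 1).toNat, by omega⟩
    have hd' : DifferentiableOn ℂ (fun z => (z - c) ^ (-(m + N) - 1) * G z)
        (Metric.closedBall c r) := by
      rw [hk]
      simp only [zpow_natCast]
      exact (by fun_prop : DifferentiableOn ℂ (fun z => (z - c) ^ k) _).mul hd
    rw [DiffContOnCl.circleIntegral_eq_zero hr0.le
      ((hd'.mono Metric.closure_ball_subset_closedBall).diffContOnCl), mul_zero]
  · obtain ⟨k, hk⟩ : ∃ k : ℕ, m + N = k := ⟨(m + N).toNat, by omega⟩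
    have h := hd.circleIntegral_one_div_sub_center_pow_smul hr0 k
    have e' : (∮ z in C(c, r), (z - c) ^ (-(m + N) - 1) * G z) =
        ∮ z in C(c, r), (1 / (z - c) ^ (k + 1)) • G z := by
      congr 1
      funext z
      rw [smul_eq_mul, hk, one_div, ← zpow_natCast, ← zpow_neg]
      congr 2
      push_cast
      ring
    rw [e', h, hk, taylorSeries, Int.natAbs_natCast, PowerSeries.coeff_mk, smul_eq_mul]
    field_simp

/-- Each coefficient is the value of a contour integral over any sufficiently small circle. -/
lemma unique (hA : HasLaurentAt f c A) (hB : HasLaurentAt f c B) : A = B := by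
  ext m
  obtain ⟨r, h1, h2⟩ := ((hA.contour m).and (hB.contour m)).exists
  exact h1.symm.trans h2

lemma taylorSeries_deriv (n : ℕ) (G : ℂ → ℂ) (c : ℂ) :
    PowerSeries.coeff n (taylorSeries (deriv G) c) =
      (n + 1) * PowerSeries.coeff (n + 1) (taylorSeries G c) := by
  simp only [taylorSeries, PowerSeries.coeff_mk, ← iteratedDeriv_succ', Nat.factorial_succ]
  have : (n + 1 : ℂ) ≠ 0 := by exact_mod_cast n.succ_ne_zero
  push_cast
  field_simp

lemma deriv' (hf : HasLaurentAt f c A) {f' : ℂ → ℂ}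
    (hf' : ∀ᶠ z in 𝓝[≠] c, HasDerivAt f (f' z) z) :
    HasLaurentAt f' c (LaurentSeries.hasseDeriv ℂ 1 A) := by
  obtain ⟨N, G, hG, h1, h2⟩ := hf
  have hX : AnalyticAt ℂ (fun z : ℂ => z - c) c := by fun_prop
  have hN : AnalyticAt ℂ (fun _ : ℂ => (-N : ℂ)) c := analyticAt_const
  -- From (z - c)^N f = G one gets (z - c)^(N+1) f' = -N G + (z - c) G'.
  refine ⟨N + 1, fun z => (-N : ℂ) * G z + (z - c) * deriv G z,
    (hN.mul hG).add (hX.mul hG.deriv), ?_, ?_⟩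
  · have h1' := eventually_eventually_nhdsWithin.mpr h1
    have : ∀ᶠ z in 𝓝[≠] c, ∀ᶠ w in 𝓝 z, (w - c) ^ N * f w = G w := by
      filter_upwards [h1', self_mem_nhdsWithin] with z hz hz'
      rwa [(isOpen_compl_singleton).nhdsWithin_eq hz'] at hz
    filter_upwards [this, hf', self_mem_nhdsWithin,
      eventually_nhdsWithin_of_eventually_nhds hG.eventually_analyticAt] with z hz hz' hzc hGz
    have hd : HasDerivAt (fun w => (w - c) ^ N * f w)
        ((N * (z - c) ^ (N - 1) * 1) * f z + (z - c) ^ N * f' z) z :=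
      ((hasDerivAt_id z).sub_const c |>.pow N).mul hz'
    have e := hd.unique (hGz.differentiableAt.hasDerivAt.congr_of_eventuallyEq hz)
    have hpow : (N : ℂ) * ((z - c) * (z - c) ^ (N - 1)) = N * (z - c) ^ N := by
      rcases N with _ | N
      · simp
      · rw [Nat.add_sub_cancel, ← pow_succ']
    rw [← e, ← hz.self_of_nhds]
    linear_combination (-(f z)) * hpow
  · ext m
    rw [HahnSeries.coeff_single_mul, one_mul, LaurentSeries.hasseDeriv_coeff,
      coeff_shift h2, PowerSeries.coeff_coe, taylorSeries_add (F := fun z => -N * G z)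
      (G := fun z => (z - c) * deriv G z) (hN.mul hG) (hX.mul hG.deriv),
      taylorSeries_mul hN hG, taylorSeries_mul hX hG.deriv, taylorSeries_const,
      taylorSeries_sub_center]
    have e : m - ((N + 1 : ℕ) : ℤ) + (1 : ℕ) + N = m := by push_cast; ring
    rw [e]
    split_ifs with hm
    · simp
    · obtain ⟨k, rfl⟩ : ∃ k : ℕ, m = k := ⟨m.toNat, by omega⟩
      have e2 : ((k : ℤ) - ((N + 1 : ℕ) : ℤ) + (1 : ℕ)) = k - N := by push_cast; ring
      rw [Int.natAbs_natCast, map_add, PowerSeries.coeff_C_mul, e2, Ring.choose_one_right,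
        ← Int.cast_smul_eq_zsmul ℂ, smul_eq_mul]
      rcases k with _ | k
      · simp
      · rw [PowerSeries.coeff_succ_X_mul, taylorSeries_deriv]
        push_cast
        ring

end HasLaurentAt
end ChiralHomology
namespace ChiralHomology

/-! ### The Weierstrass function -/

section Weierstrass

variable (τ : ℍ)

/-- `℘`. -/
abbrev wp (z : ℂ) : ℂ := (periods τ).weierstrassP z

/-- `℘'`. -/
abbrev wp' (z : ℂ) : ℂ := (periods τ).derivWeierstrassP z

/-- The lattice `Λ`. -/
abbrev Lat : Submodule ℤ ℂ := (periods τ).lattice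

lemma isOpen_compl_Lat : IsOpen ((Lat τ : Set ℂ)ᶜ) := (periods τ).isClosed_lattice.isOpen_compl

lemma countable_Lat : (Lat τ : Set ℂ).Countable := by
  have : Countable (periods τ).lattice :=
    ((periods τ).latticeEquivProd).toEquiv.injective.countable
  exact Set.to_countable _

lemma eventually_sub_notMem_Lat (c a : ℂ) :
    ∀ᶠ z in 𝓝[≠] c, z - a ∉ Lat τ := by
  have hc : Filter.Tendsto (fun z => z - a) (𝓝 c) (𝓝 (c - a)) :=
    ((continuous_id.sub continuous_const).tendsto c)
  have := hc.eventually ((periods τ).compl_lattice_sdiff_singleton_mem_nhds (c - a))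
  filter_upwards [eventually_nhdsWithin_of_eventually_nhds this, self_mem_nhdsWithin] with z hz hz'
  intro hm
  exact hz ⟨hm, fun e => hz' (sub_left_injective e)⟩

lemma eventually_notMem_Lat (c : ℂ) : ∀ᶠ z in 𝓝[≠] c, z ∉ Lat τ := by
  simpa using eventually_sub_notMem_Lat τ c 0

variable {τ}

lemma eventually_notMem_Lat' {c : ℂ} (h : c ∉ Lat τ) : ∀ᶠ z in 𝓝 c, z ∉ Lat τ :=
  (isOpen_compl_Lat τ).mem_nhds h

lemma eventually_sub_notMem_Lat' {c a : ℂ} (h : c - a ∉ Lat τ) : ∀ᶠ z in 𝓝 c, z - a ∉ Lat τ := by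
  have hc : Filter.Tendsto (fun z => z - a) (𝓝 c) (𝓝 (c - a)) :=
    ((continuous_id.sub continuous_const).tendsto c)
  exact hc.eventually (eventually_notMem_Lat' h)

lemma analyticAt_wp {z : ℂ} (hz : z ∉ Lat τ) : AnalyticAt ℂ (wp τ) z :=
  (periods τ).analyticOnNhd_weierstrassP z hz

lemma analyticAt_wp' {z : ℂ} (hz : z ∉ Lat τ) : AnalyticAt ℂ (wp' τ) z :=
  (periods τ).analyticOnNhd_derivWeierstrassP z hz

lemma wp'_sq {z : ℂ} (hz : z ∉ Lat τ) :
    wp' τ z ^ 2 = 4 * wp τ z ^ 3 - (periods τ).g₂ * wp τ z - (periods τ).g₃ :=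
  (periods τ).derivWeierstrassP_sq z hz

variable (τ)

/-- The regular part of `℘` at the origin. -/
abbrev wpReg (z : ℂ) : ℂ := (periods τ).weierstrassPExcept 0 z

lemma wp_eq (z : ℂ) : wp τ z = wpReg τ z + (z ^ 2)⁻¹ := by
  have := (periods τ).weierstrassPExcept_add ⟨0, zero_mem _⟩ z
  simpa using this.symm

lemma analyticAt_wpReg : AnalyticAt ℂ (wpReg τ) 0 := (periods τ).analyticAt_weierstrassPExcept 0

/-- `℘` takes every value. -/
lemma exists_wp_eq (c : ℂ) : ∃ z, z ∉ Lat τ ∧ wp τ z = c := by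
  classical
  by_contra! hne
  -- If `c` is omitted, 1 / (℘ - c) extended by zero to the lattice is entire and periodic, hence
  -- bounded. By Liouville it is constant, yet it vanishes exactly on the lattice.
  set h : ℂ → ℂ := fun z => if z ∈ Lat τ then 0 else (wp τ z - c)⁻¹ with hh
  have hper : ∀ (z w : ℂ), w ∈ Lat τ → h (z + w) = h z := by
    intro z w hw
    have e : wp τ (z + w) = wp τ z := (periods τ).weierstrassP_add_coe z ⟨w, hw⟩
    have e' : z + w ∈ Lat τ ↔ z ∈ Lat τ := Submodule.add_mem_iff_left _ hw
    simp only [hh, e, e']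
  have h0 : AnalyticAt ℂ h 0 := by
    -- Multiplying numerator and denominator by `z²` removes the double pole of ℘.
    have hd : AnalyticAt ℂ (fun z => z ^ 2 / (z ^ 2 * (wpReg τ z - c) + 1)) 0 := by
      refine AnalyticAt.div (by fun_prop) ?_ (by simp)
      have := analyticAt_wpReg τ
      fun_prop
    refine hd.congr ?_
    have := (periods τ).compl_lattice_sdiff_singleton_mem_nhds 0
    filter_upwards [this] with z hz
    by_cases hz0 : z = 0
    · subst hz0
      simp [hh]
    · have hzL : z ∉ Lat τ := fun hm => hz ⟨hm, hz0⟩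
      simp only [hh, if_neg hzL]
      have hc : wp τ z - c ≠ 0 := sub_ne_zero.mpr (hne z hzL)
      have e : z ^ 2 * (wpReg τ z - c) + 1 = z ^ 2 * (wp τ z - c) := by
        rw [wp_eq]; field_simp; ring
      rw [e]
      field_simp
  have hdiff : Differentiable ℂ h := by
    intro z
    by_cases hz : z ∈ Lat τ
    · have e : h = fun w => h (w + (-z)) := by
        funext w
        rw [hper w (-z) (neg_mem hz)]
      rw [e]
      have : DifferentiableAt ℂ h (z + -z) := by simpa using h0.differentiableAt
      exact DifferentiableAt.comp (g := h) (f := fun w => w + -z) z this (by fun_prop)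
    · have ha : AnalyticAt ℂ (fun w => (wp τ w - c)⁻¹) z :=
        ((analyticAt_wp hz).sub analyticAt_const).inv (sub_ne_zero.mpr (hne z hz))
      refine (ha.congr ?_).differentiableAt
      filter_upwards [eventually_notMem_Lat' hz] with w hw
      simp [hh, if_neg hw]
  have hb := (IsZLattice.isCompact_range_of_periodic (periods τ).lattice _
    hdiff.continuous hper).isBounded
  obtain ⟨z, hz⟩ := (eventually_notMem_Lat τ 0).exists
  have e := hdiff.apply_eq_apply_of_bounded hb z 0
  simp only [hh, if_neg hz, if_pos (zero_mem (Lat τ))] at e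
  exact inv_ne_zero (sub_ne_zero.mpr (hne z hz)) e

/-- Uniformization: `(℘, ℘')` maps onto the affine cubic. -/
lemma exists_wp_wp'_eq (u v : ℂ) (h : v ^ 2 = 4 * u ^ 3 - (periods τ).g₂ * u - (periods τ).g₃) :
    ∃ z, z ∉ Lat τ ∧ wp τ z = u ∧ wp' τ z = v := by
  obtain ⟨z, hz, rfl⟩ := exists_wp_eq τ u
  -- The cubic determines `v` up to sign, and replacing `z` by `-z` fixes ℘ and negates ℘'.
  rw [← wp'_sq hz, sq_eq_sq_iff_eq_or_eq_neg] at h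
  rcases h with rfl | rfl
  · exact ⟨z, hz, rfl, rfl⟩
  · exact ⟨-z, by simpa using hz, (periods τ).weierstrassP_neg z,
      (periods τ).derivWeierstrassP_neg z⟩

/-- Polynomials in `℘` and `℘'`. -/
def polyFun (p : MvPolynomial (Fin 1 ⊕ Fin 1) ℂ) (z : ℂ) : ℂ :=
  MvPolynomial.eval (coords τ fun _ : Fin 1 => z) p

lemma hasDerivAt_polyFun (p : MvPolynomial (Fin 1 ⊕ Fin 1) ℂ) {z : ℂ} (hz : z ∉ Lat τ) :
    HasDerivAt (polyFun τ p) (polyFun τ (polyDeriv τ 0 p) z) z := by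
  have h := hasDerivAt_eval τ (0 : Fin 1)
    ⟨fun _ => z, fun _ => hz, fun i j hij => (hij (Subsingleton.elim i j)).elim⟩ p
  have e : ∀ w : ℂ, Function.update (fun _ : Fin 1 => z) 0 w = fun _ => w := by
    intro w; funext i; rw [Subsingleton.elim i 0]; simp
  simp only [e] at h
  exact h

/-- Since ℘'' is a polynomial in ℘, the ring of polynomials in ℘ and ℘' is stable under
differentiation. Thus the whole Taylor series of ℘ at a point is determined by the values of ℘ and
℘' there; injectivity and nonsingularity rest on this. -/
lemma iteratedDeriv_polyFun (m : ℕ) (p : MvPolynomial (Fin 1 ⊕ Fin 1) ℂ) {z : ℂ}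
    (hz : z ∉ Lat τ) :
    iteratedDeriv m (polyFun τ p) z = polyFun τ ((polyDeriv τ 0)^[m] p) z := by
  induction m generalizing p with
  | zero => simp
  | succ m ih =>
    rw [iteratedDeriv_succ', Function.iterate_succ_apply, ← ih]
    refine Filter.EventuallyEq.iteratedDeriv_eq m ?_
    filter_upwards [eventually_notMem_Lat' hz] with w hw
    exact (hasDerivAt_polyFun τ p hw).deriv

lemma wp_eq_polyFun : wp τ = polyFun τ (MvPolynomial.X (Sum.inl 0)) := by
  funext z; simp [polyFun, coords]

lemma polyFun_congr {a b : ℂ} (h : wp τ a = wp τ b) (h' : wp' τ a = wp' τ b)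
    (p : MvPolynomial (Fin 1 ⊕ Fin 1) ℂ) : polyFun τ p a = polyFun τ p b := by
  have : coords τ (fun _ : Fin 1 => a) = coords τ fun _ : Fin 1 => b := by
    funext k
    rcases k with k | k
    · exact h
    · exact h'
  rw [polyFun, polyFun, this]

lemma eventuallyEq_zero_of_taylor {f : ℂ → ℂ} {c : ℂ} (hf : AnalyticAt ℂ f c)
    (h : ∀ n, iteratedDeriv n f c = 0) : f =ᶠ[𝓝 c] 0 := by
  have h1 := hf.hasFPowerSeriesAt
  have h2 : (FormalMultilinearSeries.ofScalars ℂ fun n => iteratedDeriv n f c / n.factorial) =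
      (0 : FormalMultilinearSeries ℂ ℂ ℂ) := by
    ext n
    simp [FormalMultilinearSeries.ofScalars, h]
  rw [h2] at h1
  exact h1.eventually_eq_zero

lemma not_analyticAt_of_eq_wp {f : ℂ → ℂ} (hf : AnalyticAt ℂ f 0) (h : f =ᶠ[𝓝[≠] 0] wp τ) :
    False := by
  have h1 := hf.meromorphicOrderAt_nonneg
  rw [meromorphicOrderAt_congr h, (periods τ).order_weierstrassP 0 (zero_mem _)] at h1
  exact absurd h1 (by decide)

lemma isPreconnected_compl_two (d : ℂ) :
    IsPreconnected {z : ℂ | z ∉ Lat τ ∧ z + d ∉ Lat τ} := by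
  have hc : ((Lat τ : Set ℂ) ∪ (fun z => z + d) ⁻¹' (Lat τ : Set ℂ)).Countable :=
    (countable_Lat τ).union ((countable_Lat τ).preimage (add_left_injective d))
  have e : {z : ℂ | z ∉ Lat τ ∧ z + d ∉ Lat τ} =
      ((Lat τ : Set ℂ) ∪ (fun z => z + d) ⁻¹' (Lat τ : Set ℂ))ᶜ := by
    ext z; simp
  rw [e]
  exact (hc.isConnected_compl_of_one_lt_rank (by simp [Complex.rank_real_complex])).isPreconnected

lemma isOpen_compl_two (d : ℂ) : IsOpen {z : ℂ | z ∉ Lat τ ∧ z + d ∉ Lat τ} :=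
  (isOpen_compl_Lat τ).inter ((isOpen_compl_Lat τ).preimage (continuous_add_const d))

/-- `(℘, ℘')` is injective modulo the lattice. -/
lemma sub_mem_of_wp_eq {a b : ℂ} (ha : a ∉ Lat τ) (hb : b ∉ Lat τ) (h : wp τ a = wp τ b)
    (h' : wp' τ a = wp' τ b) : a - b ∈ Lat τ := by
  by_contra hab
  set d := b - a with hd
  have hd' : d ∉ Lat τ := by rw [hd, ← neg_sub, neg_mem_iff]; exact hab
  set S := {z : ℂ | z ∉ Lat τ ∧ z + d ∉ Lat τ}
  have haS : a ∈ S := ⟨ha, by simpa [hd] using hb⟩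
  have hana : ∀ z, z + d ∉ Lat τ → AnalyticAt ℂ (fun z => wp τ (z + d)) z := fun z hz =>
    (analyticAt_wp hz).fun_comp (f := fun z => z + d) (by fun_prop)
  have han : AnalyticOnNhd ℂ (fun z => wp τ (z + d) - wp τ z) S := fun z hz =>
    (hana z hz.2).sub (analyticAt_wp hz.1)
  -- At `a` all derivatives of ℘ agree with those at `a + d = b`.
  have hloc : (fun z => wp τ (z + d) - wp τ z) =ᶠ[𝓝 a] 0 := by
    refine eventuallyEq_zero_of_taylor (han a haS) fun n => ?_
    rw [iteratedDeriv_fun_sub (hana a haS.2).contDiffAt (analyticAt_wp ha).contDiffAt,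
      iteratedDeriv_comp_add_const, wp_eq_polyFun]
    dsimp only
    rw [iteratedDeriv_polyFun τ _ _ haS.2,
      iteratedDeriv_polyFun τ _ _ ha, sub_eq_zero]
    have : a + d = b := by simp [hd]
    rw [this]
    exact (polyFun_congr τ h h' _).symm
  have hall := han.eqOn_zero_of_preconnected_of_eventuallyEq_zero
    (isPreconnected_compl_two τ d) haS hloc
  -- Now ℘(z + d) = ℘(z) wherever both are regular; but at the origin the left side is regular, as
  -- `d` is not a period, and ℘ has a pole.
  refine not_analyticAt_of_eq_wp τ (hana 0 (by simpa using hd')) ?_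
  have h0d : (0 : ℂ) - (-d) ∉ Lat τ := by simpa using hd'
  filter_upwards [eventually_notMem_Lat τ 0,
    eventually_nhdsWithin_of_eventually_nhds (eventually_sub_notMem_Lat' h0d)] with z hz hz'
  exact sub_eq_zero.mp (hall ⟨hz, by simpa using hz'⟩)

/-- `℘` is not locally constant. -/
lemma not_eventually_wp_eq {a : ℂ} (ha : a ∉ Lat τ) (c : ℂ) : ¬ ∀ᶠ z in 𝓝 a, wp τ z = c := by
  intro h
  have han : AnalyticOnNhd ℂ (fun z => wp τ z - c) (Lat τ : Set ℂ)ᶜ := fun z hz =>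
    (analyticAt_wp hz).sub analyticAt_const
  have h0 : (fun z => wp τ z - c) =ᶠ[𝓝 a] 0 := by
    filter_upwards [h] with z hz
    simp [hz]
  have hall := han.eqOn_zero_of_preconnected_of_eventuallyEq_zero
    (isPreconnected_compl_lattice τ) ha h0
  refine not_analyticAt_of_eq_wp τ (f := fun _ => c) analyticAt_const ?_
  filter_upwards [eventually_notMem_Lat τ 0] with z hz
  exact (sub_eq_zero.mp (hall hz)).symm

/-- The cubic is nonsingular. -/
lemma wp''_ne_zero {a : ℂ} (ha : a ∉ Lat τ) (h : wp' τ a = 0) :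
    6 * wp τ a ^ 2 - (periods τ).g₂ / 2 ≠ 0 := by
  intro h2
  -- If ℘' and ℘'' vanish at `a`, both generators have zero derivative there, hence so does every
  -- polynomial in them. Then all derivatives of ℘ vanish at `a` and ℘ would be locally constant.
  have hz : ∀ p, polyFun τ (polyDeriv τ 0 p) a = 0 := by
    intro p
    induction p using MvPolynomial.induction_on with
    | C c =>
      have : polyDeriv τ (0 : Fin 1) (MvPolynomial.C c) = 0 := MvPolynomial.derivation_C _ c
      rw [this, polyFun, map_zero]
    | add p q hp hq =>
      rw [map_add, polyFun, map_add]
      exact (congrArg₂ (· + ·) hp hq).trans (add_zero 0)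
    | mul_X p k hp =>
      have hX : polyFun τ (polyDeriv τ 0 (MvPolynomial.X k)) a = 0 := by
        rcases k with k | k <;> obtain rfl : k = 0 := Subsingleton.elim _ _
        · simpa [polyFun, polyDeriv, coords, MvPolynomial.mkDerivation_X] using h
        · simpa [polyFun, polyDeriv, coords, MvPolynomial.mkDerivation_X] using h2
      simp only [polyFun] at hp hX
      simp only [polyFun, Derivation.leibniz, smul_eq_mul, map_add, map_mul, hp, hX]
      ring
  refine not_eventually_wp_eq τ ha (wp τ a) ?_
  have h0 : (fun z => wp τ z - wp τ a) =ᶠ[𝓝 a] 0 := by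
    refine eventuallyEq_zero_of_taylor ((analyticAt_wp ha).sub analyticAt_const) fun n => ?_
    rcases n with _ | n
    · simp
    · rw [iteratedDeriv_fun_sub (analyticAt_wp ha).contDiffAt contDiffAt_const,
        wp_eq_polyFun, iteratedDeriv_polyFun τ _ _ ha, Function.iterate_succ_apply', hz]
      simp [iteratedDeriv_const]
  filter_upwards [h0] with z hz
  exact sub_eq_zero.mp hz

end Weierstrass
end ChiralHomology
namespace ChiralHomology

/-! ### The function `ζ(x - y) - ζ(x) + ζ(y)` -/

section Phi

variable (τ : ℍ)

/-- The function `(℘'(x) + ℘'(y)) / (2 (℘(x) - ℘(y))) = ζ(x - y) - ζ(x) + ζ(y)`. -/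
def phi (x y : ℂ) : ℂ :=
  if wp τ x ≠ wp τ y then (wp' τ x + wp' τ y) / (2 * (wp τ x - wp τ y))
  else (4 * (wp τ x ^ 2 + wp τ x * wp τ y + wp τ y ^ 2) - (periods τ).g₂) /
    (2 * (wp' τ x - wp' τ y))

variable {τ}

lemma cubic_sub {x y : ℂ} (hx : x ∉ Lat τ) (hy : y ∉ Lat τ) :
    (wp' τ x - wp' τ y) * (wp' τ x + wp' τ y) = (wp τ x - wp τ y) *
      (4 * (wp τ x ^ 2 + wp τ x * wp τ y + wp τ y ^ 2) - (periods τ).g₂) := by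
  linear_combination wp'_sq hx - wp'_sq hy

lemma wp_ne_or {x y : ℂ} (hx : x ∉ Lat τ) (hy : y ∉ Lat τ) (hxy : x - y ∉ Lat τ) :
    wp τ x - wp τ y ≠ 0 ∨ wp' τ x - wp' τ y ≠ 0 := by
  by_contra! h
  exact hxy (sub_mem_of_wp_eq τ hx hy (sub_eq_zero.mp h.1) (sub_eq_zero.mp h.2))

/-- By `cubic_sub` the two fractions in the definition of `phi` are compatible, so both
cross-multiplied equations hold at every pair of distinct points. Identities for `phi` can then be
proved without a case distinction on the denominators. -/
lemma phi_rel {x y : ℂ} (hx : x ∉ Lat τ) (hy : y ∉ Lat τ) (hxy : x - y ∉ Lat τ) :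
    2 * phi τ x y * (wp τ x - wp τ y) = wp' τ x + wp' τ y ∧
    2 * phi τ x y * (wp' τ x - wp' τ y) =
      4 * (wp τ x ^ 2 + wp τ x * wp τ y + wp τ y ^ 2) - (periods τ).g₂ := by
  have hc := cubic_sub hx hy
  by_cases h : wp τ x = wp τ y
  · have hv := (wp_ne_or hx hy hxy).resolve_left (by simp [h])
    have hs : wp' τ x + wp' τ y = 0 := by
      refine (mul_eq_zero.mp ?_).resolve_left hv
      rw [hc, h]
      ring
    rw [phi, if_neg (by simpa using h)]
    refine ⟨?_, by field_simp⟩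
    rw [hs, h]
    ring
  · have hu : wp τ x - wp τ y ≠ 0 := sub_ne_zero.mpr h
    rw [phi, if_pos h]
    refine ⟨by field_simp, ?_⟩
    field_simp
    linear_combination hc

/-- Distinct points of the curve differ in ℘ or in ℘', so one of the two factors can be cancelled.
-/
lemma eq_of_phi_rel {x y c d : ℂ} (hx : x ∉ Lat τ) (hy : y ∉ Lat τ) (hxy : x - y ∉ Lat τ)
    (h1 : c * (wp τ x - wp τ y) = d * (wp τ x - wp τ y))
    (h2 : c * (wp' τ x - wp' τ y) = d * (wp' τ x - wp' τ y)) : c = d := by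
  rcases wp_ne_or hx hy hxy with h | h
  · exact mul_right_cancel₀ h h1
  · exact mul_right_cancel₀ h h2

lemma sub_swap_notMem {x y : ℂ} (hxy : x - y ∉ Lat τ) : y - x ∉ Lat τ := by
  rwa [← neg_sub, neg_mem_iff]

lemma phi_antisymm {x y : ℂ} (hx : x ∉ Lat τ) (hy : y ∉ Lat τ) (hxy : x - y ∉ Lat τ) :
    phi τ y x = -phi τ x y := by
  have h := phi_rel hx hy hxy
  have h' := phi_rel hy hx (sub_swap_notMem hxy)
  refine eq_of_phi_rel hx hy hxy ?_ ?_
  · linear_combination -(1 / 2) * h'.1 + (1 / 2) * h.1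
  · linear_combination -(1 / 2) * h'.2 + (1 / 2) * h.2

lemma analyticAt_phi {x y : ℂ → ℂ} {t : ℂ} (ax : AnalyticAt ℂ x t) (ay : AnalyticAt ℂ y t)
    (hx : x t ∉ Lat τ) (hy : y t ∉ Lat τ) (hxy : x t - y t ∉ Lat τ) :
    AnalyticAt ℂ (fun s => phi τ (x s) (y s)) t := by
  have ux : AnalyticAt ℂ (fun s => wp τ (x s)) t := (analyticAt_wp hx).fun_comp ax
  have uy : AnalyticAt ℂ (fun s => wp τ (y s)) t := (analyticAt_wp hy).fun_comp ay
  have vx : AnalyticAt ℂ (fun s => wp' τ (x s)) t := (analyticAt_wp' hx).fun_comp ax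
  have vy : AnalyticAt ℂ (fun s => wp' τ (y s)) t := (analyticAt_wp' hy).fun_comp ay
  have hx' := ax.continuousAt.eventually (eventually_notMem_Lat' hx)
  have hy' := ay.continuousAt.eventually (eventually_notMem_Lat' hy)
  have hxy' := (ax.continuousAt.sub ay.continuousAt).eventually (eventually_notMem_Lat' hxy)
  rcases wp_ne_or hx hy hxy with h | h
  · refine AnalyticAt.congr (f := fun s => (wp' τ (x s) + wp' τ (y s)) /
      (2 * (wp τ (x s) - wp τ (y s)))) ((vx.add vy).div (analyticAt_const.mul (ux.sub uy))
      (mul_ne_zero two_ne_zero h)) ?_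
    filter_upwards [hx', hy', hxy', (ux.sub uy).continuousAt.eventually_ne h] with s h1 h2 h3 h4
    rw [Pi.sub_apply] at h4
    rw [← (phi_rel h1 h2 h3).1, div_eq_iff (mul_ne_zero two_ne_zero h4)]
    ring
  · refine AnalyticAt.congr (f := fun s => (4 * (wp τ (x s) ^ 2 + wp τ (x s) * wp τ (y s) +
      wp τ (y s) ^ 2) - (periods τ).g₂) / (2 * (wp' τ (x s) - wp' τ (y s))))
      (AnalyticAt.div (by fun_prop) (analyticAt_const.mul (vx.sub vy))
      (mul_ne_zero two_ne_zero h)) ?_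
    filter_upwards [hx', hy', hxy', (vx.sub vy).continuousAt.eventually_ne h] with s h1 h2 h3 h4
    rw [Pi.sub_apply] at h4
    rw [← (phi_rel h1 h2 h3).2, div_eq_iff (mul_ne_zero two_ne_zero h4)]
    ring

lemma hasDerivAt_wp_comp {x : ℂ → ℂ} {t α : ℂ} (ax : HasDerivAt x α t) (hx : x t ∉ Lat τ) :
    HasDerivAt (fun s => wp τ (x s)) (wp' τ (x t) * α) t :=
  (hasDerivAt_weierstrassP τ hx).comp t ax

lemma hasDerivAt_wp'_comp {x : ℂ → ℂ} {t α : ℂ} (ax : HasDerivAt x α t) (hx : x t ∉ Lat τ) :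
    HasDerivAt (fun s => wp' τ (x s)) ((6 * wp τ (x t) ^ 2 - (periods τ).g₂ / 2) * α) t :=
  (hasDerivAt_derivWeierstrassP τ hx).comp t ax

/-- Differentiating both equations of `phi_rel` along a curve determines the derivative. The square
of `phi` on the right is provisional: the addition theorem is deduced from this formula and
afterwards eliminates the square. -/
lemma hasDerivAt_phi_aux {x y : ℂ → ℂ} {t α β : ℂ} (dx : HasDerivAt x α t)
    (dy : HasDerivAt y β t) (ax : AnalyticAt ℂ x t) (ay : AnalyticAt ℂ y t)
    (hx : x t ∉ Lat τ) (hy : y t ∉ Lat τ) (hxy : x t - y t ∉ Lat τ) :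
    HasDerivAt (fun s => phi τ (x s) (y s))
      (α * (2 * wp τ (x t) + wp τ (y t) - phi τ (x t) (y t) ^ 2) -
        β * (2 * wp τ (y t) + wp τ (x t) - phi τ (x t) (y t) ^ 2)) t := by
  have hd := (analyticAt_phi ax ay hx hy hxy).differentiableAt.hasDerivAt
  have hx' := ax.continuousAt.eventually (eventually_notMem_Lat' hx)
  have hy' := ay.continuousAt.eventually (eventually_notMem_Lat' hy)
  have hxy' := (ax.continuousAt.sub ay.continuousAt).eventually (eventually_notMem_Lat' hxy)
  have ux := hasDerivAt_wp_comp dx hx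
  have uy := hasDerivAt_wp_comp dy hy
  have vx := hasDerivAt_wp'_comp dx hx
  have vy := hasDerivAt_wp'_comp dy hy
  have e1 := ((hd.const_mul 2).mul (ux.sub uy)).unique ((vx.add vy).congr_of_eventuallyEq (by
    filter_upwards [hx', hy', hxy'] with s h1 h2 h3
    exact (phi_rel h1 h2 h3).1))
  have e2 := ((hd.const_mul 2).mul (vx.sub vy)).unique
    ((((((ux.pow 2).add (ux.mul uy)).add (uy.pow 2)).const_mul 4).sub_const
      (periods τ).g₂).congr_of_eventuallyEq (by
    filter_upwards [hx', hy', hxy'] with s h1 h2 h3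
    exact (phi_rel h1 h2 h3).2))
  obtain ⟨r1, r2⟩ := phi_rel hx hy hxy
  refine hd.congr_deriv (eq_of_phi_rel hx hy hxy ?_ ?_)
  all_goals
    simp only [Pi.sub_apply, Nat.add_one_sub_one, pow_one, Nat.cast_ofNat] at e1 e2
    set p := phi τ (x t) (y t)
    set u := wp τ (x t)
    set v := wp' τ (x t)
    set z := wp τ (y t)
    set w := wp' τ (y t)
    set D := deriv (fun s => phi τ (x s) (y s)) t
  · linear_combination (1 / 2) * e1 + (p / 2) * (α - β) * r1 - (α + β) / 4 * r2
  · linear_combination (1 / 2) * e2 - α * ((2 * u + z) * r1 - p / 2 * r2) -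
      β * ((u + 2 * z) * r1 + p / 2 * r2)

lemma meromorphicAt_wp (c : ℂ) : MeromorphicAt (wp τ) c := (periods τ).meromorphic_weierstrassP c

lemma meromorphicAt_wp' (c : ℂ) : MeromorphicAt (wp' τ) c :=
  (periods τ).meromorphic_derivWeierstrassP c

end Phi

/-! ### Laurent expansions of `℘` and `phi` -/

lemma exists_hasLaurentAt {g : ℂ → ℂ} {c : ℂ} (h : MeromorphicAt g c) :
    ∃ A, HasLaurentAt g c A := by
  obtain ⟨N, hN⟩ := h
  refine ⟨HahnSeries.single (-(N : ℤ)) 1 *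
    (taylorSeries (fun z => (z - c) ^ N * g z) c : LaurentSeries ℂ), N, _, hN,
    Filter.Eventually.of_forall fun z => rfl, ?_⟩
  rw [← mul_assoc, HahnSeries.single_mul_single]
  simp

/-- For a series with at most a simple pole, these coefficients of the square recover the constants
of integration that the derivative does not see. -/
lemma coeff_mul_self {R : Type*} [CommRing R] {A : LaurentSeries R}
    (h : ∀ m < -1, A.coeff m = 0) :
    (A * A).coeff (-1) = 2 * A.coeff (-1) * A.coeff 0 ∧
    (A * A).coeff 0 = 2 * A.coeff (-1) * A.coeff 1 + A.coeff 0 ^ 2 := by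
  set P : PowerSeries R := PowerSeries.mk fun n => A.coeff (n - 1) with hP
  have hA : A = HahnSeries.single (-1) 1 * (P : LaurentSeries R) := by
    ext m
    rw [HahnSeries.coeff_single_mul, PowerSeries.coeff_coe, one_mul]
    split_ifs with hm
    · exact h m (by omega)
    · rw [hP, PowerSeries.coeff_mk]
      congr 1
      omega
  have hA2 : A * A = HahnSeries.single (-2) 1 * ((P * P : PowerSeries R) : LaurentSeries R) := by
    rw [PowerSeries.coe_mul, hA]
    have : (HahnSeries.single (-2) 1 : LaurentSeries R) =
        HahnSeries.single (-1) 1 * HahnSeries.single (-1) 1 := by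
      rw [HahnSeries.single_mul_single]; simp
    rw [this]
    ring
  have e1 : (A * A).coeff (-1) = PowerSeries.coeff 1 (P * P) := by
    rw [hA2, HahnSeries.coeff_single_mul, PowerSeries.coeff_coe]; norm_num
  have e2 : (A * A).coeff 0 = PowerSeries.coeff 2 (P * P) := by
    rw [hA2, HahnSeries.coeff_single_mul, PowerSeries.coeff_coe]; norm_num
  have p0 : PowerSeries.coeff 0 P = A.coeff (-1) := by simp [hP]
  have p1 : PowerSeries.coeff 1 P = A.coeff 0 := by simp [hP]
  have p2 : PowerSeries.coeff 2 P = A.coeff 1 := by simp [hP]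
  constructor
  · rw [e1, PowerSeries.coeff_mul, Finset.Nat.sum_antidiagonal_eq_sum_range_succ_mk,
      Finset.sum_range_succ, Finset.sum_range_one]
    simp only [Nat.sub_zero, Nat.sub_self, p0, p1]
    ring
  · rw [e2, PowerSeries.coeff_mul, Finset.Nat.sum_antidiagonal_eq_sum_range_succ_mk,
      Finset.sum_range_succ, Finset.sum_range_succ, Finset.sum_range_one]
    simp only [Nat.sub_zero, Nat.sub_self, p0, p1, p2, Nat.reduceSub]
    ring

section Expansions

variable (τ : ℍ)

/-- The Laurent series of `℘` at the origin. -/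
def wpSeries : LaurentSeries ℂ :=
  (taylorSeries (wpReg τ) 0 : LaurentSeries ℂ) + HahnSeries.single (-1) 1 * HahnSeries.single (-1) 1

lemma hasLaurentAt_wp : HasLaurentAt (wp τ) 0 (wpSeries τ) := by
  have h : HasLaurentAt (fun z : ℂ => z⁻¹) 0 (HahnSeries.single (-1) 1) := by
    simpa using HasLaurentAt.inv_sub_center (c := 0)
  refine ((HasLaurentAt.of_analyticAt (analyticAt_wpReg τ)).add (h.mul h)).congr ?_
  filter_upwards with z
  rw [wp_eq]
  ring

lemma hasLaurentAt_wp_add {c : ℂ} (hc : c ∉ Lat τ) (a : ℂ) :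
    HasLaurentAt (fun z => wp τ (z - a + c)) a (taylorSeries (wp τ) c : LaurentSeries ℂ) := by
  have ha : AnalyticAt ℂ (fun z => wp τ (z - a + c)) a :=
    AnalyticAt.fun_comp (g := wp τ) (analyticAt_wp (by simpa using hc)) (by fun_prop)
  have h := HasLaurentAt.of_analyticAt ha
  have e : taylorSeries (fun z => wp τ (z - a + c)) a = taylorSeries (wp τ) c := by
    ext n
    have : (fun z => wp τ (z - a + c)) = fun z => wp τ (z + (c - a)) := by
      funext z; congr 1; ring
    rw [this]
    simp [taylorSeries, iteratedDeriv_comp_add_const]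
  rwa [e] at h

lemma HasLaurentAt.translate {g : ℂ → ℂ} {A : LaurentSeries ℂ} (h : HasLaurentAt g 0 A) (a : ℂ) :
    HasLaurentAt (fun z => g (z - a)) a A := by
  obtain ⟨N, G, hG, h1, h2⟩ := h
  refine ⟨N, fun z => G (z - a), ?_, ?_, ?_⟩
  · exact AnalyticAt.fun_comp (g := G) (by simpa using hG) (by fun_prop)
  · have : Filter.Tendsto (fun z => z - a) (𝓝[≠] a) (𝓝[≠] 0) := by
      refine tendsto_nhdsWithin_iff.mpr ⟨?_, ?_⟩
      · have : Filter.Tendsto (fun z => z - a) (𝓝 a) (𝓝 (a - a)) :=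
          (continuous_id.sub continuous_const).tendsto a
        rw [sub_self] at this
        exact this.mono_left nhdsWithin_le_nhds
      · filter_upwards [self_mem_nhdsWithin] with z hz
        exact sub_ne_zero.mpr hz
    filter_upwards [this.eventually h1] with z hz
    simpa using hz
  · rw [h2]
    congr 1
    ext n
    simp [taylorSeries, iteratedDeriv_comp_sub_const]

lemma wpSeries_coeff (m : ℤ) : (wpSeries τ).coeff m =
    (taylorSeries (wpReg τ) 0 : LaurentSeries ℂ).coeff m + if m = -2 then 1 else 0 := by
  rw [wpSeries, HahnSeries.coeff_add, HahnSeries.single_mul_single]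
  norm_num [HahnSeries.coeff_single]

lemma wpSeries_coeff_neg_one : (wpSeries τ).coeff (-1) = 0 := by
  rw [wpSeries_coeff, PowerSeries.coeff_coe]; simp

lemma wpSeries_coeff_neg_two : (wpSeries τ).coeff (-2) = 1 := by
  rw [wpSeries_coeff, PowerSeries.coeff_coe]; simp

lemma wpSeries_coeff_of_lt {m : ℤ} (hm : m < -2) : (wpSeries τ).coeff m = 0 := by
  rw [wpSeries_coeff, PowerSeries.coeff_coe, if_pos (by omega), if_neg (by omega), add_zero]

lemma wpSeries_coeff_zero : (wpSeries τ).coeff 0 = 0 := by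
  rw [wpSeries_coeff, PowerSeries.coeff_coe]
  simp [taylorSeries]

lemma wpSeries_coeff_odd {m : ℤ} (hm : Odd m) : (wpSeries τ).coeff m = 0 := by
  rw [wpSeries_coeff, PowerSeries.coeff_coe, if_neg (c := m = -2) (by rintro rfl; exact absurd hm (by decide)),
    add_zero]
  split_ifs with h
  · rfl
  · obtain ⟨n, rfl⟩ : ∃ n : ℕ, m = n := ⟨m.toNat, by omega⟩
    have hn : Odd n := by exact_mod_cast hm
    have e : (fun z => wpReg τ (-z)) = wpReg τ := by
      funext z
      have := (periods τ).weierstrassPExcept_neg 0 z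
      rwa [neg_zero] at this
    have h1 := iteratedDeriv_comp_neg n (wpReg τ) 0
    rw [e, hn.neg_one_pow, neg_zero, neg_smul, one_smul] at h1
    have h2 : iteratedDeriv n (wpReg τ) 0 = 0 := by linear_combination h1 / 2
    simp [taylorSeries, h2]

/-- The Laurent series of the Weierstrass `ζ`-function at the origin. -/
def zetaSeries : LaurentSeries ℂ :=
  -- The constant term is zero by the convention `x / 0 = 0`, as it should be for the odd function
  -- ζ.
  HahnSeries.ofSuppBddBelow (fun m => -(wpSeries τ).coeff (m - 1) / m) <| by
    refine ⟨-1, fun m hm => ?_⟩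
    by_contra h
    refine hm ?_
    dsimp only
    rw [wpSeries_coeff_of_lt τ (by omega), neg_zero, zero_div]

lemma zetaSeries_coeff (m : ℤ) :
    (zetaSeries τ).coeff m = -(wpSeries τ).coeff (m - 1) / m := rfl

lemma zetaSeries_odd (m : ℤ) :
    ((-1 : ℂ) ^ m) * (zetaSeries τ).coeff m = -(zetaSeries τ).coeff m := by
  rcases Int.even_or_odd m with h | h
  · have : Odd (m - 1) := h.sub_odd odd_one
    rw [zetaSeries_coeff, wpSeries_coeff_odd τ this]
    simp
  · rw [h.neg_one_zpow]
    ring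

end Expansions
end ChiralHomology
namespace ChiralHomology

/-! ### The addition theorem and the Laurent expansions of `phi` -/

section Addition

variable {τ : ℍ}

lemma meromorphicAt_phi {x y : ℂ → ℂ} {t : ℂ} (ux : MeromorphicAt (fun s => wp τ (x s)) t)
    (uy : MeromorphicAt (fun s => wp τ (y s)) t) (vx : MeromorphicAt (fun s => wp' τ (x s)) t)
    (vy : MeromorphicAt (fun s => wp' τ (y s)) t)
    (hne : ¬ ∀ᶠ s in 𝓝[≠] t, wp τ (x s) = wp τ (y s)) :
    MeromorphicAt (fun s => phi τ (x s) (y s)) t := by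
  have hm : MeromorphicAt (fun s => (wp' τ (x s) + wp' τ (y s)) /
      (2 * (wp τ (x s) - wp τ (y s)))) t := by fun_prop
  refine hm.congr ?_
  have hd : MeromorphicAt (fun s => wp τ (x s) - wp τ (y s)) t := by fun_prop
  rcases hd.eventually_eq_zero_or_eventually_ne_zero with h | h
  · exact (hne (h.mono fun s hs => sub_eq_zero.mp hs)).elim
  · filter_upwards [h] with s hs
    rw [phi, if_pos (sub_ne_zero.mp hs)]

lemma hasseDeriv_one_coeff (A : LaurentSeries ℂ) (m : ℤ) :
    (LaurentSeries.hasseDeriv ℂ 1 A).coeff m = (m + 1) * A.coeff (m + 1) := by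
  rw [LaurentSeries.hasseDeriv_coeff, Nat.cast_one, Ring.choose_one_right, zsmul_eq_mul]
  push_cast
  rfl

lemma coeff_eq_of_hasseDeriv {A B : LaurentSeries ℂ} (h : LaurentSeries.hasseDeriv ℂ 1 A = B)
    {m : ℤ} (hm : m ≠ 0) : A.coeff m = B.coeff (m - 1) / m := by
  have hm' : (m : ℂ) ≠ 0 := by exact_mod_cast hm
  rw [← h, hasseDeriv_one_coeff, sub_add_cancel, eq_div_iff hm']
  push_cast
  ring

lemma powerSeries_coeff_of_neg {R : Type*} [CommRing R] (P : PowerSeries R) {m : ℤ} (hm : m < 0) :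
    (P : LaurentSeries R).coeff m = 0 := by
  rw [PowerSeries.coeff_coe, if_pos hm]

lemma taylor_coeff_zero (f : ℂ → ℂ) (c : ℂ) :
    (taylorSeries f c : LaurentSeries ℂ).coeff 0 = f c := by
  simp [PowerSeries.coeff_coe, taylorSeries]

lemma C_coeff_of_ne {R : Type*} [CommRing R] (a : R) {m : ℤ} (hm : m ≠ 0) :
    (HahnSeries.C a : LaurentSeries R).coeff m = 0 := by
  simp [HahnSeries.C_apply, hm]

lemma hasLaurentAt_wp_taylor {c : ℂ} (hc : c ∉ Lat τ) :
    HasLaurentAt (fun z => wp τ (z + c)) 0 (taylorSeries (wp τ) c : LaurentSeries ℂ) := by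
  simpa using hasLaurentAt_wp_add τ hc 0

/-- The addition theorem. -/
lemma phi_sq {x y : ℂ} (hx : x ∉ Lat τ) (hy : y ∉ Lat τ) (hxy : x - y ∉ Lat τ) :
    phi τ x y ^ 2 = wp τ (x - y) + wp τ x + wp τ y := by
  set c := x - y with hc
  set S := {z : ℂ | z ∉ Lat τ ∧ z + c ∉ Lat τ}
  have hder : ∀ z ∈ S, HasDerivAt (fun s => phi τ (s + c) s) (wp τ (z + c) - wp τ z) z := by
    intro z hz
    refine (hasDerivAt_phi_aux (x := fun s => s + c) (y := fun s => s) (t := z) (α := 1) (β := 1)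
      ((hasDerivAt_id z).add_const c) (hasDerivAt_id z) (by fun_prop) (by fun_prop)
      hz.2 hz.1 (by simpa using hxy)).congr_deriv ?_
    ring
  have hder2 : ∀ z ∈ S,
      HasDerivAt (fun s => phi τ (s + c) s ^ 2 - wp τ (s + c) - wp τ s) 0 z := by
    intro z hz
    refine ((((hder z hz).pow 2).sub (hasDerivAt_wp_comp ((hasDerivAt_id z).add_const c)
      hz.2)).sub (hasDerivAt_weierstrassP τ hz.1)).congr_deriv ?_
    have := (phi_rel hz.2 hz.1 (by simpa using hxy)).1
    simp only [id]
    push_cast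
    linear_combination this
  -- For a fixed difference `c` of the arguments, phi² - ℘ - ℘ is constant on a connected set. The
  -- constant is found from the Laurent expansion as the second argument tends to the origin.
  obtain ⟨k, hk⟩ := (isOpen_compl_two τ c).exists_is_const_of_deriv_eq_zero
    (isPreconnected_compl_two τ c)
    (fun z hz => (hder2 z hz).differentiableAt.differentiableWithinAt)
    (fun z hz => (hder2 z hz).deriv)
  have hS : ∀ᶠ z in 𝓝[≠] (0 : ℂ), z ∈ S := by
    have h0c : (0 : ℂ) - (-c) ∉ Lat τ := by simpa using hxy
    filter_upwards [eventually_notMem_Lat τ 0,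
      eventually_nhdsWithin_of_eventually_nhds (eventually_sub_notMem_Lat' h0c)] with z hz hz'
    exact ⟨hz, by simpa using hz'⟩
  have a1 : AnalyticAt ℂ (fun z => wp τ (z + c)) 0 :=
    AnalyticAt.fun_comp (g := wp τ) (analyticAt_wp (by simpa using hxy)) (by fun_prop)
  have a2 : AnalyticAt ℂ (fun z => wp' τ (z + c)) 0 :=
    AnalyticAt.fun_comp (g := wp' τ) (analyticAt_wp' (by simpa using hxy)) (by fun_prop)
  obtain ⟨B, hB⟩ := exists_hasLaurentAt (meromorphicAt_phi (x := fun s => s + c)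
    (y := fun s => s) (t := 0) a1.meromorphicAt (meromorphicAt_wp 0) a2.meromorphicAt
    (meromorphicAt_wp' 0) (fun h => not_analyticAt_of_eq_wp τ a1 h))
  have hB1 : LaurentSeries.hasseDeriv ℂ 1 B =
      (taylorSeries (wp τ) c : LaurentSeries ℂ) - wpSeries τ :=
    (hB.deriv' (hS.mono fun z hz => hder z hz)).unique
      ((hasLaurentAt_wp_taylor hxy).sub (hasLaurentAt_wp τ))
  have hB2 : B * B = HahnSeries.C k + (taylorSeries (wp τ) c : LaurentSeries ℂ) + wpSeries τ := by
    refine (hB.mul hB).unique ((((HasLaurentAt.const k).add (hasLaurentAt_wp_taylor hxy)).add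
      (hasLaurentAt_wp τ)).congr ?_)
    filter_upwards [hS] with z hz
    rw [← hk z hz]
    ring
  have b1 : ∀ m < -1, B.coeff m = 0 := by
    intro m hm
    rw [coeff_eq_of_hasseDeriv hB1 (by omega), HahnSeries.coeff_sub,
      powerSeries_coeff_of_neg _ (by omega), wpSeries_coeff_of_lt τ (by omega)]
    simp
  have b2 : B.coeff (-1) = 1 := by
    rw [coeff_eq_of_hasseDeriv hB1 (by norm_num), HahnSeries.coeff_sub,
      powerSeries_coeff_of_neg _ (by norm_num)]
    norm_num [wpSeries_coeff_neg_two]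
  have b3 : B.coeff 1 = wp τ c := by
    rw [coeff_eq_of_hasseDeriv hB1 (by norm_num), HahnSeries.coeff_sub]
    norm_num [taylor_coeff_zero, wpSeries_coeff_zero]
  obtain ⟨c1, c2⟩ := coeff_mul_self b1
  rw [hB2] at c1 c2
  simp only [HahnSeries.coeff_add, taylor_coeff_zero, wpSeries_coeff_zero,
    powerSeries_coeff_of_neg _ (show (-1 : ℤ) < 0 by norm_num), wpSeries_coeff_neg_one,
    C_coeff_of_ne _ (show (-1 : ℤ) ≠ 0 by norm_num), b2, b3] at c1 c2
  -- `B` has residue 1 and its square has no residue, so the constant term of `B` vanishes. The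
  -- constant term of the square is then 2℘(c) on one side and k + ℘(c) on the other.
  have b0 : B.coeff 0 = 0 := by linear_combination -c1 / 2
  have hkk : k = wp τ c := by
    rw [b0] at c2
    simp [HahnSeries.C_apply] at c2
    linear_combination c2
  have := hk y ⟨hy, by simpa [hc] using hx⟩
  rw [hkk] at this
  have e : y + c = x := by rw [hc]; ring
  simp only [e] at this
  linear_combination this

lemma hasDerivAt_phi_left {x y : ℂ} (hx : x ∉ Lat τ) (hy : y ∉ Lat τ) (hxy : x - y ∉ Lat τ) :
    HasDerivAt (fun s => phi τ s y) (wp τ x - wp τ (x - y)) x := by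
  refine (hasDerivAt_phi_aux (x := fun s => s) (y := fun _ => y) (t := x) (α := 1) (β := 0)
    (hasDerivAt_id x) (hasDerivAt_const x y) (by fun_prop) (by fun_prop) hx hy hxy).congr_deriv ?_
  rw [phi_sq hx hy hxy]
  ring

lemma hasDerivAt_phi_right {x y : ℂ} (hx : x ∉ Lat τ) (hy : y ∉ Lat τ) (hxy : x - y ∉ Lat τ) :
    HasDerivAt (fun s => phi τ x s) (wp τ (x - y) - wp τ y) y := by
  refine (hasDerivAt_phi_aux (x := fun _ => x) (y := fun s => s) (t := y) (α := 0) (β := 1)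
    (hasDerivAt_const y x) (hasDerivAt_id y) (by fun_prop) (by fun_prop) hx hy hxy).congr_deriv ?_
  rw [phi_sq hx hy hxy]
  ring

/-- The power series with coefficients `f^{(m-1)}(c) / m!` for `m ≥ 1`. -/
def primSeries (f : ℂ → ℂ) (c : ℂ) : PowerSeries ℂ :=
  PowerSeries.mk fun m => if m = 0 then 0 else (m.factorial : ℂ)⁻¹ * iteratedDeriv (m - 1) f c

lemma primSeries_coeff (f : ℂ → ℂ) (c : ℂ) {m : ℤ} (hm : m ≠ 0) :
    (primSeries f c : LaurentSeries ℂ).coeff m =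
      (taylorSeries f c : LaurentSeries ℂ).coeff (m - 1) / m := by
  rcases lt_or_gt_of_ne hm with h | h
  · rw [powerSeries_coeff_of_neg _ h, powerSeries_coeff_of_neg _ (by omega), zero_div]
  · obtain ⟨n, rfl⟩ : ∃ n : ℕ, m = (n + 1 : ℕ) := ⟨(m - 1).toNat, by omega⟩
    have e : ((n + 1 : ℕ) : ℤ) - 1 = n := by push_cast; ring
    have h0 : (n + 1 : ℂ) ≠ 0 := by exact_mod_cast n.succ_ne_zero
    have h1 : (n.factorial : ℂ) ≠ 0 := by exact_mod_cast n.factorial_ne_zero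
    rw [e, PowerSeries.coeff_coe, if_neg (by omega), PowerSeries.coeff_coe, if_neg (by omega)]
    simp only [primSeries, taylorSeries, PowerSeries.coeff_mk, Int.natAbs_natCast,
      Nat.succ_ne_zero, if_false, Nat.add_sub_cancel, Nat.factorial_succ]
    push_cast
    field_simp

lemma primSeries_coeff_zero (f : ℂ → ℂ) (c : ℂ) :
    (primSeries f c : LaurentSeries ℂ).coeff 0 = 0 := by
  simp [PowerSeries.coeff_coe, primSeries]

/-- The Laurent expansion of `phi · y` at `y`. -/
lemma hasLaurentAt_phi_self {y : ℂ} (hy : y ∉ Lat τ) : HasLaurentAt (fun z => phi τ z y) y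
    (zetaSeries τ + (primSeries (wp τ) y : LaurentSeries ℂ)) := by
  have hne : ¬ ∀ᶠ z in 𝓝[≠] y, wp τ z = wp τ y := by
    intro h
    refine not_eventually_wp_eq τ hy (wp τ y) ?_
    filter_upwards [eventually_nhdsWithin_iff.mp h] with z hz
    by_cases hzy : z = y
    · rw [hzy]
    · exact hz hzy
  obtain ⟨A, hA⟩ := exists_hasLaurentAt (meromorphicAt_phi (x := fun s => s)
    (y := fun _ => y) (t := y) (meromorphicAt_wp y) (by fun_prop) (meromorphicAt_wp' y)
    (by fun_prop) hne)
  have hS : ∀ᶠ z in 𝓝[≠] y, z ∉ Lat τ ∧ z - y ∉ Lat τ := by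
    filter_upwards [eventually_nhdsWithin_of_eventually_nhds (eventually_notMem_Lat' hy),
      eventually_sub_notMem_Lat τ y y] with z h1 h2 using ⟨h1, h2⟩
  have l1 : HasLaurentAt (wp τ) y (taylorSeries (wp τ) y : LaurentSeries ℂ) :=
    HasLaurentAt.of_analyticAt (analyticAt_wp hy)
  have l2 := (hasLaurentAt_wp τ).translate y
  have hA1 : LaurentSeries.hasseDeriv ℂ 1 A =
      (taylorSeries (wp τ) y : LaurentSeries ℂ) - wpSeries τ :=
    (hA.deriv' (hS.mono fun z hz => hasDerivAt_phi_left hz.1 hy hz.2)).unique (l1.sub l2)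
  have hA2 : A * A = wpSeries τ + (taylorSeries (wp τ) y : LaurentSeries ℂ) +
      HahnSeries.C (wp τ y) := by
    refine (hA.mul hA).unique (((l2.add l1).add (HasLaurentAt.const _)).congr ?_)
    filter_upwards [hS] with z hz
    rw [← phi_sq hz.1 hy hz.2]
    ring
  have b1 : ∀ m < -1, A.coeff m = 0 := by
    intro m hm
    rw [coeff_eq_of_hasseDeriv hA1 (by omega), HahnSeries.coeff_sub,
      powerSeries_coeff_of_neg _ (by omega), wpSeries_coeff_of_lt τ (by omega)]
    simp
  have b2 : A.coeff (-1) = 1 := by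
    rw [coeff_eq_of_hasseDeriv hA1 (by norm_num), HahnSeries.coeff_sub,
      powerSeries_coeff_of_neg _ (by norm_num)]
    norm_num [wpSeries_coeff_neg_two]
  have c1 := (coeff_mul_self b1).1
  rw [hA2] at c1
  simp only [HahnSeries.coeff_add,
    powerSeries_coeff_of_neg _ (show (-1 : ℤ) < 0 by norm_num), wpSeries_coeff_neg_one,
    C_coeff_of_ne _ (show (-1 : ℤ) ≠ 0 by norm_num), b2] at c1
  -- The derivative fixes every coefficient except the constant one, which is zero because the
  -- square has no residue.
  have e : A = zetaSeries τ + (primSeries (wp τ) y : LaurentSeries ℂ) := by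
    ext m
    rw [HahnSeries.coeff_add, zetaSeries_coeff]
    by_cases hm : m = 0
    · subst hm
      rw [primSeries_coeff_zero]
      simp
      linear_combination -c1 / 2
    · rw [coeff_eq_of_hasseDeriv hA1 hm, primSeries_coeff _ _ hm, HahnSeries.coeff_sub]
      ring
  rwa [← e]

/-- The Laurent expansion of `phi · y` at the origin. -/
lemma hasLaurentAt_phi_zero {y : ℂ} (hy : y ∉ Lat τ) : HasLaurentAt (fun z => phi τ z y) 0
    (-zetaSeries τ - (primSeries (wp τ) (-y) : LaurentSeries ℂ)) := by
  have hy' : -y ∉ Lat τ := by simpa using hy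
  obtain ⟨A, hA⟩ := exists_hasLaurentAt (meromorphicAt_phi (x := fun s => s)
    (y := fun _ => y) (t := 0) (meromorphicAt_wp 0) (by fun_prop) (meromorphicAt_wp' 0)
    (by fun_prop) (fun h => not_analyticAt_of_eq_wp τ (f := fun _ => wp τ y) analyticAt_const
      (h.mono fun z hz => hz.symm)))
  have hS : ∀ᶠ z in 𝓝[≠] (0 : ℂ), z ∉ Lat τ ∧ z - y ∉ Lat τ := by
    filter_upwards [eventually_notMem_Lat τ 0, eventually_nhdsWithin_of_eventually_nhds
      (eventually_sub_notMem_Lat' (by simpa using hy))] with z h1 h2 using ⟨h1, h2⟩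
  have l1 := hasLaurentAt_wp τ
  have l2 : HasLaurentAt (fun z => wp τ (z - y)) 0
      (taylorSeries (wp τ) (-y) : LaurentSeries ℂ) := by
    simpa [sub_eq_add_neg] using hasLaurentAt_wp_taylor hy'
  have hA1 : LaurentSeries.hasseDeriv ℂ 1 A =
      wpSeries τ - (taylorSeries (wp τ) (-y) : LaurentSeries ℂ) :=
    (hA.deriv' (hS.mono fun z hz => hasDerivAt_phi_left hz.1 hy hz.2)).unique (l1.sub l2)
  have hA2 : A * A = (taylorSeries (wp τ) (-y) : LaurentSeries ℂ) + wpSeries τ +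
      HahnSeries.C (wp τ y) := by
    refine (hA.mul hA).unique (((l2.add l1).add (HasLaurentAt.const _)).congr ?_)
    filter_upwards [hS] with z hz
    rw [← phi_sq hz.1 hy hz.2]
    ring
  have b1 : ∀ m < -1, A.coeff m = 0 := by
    intro m hm
    rw [coeff_eq_of_hasseDeriv hA1 (by omega), HahnSeries.coeff_sub,
      powerSeries_coeff_of_neg _ (by omega), wpSeries_coeff_of_lt τ (by omega)]
    simp
  have b2 : A.coeff (-1) = -1 := by
    rw [coeff_eq_of_hasseDeriv hA1 (by norm_num), HahnSeries.coeff_sub,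
      powerSeries_coeff_of_neg _ (by norm_num)]
    norm_num [wpSeries_coeff_neg_two]
  have c1 := (coeff_mul_self b1).1
  rw [hA2] at c1
  simp only [HahnSeries.coeff_add,
    powerSeries_coeff_of_neg _ (show (-1 : ℤ) < 0 by norm_num), wpSeries_coeff_neg_one,
    C_coeff_of_ne _ (show (-1 : ℤ) ≠ 0 by norm_num), b2] at c1
  have e : A = -zetaSeries τ - (primSeries (wp τ) (-y) : LaurentSeries ℂ) := by
    ext m
    rw [HahnSeries.coeff_sub, HahnSeries.coeff_neg, zetaSeries_coeff]
    by_cases hm : m = 0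
    · subst hm
      rw [primSeries_coeff_zero]
      simp
      linear_combination c1 / 2
    · rw [coeff_eq_of_hasseDeriv hA1 hm, primSeries_coeff _ _ hm, HahnSeries.coeff_sub]
      ring
  rwa [← e]

end Addition
end ChiralHomology
namespace ChiralHomology

/-! ### Generators of `Γₙ` -/

section Generators

variable (τ : ℍ) {n m k : ℕ}

@[ext] lemma Gam.ext' {τ : ℍ} {f g : Gam τ n} (h : ∀ x, f.1 x = g.1 x) : f = g :=
  Subtype.ext (funext h)

/-- Evaluation at a point. -/
def ev {τ : ℍ} (x : config τ n) : Gam τ n →ₐ[ℂ] ℂ :=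
  (Pi.evalAlgHom ℂ (fun _ : config τ n => ℂ) x).comp (Gam τ n).val

lemma ev_apply {τ : ℍ} (x : config τ n) (f : Gam τ n) : ev x f = f.1 x := rfl

lemma ext_ev {τ : ℍ} {f g : Gam τ n} (h : ∀ x, ev x f = ev x g) : f = g := Gam.ext' h

/-- The coordinate functions. -/
def gCoord (c : Fin n ⊕ Fin n) : Gam τ n :=
  ⟨fun x => coords τ x.1 c, fun _ => ⟨MvPolynomial.X c, 1, by simp, fun y => by simp⟩⟩

/-- The function `℘(xᵢ)`. -/
abbrev gU (i : Fin n) : Gam τ n := gCoord τ (Sum.inl i)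

/-- The function `℘'(xᵢ)`. -/
abbrev gV (i : Fin n) : Gam τ n := gCoord τ (Sum.inr i)

/-- The function `phi xᵢ xⱼ`. -/
def gPhi (i j : Fin n) (h : i ≠ j) : Gam τ n :=
  ⟨fun x => phi τ (x.1 i) (x.1 j), fun x => by
    have hx := x.2.1 i
    have hy := x.2.1 j
    have hxy := x.2.2 i j h
    -- Each of the two fractions serves as a local representation where its own denominator is
    -- nonzero.
    rcases wp_ne_or hx hy hxy with h0 | h0
    · refine ⟨MvPolynomial.X (Sum.inr i) + MvPolynomial.X (Sum.inr j),
        2 * (MvPolynomial.X (Sum.inl i) - MvPolynomial.X (Sum.inl j)), ?_, fun y => ?_⟩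
      · simpa [coords] using h0
      · have := (phi_rel (y.2.1 i) (y.2.1 j) (y.2.2 i j h)).1
        simp only [map_mul, map_sub, map_add, MvPolynomial.eval_X, coords, Sum.elim_inl,
          Sum.elim_inr, map_ofNat]
        linear_combination this
    · refine ⟨4 * (MvPolynomial.X (Sum.inl i) ^ 2 + MvPolynomial.X (Sum.inl i) *
          MvPolynomial.X (Sum.inl j) + MvPolynomial.X (Sum.inl j) ^ 2) -
          MvPolynomial.C (periods τ).g₂,
        2 * (MvPolynomial.X (Sum.inr i) - MvPolynomial.X (Sum.inr j)), ?_, fun y => ?_⟩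
      · simpa [coords] using h0
      · have := (phi_rel (y.2.1 i) (y.2.1 j) (y.2.2 i j h)).2
        simp only [map_mul, map_sub, map_add, map_pow, MvPolynomial.eval_X, MvPolynomial.eval_C,
          coords, Sum.elim_inl, Sum.elim_inr, map_ofNat]
        linear_combination this⟩

lemma ev_gU (i : Fin n) (x : config τ n) : ev x (gU τ i) = wp τ (x.1 i) := rfl
lemma ev_gV (i : Fin n) (x : config τ n) : ev x (gV τ i) = wp' τ (x.1 i) := rfl
lemma ev_gPhi (i j : Fin n) (h : i ≠ j) (x : config τ n) :
    ev x (gPhi τ i j h) = phi τ (x.1 i) (x.1 j) := rfl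

lemma gPhi_antisymm (i j : Fin n) (h : i ≠ j) : gPhi τ j i h.symm = -gPhi τ i j h :=
  ext_ev fun x => by
    rw [map_neg, ev_gPhi, ev_gPhi, phi_antisymm (x.2.1 i) (x.2.1 j) (x.2.2 i j h)]

/-- The index set of the generators of `Γₙ`. -/
abbrev GenIdx (n : ℕ) : Type := (Fin n ⊕ Fin n) ⊕ {p : Fin n × Fin n // p.1 ≠ p.2}

/-- The presentation of `Γₙ` by the functions `℘(xᵢ)`, `℘'(xᵢ)` and `phi xᵢ xⱼ`. -/
def genHom (n : ℕ) : MvPolynomial (GenIdx n) ℂ →ₐ[ℂ] Gam τ n :=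
  MvPolynomial.aeval (Sum.elim (gCoord τ) fun p => gPhi τ p.1.1 p.1.2 p.2)

lemma genHom_inl (c : Fin n ⊕ Fin n) :
    genHom τ n (MvPolynomial.X (Sum.inl c)) = gCoord τ c := by
  rw [genHom, MvPolynomial.aeval_X, Sum.elim_inl]

lemma genHom_inr (i j : Fin n) (h : i ≠ j) :
    genHom τ n (MvPolynomial.X (Sum.inr ⟨(i, j), h⟩)) = gPhi τ i j h := by
  rw [genHom, MvPolynomial.aeval_X, Sum.elim_inr]

lemma ev_genHom_rename (x : config τ n) (p : MvPolynomial (Fin n ⊕ Fin n) ℂ) :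
    ev x (genHom τ n (MvPolynomial.rename Sum.inl p)) = MvPolynomial.eval (coords τ x.1) p := by
  have : ((ev x).comp (genHom τ n)).comp (MvPolynomial.rename Sum.inl) =
      MvPolynomial.aeval (coords τ x.1) := by
    refine MvPolynomial.algHom_ext fun c => ?_
    rw [AlgHom.comp_apply, AlgHom.comp_apply, MvPolynomial.rename_X, genHom_inl,
      MvPolynomial.aeval_X]
    rfl
  have h := DFunLike.congr_fun this p
  rw [MvPolynomial.aeval_eq_eval] at h
  exact h

/-- Every character of the generated algebra is the evaluation at a point. -/
lemma exists_point (χ : MvPolynomial (GenIdx n) ℂ →ₐ[ℂ] ℂ)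
    (hχ : ∀ q, genHom τ n q = 0 → χ q = 0) :
    ∃ x : config τ n, ∀ q, χ q = ev x (genHom τ n q) := by
  set U : Fin n → MvPolynomial (GenIdx n) ℂ := fun i => MvPolynomial.X (Sum.inl (Sum.inl i)) with hU
  set W : Fin n → MvPolynomial (GenIdx n) ℂ := fun i => MvPolynomial.X (Sum.inl (Sum.inr i)) with hW
  have eU : ∀ i x, ev x (genHom τ n (U i)) = wp τ (x.1 i) := fun i x => by
    rw [hU, genHom_inl, ev_gU]
  have eW : ∀ i x, ev x (genHom τ n (W i)) = wp' τ (x.1 i) := fun i x => by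
    rw [hW, genHom_inl, ev_gV]
  have hC : ∀ c (x : config τ n), ev x (genHom τ n (MvPolynomial.C c)) = c := fun c x => by
    rw [← MvPolynomial.algebraMap_eq, AlgHom.commutes, AlgHom.commutes]
    rfl
  have hχC : ∀ c, χ (MvPolynomial.C c) = c := fun c => by
    rw [← MvPolynomial.algebraMap_eq, AlgHom.commutes]
    rfl
  have key : ∀ i, χ (W i) ^ 2 = 4 * χ (U i) ^ 3 - (periods τ).g₂ * χ (U i) - (periods τ).g₃ := by
    intro i
    have h := hχ (W i ^ 2 - (4 * U i ^ 3 - MvPolynomial.C (periods τ).g₂ * U i -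
      MvPolynomial.C (periods τ).g₃)) (ext_ev fun x => by
        simp only [map_sub, map_mul, map_pow, map_ofNat, map_zero, eU, eW, hC]
        exact sub_eq_zero.mpr (wp'_sq (x.2.1 i)))
    simp only [map_sub, map_mul, map_pow, map_ofNat, hχC] at h
    exact sub_eq_zero.mp h
  have hex : ∀ i, ∃ z, z ∉ Lat τ ∧ wp τ z = χ (U i) ∧ wp' τ z = χ (W i) :=
    fun i => exists_wp_wp'_eq τ _ _ (key i)
  choose z hz hzU hzW using hex
  have rel : ∀ (i j : Fin n) (h : i ≠ j),
      2 * χ (MvPolynomial.X (Sum.inr ⟨(i, j), h⟩)) * (χ (U i) - χ (U j)) = χ (W i) + χ (W j) ∧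
      2 * χ (MvPolynomial.X (Sum.inr ⟨(i, j), h⟩)) * (χ (W i) - χ (W j)) =
        4 * (χ (U i) ^ 2 + χ (U i) * χ (U j) + χ (U j) ^ 2) - (periods τ).g₂ := by
    intro i j h
    have h1 := hχ (2 * MvPolynomial.X (Sum.inr ⟨(i, j), h⟩) * (U i - U j) - (W i + W j))
      (ext_ev fun x => by
        simp only [map_sub, map_add, map_mul, map_ofNat, map_zero, eU, eW, genHom_inr, ev_gPhi]
        exact sub_eq_zero.mpr (phi_rel (x.2.1 i) (x.2.1 j) (x.2.2 i j h)).1)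
    have h2 := hχ (2 * MvPolynomial.X (Sum.inr ⟨(i, j), h⟩) * (W i - W j) -
      (4 * (U i ^ 2 + U i * U j + U j ^ 2) - MvPolynomial.C (periods τ).g₂))
      (ext_ev fun x => by
        simp only [map_sub, map_add, map_mul, map_pow, map_ofNat, map_zero, eU, eW, hC,
          genHom_inr, ev_gPhi]
        exact sub_eq_zero.mpr (phi_rel (x.2.1 i) (x.2.1 j) (x.2.2 i j h)).2)
    simp only [map_mul, map_sub, map_add, map_pow, map_ofNat, hχC] at h1 h2
    exact ⟨sub_eq_zero.mp h1, sub_eq_zero.mp h2⟩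
  -- The value of the character on the generator `phi` excludes the diagonal: if the two points
  -- coincided, the first relation would force ℘' = 0 and the second ℘'' = 0, a singular point of
  -- the cubic.
  have hzz : ∀ i j, i ≠ j → z i - z j ∉ Lat τ := by
    intro i j hij hm
    have e : z i = z j + ((⟨z i - z j, hm⟩ : Lat τ) : ℂ) := by simp
    have eu : wp τ (z i) = wp τ (z j) := by
      conv_lhs => rw [e]
      exact (periods τ).weierstrassP_add_coe _ _
    have ev : wp' τ (z i) = wp' τ (z j) := by
      conv_lhs => rw [e]
      exact (periods τ).derivWeierstrassP_add_coe _ _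
    obtain ⟨h1, h2⟩ := rel i j hij
    rw [← hzU, ← hzU, ← hzW, ← hzW, eu, ev] at h1 h2
    have hv : wp' τ (z j) = 0 := by linear_combination -h1 / 2
    exact wp''_ne_zero τ (hz j) hv (by linear_combination -h2 / 2)
  refine ⟨⟨z, hz, hzz⟩, fun q => ?_⟩
  refine DFunLike.congr_fun (f := χ) (g := (ev _).comp (genHom τ n))
    (MvPolynomial.algHom_ext fun c => ?_) q
  rw [AlgHom.comp_apply]
  rcases c with (i | i) | ⟨⟨i, j⟩, h⟩
  · rw [genHom_inl]
    exact (hzU i).symm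
  · rw [genHom_inl]
    exact (hzW i).symm
  · obtain ⟨r1, r2⟩ := rel i j h
    obtain ⟨s1, s2⟩ := phi_rel (hz i) (hz j) (hzz i j h)
    rw [← hzU, ← hzU, ← hzW, ← hzW] at r1 r2
    rw [genHom_inr, ev_gPhi]
    refine eq_of_phi_rel (hz i) (hz j) (hzz i j h) ?_ ?_
    · linear_combination r1 / 2 - s1 / 2
    · linear_combination r2 / 2 - s2 / 2

/-- `Γₙ` is generated by the functions `℘(xᵢ)`, `℘'(xᵢ)` and `phi xᵢ xⱼ`. -/
theorem genHom_surjective : Function.Surjective (genHom τ n) := by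
  intro f
  -- The ideal of denominators of `f` with respect to the generated algebra. If it is proper, the
  -- Nullstellensatz gives a character vanishing on it, which is evaluation at a configuration `x`.
  -- But a local fraction for `f` at `x` supplies a denominator in the ideal that does not vanish at
  -- `x`.
  let J : Ideal (MvPolynomial (GenIdx n) ℂ) :=
    { carrier := {q | f * genHom τ n q ∈ (genHom τ n).range}
      add_mem' := fun {a b} ha hb => by
        rw [Set.mem_ofPred_eq, map_add, mul_add]
        exact add_mem ha hb
      zero_mem' := by
        rw [Set.mem_ofPred_eq, map_zero, mul_zero]
        exact zero_mem _
      smul_mem' := fun c a ha => by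
        rw [smul_eq_mul, Set.mem_ofPred_eq, map_mul, mul_left_comm]
        exact mul_mem ⟨c, rfl⟩ ha }
  by_cases hJ : J = ⊤
  · have h1 : f * genHom τ n 1 ∈ (genHom τ n).range :=
      (hJ ▸ Submodule.mem_top : (1 : MvPolynomial (GenIdx n) ℂ) ∈ J)
    rwa [map_one, mul_one] at h1
  · exfalso
    obtain ⟨M, hM, hJM⟩ := Ideal.exists_le_maximal J hJ
    let _ : Field (MvPolynomial (GenIdx n) ℂ ⧸ M) := Ideal.Quotient.field M
    have hfin : Module.Finite ℂ (MvPolynomial (GenIdx n) ℂ ⧸ M) :=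
      finite_of_finite_type_of_isJacobsonRing ℂ _
    have hbij := IsAlgClosed.algebraMap_bijective_of_isIntegral (k := ℂ)
      (K := MvPolynomial (GenIdx n) ℂ ⧸ M)
    let e : ℂ ≃ₐ[ℂ] MvPolynomial (GenIdx n) ℂ ⧸ M :=
      AlgEquiv.ofBijective (Algebra.ofId ℂ _) hbij
    let χ : MvPolynomial (GenIdx n) ℂ →ₐ[ℂ] ℂ :=
      e.symm.toAlgHom.comp (Ideal.Quotient.mkₐ ℂ M)
    have hχ : ∀ a ∈ M, χ a = 0 := by
      intro a ha
      have : Ideal.Quotient.mkₐ ℂ M a = 0 := Ideal.Quotient.eq_zero_iff_mem.mpr ha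
      change e.symm (Ideal.Quotient.mkₐ ℂ M a) = 0
      rw [this, map_zero]
    -- Relations between the generators lie in `J` because they map to zero, so the character
    -- factors through the generated algebra.
    obtain ⟨x, hx⟩ := exists_point τ χ fun q hq => hχ q <| hJM <| by
      change f * genHom τ n q ∈ (genHom τ n).range
      rw [hq, mul_zero]
      exact zero_mem _
    obtain ⟨p, q, hq, hpq⟩ := f.2 x
    have hmem : MvPolynomial.rename Sum.inl q ∈ J := by
      refine ⟨MvPolynomial.rename Sum.inl p, ext_ev fun y => ?_⟩
      change ev y (genHom τ n _) = ev y (f * genHom τ n _)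
      rw [map_mul, ev_genHom_rename, ev_genHom_rename]
      exact (hpq y).symm
    refine hq ?_
    rw [← ev_genHom_rename, ← hx, hχ _ (hJM hmem)]

/-- Induction over the generators. -/
lemma Gam.induction {p : Gam τ n → Prop} (hU : ∀ i, p (gU τ i)) (hV : ∀ i, p (gV τ i))
    (hP : ∀ i j h, p (gPhi τ i j h)) (hC : ∀ c : ℂ, p (algebraMap ℂ _ c))
    (hadd : ∀ f g, p f → p g → p (f + g)) (hmul : ∀ f g, p f → p g → p (f * g))
    (f : Gam τ n) : p f := by
  obtain ⟨q, rfl⟩ := genHom_surjective τ f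
  induction q using MvPolynomial.induction_on with
  | C c =>
    rw [← MvPolynomial.algebraMap_eq, AlgHom.commutes]
    exact hC c
  | add f g h1 h2 =>
    rw [map_add]
    exact hadd _ _ h1 h2
  | mul_X f c h =>
    rw [map_mul]
    refine hmul _ _ h ?_
    rcases c with (i | i) | ⟨⟨i, j⟩, h⟩
    · rw [genHom_inl]
      exact hU i
    · rw [genHom_inl]
      exact hV i
    · rw [genHom_inr]
      exact hP i j h

/-! ### Pulling back functions along injections of index sets -/

lemma comp_emb_mem (ι : Fin n ↪ Fin m) {x : Fin m → ℂ} (hx : x ∈ config τ m) :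
    x ∘ ι ∈ config τ n :=
  ⟨fun i => hx.1 (ι i), fun i j hij => hx.2 (ι i) (ι j) (ι.injective.ne hij)⟩

/-- The point with coordinates `x_{ι(1)}, …, x_{ι(n)}`. -/
def compEmb {τ : ℍ} (ι : Fin n ↪ Fin m) (x : config τ m) : config τ n :=
  ⟨x.1 ∘ ι, comp_emb_mem τ ι x.2⟩

/-- The algebra homomorphism `f ↦ f(x_{ι(1)}, …, x_{ι(n)})`. -/
def pull (ι : Fin n ↪ Fin m) : Gam τ n →ₐ[ℂ] Gam τ m where
  toFun f := ⟨fun x => f.1 (compEmb ι x), fun x => by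
    obtain ⟨p, q, hq, h⟩ := f.2 (compEmb ι x)
    have e : ∀ y : Fin m → ℂ, coords τ (y ∘ ι) = coords τ y ∘ Sum.map ι ι := by
      intro y
      funext k
      rcases k with k | k <;> rfl
    refine ⟨MvPolynomial.rename (Sum.map ι ι) p, MvPolynomial.rename (Sum.map ι ι) q, ?_,
      fun y => ?_⟩
    · rw [MvPolynomial.eval_rename, ← e]
      exact hq
    · rw [MvPolynomial.eval_rename, MvPolynomial.eval_rename, ← e]
      exact h _⟩
  map_one' := rfl
  map_mul' _ _ := rfl
  map_zero' := rfl
  map_add' _ _ := rfl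
  commutes' _ := rfl

lemma ev_pull (ι : Fin n ↪ Fin m) (f : Gam τ n) (x : config τ m) :
    ev x (pull τ ι f) = ev (compEmb ι x) f := rfl

lemma pull_gU (ι : Fin n ↪ Fin m) (i : Fin n) : pull τ ι (gU τ i) = gU τ (ι i) := rfl
lemma pull_gPhi (ι : Fin n ↪ Fin m) (i j : Fin n) (h : i ≠ j) :
    pull τ ι (gPhi τ i j h) = gPhi τ (ι i) (ι j) (ι.injective.ne h) := rfl
lemma pull_pull (ι : Fin n ↪ Fin m) (κ : Fin m ↪ Fin k) (f : Gam τ n) :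
    pull τ κ (pull τ ι f) = pull τ (ι.trans κ) f := rfl
/-- Every function is a polynomial in functions which do not depend on `xᵢ`, functions which do not
depend on `xⱼ`, and `phi xᵢ xⱼ`. -/
lemma Gam.induction_pair {p : Gam τ m → Prop} (i j : Fin m) (hij : i ≠ j)
    (ι κ : Fin n ↪ Fin m) (hι : ∀ l, l ≠ i → l ∈ Set.range ι) (hκ : ∀ l, l ≠ j → l ∈ Set.range κ)
    (h1 : ∀ g, p (pull τ ι g)) (h2 : ∀ g, p (pull τ κ g)) (hP : p (gPhi τ i j hij))
    (hadd : ∀ f g, p f → p g → p (f + g)) (hmul : ∀ f g, p f → p g → p (f * g))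
    (f : Gam τ m) : p f := by
  have hC : ∀ c : ℂ, p (algebraMap ℂ _ c) := fun c => by
    rw [← (pull τ ι).commutes c]; exact h1 _
  have cover : ∀ l, l ∈ Set.range ι ∨ l ∈ Set.range κ := by
    intro l
    by_cases h : l = i
    · exact Or.inr (hκ l (h ▸ hij))
    · exact Or.inl (hι l h)
  refine Gam.induction τ (fun l => ?_) (fun l => ?_) (fun a b h => ?_) hC hadd hmul f
  · rcases cover l with ⟨l, rfl⟩ | ⟨l, rfl⟩
    · exact h1 (gU τ l)
    · exact h2 (gU τ l)
  · rcases cover l with ⟨l, rfl⟩ | ⟨l, rfl⟩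
    · exact h1 (gV τ l)
    · exact h2 (gV τ l)
  · by_cases hi : a ≠ i ∧ b ≠ i
    · obtain ⟨a, rfl⟩ := hι a hi.1
      obtain ⟨b, rfl⟩ := hι b hi.2
      exact h1 (gPhi τ a b fun e => h (congrArg ι e))
    by_cases hj : a ≠ j ∧ b ≠ j
    · obtain ⟨a, rfl⟩ := hκ a hj.1
      obtain ⟨b, rfl⟩ := hκ b hj.2
      exact h2 (gPhi τ a b fun e => h (congrArg κ e))
    by_cases ha : a = i
    · obtain rfl : b = j := by
        by_contra hb
        exact hj ⟨ha ▸ hij, hb⟩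
      subst ha
      exact hP
    · obtain rfl : b = i := by
        by_contra hb
        exact hi ⟨ha, hb⟩
      obtain rfl : a = j := by
        by_contra hb
        exact hj ⟨hb, hij⟩
      have e : gPhi τ a b h = algebraMap ℂ _ (-1) * gPhi τ b a hij := by
        rw [gPhi_antisymm τ b a hij, map_neg, map_one]
        exact (neg_one_mul (gPhi τ b a hij)).symm
      rw [e]
      exact hmul _ _ (hC _) hP

end Generators
end ChiralHomology
namespace ChiralHomology

/-! ### Rules for the derivations `∂ᵢ` -/

section PartialDerivatives

variable {τ : ℍ} {n m : ℕ}

lemma hasDerivAt_pd (i : Fin n) (f : Gam τ n) (y : config τ n) :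
    HasDerivAt (fun z : ℂ => ext τ f.1 (Function.update y.1 i z)) (ev y (pd τ i f)) (y.1 i) :=
  hasDerivAt_pderivFun τ i f.2 y

lemma ev_pd_eq {i : Fin n} {f : Gam τ n} {y : config τ n} {g : ℂ → ℂ} {c : ℂ}
    (hg : HasDerivAt g c (y.1 i))
    (h : ∀ z (hz : Function.update y.1 i z ∈ config τ n), ev ⟨_, hz⟩ f = g z) :
    ev y (pd τ i f) = c := by
  refine (hasDerivAt_pd i f y).unique (hg.congr_of_eventuallyEq ?_)
  filter_upwards [eventually_update_mem τ i y] with z hz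
  rw [ext_apply τ f.1 ⟨_, hz⟩]
  exact h z hz

lemma pd_mul (i : Fin n) (f g : Gam τ n) :
    pd τ i (f * g) = pd τ i f * g + f * pd τ i g := by
  refine ext_ev fun y => ?_
  have h := (hasDerivAt_pd i f y).mul (hasDerivAt_pd i g y)
  simp only [Function.update_eq_self, ext_apply] at h
  change ev y (pd τ i (f * g)) = ev y (pd τ i f) * g.1 y + f.1 y * ev y (pd τ i g)
  refine ev_pd_eq h fun z hz => ?_
  rw [map_mul, Pi.mul_apply, ext_apply τ f.1 ⟨_, hz⟩, ext_apply τ g.1 ⟨_, hz⟩]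
  rfl

lemma pd_algebraMap (i : Fin n) (c : ℂ) : pd τ i (algebraMap ℂ (Gam τ n) c) = 0 :=
  ext_ev fun y => by
    rw [map_zero]
    exact ev_pd_eq (hasDerivAt_const _ c) fun z hz => AlgHom.commutes _ c

lemma pd_pull (ι : Fin n ↪ Fin m) (i : Fin n) (f : Gam τ n) :
    pd τ (ι i) (pull τ ι f) = pull τ ι (pd τ i f) := by
  refine ext_ev fun y => ?_
  rw [ev_pull]
  have e : ∀ z, Function.update (compEmb ι y).1 i z = Function.update y.1 (ι i) z ∘ ι := by
    intro z
    funext k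
    by_cases hk : k = i
    · subst hk; simp
    · simp [Function.update_of_ne hk, Function.update_of_ne (ι.injective.ne hk), compEmb]
  refine ev_pd_eq (hasDerivAt_pd i f (compEmb ι y)) fun z hz => ?_
  rw [e, ext_apply τ f.1 ⟨_, comp_emb_mem τ ι hz⟩]
  rfl

lemma pd_pull_of_notMem (ι : Fin n ↪ Fin m) (j : Fin m) (hj : ∀ i, ι i ≠ j) (f : Gam τ n) :
    pd τ j (pull τ ι f) = 0 := by
  refine ext_ev fun y => ?_
  rw [map_zero]
  refine ev_pd_eq (hasDerivAt_const _ (ev (compEmb ι y) f)) fun z hz => ?_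
  rw [ev_pull]
  congr 2
  refine Subtype.ext (funext fun k => ?_)
  simp [compEmb, hj]

lemma pd_gU (i : Fin n) : pd τ i (gU τ i) = gV τ i :=
  ext_ev fun y => ev_pd_eq (hasDerivAt_weierstrassP τ (y.2.1 i)) fun z hz => by
    rw [ev_gU]; simp

/-- The function `℘(xᵢ - xⱼ)`. -/
def gW (τ : ℍ) (i j : Fin n) (h : i ≠ j) : Gam τ n := gPhi τ i j h * gPhi τ i j h - gU τ i - gU τ j

lemma ev_gW (i j : Fin n) (h : i ≠ j) (y : config τ n) :
    ev y (gW τ i j h) = wp τ (y.1 i - y.1 j) := by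
  rw [gW, map_sub, map_sub, map_mul, ev_gPhi, ev_gU, ev_gU]
  linear_combination phi_sq (y.2.1 i) (y.2.1 j) (y.2.2 i j h)

lemma pd_gPhi_left (i j : Fin n) (h : i ≠ j) : pd τ i (gPhi τ i j h) = gU τ i - gW τ i j h :=
  ext_ev fun y => by
    rw [map_sub, ev_gU, ev_gW]
    refine ev_pd_eq (hasDerivAt_phi_left (y.2.1 i) (y.2.1 j) (y.2.2 i j h)) fun z hz => ?_
    rw [ev_gPhi]
    simp [h.symm]

lemma pd_gPhi_right (i j : Fin n) (h : i ≠ j) : pd τ j (gPhi τ i j h) = gW τ i j h - gU τ j :=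
  ext_ev fun y => by
    rw [map_sub, ev_gU, ev_gW]
    refine ev_pd_eq (hasDerivAt_phi_right (y.2.1 i) (y.2.1 j) (y.2.2 i j h)) fun z hz => ?_
    rw [ev_gPhi]
    simp [h]

lemma gPhi_rel (i j : Fin n) (h : i ≠ j) :
    2 * gPhi τ i j h * (gU τ i - gU τ j) = gV τ i + gV τ j :=
  ext_ev fun y => by
    have e2 : ev y (2 : Gam τ n) = 2 := map_ofNat _ 2
    rw [map_mul, map_mul, map_sub, map_add, ev_gPhi, ev_gU, ev_gU, ev_gV, ev_gV, e2]
    exact (phi_rel (y.2.1 i) (y.2.1 j) (y.2.2 i j h)).1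

/-- The embedding which omits `i`. -/
abbrev skip (i : Fin (n + 1)) : Fin n ↪ Fin (n + 1) := Fin.succAboveEmb i

lemma mem_range_skip {i l : Fin (n + 1)} (h : l ≠ i) : l ∈ Set.range (skip i) :=
  Fin.exists_succAbove_eq h

lemma pd_gU_of_ne {i j : Fin n} (h : i ≠ j) : pd τ j (gU τ i) = 0 :=
  ext_ev fun y => by
    rw [map_zero]
    exact ev_pd_eq (hasDerivAt_const _ (wp τ (y.1 i))) fun z hz => by rw [ev_gU]; simp [h]

/-- By the Leibniz rule it is enough to test functions missing one of the two variables, where both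
sides vanish, and `phi xᵢ xⱼ`, where the equality of mixed derivatives amounts to `gPhi_rel`. -/
lemma pd_comm (i j : Fin n) (f : Gam τ n) : pd τ i (pd τ j f) = pd τ j (pd τ i f) := by
  by_cases hij : i = j
  · rw [hij]
  obtain ⟨n, rfl⟩ : ∃ k, n = k + 1 := ⟨n - 1, by have := i.pos; omega⟩
  have miss : ∀ (a b : Fin (n + 1)), a ≠ b → ∀ g : Gam τ n,
      pd τ a (pd τ b (pull τ (skip a) g)) = pd τ b (pd τ a (pull τ (skip a) g)) := by
    intro a b hab g
    obtain ⟨b, rfl⟩ := mem_range_skip hab.symm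
    have ha : ∀ l, (skip a) l ≠ a := fun l => Fin.succAbove_ne a l
    rw [pd_pull, pd_pull_of_notMem _ a ha, pd_pull_of_notMem _ a ha, map_zero]
  induction f using Gam.induction_pair τ i j hij (skip i) (skip j)
    (fun l => mem_range_skip) (fun l => mem_range_skip) with
  | h1 g => exact miss i j hij g
  | h2 g => exact (miss j i (Ne.symm hij) g).symm
  | hP =>
    rw [pd_gPhi_left, pd_gPhi_right, map_sub, map_sub, pd_gU_of_ne hij,
      pd_gU_of_ne (Ne.symm hij), gW]
    simp only [map_sub, pd_mul, pd_gPhi_left, pd_gPhi_right, pd_gU, pd_gU_of_ne hij,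
      pd_gU_of_ne (Ne.symm hij)]
    linear_combination gPhi_rel i j hij
  | hadd f g hf hg => rw [map_add, map_add, map_add, map_add, hf, hg]
  | hmul f g hf hg =>
    simp only [pd_mul, map_add, hf, hg]
    ring

end PartialDerivatives
end ChiralHomology
namespace ChiralHomology

/-! ### Laurent series over commutative rings -/

section LaurentSeriesRings

variable {R S : Type*} [CommRing R] [CommRing S]

/-- The application of a ring homomorphism to the coefficients of Laurent series. -/
def mapL (φ : R →+* S) : LaurentSeries R →+* LaurentSeries S where
  toFun A := HahnSeries.map A φ
  map_one' := by
    rw [← HahnSeries.C_one, HahnSeries.map_C, map_one, HahnSeries.C_one]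
  map_mul' A B := HahnSeries.map_mul (φ : R →ₙ+* S)
  map_zero' := by ext m; simp
  map_add' A B := by ext m; simp

@[simp] lemma mapL_coeff (φ : R →+* S) (A : LaurentSeries R) (m : ℤ) :
    (mapL φ A).coeff m = φ (A.coeff m) := rfl

@[simp] lemma mapL_C (φ : R →+* S) (r : R) : mapL φ (HahnSeries.C r) = HahnSeries.C (φ r) :=
  HahnSeries.map_C r φ

@[simp] lemma mapL_single (φ : R →+* S) (m : ℤ) (r : R) :
    mapL φ (HahnSeries.single m r) = HahnSeries.single m (φ r) := by
  ext k
  simp only [mapL_coeff, HahnSeries.coeff_single]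
  split_ifs <;> simp

lemma exists_coeff_eq_zero (A : LaurentSeries R) : ∃ N : ℤ, ∀ m < N, A.coeff m = 0 :=
  ⟨A.order, fun _ h => HahnSeries.coeff_eq_zero_of_lt_order h⟩

/-- A product coefficient as a sum over an interval that depends only on lower bounds of the
supports. In contrast to the antidiagonal of the supports, such a range survives changes of the
coefficients and rearrangements. -/
lemma coeff_mul_Icc {A B : LaurentSeries R} {M N : ℤ} (hA : ∀ m < M, A.coeff m = 0)
    (hB : ∀ m < N, B.coeff m = 0) (m : ℤ) :
    (A * B).coeff m = ∑ j ∈ Finset.Icc M (m - N), A.coeff j * B.coeff (m - j) := by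
  rw [HahnSeries.coeff_mul]
  refine Finset.sum_bij_ne_zero (fun p _ _ => p.1) ?_ ?_ ?_ ?_
  · intro p hp h0
    rw [Finset.mem_antidiagonal] at hp
    have h1 : M ≤ p.1 := not_lt.mp fun h => left_ne_zero_of_mul h0 (hA _ h)
    have h2 : N ≤ p.2 := not_lt.mp fun h => right_ne_zero_of_mul h0 (hB _ h)
    rw [Finset.mem_Icc]
    omega
  · intro p hp _ q hq _ h
    rw [Finset.mem_antidiagonal] at hp hq
    exact Prod.ext h (by omega)
  · intro j _ h0
    refine ⟨(j, m - j), ?_, h0, rfl⟩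
    rw [Finset.mem_antidiagonal]
    exact ⟨left_ne_zero_of_mul h0, right_ne_zero_of_mul h0, by omega⟩
  · intro p hp _
    rw [Finset.mem_antidiagonal] at hp
    rw [← hp.2.2]
    simp

lemma hasseDeriv_coeff_one {K : Type*} [CommRing K] [Module K R] (A : LaurentSeries R) (m : ℤ) :
    (LaurentSeries.hasseDeriv K 1 A).coeff m = (m + 1) • A.coeff (m + 1) := by
  rw [LaurentSeries.hasseDeriv_coeff, Nat.cast_one, Ring.choose_one_right]

/-- The series `∑ Dᵐ(g) tᵐ / m!`. -/
def expSeries [Algebra ℂ R] (D : R →ₗ[ℂ] R) (g : R) : PowerSeries R :=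
  PowerSeries.mk fun m => (m.factorial : ℂ)⁻¹ • (D ^ m) g

/-- The series `∑ D^{m-1}(g) tᵐ / m!`, where `m ≥ 1`. -/
def primExp [Algebra ℂ R] (D : R →ₗ[ℂ] R) (g : R) : PowerSeries R :=
  PowerSeries.mk fun m => if m = 0 then 0 else (m.factorial : ℂ)⁻¹ • (D ^ (m - 1)) g

end LaurentSeriesRings

/-! ### Laurent expansions of regular functions -/

section Expansions

instance (τ : ℍ) (n : ℕ) : CommRing (Gam τ n) := (Gam τ n).toCommRing
instance (τ : ℍ) (n : ℕ) : CommSemiring (Gam τ n) := CommRing.toCommSemiring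
instance (τ : ℍ) (n : ℕ) : Ring (Gam τ n) := CommRing.toRing
instance (τ : ℍ) (n : ℕ) : Semiring (Gam τ n) := CommSemiring.toSemiring
instance (τ : ℍ) (n : ℕ) : NonAssocSemiring (Gam τ n) := Semiring.toNonAssocSemiring
instance (τ : ℍ) (n : ℕ) : NonUnitalNonAssocSemiring (Gam τ n) :=
  NonAssocSemiring.toNonUnitalNonAssocSemiring
instance (τ : ℍ) (n : ℕ) : AddGroup (Gam τ n) := AddCommGroup.toAddGroup
instance (τ : ℍ) (n : ℕ) : Zero (Gam τ n) := MulZeroClass.toZero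
instance (τ : ℍ) (n : ℕ) : Algebra ℂ (Gam τ n) := (Gam τ n).algebra

variable {τ : ℍ} {n m : ℕ}

/-- `A` is the Laurent series of `f` in the variable `xᵢ` at the centre given by `s`. -/
def HasExpansion (i : Fin (n + 1)) (s : Option (Fin n)) (f : Gam τ (n + 1))
    (A : LaurentSeries (Gam τ n)) : Prop :=
  ∀ y : config τ n, HasLaurentAt (fun z => ext τ f.1 (i.insertNth z y.1)) (center s y.1)
    (mapL (ev y : Gam τ n →+* ℂ) A)

lemma ext_mul (f g : config τ n → ℂ) (x : Fin n → ℂ) : ext τ (f * g) x = ext τ f x * ext τ g x := by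
  by_cases hx : x ∈ config τ n
  · rw [ext_apply τ _ ⟨x, hx⟩, ext_apply τ _ ⟨x, hx⟩, ext_apply τ _ ⟨x, hx⟩]
    rfl
  · have h : ¬ ∃ a : config τ n, a.1 = x := by rintro ⟨a, rfl⟩; exact hx a.2
    simp [ext, Function.extend_apply' _ _ _ h]

lemma ext_add (f g : config τ n → ℂ) (x : Fin n → ℂ) : ext τ (f + g) x = ext τ f x + ext τ g x := by
  by_cases hx : x ∈ config τ n
  · rw [ext_apply τ _ ⟨x, hx⟩, ext_apply τ _ ⟨x, hx⟩, ext_apply τ _ ⟨x, hx⟩]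
    rfl
  · have h : ¬ ∃ a : config τ n, a.1 = x := by rintro ⟨a, rfl⟩; exact hx a.2
    simp [ext, Function.extend_apply' _ _ _ h]

lemma ext_neg (f : config τ n → ℂ) (x : Fin n → ℂ) : ext τ (-f) x = -ext τ f x := by
  by_cases hx : x ∈ config τ n
  · rw [ext_apply τ _ ⟨x, hx⟩, ext_apply τ _ ⟨x, hx⟩]
    rfl
  · have h : ¬ ∃ a : config τ n, a.1 = x := by rintro ⟨a, rfl⟩; exact hx a.2
    simp [ext, Function.extend_apply' _ _ _ h]

lemma insertNth_mem {i : Fin (n + 1)} {z : ℂ} {y : Fin n → ℂ} (hy : y ∈ config τ n)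
    (hz : z ∉ Lat τ) (h : ∀ j, z - y j ∉ Lat τ) : i.insertNth z y ∈ config τ (n + 1) := by
  refine ⟨fun k => ?_, fun k l hkl => ?_⟩
  · rcases Fin.eq_self_or_eq_succAbove i k with rfl | ⟨k, rfl⟩
    · simpa using hz
    · simpa using hy.1 k
  · rcases Fin.eq_self_or_eq_succAbove i k with rfl | ⟨k, rfl⟩
    · rcases Fin.eq_self_or_eq_succAbove k l with rfl | ⟨l, rfl⟩
      · exact absurd rfl hkl
      · simpa using h l
    · rcases Fin.eq_self_or_eq_succAbove i l with rfl | ⟨l, rfl⟩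
      · simpa using sub_swap_notMem (h k)
      · simpa using hy.2 k l fun e => hkl (congrArg _ e)

lemma eventually_insertNth_mem (i : Fin (n + 1)) (c : ℂ) (y : config τ n) :
    ∀ᶠ z in 𝓝[≠] c, i.insertNth z y.1 ∈ config τ (n + 1) := by
  filter_upwards [eventually_notMem_Lat τ c,
    Filter.eventually_all.mpr fun j => eventually_sub_notMem_Lat τ c (y.1 j)] with z hz h
  exact insertNth_mem y.2 hz h

namespace HasExpansion

variable {i : Fin (n + 1)} {s : Option (Fin n)} {f g : Gam τ (n + 1)}
  {A B : LaurentSeries (Gam τ n)}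

lemma of_eq (h : ∀ y : config τ n, ∃ G : ℂ → ℂ, HasLaurentAt G (center s y.1)
      (mapL (ev y : Gam τ n →+* ℂ) A) ∧
      ∀ z (hz : i.insertNth z y.1 ∈ config τ (n + 1)), G z = ev ⟨_, hz⟩ f) :
    HasExpansion i s f A := by
  intro y
  obtain ⟨G, hG, h⟩ := h y
  refine hG.congr ?_
  filter_upwards [eventually_insertNth_mem i (center s y.1) y] with z hz
  rw [h z hz, ext_apply τ f.1 ⟨_, hz⟩]
  rfl

lemma add (hf : HasExpansion i s f A) (hg : HasExpansion i s g B) :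
    HasExpansion i s (f + g) (A + B) := by
  intro y
  have := (hf y).add (hg y)
  simp only [← ext_add] at this
  rwa [map_add]

lemma mul (hf : HasExpansion i s f A) (hg : HasExpansion i s g B) :
    HasExpansion i s (f * g) (A * B) := by
  intro y
  have := (hf y).mul (hg y)
  simp only [← ext_mul] at this
  rwa [map_mul]

/-- The coefficients are functions, and their values at each configuration are determined by
uniqueness in one variable. -/
lemma unique (hf : HasExpansion i s f A) (hg : HasExpansion i s f B) : A = B := by
  refine HahnSeries.ext (funext fun m => ext_ev fun y => ?_)
  exact congrArg (fun C => HahnSeries.coeff C m) ((hf y).unique (hg y))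

lemma pull_skip (g : Gam τ n) : HasExpansion i s (pull τ (skip i) g) (HahnSeries.C g) := by
  refine of_eq fun y => ⟨fun _ => ev y g, ?_, fun z hz => ?_⟩
  · rw [mapL_C]
    exact HasLaurentAt.const _
  · have e : compEmb (skip i) ⟨_, hz⟩ = y := Subtype.ext (funext fun k => by simp [compEmb])
    rw [ev_pull, e]

lemma scalar (c : ℂ) : HasExpansion i s (algebraMap ℂ (Gam τ (n + 1)) c)
    (HahnSeries.C (algebraMap ℂ (Gam τ n) c)) := by
  rw [← (pull τ (skip i)).commutes c]
  exact pull_skip _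

lemma neg (hf : HasExpansion i s f A) : HasExpansion i s (-f) (-A) := by
  intro y
  have := (hf y).neg
  simp only [← ext_neg] at this
  rwa [map_neg]

end HasExpansion

lemma iteratedDeriv_ext (k : Fin n) (g : Gam τ n) (p : ℕ) : ∀ y : config τ n,
    iteratedDeriv p (fun z => ext τ g.1 (Function.update y.1 k z)) (y.1 k) =
      ev y ((pd τ k ^ p) g) := by
  induction p generalizing g with
  | zero => intro y; simp [ext_apply, ev_apply]
  | succ p ih =>
    intro y
    rw [iteratedDeriv_succ', pow_succ, Module.End.mul_apply, ← ih]
    refine Filter.EventuallyEq.iteratedDeriv_eq _ ?_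
    filter_upwards [eventually_update_mem τ k y] with z hz
    have := hasDerivAt_pd k g ⟨_, hz⟩
    simp only [Function.update_idem, Function.update_self] at this
    rw [this.deriv, ext_apply τ _ ⟨_, hz⟩]
    rfl

lemma analyticAt_ext (k : Fin n) (g : Gam τ n) (y : config τ n) :
    AnalyticAt ℂ (fun z => ext τ g.1 (Function.update y.1 k z)) (y.1 k) := by
  have : ∀ᶠ z in 𝓝 (y.1 k),
      DifferentiableAt ℂ (fun z => ext τ g.1 (Function.update y.1 k z)) z := by
    filter_upwards [eventually_update_mem τ k y] with z hz
    have := hasDerivAt_pd k g ⟨_, hz⟩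
    simp only [Function.update_idem, Function.update_self] at this
    exact this.differentiableAt
  exact Complex.analyticAt_iff_eventually_differentiableAt.mpr this

/-- The embedding which omits `i.succAbove k` and sends `k` to `i`. -/
def moved (i : Fin (n + 1)) (k : Fin n) : Fin n ↪ Fin (n + 1) where
  toFun := Function.update i.succAbove k i
  inj' a b h := by
    by_cases ha : a = k <;> by_cases hb : b = k
    · rw [ha, hb]
    · subst ha
      rw [Function.update_self, Function.update_of_ne hb] at h
      exact absurd h.symm (Fin.succAbove_ne i b)
    · subst hb
      rw [Function.update_self, Function.update_of_ne ha] at h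
      exact absurd h (Fin.succAbove_ne i a)
    · rwa [Function.update_of_ne ha, Function.update_of_ne hb, Fin.succAbove_right_inj] at h

@[simp] lemma moved_self (i : Fin (n + 1)) (k : Fin n) : moved i k k = i :=
  Function.update_self (β := fun _ => Fin (n + 1)) k i i.succAbove

lemma moved_of_ne (i : Fin (n + 1)) {k l : Fin n} (h : l ≠ k) : moved i k l = i.succAbove l :=
  Function.update_of_ne (β := fun _ => Fin (n + 1)) h i i.succAbove

lemma mem_range_moved (i : Fin (n + 1)) (k : Fin n) (l : Fin (n + 1)) (h : l ≠ i.succAbove k) :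
    l ∈ Set.range (moved i k) := by
  rcases Fin.eq_self_or_eq_succAbove i l with rfl | ⟨l, rfl⟩
  · exact ⟨k, moved_self _ _⟩
  · exact ⟨l, moved_of_ne i fun e => h (congrArg _ e)⟩

/-- Taylor's formula: when `xₖ` is replaced by xᵢ = xₖ + t, the result is exp(t∂ₖ)g and has no polar
part. -/
lemma hasExpansion_moved (i : Fin (n + 1)) (k : Fin n) (g : Gam τ n) :
    HasExpansion i (some k) (pull τ (moved i k) g) (expSeries (pd τ k) g : LaurentSeries (Gam τ n)) := by
  refine HasExpansion.of_eq fun y =>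
    ⟨fun z => ext τ g.1 (Function.update y.1 k z), ?_, fun z hz => ?_⟩
  · have := HasLaurentAt.of_analyticAt (analyticAt_ext k g y)
    refine (congrArg _ ?_ : HasLaurentAt _ _ _ = _).mpr this
    refine HahnSeries.ext (funext fun m => ?_)
    rw [mapL_coeff, PowerSeries.coeff_coe, PowerSeries.coeff_coe]
    split_ifs
    · exact map_zero _
    · rw [expSeries, taylorSeries, PowerSeries.coeff_mk, PowerSeries.coeff_mk, iteratedDeriv_ext]
      exact map_smul (ev y) _ _
  · have e : Function.update y.1 k z = (i.insertNth z y.1 : Fin (n + 1) → ℂ) ∘ moved i k := by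
      funext l
      by_cases hl : l = k
      · subst hl; simp
      · simp [moved_of_ne i hl, hl]
    change ext τ g.1 (Function.update y.1 k z) = _
    rw [e, ext_apply τ g.1 ⟨_, comp_emb_mem τ _ hz⟩]
    rfl

lemma iteratedDeriv_wp (k : Fin n) (p : ℕ) (y : config τ n) :
    iteratedDeriv p (wp τ) (y.1 k) = ev y ((pd τ k ^ p) (gU τ k)) := by
  rw [← iteratedDeriv_ext]
  refine Filter.EventuallyEq.iteratedDeriv_eq _ ?_
  filter_upwards [eventually_update_mem τ k y] with z hz
  rw [ext_apply τ _ ⟨_, hz⟩]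
  simp [gCoord, coords]

/-- The scalars in `Γₙ`. -/
abbrev scal (τ : ℍ) (n : ℕ) : ℂ →+* Gam τ n := algebraMap ℂ (Gam τ n)

lemma mapL_ev_scal (y : config τ n) (A : LaurentSeries ℂ) :
    mapL (ev y : Gam τ n →+* ℂ) (mapL (scal τ n) A) = A := by
  ext m
  exact (ev y).commutes _

lemma hasExpansion_gPhi_some (i : Fin (n + 1)) (k : Fin n) :
    HasExpansion i (some k) (gPhi τ i (i.succAbove k) (Fin.ne_succAbove i k))
      (mapL (scal τ n) (zetaSeries τ) +
        (primExp (pd τ k) (gU τ k) : LaurentSeries (Gam τ n))) := by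
  refine HasExpansion.of_eq fun y =>
    ⟨fun z => phi τ z (y.1 k), ?_, fun z hz => by rw [ev_gPhi]; simp⟩
  refine (congrArg _ ?_ : HasLaurentAt _ _ _ = _).mpr (hasLaurentAt_phi_self (y.2.1 k))
  rw [map_add, mapL_ev_scal]
  congr 1
  refine HahnSeries.ext (funext fun m => ?_)
  rw [mapL_coeff, PowerSeries.coeff_coe, PowerSeries.coeff_coe]
  split_ifs
  · exact map_zero _
  · rw [primExp, PowerSeries.coeff_mk]
    split_ifs with h0
    · rw [primSeries, PowerSeries.coeff_mk, if_pos h0]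
      exact map_zero _
    · rw [primSeries, PowerSeries.coeff_mk, if_neg h0, iteratedDeriv_wp]
      exact map_smul (ev y) _ _

/-- The substitution `t ↦ -t`. -/
def negT {R : Type*} [CommRing R] : PowerSeries R →+* PowerSeries R := PowerSeries.rescale (-1)

/-- The regular part involves derivatives of ℘ at minus the remaining point. Since ℘ is even, they
equal those at the point up to alternating signs, whence `negT`. -/
lemma hasExpansion_gPhi_none (i : Fin (n + 1)) (k : Fin n) :
    HasExpansion i none (gPhi τ i (i.succAbove k) (Fin.ne_succAbove i k))
      (-mapL (scal τ n) (zetaSeries τ) +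
        (negT (primExp (pd τ k) (gU τ k)) : LaurentSeries (Gam τ n))) := by
  refine HasExpansion.of_eq fun y =>
    ⟨fun z => phi τ z (y.1 k), ?_, fun z hz => by rw [ev_gPhi]; simp⟩
  refine (congrArg _ ?_ : HasLaurentAt _ _ _ = _).mpr (hasLaurentAt_phi_zero (y.2.1 k))
  rw [map_add, map_neg, mapL_ev_scal, sub_eq_add_neg]
  congr 1
  refine HahnSeries.ext (funext fun m => ?_)
  rw [mapL_coeff, PowerSeries.coeff_coe, HahnSeries.coeff_neg, PowerSeries.coeff_coe]
  split_ifs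
  · rw [neg_zero]
    exact map_zero _
  · rw [negT, PowerSeries.coeff_rescale, primExp, PowerSeries.coeff_mk, primSeries,
      PowerSeries.coeff_mk]
    split_ifs with h0
    · rw [mul_zero, neg_zero]
      exact map_zero _
    · obtain ⟨p, hp⟩ : ∃ p, m.natAbs = p + 1 := ⟨m.natAbs - 1, by omega⟩
      have e : iteratedDeriv p (wp τ) (-y.1 k) = (-1) ^ p * iteratedDeriv p (wp τ) (y.1 k) := by
        have h := iteratedDeriv_comp_neg p (wp τ) (y.1 k)
        have h' : (fun x => wp τ (-x)) = wp τ := funext fun x => (periods τ).weierstrassP_neg x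
        rw [h', smul_eq_mul] at h
        rw [h, ← mul_assoc, ← mul_pow]
        simp
      rw [hp, Nat.add_sub_cancel, e, iteratedDeriv_wp, map_mul, map_pow, map_neg, map_one]
      have h2 : (ev y : Gam τ n →+* ℂ) (((p + 1).factorial : ℂ)⁻¹ • (pd τ k ^ p) (gU τ k)) =
        ((p + 1).factorial : ℂ)⁻¹ * ev y ((pd τ k ^ p) (gU τ k)) := map_smul (ev y) _ _
      rw [h2]
      ring

/-! ### The expansion homomorphisms -/

/-- Expandable functions are stable under sums and products, so generators suffice. At the origin
each generator is treated explicitly; at another point every function is built from functions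
missing the integrated variable, functions missing the centre, and a single `phi`. -/
lemma exists_hasExpansion (i : Fin (n + 1)) (s : Option (Fin n)) (f : Gam τ (n + 1)) :
    ∃ A, HasExpansion i s f A := by
  have hadd : ∀ f g : Gam τ (n + 1), (∃ A, HasExpansion i s f A) → (∃ A, HasExpansion i s g A) →
      ∃ A, HasExpansion i s (f + g) A :=
    fun f g ⟨A, hA⟩ ⟨B, hB⟩ => ⟨_, hA.add hB⟩
  have hmul : ∀ f g : Gam τ (n + 1), (∃ A, HasExpansion i s f A) → (∃ A, HasExpansion i s g A) →
      ∃ A, HasExpansion i s (f * g) A :=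
    fun f g ⟨A, hA⟩ ⟨B, hB⟩ => ⟨_, hA.mul hB⟩
  rcases s with _ | k
  · have hU : HasExpansion i none (gU τ i) (mapL (scal τ n) (wpSeries τ)) := by
      refine HasExpansion.of_eq fun y => ⟨wp τ, ?_, fun z hz => by rw [ev_gU]; simp⟩
      rw [mapL_ev_scal]
      exact hasLaurentAt_wp τ
    refine Gam.induction τ (fun l => ?_) (fun l => ?_) (fun a b h => ?_)
      (fun c => ⟨_, HasExpansion.scalar c⟩) hadd hmul f
    · rcases Fin.eq_self_or_eq_succAbove i l with rfl | ⟨l, rfl⟩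
      · exact ⟨_, hU⟩
      · exact ⟨_, HasExpansion.pull_skip (gU τ l)⟩
    · rcases Fin.eq_self_or_eq_succAbove i l with rfl | ⟨l, rfl⟩
      · refine ⟨mapL (scal τ n) (LaurentSeries.hasseDeriv ℂ 1 (wpSeries τ)),
          HasExpansion.of_eq fun y => ⟨wp' τ, ?_, fun z hz => by rw [ev_gV]; simp⟩⟩
        rw [mapL_ev_scal]
        exact (hasLaurentAt_wp τ).deriv'
          ((eventually_notMem_Lat τ 0).mono fun z hz => hasDerivAt_weierstrassP τ hz)
      · exact ⟨_, HasExpansion.pull_skip (gV τ l)⟩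
    · rcases Fin.eq_self_or_eq_succAbove i a with rfl | ⟨a, rfl⟩
      · rcases Fin.eq_self_or_eq_succAbove a b with rfl | ⟨b, rfl⟩
        · exact absurd rfl h
        · exact ⟨_, hasExpansion_gPhi_none a b⟩
      · rcases Fin.eq_self_or_eq_succAbove i b with rfl | ⟨b, rfl⟩
        · have := (hasExpansion_gPhi_none (τ := τ) b a).neg
          rw [← gPhi_antisymm τ b (b.succAbove a) (Fin.ne_succAbove b a)] at this
          exact ⟨_, this⟩
        · exact ⟨_, HasExpansion.pull_skip (gPhi τ a b fun e => h (congrArg _ e))⟩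
  · exact Gam.induction_pair τ i (i.succAbove k) (Fin.ne_succAbove i k) (skip i) (moved i k)
      (fun l => mem_range_skip) (mem_range_moved i k)
      (fun g => ⟨_, HasExpansion.pull_skip g⟩) (fun g => ⟨_, hasExpansion_moved i k g⟩)
      ⟨_, hasExpansion_gPhi_some i k⟩ hadd hmul f

/-- The Laurent expansion in the variable `xᵢ` at the centre given by `s`. -/
def expand (i : Fin (n + 1)) (s : Option (Fin n)) : Gam τ (n + 1) →+* LaurentSeries (Gam τ n) where
  toFun f := (exists_hasExpansion i s f).choose
  map_add' f g := (exists_hasExpansion i s (f + g)).choose_spec.unique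
    ((exists_hasExpansion i s f).choose_spec.add (exists_hasExpansion i s g).choose_spec)
  map_mul' f g := (exists_hasExpansion i s (f * g)).choose_spec.unique
    ((exists_hasExpansion i s f).choose_spec.mul (exists_hasExpansion i s g).choose_spec)
  map_one' := (exists_hasExpansion i s 1).choose_spec.unique (by
    have := HasExpansion.scalar (τ := τ) (i := i) (s := s) 1
    rwa [map_one, map_one, HahnSeries.C_one] at this)
  map_zero' := (exists_hasExpansion i s 0).choose_spec.unique (by
    have := HasExpansion.scalar (τ := τ) (i := i) (s := s) 0
    rwa [map_zero, map_zero, HahnSeries.C_zero] at this)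

lemma hasExpansion_expand (i : Fin (n + 1)) (s : Option (Fin n)) (f : Gam τ (n + 1)) :
    HasExpansion i s f (expand i s f) := (exists_hasExpansion i s f).choose_spec

lemma HasExpansion.expand_eq {i : Fin (n + 1)} {s : Option (Fin n)} {f : Gam τ (n + 1)}
    {A : LaurentSeries (Gam τ n)} (h : HasExpansion i s f A) : expand i s f = A :=
  (hasExpansion_expand i s f).unique h

lemma expand_smul_coeff (i : Fin (n + 1)) (s : Option (Fin n)) (c : ℂ) (f : Gam τ (n + 1))
    (m : ℤ) : (expand i s (c • f)).coeff m = c • (expand i s f).coeff m := by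
  rw [Algebra.smul_def, map_mul, (HasExpansion.scalar c).expand_eq, HahnSeries.C_mul_eq_smul,
    HahnSeries.coeff_smul, smul_eq_mul, Algebra.smul_def]

lemma eventually_contourIntegral (f : Gam τ (n + 1)) (i : Fin (n + 1)) (s : Option (Fin n)) (m : ℤ)
    (y : config τ n) : ∀ᶠ r in 𝓝[>] (0 : ℝ),
      contourIntegral τ f.1 i s m y.1 r = ev y ((expand i s f).coeff m) :=
  (hasExpansion_expand i s f y).contour m

lemma laurentCoeff_eq (f : Gam τ (n + 1)) (i : Fin (n + 1)) (s : Option (Fin n)) (m : ℤ) :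
    laurentCoeff τ f.1 i s m = ((expand i s f).coeff m).1 := by
  funext y
  refine Filter.Tendsto.limUnder_eq (tendsto_const_nhds.congr' ?_)
  filter_upwards [eventually_contourIntegral f i s m y] with r hr
  rw [hr]
  rfl

theorem hasLaurentExpansions (f : Gam τ (n + 1)) : HasLaurentExpansions τ f := by
  refine fun i s => ⟨fun m y => ?_, fun m => ?_, ?_⟩
  · rw [laurentCoeff_eq]
    exact eventually_contourIntegral f i s m y
  · rw [laurentCoeff_eq]
    exact Subtype.property _
  · obtain ⟨N, hN⟩ := exists_coeff_eq_zero (expand i s f)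
    refine ⟨N, fun m hm => ?_⟩
    rw [laurentCoeff_eq, hN m hm]
    rfl

end Expansions
end ChiralHomology
namespace ChiralHomology

/-! ### Compatibility of expansions with pullbacks and derivations -/

section ExpansionRules

variable {τ : ℍ} {n m : ℕ}

lemma expand_pull_skip (i : Fin (n + 1)) (s : Option (Fin n)) (g : Gam τ n) :
    expand i s (pull τ (skip i) g) = HahnSeries.C g :=
  (HasExpansion.pull_skip g).expand_eq

lemma expand_pull_moved (i : Fin (n + 1)) (k : Fin n) (g : Gam τ n) :
    expand i (some k) (pull τ (moved i k) g) = (expSeries (pd τ k) g : LaurentSeries (Gam τ n)) :=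
  (hasExpansion_moved i k g).expand_eq

lemma expand_gPhi_some (i : Fin (n + 1)) (k : Fin n) :
    expand i (some k) (gPhi τ i (i.succAbove k) (Fin.ne_succAbove i k)) =
      mapL (scal τ n) (zetaSeries τ) +
        (primExp (pd τ k) (gU τ k) : LaurentSeries (Gam τ n)) :=
  (hasExpansion_gPhi_some i k).expand_eq

lemma expand_gPhi_none (i : Fin (n + 1)) (k : Fin n) :
    expand i none (gPhi τ i (i.succAbove k) (Fin.ne_succAbove i k)) =
      -mapL (scal τ n) (zetaSeries τ) +
        (negT (primExp (pd τ k) (gU τ k)) : LaurentSeries (Gam τ n)) :=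
  (hasExpansion_gPhi_none i k).expand_eq

lemma expand_gU_none (i : Fin (n + 1)) :
    expand i none (gU τ i) = mapL (scal τ n) (wpSeries τ) := by
  refine (HasExpansion.of_eq fun y => ⟨wp τ, ?_, fun z hz => by rw [ev_gU]; simp⟩).expand_eq
  rw [mapL_ev_scal]
  exact hasLaurentAt_wp τ

lemma expand_scalar (i : Fin (n + 1)) (s : Option (Fin n)) (c : ℂ) :
    expand i s (algebraMap ℂ (Gam τ (n + 1)) c) = HahnSeries.C (algebraMap ℂ (Gam τ n) c) :=
  (HasExpansion.scalar c).expand_eq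

/-- The expansions are compatible with pulling back functions. -/
lemma expand_pull {i : Fin (n + 1)} {i' : Fin (m + 1)} {ι : Fin (n + 1) ↪ Fin (m + 1)}
    {ι' : Fin n ↪ Fin m} (hi : ι i = i') (h : ∀ k, ι (i.succAbove k) = i'.succAbove (ι' k))
    (s : Option (Fin n)) (f : Gam τ (n + 1)) :
    expand i' (s.map ι') (pull τ ι f) = mapL (pull τ ι' : Gam τ n →+* Gam τ m) (expand i s f) := by
  refine (HasExpansion.of_eq fun y => ?_).expand_eq
  refine ⟨fun z => ext τ f.1 (i.insertNth z (compEmb ι' y).1), ?_, fun z hz => ?_⟩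
  · have hc : center (s.map ι') y.1 = center s (compEmb ι' y).1 := by cases s <;> rfl
    rw [hc]
    exact hasExpansion_expand i s f (compEmb ι' y)
  · have e : (i.insertNth z (compEmb ι' y).1 : Fin (n + 1) → ℂ) =
        (i'.insertNth z y.1 : Fin (m + 1) → ℂ) ∘ ι := by
      funext l
      rcases Fin.eq_self_or_eq_succAbove i l with rfl | ⟨l, rfl⟩
      · simp [hi]
      · simp [h, compEmb]
    change ext τ f.1 _ = _
    rw [e, ext_apply τ f.1 ⟨_, comp_emb_mem τ ι hz⟩]
    rfl

lemma expand_pd_self (i : Fin (n + 1)) (s : Option (Fin n)) (f : Gam τ (n + 1)) :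
    expand i s (pd τ i f) = LaurentSeries.hasseDeriv ℂ 1 (expand i s f) := by
  refine HasExpansion.expand_eq fun y => ?_
  have h := (hasExpansion_expand i s f y).deriv'
    (f' := fun z => ext τ (pd τ i f).1 (i.insertNth z y.1)) (by
      filter_upwards [eventually_insertNth_mem i (center s y.1) y] with z hz
      have := hasDerivAt_pd i f ⟨_, hz⟩
      simp only [Fin.insertNth_apply_same, Fin.update_insertNth] at this
      rw [ext_apply τ (pd τ i f).1 ⟨_, hz⟩]
      exact this)
  refine (congrArg _ ?_ : HasLaurentAt _ _ _ = _).mpr h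
  refine HahnSeries.ext (funext fun m => ?_)
  rw [mapL_coeff, hasseDeriv_coeff_one, hasseDeriv_coeff_one]
  exact map_zsmul _ _ _

/-- The application of a linear map to the coefficients of Laurent series. -/
def mapD {R : Type*} [CommRing R] [Algebra ℂ R] (D : R →ₗ[ℂ] R) (A : LaurentSeries R) :
    LaurentSeries R := HahnSeries.map A D

section
variable {R : Type*} [CommRing R] [Algebra ℂ R] (D : R →ₗ[ℂ] R)

@[simp] lemma mapD_coeff (A : LaurentSeries R) (m : ℤ) : (mapD D A).coeff m = D (A.coeff m) := rfl

lemma mapD_add (A B : LaurentSeries R) : mapD D (A + B) = mapD D A + mapD D B := by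
  ext m
  simp

lemma mapD_mul (hD : ∀ f g, D (f * g) = D f * g + f * D g) (A B : LaurentSeries R) :
    mapD D (A * B) = mapD D A * B + A * mapD D B := by
  obtain ⟨M, hM⟩ := exists_coeff_eq_zero A
  obtain ⟨N, hN⟩ := exists_coeff_eq_zero B
  have hM' : ∀ m < M, (mapD D A).coeff m = 0 := fun m h => by rw [mapD_coeff, hM m h, map_zero]
  have hN' : ∀ m < N, (mapD D B).coeff m = 0 := fun m h => by rw [mapD_coeff, hN m h, map_zero]
  ext m
  rw [HahnSeries.coeff_add, coeff_mul_Icc hM' hN, coeff_mul_Icc hM hN', mapD_coeff,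
    coeff_mul_Icc hM hN, map_sum, ← Finset.sum_add_distrib]
  exact Finset.sum_congr rfl fun j _ => hD _ _

lemma mapD_C (r : R) : mapD D (HahnSeries.C r) = HahnSeries.C (D r) := by
  ext m
  simp only [mapD_coeff, HahnSeries.C_apply, HahnSeries.coeff_single]
  split_ifs <;> simp

lemma mapD_coe (P Q : PowerSeries R) (h : ∀ m, D (PowerSeries.coeff m P) = PowerSeries.coeff m Q) :
    mapD D (P : LaurentSeries R) = (Q : LaurentSeries R) := by
  ext m
  rw [mapD_coeff, PowerSeries.coeff_coe, PowerSeries.coeff_coe]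
  split_ifs
  · exact map_zero _
  · exact h _

end

lemma mapD_pd_mul (j : Fin n) (A B : LaurentSeries (Gam τ n)) :
    mapD (pd τ j) (A * B) = mapD (pd τ j) A * B + A * mapD (pd τ j) B := by
  apply mapD_mul
  intro f g
  exact pd_mul j f g

lemma mapD_scal (j : Fin n) (A : LaurentSeries ℂ) : mapD (pd τ j) (mapL (scal τ n) A) = 0 := by
  refine HahnSeries.ext (funext fun m => ?_)
  exact pd_algebraMap j _

lemma mapD_neg_scal (j : Fin n) (A : LaurentSeries ℂ) :
    mapD (pd τ j) (-mapL (scal τ n) A) = 0 := by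
  rw [← RingHom.map_neg, mapD_scal]

lemma pd_pow_comm (j k : Fin n) (p : ℕ) (f : Gam τ n) :
    pd τ j ((pd τ k ^ p) f) = (pd τ k ^ p) (pd τ j f) := by
  induction p with
  | zero => rfl
  | succ p ih => rw [pow_succ', Module.End.mul_apply, Module.End.mul_apply, pd_comm, ih]

lemma pd_primExp_of_ne {j k : Fin n} (h : k ≠ j) (p : ℕ) :
    pd τ j (PowerSeries.coeff p (primExp (pd τ k) (gU τ k))) = 0 := by
  rw [primExp, PowerSeries.coeff_mk]
  split_ifs
  · exact map_zero _
  · rw [map_smul, pd_pow_comm, pd_gU_of_ne h, map_zero, smul_zero]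

lemma hasseDeriv_one_coe {R : Type*} [CommRing R] [Algebra ℂ R] {P Q : PowerSeries R}
    (h : ∀ p : ℕ, (p + 1 : ℂ) • PowerSeries.coeff (p + 1) P = PowerSeries.coeff p Q) :
    LaurentSeries.hasseDeriv ℂ 1 (P : LaurentSeries R) = (Q : LaurentSeries R) := by
  ext m
  rw [hasseDeriv_coeff_one]
  rcases lt_or_ge m 0 with hm | hm
  · rw [powerSeries_coeff_of_neg Q hm]
    rcases eq_or_ne m (-1) with rfl | h1
    · simp
    · rw [powerSeries_coeff_of_neg P (by omega), smul_zero]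
  · obtain ⟨p, rfl⟩ : ∃ p : ℕ, m = p := ⟨m.toNat, by omega⟩
    have e : ((p : ℤ) + 1) = ((p + 1 : ℕ) : ℤ) := by push_cast; ring
    rw [e, PowerSeries.coeff_coe, if_neg (by omega), PowerSeries.coeff_coe, if_neg (by omega),
      Int.natAbs_natCast, Int.natAbs_natCast, ← h, ← Int.cast_smul_eq_zsmul ℂ]
    push_cast
    rfl

lemma smul_factorial_succ {M : Type*} [AddCommGroup M] [Module ℂ M] (p : ℕ) (x : M) :
    (p + 1 : ℂ) • ((p + 1).factorial : ℂ)⁻¹ • x = (p.factorial : ℂ)⁻¹ • x := by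
  rw [smul_smul]
  congr 1
  have h0 : (p + 1 : ℂ) ≠ 0 := by exact_mod_cast p.succ_ne_zero
  have h1 : (p.factorial : ℂ) ≠ 0 := by exact_mod_cast p.factorial_ne_zero
  rw [Nat.factorial_succ]
  push_cast
  field_simp

lemma hasseDeriv_one_primExp {R : Type*} [CommRing R] [Algebra ℂ R] (D : R →ₗ[ℂ] R) (g : R) :
    LaurentSeries.hasseDeriv ℂ 1 (primExp D g : LaurentSeries R) =
      (expSeries D g : LaurentSeries R) := by
  refine hasseDeriv_one_coe fun p => ?_
  rw [primExp, expSeries, PowerSeries.coeff_mk, PowerSeries.coeff_mk, if_neg p.succ_ne_zero,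
    Nat.add_sub_cancel, smul_factorial_succ]

lemma mapD_primExp {R : Type*} [CommRing R] [Algebra ℂ R] (D : R →ₗ[ℂ] R) (g : R) :
    mapD D (primExp D g : LaurentSeries R) =
      (expSeries D g : LaurentSeries R) - HahnSeries.C g := by
  rw [← PowerSeries.coe_C, ← PowerSeries.coe_sub]
  refine mapD_coe _ _ _ fun p => ?_
  rw [primExp, expSeries, PowerSeries.coeff_mk, map_sub, PowerSeries.coeff_mk, PowerSeries.coeff_C]
  rcases p with _ | p
  · simp
  · rw [if_neg p.succ_ne_zero, if_neg p.succ_ne_zero, sub_zero, map_smul, Nat.add_sub_cancel,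
      pow_succ', Module.End.mul_apply]

lemma hasseDeriv_zetaSeries :
    LaurentSeries.hasseDeriv ℂ 1 (mapL (scal τ n) (zetaSeries τ)) =
      -mapL (scal τ n) (wpSeries τ) := by
  refine HahnSeries.ext (funext fun m => ?_)
  rw [hasseDeriv_coeff_one, HahnSeries.coeff_neg, mapL_coeff, mapL_coeff, zetaSeries_coeff,
    ← map_zsmul, ← map_neg]
  congr 1
  rw [add_sub_cancel_right, zsmul_eq_mul]
  -- At `m = -1` the factor `m + 1` is zero, so the equality requires that ℘ have no residue.
  rcases eq_or_ne m (-1) with rfl | h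
  · rw [wpSeries_coeff_neg_one]; simp
  · have : ((m + 1 : ℤ) : ℂ) ≠ 0 := by exact_mod_cast (by omega : m + 1 ≠ 0)
    field_simp

/-- The derivation `∂` in the variable `x_{i.succAbove j}` or, if this is the centre of the
expansion, in this variable and `xᵢ` simultaneously. -/
def pdCenter (τ : ℍ) (i : Fin (n + 1)) (s : Option (Fin n)) (j : Fin n) (f : Gam τ (n + 1)) :
    Gam τ (n + 1) :=
  pd τ (i.succAbove j) f + if s = some j then pd τ i f else 0

lemma pdCenter_mul (i : Fin (n + 1)) (s : Option (Fin n)) (j : Fin n) (f g : Gam τ (n + 1)) :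
    pdCenter τ i s j (f * g) = pdCenter τ i s j f * g + f * pdCenter τ i s j g := by
  rw [pdCenter, pdCenter, pdCenter]
  split_ifs
  · rw [pd_mul, pd_mul]; ring
  · rw [pd_mul]; ring

lemma pdCenter_add (i : Fin (n + 1)) (s : Option (Fin n)) (j : Fin n) (f g : Gam τ (n + 1)) :
    pdCenter τ i s j (f + g) = pdCenter τ i s j f + pdCenter τ i s j g := by
  rw [pdCenter, pdCenter, pdCenter]
  split_ifs
  · rw [map_add, map_add]; ring
  · rw [map_add]; ring

lemma expand_pdCenter_skip (i : Fin (n + 1)) (s : Option (Fin n)) (j : Fin n) (g : Gam τ n) :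
    expand i s (pdCenter τ i s j (pull τ (skip i) g)) =
      mapD (pd τ j) (expand i s (pull τ (skip i) g)) := by
  have h0 : pd τ i (pull τ (skip i) g) = 0 :=
    pd_pull_of_notMem _ i (fun l => Fin.succAbove_ne i l) g
  have h1 : pd τ (i.succAbove j) (pull τ (skip i) g) = pull τ (skip i) (pd τ j g) :=
    pd_pull (skip i) j g
  have h2 : pdCenter τ i s j (pull τ (skip i) g) = pull τ (skip i) (pd τ j g) := by
    rw [pdCenter, h0, h1]
    split_ifs <;> exact add_zero _
  rw [h2, expand_pull_skip, expand_pull_skip, mapD_C]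

lemma pd_gPhi_of_ne {i k j : Fin n} (h : i ≠ k) (hi : i ≠ j) (hk : k ≠ j) :
    pd τ j (gPhi τ i k h) = 0 :=
  ext_ev fun y => by
    rw [map_zero]
    exact ev_pd_eq (hasDerivAt_const _ (phi τ (y.1 i) (y.1 k))) fun z hz => by
      rw [ev_gPhi]; simp [hi, hk]

lemma mapD_eq_zero {j : Fin n} {P : PowerSeries (Gam τ n)}
    (hP : ∀ p, pd τ j (PowerSeries.coeff p P) = 0) : mapD (pd τ j) (P : LaurentSeries (Gam τ n)) = 0 := by
  rw [← PowerSeries.coe_zero]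
  exact mapD_coe _ _ _ fun p => by rw [hP, map_zero]

lemma pd_neg_one_pow_mul (j : Fin n) (p : ℕ) (g : Gam τ n) :
    pd τ j ((-1) ^ p * g) = (-1) ^ p * pd τ j g := by
  rcases neg_one_pow_eq_or (Gam τ n) p with h | h
  · rw [h, one_mul, one_mul]
  · rw [h, neg_one_mul, neg_one_mul, map_neg]

/-- The expansion at `s` is compatible with the derivations for the function `f`. -/
def ExpandCompat (i : Fin (n + 1)) (s : Option (Fin n)) (j : Fin n) (f : Gam τ (n + 1)) : Prop :=
  expand i s (pdCenter τ i s j f) = mapD (pd τ j) (expand i s f)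

namespace ExpandCompat

variable {i : Fin (n + 1)} {s : Option (Fin n)} {j : Fin n} {f g : Gam τ (n + 1)}

lemma add (hf : ExpandCompat i s j f) (hg : ExpandCompat i s j g) : ExpandCompat i s j (f + g) := by
  unfold ExpandCompat at *
  rw [pdCenter_add, RingHom.map_add, RingHom.map_add, mapD_add, hf, hg]

lemma mul (hf : ExpandCompat i s j f) (hg : ExpandCompat i s j g) : ExpandCompat i s j (f * g) := by
  unfold ExpandCompat at *
  have h2 := mapD_pd_mul j (expand i s f) (expand i s g)
  rw [pdCenter_mul, RingHom.map_add, RingHom.map_mul, RingHom.map_mul, hf, hg, RingHom.map_mul, h2]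

lemma pull_skip (g : Gam τ n) : ExpandCompat i s j (pull τ (skip i) g) :=
  expand_pdCenter_skip i s j g

lemma scalar (c : ℂ) : ExpandCompat i s j (algebraMap ℂ (Gam τ (n + 1)) c) := by
  rw [← (pull τ (skip i)).commutes]
  exact pull_skip _

lemma neg (hf : ExpandCompat i s j f) : ExpandCompat i s j (-f) := by
  have e : -f = algebraMap ℂ (Gam τ (n + 1)) (-1) * f := by
    rw [RingHom.map_neg, RingHom.map_one, neg_one_mul]
  rw [e]
  exact (scalar _).mul hf

end ExpandCompat

lemma pdCenter_none (i : Fin (n + 1)) (j : Fin n) (f : Gam τ (n + 1)) :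
    pdCenter τ i none j f = pd τ (i.succAbove j) f := by
  rw [pdCenter, if_neg (by simp), add_zero]

lemma expandCompat_gU_none (i : Fin (n + 1)) (j : Fin n) : ExpandCompat i none j (gU τ i) := by
  unfold ExpandCompat
  rw [pdCenter_none, expand_gU_none, mapD_scal, pd_gU_of_ne (Fin.ne_succAbove i j), RingHom.map_zero]

lemma expandCompat_gV_none (i : Fin (n + 1)) (j : Fin n) : ExpandCompat i none j (gV τ i) := by
  unfold ExpandCompat
  rw [pdCenter_none, ← pd_gU, pd_comm, pd_gU_of_ne (Fin.ne_succAbove i j), LinearMap.map_zero,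
    RingHom.map_zero, expand_pd_self, expand_gU_none]
  refine HahnSeries.ext (funext fun m => ?_)
  rw [mapD_coeff, hasseDeriv_coeff_one, map_zsmul, mapL_coeff, pd_algebraMap, smul_zero]
  rfl

lemma hasseDeriv_negT_primExp {R : Type*} [CommRing R] [Algebra ℂ R] (D : R →ₗ[ℂ] R) (g : R) :
    LaurentSeries.hasseDeriv ℂ 1 (negT (primExp D g) : LaurentSeries R) =
      -(negT (expSeries D g) : LaurentSeries R) := by
  rw [← PowerSeries.coe_neg]
  refine hasseDeriv_one_coe fun p => ?_
  rw [map_neg, negT, PowerSeries.coeff_rescale, PowerSeries.coeff_rescale, primExp,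
    expSeries, PowerSeries.coeff_mk, PowerSeries.coeff_mk, if_neg p.succ_ne_zero,
    Nat.add_sub_cancel, ← mul_smul_comm, smul_factorial_succ]
  ring

lemma mapD_negT_primExp (k : Fin n) (g : Gam τ n) :
    mapD (pd τ k) (negT (primExp (pd τ k) g) : LaurentSeries (Gam τ n)) =
      (negT (expSeries (pd τ k) g) : LaurentSeries (Gam τ n)) - HahnSeries.C g := by
  rw [← PowerSeries.coe_C, ← PowerSeries.coe_sub]
  refine mapD_coe _ _ _ fun p => ?_
  rw [map_sub, negT, PowerSeries.coeff_rescale, PowerSeries.coeff_rescale, pd_neg_one_pow_mul,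
    primExp, expSeries, PowerSeries.coeff_mk, PowerSeries.coeff_mk, PowerSeries.coeff_C]
  rcases p with _ | p
  · simp
  · rw [if_neg p.succ_ne_zero, if_neg p.succ_ne_zero, sub_zero, map_smul,
      Nat.add_sub_cancel, pow_succ' (pd τ k), Module.End.mul_apply]

/-- In the main case `k = j`, the derivative of `phi` in its second variable is ℘(xᵢ) - ℘(xₖ) - ∂ᵢ
phi. This trades it for a derivative in the expansion variable, which acts term by term. -/
lemma expandCompat_gPhi_none (i : Fin (n + 1)) (j k : Fin n) :
    ExpandCompat i none j (gPhi τ i (i.succAbove k) (Fin.ne_succAbove i k)) := by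
  unfold ExpandCompat
  rw [pdCenter_none]
  by_cases hk : k = j
  · subst hk
    have e : pd τ (i.succAbove k) (gPhi τ i (i.succAbove k) (Fin.ne_succAbove i k)) =
        gU τ i - gU τ (i.succAbove k) -
          pd τ i (gPhi τ i (i.succAbove k) (Fin.ne_succAbove i k)) := by
      rw [pd_gPhi_left, pd_gPhi_right]; ring
    have e2 : expand i none (gU τ (i.succAbove k)) = HahnSeries.C (gU τ k) :=
      expand_pull_skip i none (gU τ k)
    rw [e, RingHom.map_sub, RingHom.map_sub, expand_gU_none, e2, expand_pd_self, expand_gPhi_none,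
      LinearMap.map_add, LinearMap.map_neg, hasseDeriv_zetaSeries, hasseDeriv_negT_primExp,
      mapD_add, mapD_neg_scal, mapD_negT_primExp]
    abel
  · rw [pd_gPhi_of_ne _ (Fin.ne_succAbove i j) (fun e => hk (Fin.succAbove_right_injective e)),
      RingHom.map_zero, expand_gPhi_none, mapD_add, mapD_neg_scal, zero_add,
      mapD_eq_zero]
    intro p
    rw [negT, PowerSeries.coeff_rescale, pd_neg_one_pow_mul, pd_primExp_of_ne hk, mul_zero]

/-- The pulled back function depends on `xᵢ` in place of the centre variable. So the simultaneous
derivation in both variables is simply `∂ⱼ` before the pullback, and it commutes with the powers of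
`∂ₖ` in Taylor's formula. -/
lemma expandCompat_moved (i : Fin (n + 1)) (j k : Fin n) (g : Gam τ n) :
    ExpandCompat i (some k) j (pull τ (moved i k) g) := by
  have key : pdCenter τ i (some k) j (pull τ (moved i k) g) = pull τ (moved i k) (pd τ j g) := by
    by_cases hk : k = j
    · subst hk
      have h0 : pd τ (i.succAbove k) (pull τ (moved i k) g) = 0 := by
        refine pd_pull_of_notMem _ _ (fun l hl => ?_) g
        by_cases h : l = k
        · subst h
          rw [moved_self] at hl
          exact Fin.succAbove_ne _ _ hl.symm
        · rw [moved_of_ne i h, Fin.succAbove_right_inj] at hl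
          exact h hl
      have h1 := pd_pull (moved i k) k g
      rw [moved_self] at h1
      rw [pdCenter, if_pos rfl, h0, h1, zero_add]
    · have h1 := pd_pull (moved i k) j g
      rw [moved_of_ne i (Ne.symm hk)] at h1
      rw [pdCenter, if_neg (by simpa using hk), h1, add_zero]
  unfold ExpandCompat
  rw [key, expand_pull_moved, expand_pull_moved]
  refine (mapD_coe _ _ _ fun p => ?_).symm
  rw [expSeries, expSeries, PowerSeries.coeff_mk, PowerSeries.coeff_mk, map_smul, pd_pow_comm]

/-- The polar part ζ(xᵢ - xₖ) is invariant under simultaneous translation. For `k = j` there remains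
(∂ᵢ + ∂ₖ) phi = ℘(xᵢ) - ℘(xₖ), which is what differentiating the regular part gives. -/
lemma expandCompat_gPhi_some (i : Fin (n + 1)) (j k : Fin n) :
    ExpandCompat i (some k) j (gPhi τ i (i.succAbove k) (Fin.ne_succAbove i k)) := by
  unfold ExpandCompat
  rw [expand_gPhi_some, mapD_add, mapD_scal, zero_add]
  by_cases hk : k = j
  · subst hk
    have e2 : expand i (some k) (gU τ (i.succAbove k)) = HahnSeries.C (gU τ k) :=
      expand_pull_skip i (some k) (gU τ k)
    have e3 := expand_pull_moved i k (gU τ k)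
    rw [pull_gU, moved_self] at e3
    have e : pdCenter τ i (some k) k (gPhi τ i (i.succAbove k) (Fin.ne_succAbove i k)) =
        gU τ i - gU τ (i.succAbove k) := by
      rw [pdCenter, if_pos rfl, pd_gPhi_left, pd_gPhi_right]; ring
    rw [e, RingHom.map_sub, e2, e3, mapD_primExp]
  · rw [pdCenter, if_neg (by simpa using hk), add_zero, pd_gPhi_of_ne _ (Fin.ne_succAbove i j)
      (fun e => hk (Fin.succAbove_right_injective e)), RingHom.map_zero, mapD_eq_zero]
    exact pd_primExp_of_ne hk

/-- The expansions are compatible with the derivations. -/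
theorem expand_pdCenter (i : Fin (n + 1)) (s : Option (Fin n)) (j : Fin n) (f : Gam τ (n + 1)) :
    expand i s (pdCenter τ i s j f) = mapD (pd τ j) (expand i s f) := by
  -- Both sides are derivations along the ring homomorphism `expand`, so it is enough to check
  -- generators.
  change ExpandCompat i s j f
  rcases s with _ | k
  · refine Gam.induction τ (fun l => ?_) (fun l => ?_) (fun a b h => ?_)
      (fun c => .scalar c) (fun _ _ => .add) (fun _ _ => .mul) f
    · rcases Fin.eq_self_or_eq_succAbove i l with rfl | ⟨l, rfl⟩
      · exact expandCompat_gU_none _ _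
      · exact .pull_skip (gU τ l)
    · rcases Fin.eq_self_or_eq_succAbove i l with rfl | ⟨l, rfl⟩
      · exact expandCompat_gV_none _ _
      · exact .pull_skip (gV τ l)
    · rcases Fin.eq_self_or_eq_succAbove i a with rfl | ⟨a, rfl⟩
      · rcases Fin.eq_self_or_eq_succAbove a b with rfl | ⟨b, rfl⟩
        · exact absurd rfl h
        · exact expandCompat_gPhi_none _ _ b
      · rcases Fin.eq_self_or_eq_succAbove i b with rfl | ⟨b, rfl⟩
        · rw [gPhi_antisymm τ b (b.succAbove a) (Fin.ne_succAbove b a)]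
          exact (expandCompat_gPhi_none _ _ a).neg
        · exact .pull_skip (gPhi τ a b fun e => h (congrArg _ e))
  · exact Gam.induction_pair τ i (i.succAbove k) (Fin.ne_succAbove i k) (skip i) (moved i k)
      (fun l => mem_range_skip) (mem_range_moved i k) (fun g => .pull_skip g)
      (expandCompat_moved i j k) (expandCompat_gPhi_some i j k) (fun _ _ => .add)
      (fun _ _ => .mul) f

end ExpansionRules
end ChiralHomology
namespace ChiralHomology

/-! ### Exchanging the roles of two points -/

section Skew

variable {R : Type*} [CommRing R] [Algebra ℂ R]

/-- The operator `Dᵏ / k!`, which is zero for `k < 0`. -/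
def divPow (D : R →ₗ[ℂ] R) (k : ℤ) : R →ₗ[ℂ] R :=
  if k < 0 then 0 else (k.toNat.factorial : ℂ)⁻¹ • D ^ k.toNat

lemma divPow_of_neg (D : R →ₗ[ℂ] R) {k : ℤ} (h : k < 0) : divPow D k = 0 := if_pos h

lemma divPow_natCast (D : R →ₗ[ℂ] R) (k : ℕ) : divPow D k = (k.factorial : ℂ)⁻¹ • D ^ k := by
  rw [divPow, if_neg (by omega), Int.toNat_natCast]

lemma divPow_zero (D : R →ₗ[ℂ] R) (g : R) : divPow D 0 g = g := by
  have := divPow_natCast D 0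
  rw [Nat.cast_zero] at this
  rw [this]
  simp

lemma coeff_expSeries (D : R →ₗ[ℂ] R) (g : R) (k : ℤ) :
    (expSeries D g : LaurentSeries R).coeff k = divPow D k g := by
  rcases lt_or_ge k 0 with h | h
  · rw [powerSeries_coeff_of_neg _ h, divPow_of_neg D h, LinearMap.zero_apply]
  · obtain ⟨k, rfl⟩ := Int.eq_ofNat_of_zero_le h
    rw [PowerSeries.coeff_coe, if_neg (by omega), divPow_natCast, expSeries, PowerSeries.coeff_mk]
    rfl

/-- The coefficients of `∑ₘ (-t)ᵐ exp(tD) Aₘ`. -/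
def skewSum (D : R →ₗ[ℂ] R) (A : LaurentSeries R) (k : ℤ) : R :=
  ∑ᶠ m : ℤ, ((-1 : ℂ) ^ m) • divPow D (k - m) (A.coeff m)

lemma skewSum_eq (D : R →ₗ[ℂ] R) {A : LaurentSeries R} {M : ℤ} (hM : ∀ m < M, A.coeff m = 0)
    (k : ℤ) : skewSum D A k =
      ∑ m ∈ Finset.Icc M k, ((-1 : ℂ) ^ m) • divPow D (k - m) (A.coeff m) := by
  refine finsum_eq_sum_of_support_subset _ fun m hm => ?_
  rw [Finset.coe_Icc, Set.mem_Icc]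
  by_contra h
  rw [not_and_or, not_le, not_le] at h
  refine hm ?_
  rcases h with h | h
  · simp only [hM m h, map_zero, smul_zero]
  · simp only [divPow_of_neg D (by omega : k - m < 0), LinearMap.zero_apply, smul_zero]

lemma skewSum_add (D : R →ₗ[ℂ] R) (A B : LaurentSeries R) (k : ℤ) :
    skewSum D (A + B) k = skewSum D A k + skewSum D B k := by
  obtain ⟨M, hM⟩ := exists_coeff_eq_zero A
  obtain ⟨N, hN⟩ := exists_coeff_eq_zero B
  have hA : ∀ m < min M N, A.coeff m = 0 := fun m h => hM m (lt_of_lt_of_le h (min_le_left _ _))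
  have hB : ∀ m < min M N, B.coeff m = 0 := fun m h => hN m (lt_of_lt_of_le h (min_le_right _ _))
  rw [skewSum_eq D hA, skewSum_eq D hB, skewSum_eq D (A := A + B) (M := min M N)
    fun m h => by rw [HahnSeries.coeff_add, hA m h, hB m h, add_zero], ← Finset.sum_add_distrib]
  refine Finset.sum_congr rfl fun m _ => ?_
  rw [HahnSeries.coeff_add, map_add, smul_add]

/-- The operation A(t) ↦ exp(tD) A(-t) is multiplicative, since t ↦ -t is and exp(tD) is by
assumption. The proof is this statement on coefficients. -/
lemma skewSum_mul {D : R →ₗ[ℂ] R} (hD : ∀ f g, (expSeries D (f * g) : LaurentSeries R) =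
      (expSeries D f : LaurentSeries R) * (expSeries D g : LaurentSeries R))
    {A B A' B' : LaurentSeries R} (hA : ∀ k, A'.coeff k = skewSum D A k)
    (hB : ∀ k, B'.coeff k = skewSum D B k) (k : ℤ) :
    (A' * B').coeff k = skewSum D (A * B) k := by
  obtain ⟨M, hM⟩ := exists_coeff_eq_zero A
  obtain ⟨N, hN⟩ := exists_coeff_eq_zero B
  have hM' : ∀ m < M, A'.coeff m = 0 := fun m h => by
    rw [hA, skewSum_eq D hM, Finset.Icc_eq_empty (by omega), Finset.sum_empty]
  have hN' : ∀ m < N, B'.coeff m = 0 := fun m h => by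
    rw [hB, skewSum_eq D hN, Finset.Icc_eq_empty (by omega), Finset.sum_empty]
  have hMN : ∀ m < M + N, (A * B).coeff m = 0 := fun m h => by
    rw [coeff_mul_Icc hM hN, Finset.Icc_eq_empty (by omega), Finset.sum_empty]
  have hE : ∀ (f : R) (m : ℤ), m < 0 → (expSeries D f : LaurentSeries R).coeff m = 0 :=
    fun f m h => powerSeries_coeff_of_neg _ h
  have hE2 : ∀ (j : ℤ) (f g : R), divPow D j (f * g) =
      ∑ q ∈ Finset.Icc 0 j, divPow D q f * divPow D (j - q) g := by
    intro j f g
    rw [← coeff_expSeries, hD, coeff_mul_Icc (hE f) (hE g), sub_zero]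
    simp only [coeff_expSeries]
  rw [coeff_mul_Icc hM' hN', skewSum_eq D hMN]
  have l : ∀ m, ((-1 : ℂ) ^ m) • divPow D (k - m) ((A * B).coeff m) =
      ∑ p ∈ Finset.Icc M (m - N) ×ˢ Finset.Icc 0 (k - m), ((-1 : ℂ) ^ m) •
        (divPow D p.2 (A.coeff p.1) * divPow D (k - m - p.2) (B.coeff (m - p.1))) := by
    intro m
    rw [coeff_mul_Icc hM hN, map_sum, Finset.smul_sum, Finset.sum_product]
    refine Finset.sum_congr rfl fun j _ => ?_
    rw [hE2, Finset.smul_sum]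
  have r : ∀ j, A'.coeff j * B'.coeff (k - j) =
      ∑ p ∈ Finset.Icc M j ×ˢ Finset.Icc N (k - j), ((-1 : ℂ) ^ (p.1 + p.2)) •
        (divPow D (j - p.1) (A.coeff p.1) * divPow D (k - j - p.2) (B.coeff p.2)) := by
    intro j
    rw [hA, hB, skewSum_eq D hM, skewSum_eq D hN, Finset.sum_mul_sum, Finset.sum_product]
    refine Finset.sum_congr rfl fun p _ => Finset.sum_congr rfl fun q _ => ?_
    rw [smul_mul_smul_comm, zpow_add₀ (by norm_num : (-1 : ℂ) ≠ 0)]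
  rw [Finset.sum_congr rfl fun m _ => l m, Finset.sum_congr rfl fun j _ => r j,
    Finset.sum_sigma', Finset.sum_sigma']
  -- On one side the indices are the output index of `A'` and the source indices in `A` and `B`; on
  -- the other they are the total source index, its `A`-part, and the number of derivations falling
  -- on `A`. Both changes of variables are given by the same formula.
  refine Finset.sum_bij' (fun x _ => ⟨x.2.1 + x.2.2, (x.2.1, x.1 - x.2.1)⟩)
    (fun x _ => ⟨x.2.1 + x.2.2, (x.2.1, x.1 - x.2.1)⟩) ?_ ?_ ?_ ?_ ?_
  · rintro ⟨a, b, c⟩ h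
    simp only [Finset.mem_sigma, Finset.mem_product, Finset.mem_Icc] at h ⊢
    omega
  · rintro ⟨a, b, c⟩ h
    simp only [Finset.mem_sigma, Finset.mem_product, Finset.mem_Icc] at h ⊢
    omega
  · rintro ⟨a, b, c⟩ _
    simp
  · rintro ⟨a, b, c⟩ _
    simp
  · rintro ⟨a, b, c⟩ _
    simp only
    congr 3 <;> ring_nf

lemma skewSum_C (D : R →ₗ[ℂ] R) (g : R) (k : ℤ) : skewSum D (HahnSeries.C g) k = divPow D k g := by
  rw [skewSum, finsum_eq_single _ 0 fun m hm => by rw [C_coeff_of_ne g hm, map_zero, smul_zero]]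
  simp

/-- Scalars are annihilated by `D`, so exp(tD) acts trivially and only the substitution t ↦ -t
remains. -/
lemma skewSum_scalar {D : R →ₗ[ℂ] R} (hD : ∀ c : ℂ, D (algebraMap ℂ R c) = 0)
    (A : LaurentSeries ℂ) (k : ℤ) :
    skewSum D (mapL (algebraMap ℂ R) A) k = algebraMap ℂ R ((-1 : ℂ) ^ k * A.coeff k) := by
  rw [skewSum, finsum_eq_single _ k fun m hm => ?_]
  · rw [sub_self, divPow_zero, mapL_coeff, Algebra.smul_def, map_mul]
  · rcases lt_or_ge (k - m) 0 with h | h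
    · rw [divPow_of_neg D h, LinearMap.zero_apply, smul_zero]
    · obtain ⟨j, hj⟩ : ∃ j : ℕ, k - m = (j + 1 : ℕ) := ⟨(k - m - 1).toNat, by omega⟩
      rw [hj, divPow_natCast, LinearMap.smul_apply, pow_succ, Module.End.mul_apply, mapL_coeff, hD,
        map_zero, smul_zero, smul_zero]

lemma sum_Icc_natCast {M : Type*} [AddCommMonoid M] (F : ℤ → M) (k : ℕ) :
    ∑ m ∈ Finset.Icc (0 : ℤ) k, F m = ∑ m ∈ Finset.range (k + 1), F m := by
  refine Finset.sum_nbij' Int.toNat (fun m => (m : ℤ)) ?_ ?_ ?_ ?_ ?_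
  · intro m hm
    rw [Finset.mem_Icc] at hm
    rw [Finset.mem_range]
    omega
  · intro m hm
    rw [Finset.mem_range] at hm
    rw [Finset.mem_Icc]
    omega
  · intro m hm
    exact Int.toNat_of_nonneg (Finset.mem_Icc.mp hm).1
  · intro m _
    rfl
  · intro m hm
    rw [Int.toNat_of_nonneg (Finset.mem_Icc.mp hm).1]

lemma skewSum_coe (D : R →ₗ[ℂ] R) (P : PowerSeries R) (k : ℕ) :
    skewSum D (P : LaurentSeries R) k = ∑ m ∈ Finset.range (k + 1),
      ((-1 : ℂ) ^ m) • ((k - m).factorial : ℂ)⁻¹ • (D ^ (k - m)) (PowerSeries.coeff m P) := by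
  rw [skewSum_eq D (M := 0) (fun m h => powerSeries_coeff_of_neg P h), sum_Icc_natCast]
  refine Finset.sum_congr rfl fun m hm => ?_
  have e : (k : ℤ) - m = (k - m : ℕ) := by
    have := Finset.mem_range.mp hm
    omega
  rw [e, divPow_natCast, PowerSeries.coeff_coe, if_neg (by omega), zpow_natCast]
  rfl

lemma skewSum_coe_of_neg (D : R →ₗ[ℂ] R) (P : PowerSeries R) {k : ℤ} (hk : k < 0) :
    skewSum D (P : LaurentSeries R) k = 0 := by
  rw [skewSum_eq D (M := 0) (fun m h => powerSeries_coeff_of_neg P h),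
    Finset.Icc_eq_empty (by omega), Finset.sum_empty]

lemma inv_factorial_mul_inv_factorial {m k : ℕ} (h : m ≤ k) :
    ((k - m).factorial : ℂ)⁻¹ * (m.factorial : ℂ)⁻¹ = (k.choose m : ℂ) * (k.factorial : ℂ)⁻¹ := by
  rw [Nat.cast_choose ℂ h]
  have h3 : (k.factorial : ℂ) ≠ 0 := by exact_mod_cast k.factorial_ne_zero
  field_simp

/-- This is exp(tD) exp(-tD) = 1, in the form of the vanishing alternating sum of binomial
coefficients. -/
lemma skewSum_expSeries (D : R →ₗ[ℂ] R) (g : R) (k : ℤ) :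
    skewSum D (expSeries D g : LaurentSeries R) k = (HahnSeries.C g : LaurentSeries R).coeff k := by
  rcases lt_or_ge k 0 with hk | hk
  · rw [skewSum_coe_of_neg D _ hk, C_coeff_of_ne g hk.ne]
  obtain ⟨k, rfl⟩ := Int.eq_ofNat_of_zero_le hk
  have e : ∀ m ∈ Finset.range (k + 1), ((-1 : ℂ) ^ m) • ((k - m).factorial : ℂ)⁻¹ •
      (D ^ (k - m)) (PowerSeries.coeff m (expSeries D g)) =
      ((-1 : ℂ) ^ m * (k.choose m : ℂ)) • (k.factorial : ℂ)⁻¹ • (D ^ k) g := by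
    intro m hm
    have hm : m ≤ k := Nat.lt_succ_iff.mp (Finset.mem_range.mp hm)
    rw [expSeries, PowerSeries.coeff_mk, map_smul, ← Module.End.mul_apply, ← pow_add,
      Nat.sub_add_cancel hm]
    simp only [smul_smul]
    rw [mul_assoc, inv_factorial_mul_inv_factorial hm]
  rw [skewSum_coe, Finset.sum_congr rfl e, ← Finset.sum_smul]
  have h := congrArg (Int.cast : ℤ → ℂ) (Int.alternating_sum_range_choose (n := k))
  push_cast at h
  rw [h]
  rcases k with _ | k
  · simp
  · rw [if_neg k.succ_ne_zero, zero_smul, C_coeff_of_ne g (by omega)]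

/-- Formally `primExp` is (exp(tD) - 1)/D, and exp(tD)(exp(-tD) - 1) = -(exp(tD) - 1). On
coefficients the alternating binomial sum lacks its first term, which produces the sign. -/
lemma skewSum_primExp (D : R →ₗ[ℂ] R) (g : R) (k : ℤ) :
    skewSum D (primExp D g : LaurentSeries R) k = -(primExp D g : LaurentSeries R).coeff k := by
  rcases lt_or_ge k 0 with hk | hk
  · rw [skewSum_coe_of_neg D _ hk, powerSeries_coeff_of_neg _ hk, neg_zero]
  obtain ⟨k, rfl⟩ := Int.eq_ofNat_of_zero_le hk
  rw [PowerSeries.coeff_coe, if_neg (by omega), Int.natAbs_natCast, skewSum_coe,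
    Finset.sum_range_succ']
  have h0 : PowerSeries.coeff 0 (primExp D g) = 0 := by rw [primExp, PowerSeries.coeff_mk, if_pos rfl]
  rw [h0, map_zero, smul_zero, smul_zero, add_zero]
  rcases k with _ | k
  · rw [Finset.sum_range_zero, h0, neg_zero]
  have e : ∀ m ∈ Finset.range (k + 1), ((-1 : ℂ) ^ (m + 1)) • ((k + 1 - (m + 1)).factorial : ℂ)⁻¹ •
      (D ^ (k + 1 - (m + 1))) (PowerSeries.coeff (m + 1) (primExp D g)) =
      ((-1 : ℂ) ^ (m + 1) * ((k + 1).choose (m + 1) : ℂ)) •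
        ((k + 1).factorial : ℂ)⁻¹ • (D ^ k) g := by
    intro m hm
    have hm : m + 1 ≤ k + 1 := Nat.succ_le_of_lt (Finset.mem_range.mp hm)
    have e1 : k + 1 - (m + 1) + (m + 1 - 1) = k := by omega
    rw [primExp, PowerSeries.coeff_mk, if_neg m.succ_ne_zero, map_smul, ← Module.End.mul_apply,
      ← pow_add, e1]
    simp only [smul_smul]
    rw [mul_assoc, inv_factorial_mul_inv_factorial hm]
  rw [Finset.sum_congr rfl e, ← Finset.sum_smul]
  have h := congrArg (Int.cast : ℤ → ℂ) (Int.alternating_sum_range_choose (n := k + 1))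
  rw [Finset.sum_range_succ'] at h
  push_cast at h
  rw [primExp, PowerSeries.coeff_mk, if_neg k.succ_ne_zero, Nat.add_sub_cancel]
  simp only [Nat.choose_zero_right, Nat.cast_one, one_mul] at h
  rw [eq_neg_of_add_eq_zero_left h, neg_smul, one_smul]

end Skew

/-! ### Expanding one of two adjacent points at the other -/

section SkewExpansion

variable {τ : ℍ} {n : ℕ}

/-- The series exp(t∂ₖ)g is the expansion of a pullback of `g`, and both expansion and pullback are
ring homomorphisms; no iterated Leibniz rule is needed. -/
lemma expSeries_pd_mul (k : Fin n) (f g : Gam τ n) :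
    (expSeries (pd τ k) (f * g) : LaurentSeries (Gam τ n)) =
      (expSeries (pd τ k) f : LaurentSeries (Gam τ n)) * (expSeries (pd τ k) g : LaurentSeries _) := by
  rw [← expand_pull_moved 0, ← expand_pull_moved 0, ← expand_pull_moved 0, map_mul, map_mul]

lemma val_succAbove (p : Fin (n + 1)) (l : Fin n) :
    (p.succAbove l : ℕ) = if (l : ℕ) < p then (l : ℕ) else l + 1 := by
  simp only [Fin.succAbove, Fin.lt_def, Fin.val_castSucc]
  split_ifs <;> rfl

/-- Omitting the first of two adjacent indices puts the second one in its place. Hence the two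
points exchange their roles without any further renumbering. -/
lemma skip_castSucc (i : Fin (n + 1)) : skip i.castSucc = moved i.succ i := by
  ext l
  by_cases h : l = i
  · subst h
    rw [moved_self]
    simp
  · have h' : (l : ℕ) ≠ i := fun e => h (Fin.ext e)
    rw [moved_of_ne _ h, Fin.coe_succAboveEmb, val_succAbove, val_succAbove, Fin.val_castSucc,
      Fin.val_succ]
    split_ifs <;> omega

lemma skip_succ (i : Fin (n + 1)) : skip i.succ = moved i.castSucc i := by
  ext l
  by_cases h : l = i
  · subst h
    rw [moved_self]
    simp
  · have h' : (l : ℕ) ≠ i := fun e => h (Fin.ext e)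
    rw [moved_of_ne _ h, Fin.coe_succAboveEmb, val_succAbove, val_succAbove, Fin.val_castSucc,
      Fin.val_succ]
    split_ifs <;> omega

/-- The expansion of `xᵢ₊₁` at `xᵢ` in terms of the expansion of `xᵢ` at `xᵢ₊₁`. -/
theorem expand_succ_eq_skewSum (i : Fin (n + 1)) (f : Gam τ (n + 2)) (k : ℤ) :
    (expand i.succ (some i) f).coeff k = skewSum (pd τ i) (expand i.castSucc (some i) f) k := by
  have hne : i.castSucc ≠ i.succ := (Fin.castSucc_lt_succ).ne
  suffices h : ∀ k, (expand i.succ (some i) f).coeff k =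
      skewSum (pd τ i) (expand i.castSucc (some i) f) k from h k
  -- Both sides are multiplicative in `f`. For functions of only one of the points, constant
  -- expansions and Taylor expansions change places; for `phi`, antisymmetry matches the oddness of
  -- ζ and the sign in `skewSum_primExp`.
  refine Gam.induction_pair τ (p := fun f => ∀ k, (expand i.succ (some i) f).coeff k =
      skewSum (pd τ i) (expand i.castSucc (some i) f) k) i.castSucc i.succ hne (skip i.castSucc) (skip i.succ)
      (fun l => mem_range_skip) (fun l => mem_range_skip) (fun g k => ?_) (fun g k => ?_) (fun k => ?_)
      (fun f g hf hg k => ?_) (fun f g hf hg k => ?_) f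
  · rw [expand_pull_skip, skip_castSucc, expand_pull_moved, skewSum_C, coeff_expSeries]
  · rw [expand_pull_skip, skip_succ, expand_pull_moved, skewSum_expSeries]
  · have h1 := expand_gPhi_some (τ := τ) i.castSucc i
    have h2 := expand_gPhi_some (τ := τ) i.succ i
    simp only [Fin.succAbove_castSucc_self, Fin.succAbove_succ_self] at h1 h2
    have h3 := congrArg (expand i.succ (some i)) (gPhi_antisymm τ _ _ hne.symm)
    rw [h3, RingHom.map_neg, h2, h1, skewSum_add, skewSum_primExp,
      skewSum_scalar (pd_algebraMap i), HahnSeries.coeff_neg, HahnSeries.coeff_add, mapL_coeff,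
      zetaSeries_odd, map_neg, neg_add]
  · rw [map_add, map_add, HahnSeries.coeff_add, skewSum_add, hf, hg]
  · rw [map_mul, map_mul]
    exact skewSum_mul (expSeries_pd_mul i) hf hg k

end SkewExpansion
end ChiralHomology
namespace ChiralHomology

/-! ### Expansions of functions of two points -/

section DoubleSeries

variable {R : Type*} [CommRing R]

/-- Iterated Laurent series. -/
abbrev LL (R : Type*) [CommRing R] : Type _ := LaurentSeries (LaurentSeries R)

/-- Triples of iterated Laurent series: expansions in the three regions `|s| < |t|`, `|t| < |s|`
and `|s - t| < |t|`, in the variables `(s, t)`, `(t, s)` and `(s - t, t)` respectively. -/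
abbrev Triple (R : Type*) [CommRing R] : Type _ := LL R × LL R × LL R

/-- The series of total degree at least `D`. -/
def Fil (R : Type*) [CommRing R] (D : ℤ) : AddSubgroup (LL R) where
  carrier := {A | ∀ m p : ℤ, m + p < D → (A.coeff m).coeff p = 0}
  add_mem' {A B} hA hB m p h := by
    rw [HahnSeries.coeff_add, HahnSeries.coeff_add, hA m p h, hB m p h, add_zero]
  zero_mem' m p _ := rfl
  neg_mem' {A} hA m p h := by
    rw [HahnSeries.coeff_neg, HahnSeries.coeff_neg, hA m p h, neg_zero]

lemma Fil.mul {D D' : ℤ} {A B : LL R} (hA : A ∈ Fil R D) (hB : B ∈ Fil R D') :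
    A * B ∈ Fil R (D + D') := by
  intro m p h
  obtain ⟨M, hM⟩ := exists_coeff_eq_zero A
  obtain ⟨N, hN⟩ := exists_coeff_eq_zero B
  rw [coeff_mul_Icc hM hN, HahnSeries.coeff_sum]
  refine Finset.sum_eq_zero fun j _ => ?_
  rw [coeff_mul_Icc (M := D - j) (N := D' - (m - j)) (fun q hq => hA j q (by omega))
    (fun q hq => hB (m - j) q (by omega)), Finset.Icc_eq_empty (by omega), Finset.sum_empty]

lemma Fil.anti {D D' : ℤ} (h : D' ≤ D) {A : LL R} (hA : A ∈ Fil R D) : A ∈ Fil R D' :=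
  fun m p h' => hA m p (by omega)

/-- The triples of total degree at least `D`. -/
def FilT (R : Type*) [CommRing R] (D : ℤ) : AddSubgroup (Triple R) :=
  (Fil R D).prod ((Fil R D).prod (Fil R D))

lemma mem_FilT {D : ℤ} {A B C : LL R} (hA : A ∈ Fil R D) (hB : B ∈ Fil R D) (hC : C ∈ Fil R D) :
    ((A, B, C) : Triple R) ∈ FilT R D := ⟨hA, hB, hC⟩

lemma FilT.mul {D D' : ℤ} {A B : Triple R} (hA : A ∈ FilT R D) (hB : B ∈ FilT R D') :
    A * B ∈ FilT R (D + D') :=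
  ⟨Fil.mul hA.1 hB.1, Fil.mul hA.2.1 hB.2.1, Fil.mul hA.2.2 hB.2.2⟩

lemma FilT.anti {D D' : ℤ} (h : D' ≤ D) {A : Triple R} (hA : A ∈ FilT R D) : A ∈ FilT R D' :=
  ⟨Fil.anti h hA.1, Fil.anti h hA.2.1, Fil.anti h hA.2.2⟩

/-- The series `(1 + ε x / y) ^ c`, where `x` is the outer and `y` the inner variable. -/
def bin (R : Type*) [CommRing R] (ε c : ℤ) : LL R :=
  HahnSeries.ofPowerSeries ℤ (LaurentSeries R)
    (PowerSeries.rescale (HahnSeries.single (-1 : ℤ) (ε : R))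
      (PowerSeries.map (Int.castRingHom (LaurentSeries R)) (PowerSeries.binomialSeries ℤ c)))

lemma bin_add (ε c c' : ℤ) : bin R ε (c + c') = bin R ε c * bin R ε c' := by
  rw [bin, PowerSeries.binomialSeries_add, map_mul, map_mul, map_mul]
  rfl

lemma single_pow_neg_one (r : R) (j : ℕ) :
    (HahnSeries.single (-1 : ℤ) r : LaurentSeries R) ^ j = HahnSeries.single (-(j : ℤ)) (r ^ j) := by
  rw [HahnSeries.single_pow]
  simp

lemma bin_coeff (ε c : ℤ) (j : ℕ) : (bin R ε c).coeff j =
    HahnSeries.single (-(j : ℤ)) ((ε ^ j * Ring.choose c j : ℤ) : R) := by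
  have e : ((Ring.choose c j : ℤ) : LaurentSeries R) =
      HahnSeries.single 0 ((Ring.choose c j : ℤ) : R) :=
    (map_intCast (HahnSeries.C : R →+* LaurentSeries R) _).symm
  rw [bin, PowerSeries.coeff_coe, if_neg (by omega), Int.natAbs_natCast, PowerSeries.coeff_rescale,
    PowerSeries.coeff_map, PowerSeries.binomialSeries_coeff, single_pow_neg_one, smul_eq_mul,
    mul_one, eq_intCast, e, HahnSeries.single_mul_single, add_zero]
  push_cast
  rfl

lemma bin_coeff_of_neg (ε c : ℤ) {m : ℤ} (hm : m < 0) : (bin R ε c).coeff m = 0 :=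
  powerSeries_coeff_of_neg _ hm

/-- The series `r xᵃ yᵇ (1 + ε x / y) ^ c`. -/
def binMon (r : R) (a b ε c : ℤ) : LL R :=
  HahnSeries.single a (HahnSeries.single b r) * bin R ε c

lemma binMon_mul (r r' : R) (a a' b b' ε c c' : ℤ) :
    binMon r a b ε c * binMon r' a' b' ε c' = binMon (r * r') (a + a') (b + b') ε (c + c') := by
  rw [binMon, binMon, binMon, bin_add, ← HahnSeries.single_mul_single,
    ← HahnSeries.single_mul_single]
  ring

lemma binMon_coeff (r : R) (a b ε c : ℤ) (j : ℕ) : (binMon r a b ε c).coeff (a + j) =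
    HahnSeries.single (b - j) (r * ((ε ^ j * Ring.choose c j : ℤ) : R)) := by
  rw [binMon, HahnSeries.coeff_single_mul, add_sub_cancel_left, bin_coeff,
    HahnSeries.single_mul_single, sub_eq_add_neg]

lemma binMon_coeff_of_lt (r : R) (a b ε c : ℤ) {m : ℤ} (hm : m < a) :
    (binMon r a b ε c).coeff m = 0 := by
  rw [binMon, HahnSeries.coeff_single_mul, bin_coeff_of_neg _ _ (by omega), mul_zero]

lemma binMon_mem_Fil (r : R) (a b ε c : ℤ) : binMon r a b ε c ∈ Fil R (a + b) := by
  intro m p h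
  rcases lt_or_ge m a with hm | hm
  · rw [binMon_coeff_of_lt _ _ _ _ _ hm, HahnSeries.coeff_zero]
  · obtain ⟨j, rfl⟩ : ∃ j : ℕ, m = a + j := ⟨(m - a).toNat, by omega⟩
    rw [binMon_coeff, HahnSeries.coeff_single_of_ne (by omega)]

/-- `(-1)ᶜ`. -/
def negOnePow (R : Type*) [CommRing R] (c : ℤ) : R := ((((-1 : ℤˣ) ^ c : ℤˣ) : ℤ) : R)

lemma negOnePow_add (c c' : ℤ) : negOnePow R (c + c') = negOnePow R c * negOnePow R c' := by
  rw [negOnePow, zpow_add]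
  push_cast
  rfl

/-- The expansions of `r sᵃ tᵇ (s - t)ᶜ`. -/
def mon (r : R) (a b c : ℤ) : Triple R :=
  -- The factors being expanded are (s - t)ᶜ = (-1)ᶜ tᶜ (1 - s/t)ᶜ, then (s - t)ᶜ = sᶜ (1 - t/s)ᶜ,
  -- and finally sᵃ = tᵃ (1 + (s - t)/t)ᵃ.
  (binMon (r * negOnePow R c) a (b + c) (-1) c, binMon r b (a + c) (-1) c, binMon r c (a + b) 1 a)

lemma mon_mul (r r' : R) (a a' b b' c c' : ℤ) :
    mon r a b c * mon r' a' b' c' = mon (r * r') (a + a') (b + b') (c + c') := by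
  simp only [mon, Prod.mk_mul_mk, binMon_mul, negOnePow_add]
  refine Prod.ext ?_ (Prod.ext ?_ ?_)
  · simp only
    congr 1 <;> ring
  · simp only
    congr 1; ring
  · simp only
    congr 1; ring

lemma mon_mem_FilT (r : R) (a b c : ℤ) : mon r a b c ∈ FilT R (a + b + c) :=
  ⟨Fil.anti (by omega) (binMon_mem_Fil _ _ _ _ _), Fil.anti (by omega) (binMon_mem_Fil _ _ _ _ _),
    Fil.anti (by omega) (binMon_mem_Fil _ _ _ _ _)⟩

/-- The expansions of the polynomials in `s`, `t`, `s - t` and their inverses. -/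
def Pol (R : Type*) [CommRing R] : AddSubgroup (Triple R) :=
  AddSubgroup.closure {E | ∃ (r : R) (a b c : ℤ), mon r a b c = E}

lemma mon_mem_Pol (r : R) (a b c : ℤ) : mon r a b c ∈ Pol R :=
  AddSubgroup.subset_closure ⟨r, a, b, c, rfl⟩

lemma Pol.mul {P Q : Triple R} (hP : P ∈ Pol R) (hQ : Q ∈ Pol R) : P * Q ∈ Pol R := by
  induction hP using AddSubgroup.closure_induction with
  | mem P hP =>
    obtain ⟨r, a, b, c, rfl⟩ := hP
    induction hQ using AddSubgroup.closure_induction with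
    | mem Q hQ =>
      obtain ⟨r', a', b', c', rfl⟩ := hQ
      rw [mon_mul]
      exact mon_mem_Pol _ _ _ _
    | zero => rw [mul_zero]; exact zero_mem _
    | add x y _ _ hx hy => rw [mul_add]; exact add_mem hx hy
    | neg x _ hx => exact (congrArg (· ∈ Pol R) (mul_neg _ x)).mpr (neg_mem hx)
  | zero => rw [zero_mul]; exact zero_mem _
  | add x y _ _ hx hy => rw [add_mul]; exact add_mem hx hy
  | neg x _ hx => exact (congrArg (· ∈ Pol R) (neg_mul x Q)).mpr (neg_mem hx)

lemma Pol.exists_mem_FilT {P : Triple R} (hP : P ∈ Pol R) : ∃ D, P ∈ FilT R D := by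
  induction hP using AddSubgroup.closure_induction with
  | mem P hP =>
    obtain ⟨r, a, b, c, rfl⟩ := hP
    exact ⟨_, mon_mem_FilT r a b c⟩
  | zero => exact ⟨0, zero_mem _⟩
  | add x y _ _ hx hy =>
    obtain ⟨D, hD⟩ := hx
    obtain ⟨D', hD'⟩ := hy
    exact ⟨min D D', add_mem (FilT.anti (min_le_left _ _) hD) (FilT.anti (min_le_right _ _) hD')⟩
  | neg x _ hx =>
    obtain ⟨D, hD⟩ := hx
    exact ⟨D, neg_mem hD⟩

/-- The closure of `Pol`: the expansions of Laurent series in `s`, `t` and `s - t`. -/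
def PolClosure (R : Type*) [CommRing R] : AddSubgroup (Triple R) where
  carrier := {E | ∀ D, ∃ P ∈ Pol R, E - P ∈ FilT R D}
  add_mem' {E E'} h h' D := by
    obtain ⟨P, hP, hD⟩ := h D
    obtain ⟨P', hP', hD'⟩ := h' D
    exact ⟨P + P', add_mem hP hP', by rw [add_sub_add_comm]; exact add_mem hD hD'⟩
  zero_mem' D := ⟨0, zero_mem _, by rw [sub_zero]; exact zero_mem _⟩
  neg_mem' {E} h D := by
    obtain ⟨P, hP, hD⟩ := h D
    exact ⟨-P, neg_mem hP, by rw [← neg_sub']; exact neg_mem hD⟩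

lemma PolClosure.exists_mem_FilT {E : Triple R} (hE : E ∈ PolClosure R) : ∃ D, E ∈ FilT R D := by
  obtain ⟨P, hP, hD⟩ := hE 0
  obtain ⟨D, hD'⟩ := Pol.exists_mem_FilT hP
  refine ⟨min D 0, ?_⟩
  rw [← sub_add_cancel E P]
  exact add_mem (FilT.anti (min_le_right _ _) hD) (FilT.anti (min_le_left _ _) hD')

/-- Multiplication is continuous for the degree filtration. The approximation of `E'` is chosen
after that of `E`, because the accuracy it needs depends on the lowest degree of `P`. -/
lemma PolClosure.mul {E E' : Triple R} (hE : E ∈ PolClosure R) (hE' : E' ∈ PolClosure R) :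
    E * E' ∈ PolClosure R := by
  intro D
  obtain ⟨M', hM'⟩ := PolClosure.exists_mem_FilT hE'
  obtain ⟨P, hP, hPD⟩ := hE (D - M')
  obtain ⟨M, hM⟩ := Pol.exists_mem_FilT hP
  obtain ⟨P', hP', hPD'⟩ := hE' (D - M)
  refine ⟨P * P', Pol.mul hP hP', ?_⟩
  have e : E * E' - P * P' = (E - P) * E' + P * (E' - P') := by ring
  rw [e]
  exact add_mem (FilT.anti (by omega) (FilT.mul hPD hM')) (FilT.anti (by omega) (FilT.mul hM hPD'))

lemma coeff_truncation (H : LaurentSeries R) {M : ℤ} (hM : ∀ m < M, H.coeff m = 0) (D : ℤ) (m : ℤ)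
    (hm : m < D) :
    (H - ∑ a ∈ Finset.Ico M D, HahnSeries.single a (H.coeff a)).coeff m = 0 := by
  rw [HahnSeries.coeff_sub, HahnSeries.coeff_sum]
  rcases lt_or_ge m M with h | h
  · rw [hM m h, Finset.sum_eq_zero, sub_zero]
    intro a ha
    have := (Finset.mem_Ico.mp ha).1
    exact HahnSeries.coeff_single_of_ne (by omega)
  · rw [Finset.sum_eq_single m, HahnSeries.coeff_single_same, sub_self]
    · exact fun b _ hb => HahnSeries.coeff_single_of_ne hb.symm
    · exact fun h' => absurd (Finset.mem_Ico.mpr ⟨h, hm⟩) h'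

/-- Cutting `H` off at degree `D` leaves a finite sum of monomials, which goes to `Pol`, and a
remainder whose image has total degree at least `D`. -/
lemma mem_PolClosure_of_hom (F : LaurentSeries R →+ Triple R)
    (h1 : ∀ a r, F (HahnSeries.single a r) ∈ Pol R)
    (h2 : ∀ D H, (∀ m < D, H.coeff m = 0) → F H ∈ FilT R D) (H : LaurentSeries R) :
    F H ∈ PolClosure R := by
  intro D
  obtain ⟨M, hM⟩ := exists_coeff_eq_zero H
  refine ⟨F (∑ a ∈ Finset.Ico M D, HahnSeries.single a (H.coeff a)), ?_, ?_⟩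
  · rw [map_sum]
    exact sum_mem fun a _ => h1 _ _
  · rw [← map_sub]
    exact h2 D _ (coeff_truncation H hM D)

/-- The series `H(y + ε x)`, expanded in the outer variable `x`. -/
def shiftL (ε : ℤ) : LaurentSeries R →+ LL R where
  toFun H := HahnSeries.ofPowerSeries ℤ (LaurentSeries R)
    (PowerSeries.mk fun j => ε ^ j • LaurentSeries.hasseDeriv R j H)
  map_zero' := by
    rw [← map_zero (HahnSeries.ofPowerSeries ℤ (LaurentSeries R))]
    congr 1
    ext j : 1
    rw [PowerSeries.coeff_mk, map_zero, smul_zero, map_zero]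
  map_add' H H' := by
    rw [← map_add]
    congr 1
    ext j : 1
    rw [map_add, PowerSeries.coeff_mk, PowerSeries.coeff_mk, PowerSeries.coeff_mk, map_add, smul_add]

lemma shiftL_coeff (ε : ℤ) (H : LaurentSeries R) (j : ℕ) :
    (shiftL ε H).coeff j = ε ^ j • LaurentSeries.hasseDeriv R j H := by
  change (HahnSeries.ofPowerSeries ℤ (LaurentSeries R) _).coeff _ = _
  rw [PowerSeries.coeff_coe, if_neg (by omega), Int.natAbs_natCast, PowerSeries.coeff_mk]

lemma shiftL_coeff_of_neg (ε : ℤ) (H : LaurentSeries R) {m : ℤ} (hm : m < 0) :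
    (shiftL ε H).coeff m = 0 :=
  powerSeries_coeff_of_neg _ hm

lemma shiftL_mem_Fil (ε : ℤ) {H : LaurentSeries R} {D : ℤ} (h : ∀ m < D, H.coeff m = 0) :
    shiftL ε H ∈ Fil R D := by
  intro m p hmp
  rcases lt_or_ge m 0 with hm | hm
  · rw [shiftL_coeff_of_neg _ _ hm, HahnSeries.coeff_zero]
  · obtain ⟨j, rfl⟩ := Int.eq_ofNat_of_zero_le hm
    rw [shiftL_coeff, HahnSeries.coeff_smul, LaurentSeries.hasseDeriv_coeff, h _ (by omega),
      smul_zero, smul_zero]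

/-- The binomial series (y + εx)ᵃ = yᵃ (1 + εx/y)ᵃ. -/
lemma shiftL_single (ε a : ℤ) (r : R) :
    shiftL ε (HahnSeries.single a r) = binMon r 0 a ε a := by
  ext m : 2
  rcases lt_or_ge m 0 with hm | hm
  · rw [shiftL_coeff_of_neg _ _ hm, binMon_coeff_of_lt _ _ _ _ _ hm]
  · obtain ⟨j, rfl⟩ := Int.eq_ofNat_of_zero_le hm
    have h := binMon_coeff r 0 a ε a j
    rw [zero_add] at h
    rw [shiftL_coeff, h, LaurentSeries.hasseDeriv_single]
    ext p
    rw [HahnSeries.coeff_smul, HahnSeries.coeff_single, HahnSeries.coeff_single]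
    split_ifs
    · rw [smul_smul, zsmul_eq_mul, mul_comm]
    · exact smul_zero _

lemma C_mem_Fil {H : LaurentSeries R} {D : ℤ} (h : ∀ m < D, H.coeff m = 0) :
    HahnSeries.C H ∈ Fil R D := by
  intro m p hmp
  rcases eq_or_ne m 0 with rfl | hm
  · rw [HahnSeries.C_apply, HahnSeries.coeff_single_same, h _ (by omega)]
  · rw [C_coeff_of_ne _ hm, HahnSeries.coeff_zero]

lemma mapL_C_mem_Fil {H : LaurentSeries R} {D : ℤ} (h : ∀ m < D, H.coeff m = 0) :
    mapL HahnSeries.C H ∈ Fil R D := by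
  intro m p hmp
  rw [mapL_coeff]
  rcases eq_or_ne p 0 with rfl | hp
  · rw [h _ (by omega), map_zero, HahnSeries.coeff_zero]
  · rw [C_coeff_of_ne _ hp]

lemma bin_zero (ε : ℤ) : bin R ε 0 = 1 := by
  rw [bin, PowerSeries.binomialSeries_zero, map_one, map_one, map_one]

lemma binMon_zero (r : R) (a b ε : ℤ) :
    binMon r a b ε 0 = HahnSeries.single a (HahnSeries.single b r) := by
  rw [binMon, bin_zero, mul_one]

/-- The expansions of the series `H(s)`. -/
def tripleS : LaurentSeries R →+ Triple R :=
  (mapL HahnSeries.C : LaurentSeries R →+* LL R).toAddMonoidHom.prod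
    ((HahnSeries.C : LaurentSeries R →+* LL R).toAddMonoidHom.prod (shiftL 1))

/-- The expansions of the series `H(t)`. -/
def tripleT : LaurentSeries R →+ Triple R :=
  (HahnSeries.C : LaurentSeries R →+* LL R).toAddMonoidHom.prod
    ((mapL HahnSeries.C : LaurentSeries R →+* LL R).toAddMonoidHom.prod
      (HahnSeries.C : LaurentSeries R →+* LL R).toAddMonoidHom)

/-- The series `H(-t)`. -/
def reflect : LaurentSeries R →+ LaurentSeries R where
  toFun H := ⟨fun m => negOnePow R m * H.coeff m, H.isPWO_support.mono fun m hm h0 => hm (by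
    change negOnePow R m * H.coeff m = 0
    rw [h0, mul_zero])⟩
  map_zero' := by ext m; exact mul_zero _
  map_add' A B := by ext m; exact mul_add _ _ _

lemma reflect_coeff (H : LaurentSeries R) (m : ℤ) :
    (reflect H).coeff m = negOnePow R m * H.coeff m := rfl

/-- The expansions of the series `H(s - t)`. -/
def tripleST : LaurentSeries R →+ Triple R :=
  -- For |s| < |t| the series has to be written in t - s, with `t` as the inner variable; hence the
  -- reflection in the first component only.
  ((shiftL (-1)).comp reflect).prod ((shiftL (-1)).prod
    (mapL HahnSeries.C : LaurentSeries R →+* LL R).toAddMonoidHom)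

lemma tripleS_apply (H : LaurentSeries R) : tripleS H =
    (mapL HahnSeries.C H, HahnSeries.C H, shiftL 1 H) := rfl

lemma tripleT_apply (H : LaurentSeries R) : tripleT H =
    (HahnSeries.C H, mapL HahnSeries.C H, HahnSeries.C H) := rfl

lemma tripleST_apply (H : LaurentSeries R) : tripleST H =
    (shiftL (-1) (reflect H), shiftL (-1) H, mapL HahnSeries.C H) := rfl

lemma mapL_C_single (a : ℤ) (r : R) (ε : ℤ) :
    mapL HahnSeries.C (HahnSeries.single a r) = binMon r a 0 ε 0 := by
  rw [binMon_zero, mapL_single, HahnSeries.C_apply]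

lemma C_single (a : ℤ) (r : R) (ε : ℤ) :
    HahnSeries.C (HahnSeries.single a r) = binMon r 0 a ε 0 := by
  rw [binMon_zero, HahnSeries.C_apply]

lemma negOnePow_zero : negOnePow R 0 = 1 := by simp [negOnePow]

lemma reflect_single (a : ℤ) (r : R) :
    reflect (HahnSeries.single a r) = HahnSeries.single a (r * negOnePow R a) := by
  ext m
  rw [reflect_coeff, HahnSeries.coeff_single, HahnSeries.coeff_single]
  split_ifs with h
  · rw [h, mul_comm]
  · exact mul_zero _

lemma tripleS_mem (H : LaurentSeries R) : tripleS H ∈ PolClosure R := by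
  refine mem_PolClosure_of_hom _ (fun a r => ?_) (fun D H h => ?_) H
  · have e : tripleS (HahnSeries.single a r) = mon r a 0 0 := by
      rw [tripleS_apply, mapL_C_single a r (-1), C_single a r (-1), shiftL_single, mon,
        negOnePow_zero, mul_one, add_zero, add_zero]
    rw [e]
    exact mon_mem_Pol _ _ _ _
  · rw [tripleS_apply]
    exact mem_FilT (mapL_C_mem_Fil h) (C_mem_Fil h) (shiftL_mem_Fil _ h)

lemma tripleT_mem (H : LaurentSeries R) : tripleT H ∈ PolClosure R := by
  refine mem_PolClosure_of_hom _ (fun a r => ?_) (fun D H h => ?_) H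
  · have e : tripleT (HahnSeries.single a r) = mon r 0 a 0 := by
      rw [tripleT_apply, mapL_C_single a r (-1), mon, negOnePow_zero, mul_one, add_zero, add_zero,
        zero_add, ← C_single a r (-1), ← C_single a r 1]
    rw [e]
    exact mon_mem_Pol _ _ _ _
  · rw [tripleT_apply]
    exact mem_FilT (C_mem_Fil h) (mapL_C_mem_Fil h) (C_mem_Fil h)

lemma tripleST_mem (H : LaurentSeries R) : tripleST H ∈ PolClosure R := by
  refine mem_PolClosure_of_hom _ (fun a r => ?_) (fun D H h => ?_) H
  · have e : tripleST (HahnSeries.single a r) = mon r 0 0 a := by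
      rw [tripleST_apply, reflect_single, shiftL_single, shiftL_single, mapL_C_single a r 1, mon,
        zero_add, add_zero]
    rw [e]
    exact mon_mem_Pol _ _ _ _
  · rw [tripleST_apply]
    refine mem_FilT (shiftL_mem_Fil _ fun m hm => ?_) (shiftL_mem_Fil _ h) (mapL_C_mem_Fil h)
    rw [reflect_coeff, h m hm, mul_zero]

end DoubleSeries
end ChiralHomology
namespace ChiralHomology

/-! ### The Borcherds identity for expansions of functions of two points -/

section Pairing

variable {R : Type*} [CommRing R] [Algebra ℂ R] {M : Type*} [AddCommGroup M] [Module ℂ M]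

/-- The sum `∑ Aₘ ⊗ v(m)`. -/
def pairL (A : LaurentSeries R) (v : ℤ → M) : R ⊗[ℂ] M := ∑ᶠ m : ℤ, A.coeff m ⊗ₜ[ℂ] v m

/-- `v(m)` is zero for all sufficiently large `m`. -/
def EventuallyZero {M : Type*} [Zero M] (v : ℤ → M) : Prop := ∃ N : ℤ, ∀ m, N ≤ m → v m = 0

lemma finite_support_of_Ico {M : Type*} [Zero M] {F : ℤ → M} {a b : ℤ} (h1 : ∀ m < a, F m = 0)
    (h2 : ∀ m, b ≤ m → F m = 0) : (Function.support F).Finite := by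
  refine (Set.finite_Ico a b).subset fun m hm => ?_
  rw [Set.mem_Ico]
  by_contra h
  rw [not_and_or, not_le, not_lt] at h
  exact hm (h.elim (h1 m) (h2 m))

lemma finite_support_pairL (A : LaurentSeries R) {v : ℤ → M} (hv : EventuallyZero v) :
    (Function.support fun m : ℤ => A.coeff m ⊗ₜ[ℂ] v m).Finite := by
  obtain ⟨a, ha⟩ := exists_coeff_eq_zero A
  obtain ⟨b, hb⟩ := hv
  refine finite_support_of_Ico (a := a) (b := b) (fun m h => ?_) (fun m h => ?_)
  · rw [ha m h, TensorProduct.zero_tmul]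
  · rw [hb m h, TensorProduct.tmul_zero]

lemma pairL_add (A B : LaurentSeries R) {v : ℤ → M} (hv : EventuallyZero v) :
    pairL (A + B) v = pairL A v + pairL B v := by
  rw [pairL, pairL, pairL, ← finsum_add_distrib (finite_support_pairL A hv) (finite_support_pairL B hv)]
  exact finsum_congr fun m => by rw [HahnSeries.coeff_add, TensorProduct.add_tmul]

lemma pairL_zero (v : ℤ → M) : pairL (0 : LaurentSeries R) v = 0 := by
  exact finsum_eq_zero_of_forall_eq_zero fun m => by
    rw [HahnSeries.coeff_zero, TensorProduct.zero_tmul]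

lemma pairL_single (q : ℤ) (r : R) (v : ℤ → M) :
    pairL (HahnSeries.single q r) v = r ⊗ₜ[ℂ] v q := by
  rw [pairL, finsum_eq_single _ q fun m hm => by
    rw [HahnSeries.coeff_single_of_ne hm, TensorProduct.zero_tmul], HahnSeries.coeff_single_same]

/-- The sum `∑ Aₘₚ ⊗ B(m, p)`. -/
def pairLL (A : LL R) (B : ℤ → ℤ → M) : R ⊗[ℂ] M := ∑ᶠ m : ℤ, pairL (A.coeff m) (B m)

/-- A condition under which `∑ Aₘₚ ⊗ B(m, p)` is a finite sum. -/
def Pairable (B : ℤ → ℤ → M) : Prop := EventuallyZero B ∧ ∀ m, EventuallyZero (B m)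

lemma finite_support_pairLL (A : LL R) {B : ℤ → ℤ → M} (hB : Pairable B) :
    (Function.support fun m : ℤ => pairL (A.coeff m) (B m)).Finite := by
  obtain ⟨a, ha⟩ := exists_coeff_eq_zero A
  obtain ⟨b, hb⟩ := hB.1
  refine finite_support_of_Ico (a := a) (b := b) (fun m h => ?_) (fun m h => ?_)
  · rw [ha m h, pairL_zero]
  · rw [hb m h]
    exact finsum_eq_zero_of_forall_eq_zero fun p => TensorProduct.tmul_zero _ _

lemma pairLL_add (A A' : LL R) {B : ℤ → ℤ → M} (hB : Pairable B) :
    pairLL (A + A') B = pairLL A B + pairLL A' B := by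
  rw [pairLL, pairLL, pairLL,
    ← finsum_add_distrib (finite_support_pairLL A hB) (finite_support_pairLL A' hB)]
  exact finsum_congr fun m => by rw [HahnSeries.coeff_add, pairL_add _ _ (hB.2 m)]

/-- The form of continuity used later: pairings with vanishing high-degree products ignore series of
high total degree. -/
lemma pairLL_eq_zero {A : LL R} {B : ℤ → ℤ → M} {D : ℤ} (hA : A ∈ Fil R D)
    (hB : ∀ m p, D ≤ m + p → B m p = 0) : pairLL A B = 0 := by
  refine finsum_eq_zero_of_forall_eq_zero fun m => finsum_eq_zero_of_forall_eq_zero fun p => ?_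
  rcases lt_or_ge (m + p) D with h | h
  · rw [hA m p h, TensorProduct.zero_tmul]
  · rw [hB m p h, TensorProduct.tmul_zero]

lemma finsum_shift {M : Type*} [AddCommMonoid M] (F : ℤ → M) (a : ℤ) (h : ∀ m < a, F m = 0) :
    ∑ᶠ m, F m = ∑ᶠ j : ℕ, F (a + j) := by
  have hinj : Function.Injective fun j : ℕ => a + (j : ℤ) := fun x y h => by
    have : (a + x : ℤ) = a + y := h
    omega
  rw [← finsum_mem_range (f := F) hinj, ← finsum_mem_univ]
  refine finsum_mem_inter_support_eq' _ _ _ fun m hm => ?_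
  simp only [Set.mem_univ, true_iff, Set.mem_range]
  exact ⟨(m - a).toNat, by have := not_lt.mp fun h' => hm (h m h'); omega⟩

lemma pairLL_binMon (r : R) (a b ε c : ℤ) (B : ℤ → ℤ → M) :
    pairLL (binMon r a b ε c) B =
      ∑ᶠ j : ℕ, (r * ((ε ^ j * Ring.choose c j : ℤ) : R)) ⊗ₜ[ℂ] B (a + j) (b - j) := by
  rw [pairLL, finsum_shift _ a fun m h => by rw [binMon_coeff_of_lt _ _ _ _ _ h, pairL_zero]]
  exact finsum_congr fun j => by rw [binMon_coeff, pairL_single]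

end Pairing

section Borcherds

variable {R : Type*} [CommRing R] [Algebra ℂ R] {V : Type*} [AddCommGroup V] [Module ℂ V]

/-- The Jacobi expression for the functions of two points with the given expansions. -/
def jacobi (R : Type*) [CommRing R] [Algebra ℂ R] (𝒱 : VertexAlgebra V) (a b c : V) (E : Triple R) :
    R ⊗[ℂ] V :=
  pairLL E.1 (fun m p => 𝒱.prod p b (𝒱.prod m a c)) -
    pairLL E.2.1 (fun m p => 𝒱.prod p a (𝒱.prod m b c)) +
    pairLL E.2.2 (fun m p => 𝒱.prod p (𝒱.prod m a b) c)

lemma pairable_left (𝒱 : VertexAlgebra V) (a b c : V) :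
    Pairable fun m p => 𝒱.prod p b (𝒱.prod m a c) := by
  refine ⟨?_, fun m => 𝒱.field_property _ _⟩
  obtain ⟨N, hN⟩ := 𝒱.field_property a c
  exact ⟨N, fun m hm => funext fun p => by simp [hN m hm]⟩

lemma pairable_right (𝒱 : VertexAlgebra V) (a b c : V) :
    Pairable fun m p => 𝒱.prod p (𝒱.prod m a b) c := by
  refine ⟨?_, fun m => 𝒱.field_property _ _⟩
  obtain ⟨N, hN⟩ := 𝒱.field_property a b
  exact ⟨N, fun m hm => funext fun p => by simp [hN m hm]⟩

lemma jacobi_add (𝒱 : VertexAlgebra V) (a b c : V) (E E' : Triple R) :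
    jacobi R 𝒱 a b c (E + E') = jacobi R 𝒱 a b c E + jacobi R 𝒱 a b c E' := by
  rw [jacobi, jacobi, jacobi, Prod.fst_add, Prod.snd_add, Prod.fst_add, Prod.snd_add,
    pairLL_add _ _ (pairable_left 𝒱 a b c), pairLL_add _ _ (pairable_left 𝒱 b a c),
    pairLL_add _ _ (pairable_right 𝒱 a b c)]
  abel

/-- The Jacobi expression as a homomorphism. -/
def jacobiHom (R : Type*) [CommRing R] [Algebra ℂ R] (𝒱 : VertexAlgebra V) (a b c : V) :
    Triple R →+ R ⊗[ℂ] V :=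
  AddMonoidHom.mk' (jacobi R 𝒱 a b c) (jacobi_add 𝒱 a b c)

lemma negOnePow_eq (k : ℤ) : negOnePow R k = algebraMap ℂ R ((-1 : ℂ) ^ k) := by
  rcases Int.even_or_odd k with h | h
  · rw [negOnePow, h.neg_one_zpow, h.neg_one_zpow]
    simp
  · rw [negOnePow, h.neg_one_zpow, h.neg_one_zpow]
    simp

/-- For the function sᵐ tᵏ (s - t)ⁿ the coefficients of the three binomial expansions are exactly
those in the Borcherds identity, here tensored with `r`. All sums involved are finite, so the tensor
product may be moved inside. -/
lemma jacobi_mon (𝒱 : VertexAlgebra V) (a b c : V) (r : R) (m k n : ℤ) :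
    jacobi R 𝒱 a b c (mon r m k n) = 0 := by
  have hfin : ∀ {F : ℕ → R ⊗[ℂ] V} {N : ℤ}, (∀ j : ℕ, N ≤ j → F j = 0) →
      (Function.support F).Finite := by
    intro F N h
    refine (Set.finite_Iio N.toNat).subset fun j hj => ?_
    rw [Set.mem_Iio]
    by_contra h'
    exact hj (h j (by omega))
  have hfin' : ∀ {F : ℕ → V} {N : ℤ}, (∀ j : ℕ, N ≤ j → F j = 0) →
      (Function.support F).Finite := by
    intro F N h
    refine (Set.finite_Iio N.toNat).subset fun j hj => ?_
    rw [Set.mem_Iio]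
    by_contra h'
    exact hj (h j (by omega))
  obtain ⟨N1, hN1⟩ := 𝒱.field_property a c
  obtain ⟨N2, hN2⟩ := 𝒱.field_property b c
  obtain ⟨N3, hN3⟩ := 𝒱.field_property a b
  have hB := 𝒱.borcherds a b c m n k
  have hr := congrArg (fun v => r ⊗ₜ[ℂ] v) hB
  have push : ∀ {F : ℕ → V}, (Function.support F).Finite →
      r ⊗ₜ[ℂ] (∑ᶠ j, F j) = ∑ᶠ j, r ⊗ₜ[ℂ] F j := fun {F} h =>
    (TensorProduct.mk ℂ R V r).toAddMonoidHom.map_finsum h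
  rw [push (hfin' (N := N3 - n) fun j hj => by
      rw [hN3 _ (by omega), map_zero, LinearMap.zero_apply, smul_zero]),
    push (hfin' (N := max (N2 - k) (N1 - m)) fun j hj => by
      rw [hN2 _ (by omega), hN1 _ (by omega), map_zero, map_zero, smul_zero, sub_zero, smul_zero])]
    at hr
  rw [jacobi, mon, pairLL_binMon, pairLL_binMon, pairLL_binMon]
  have f1 : (Function.support fun j : ℕ => (r * negOnePow R n * (((-1) ^ j * Ring.choose n j : ℤ) : R))
      ⊗ₜ[ℂ] 𝒱.prod (k + n - j) b (𝒱.prod (m + j) a c)).Finite :=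
    hfin (N := N1 - m) fun j hj => by rw [hN1 _ (by omega), map_zero, TensorProduct.tmul_zero]
  have f2 : (Function.support fun j : ℕ => (r * (((-1) ^ j * Ring.choose n j : ℤ) : R))
      ⊗ₜ[ℂ] 𝒱.prod (m + n - j) a (𝒱.prod (k + j) b c)).Finite :=
    hfin (N := N2 - k) fun j hj => by rw [hN2 _ (by omega), map_zero, TensorProduct.tmul_zero]
  rw [← finsum_sub_distrib f1 f2, ← neg_eq_iff_add_eq_zero, ← finsum_neg_distrib]
  have e1 : ∀ (r : R) (z : ℤ) (v : V), (r * (z : R)) ⊗ₜ[ℂ] v = r ⊗ₜ[ℂ] (z • v) := by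
    intro r z v
    rw [← zsmul_eq_mul', ← TensorProduct.smul_tmul]
  refine ((finsum_congr fun j => ?_).trans hr.symm).trans (finsum_congr fun j => ?_)
  · have e2 : ∀ v : V, (r * negOnePow R n * (((-1) ^ j * Ring.choose n j : ℤ) : R)) ⊗ₜ[ℂ] v =
        r ⊗ₜ[ℂ] (((-1) ^ j * Ring.choose n j : ℤ) • (-1 : ℂ) ^ n • v) := by
      intro v
      rw [e1, negOnePow_eq, mul_comm, ← Algebra.smul_def, TensorProduct.smul_tmul, smul_comm]
    rw [e2, e1 r, ← TensorProduct.tmul_sub, ← smul_sub, ← TensorProduct.tmul_neg, ← smul_neg, neg_sub,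
      add_comm m n, add_comm k n]
  · rw [e1, one_pow, one_mul]

/-- `b_(p) (a_(m) c)` and `(a_(m) b)_(p) c` are zero if `m + p` is large. -/
def DegreeBounded (𝒱 : VertexAlgebra V) (a b c : V) : Prop :=
  ∃ D : ℤ, ∀ m p, D ≤ m + p → 𝒱.prod p b (𝒱.prod m a c) = 0 ∧
    𝒱.prod p (𝒱.prod m a b) c = 0

lemma GradedVertexAlgebra.induction (𝒱 : GradedVertexAlgebra V) {P : V → Prop}
    (h : ∀ p, ∀ a ∈ 𝒱.deg p, P a) (h0 : P 0) (hadd : ∀ a b, P a → P b → P (a + b)) (a : V) : P a :=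
  Submodule.iSup_induction 𝒱.deg (motive := P)
    (𝒱.isInternal.submodule_iSup_eq_top ▸ Submodule.mem_top : a ∈ ⨆ p, 𝒱.deg p) h h0 hadd

lemma prod_prod_eq_zero (𝒱 : GradedVertexAlgebra V) {x y z : ℕ} {a b c : V} (ha : a ∈ 𝒱.deg x)
    (hb : b ∈ 𝒱.deg y) (hc : c ∈ 𝒱.deg z) (m p : ℤ) (h : (x : ℤ) + y + z - 1 ≤ m + p) :
    𝒱.prod p b (𝒱.prod m a c) = 0 ∧ 𝒱.prod p (𝒱.prod m a b) c = 0 := by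
  constructor
  · rcases lt_or_ge ((x : ℤ) + z - m - 1) 0 with h1 | h1
    · rw [𝒱.prod_eq_zero x z m a c ha hc h1, map_zero]
    · obtain ⟨q, hq⟩ := Int.eq_ofNat_of_zero_le h1
      exact 𝒱.prod_eq_zero y q p b _ hb (𝒱.prod_mem x z q m a c ha hc hq.symm) (by omega)
  · rcases lt_or_ge ((x : ℤ) + y - m - 1) 0 with h1 | h1
    · rw [𝒱.prod_eq_zero x y m a b ha hb h1, map_zero, LinearMap.zero_apply]
    · obtain ⟨q, hq⟩ := Int.eq_ofNat_of_zero_le h1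
      exact 𝒱.prod_eq_zero q z p _ c (𝒱.prod_mem x y q m a b ha hb hq.symm) hc (by omega)

/-- The grading enters here. For homogeneous elements the iterated products have degree equal to the
sum of the three degrees minus m + p + 2, which is negative once m + p is large. Unlike the field
property, this bounds the sum m + p alone; it extends to all elements by additivity in each
argument. -/
lemma degreeBounded (𝒱 : GradedVertexAlgebra V) (a b c : V) :
    DegreeBounded 𝒱.toVertexAlgebra a b c := by
  have comb : ∀ {P P' Q : ℤ → ℤ → Prop}, (∃ D : ℤ, ∀ m p, D ≤ m + p → P m p) →
      (∃ D : ℤ, ∀ m p, D ≤ m + p → P' m p) → (∀ m p, P m p → P' m p → Q m p) →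
      ∃ D : ℤ, ∀ m p, D ≤ m + p → Q m p := by
    rintro P P' Q ⟨D, hD⟩ ⟨D', hD'⟩ h
    exact ⟨max D D', fun m p hmp => h m p (hD m p (by omega)) (hD' m p (by omega))⟩
  induction a using 𝒱.induction with
  | h0 => exact ⟨0, fun m p _ => by simp⟩
  | hadd a a' h h' =>
    refine comb h h' fun m p h1 h2 => ?_
    simp only [map_add, LinearMap.add_apply, h1.1, h1.2, h2.1, h2.2, add_zero, and_self]
  | h x a ha =>
    induction b using 𝒱.induction with
    | h0 => exact ⟨0, fun m p _ => by simp⟩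
    | hadd a a' h h' =>
      refine comb h h' fun m p h1 h2 => ?_
      simp only [map_add, LinearMap.add_apply, h1.1, h1.2, h2.1, h2.2, add_zero, and_self]
    | h y b hb =>
      induction c using 𝒱.induction with
      | h0 => exact ⟨0, fun m p _ => by simp⟩
      | hadd a a' h h' =>
        refine comb h h' fun m p h1 h2 => ?_
        simp only [map_add, h1.1, h1.2, h2.1, h2.2, add_zero, and_self]
      | h z c hc => exact ⟨_, fun m p h => prod_prod_eq_zero 𝒱 ha hb hc m p h⟩

/-- The Jacobi identity for functions of two points. -/
theorem jacobi_eq_zero (𝒱 : GradedVertexAlgebra V) (a b c : V) {E : Triple R}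
    (hE : E ∈ PolClosure R) : jacobi R 𝒱.toVertexAlgebra a b c E = 0 := by
  obtain ⟨D, hD⟩ := degreeBounded 𝒱 a b c
  obtain ⟨D', hD'⟩ := degreeBounded 𝒱 b a c
  -- Products of total index at least `max D D'` vanish, where `D'` serves the middle term with `a`
  -- and `b` exchanged. So the Jacobi expression does not see the error of the approximation, and
  -- for `P` the claim follows from monomials.
  obtain ⟨P, hP, hPD⟩ := hE (max D D')
  have h1 : jacobi R 𝒱.toVertexAlgebra a b c (E - P) = 0 := by
    rw [jacobi, pairLL_eq_zero hPD.1 fun m p h => (hD m p (by omega)).1,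
      pairLL_eq_zero hPD.2.1 fun m p h => (hD' m p (by omega)).1,
      pairLL_eq_zero hPD.2.2 fun m p h => (hD m p (by omega)).2, sub_zero, add_zero]
  have h2 : jacobiHom R 𝒱.toVertexAlgebra a b c P = 0 := by
    clear hPD h1
    induction hP using AddSubgroup.closure_induction with
    | mem P hP =>
      obtain ⟨r, m, k, n, rfl⟩ := hP
      exact jacobi_mon 𝒱.toVertexAlgebra a b c r m k n
    | zero => exact map_zero _
    | add x y _ _ hx hy => rw [map_add, hx, hy, add_zero]
    | neg x _ hx => rw [map_neg, hx, neg_zero]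
  rw [← sub_add_cancel E P, jacobi_add, h1, zero_add]
  exact h2

end Borcherds
end ChiralHomology
namespace ChiralHomology

/-! ### Iterated expansions of regular functions -/

section IteratedExpansions

variable {τ : ℍ} {n : ℕ}

/-- Two of `n + 2` indices: `i` and `k`, where `k` is the `k'`-th index different from `i`, and `i`
is the `i'`-th index different from `k`. -/
structure TwoPoints (n : ℕ) where
  i : Fin (n + 2)
  k : Fin (n + 2)
  i' : Fin (n + 1)
  k' : Fin (n + 1)
  hk : i.succAbove k' = k
  hi : k.succAbove i' = i
  comm : ∀ a, i.succAbove (k'.succAbove a) = k.succAbove (i'.succAbove a)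

namespace TwoPoints

variable (P : TwoPoints n)

/-- The same points in the other order. -/
def swap : TwoPoints n := ⟨P.k, P.i, P.k', P.i', P.hi, P.hk, fun a => (P.comm a).symm⟩

lemma ne : P.i ≠ P.k := by
  rw [← P.hk]
  exact Fin.ne_succAbove _ _

/-- The embedding which sends `i'` to `k'` and the other indices to the ones different from `k'`. -/
def transfer : Fin (n + 1) ↪ Fin (n + 1) where
  toFun := P.i'.insertNth (α := fun _ => Fin (n + 1)) P.k' P.k'.succAbove
  inj' a b h := by
    rcases Fin.eq_self_or_eq_succAbove P.i' a with rfl | ⟨a, rfl⟩ <;>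
      rcases Fin.eq_self_or_eq_succAbove P.i' b with rfl | ⟨b, rfl⟩
    · rfl
    · simp only [Fin.insertNth_apply_same, Fin.insertNth_apply_succAbove] at h
      exact absurd h (Fin.ne_succAbove _ _)
    · simp only [Fin.insertNth_apply_same, Fin.insertNth_apply_succAbove] at h
      exact absurd h (Fin.succAbove_ne _ _)
    · simp only [Fin.insertNth_apply_succAbove] at h
      rw [Fin.succAbove_right_injective h]

lemma transfer_self : P.transfer P.i' = P.k' := Fin.insertNth_apply_same (α := fun _ => Fin (n + 1)) _ _ _

lemma transfer_succAbove (a : Fin n) : P.transfer (P.i'.succAbove a) = P.k'.succAbove a :=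
  Fin.insertNth_apply_succAbove (α := fun _ => Fin (n + 1)) _ _ _ _

/-- Writes a function that does not involve `xₖ` in the form to which Taylor's formula for `xᵢ` at
`xₖ` applies. -/
lemma skip_eq : skip P.k = P.transfer.trans (moved P.i P.k') := by
  ext a
  rcases Fin.eq_self_or_eq_succAbove P.i' a with rfl | ⟨a, rfl⟩
  · rw [Function.Embedding.trans_apply, transfer_self, moved_self, Fin.coe_succAboveEmb, P.hi]
  · rw [Function.Embedding.trans_apply, transfer_succAbove,
      moved_of_ne _ (Fin.succAbove_ne _ _), Fin.coe_succAboveEmb, P.comm]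

end TwoPoints

lemma expand_pd_pow (i : Fin (n + 1)) (s : Option (Fin n)) (j : ℕ) (f : Gam τ (n + 1)) :
    expand i s ((pd τ i ^ j) f) = (LaurentSeries.derivative ℂ)^[j] (expand i s f) := by
  induction j with
  | zero => rfl
  | succ j ih =>
    rw [Function.iterate_succ_apply', pow_succ', Module.End.mul_apply, expand_pd_self, ih,
      LaurentSeries.derivative_apply]

lemma inv_factorial_smul_smul {M : Type*} [AddCommGroup M] [Module ℂ M] (j : ℕ) (x : M) :
    (j.factorial : ℂ)⁻¹ • (j.factorial • x) = x := by
  rw [← Nat.cast_smul_eq_nsmul ℂ, smul_smul, inv_mul_cancel₀, one_smul]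
  exact_mod_cast j.factorial_ne_zero

lemma hasseDeriv_eq {R : Type*} [CommRing R] [Algebra ℂ R] (j : ℕ) (A : LaurentSeries R) :
    LaurentSeries.hasseDeriv ℂ j A = LaurentSeries.hasseDeriv R j A := by
  ext p
  rw [LaurentSeries.hasseDeriv_coeff, LaurentSeries.hasseDeriv_coeff]

lemma inv_factorial_smul_derivative {R : Type*} [CommRing R] [Algebra ℂ R] (j : ℕ)
    (A : LaurentSeries R) (p : ℤ) :
    (j.factorial : ℂ)⁻¹ • ((LaurentSeries.derivative ℂ)^[j] A).coeff p =
      (LaurentSeries.hasseDeriv R j A).coeff p := by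
  rw [LaurentSeries.derivative_iterate, HahnSeries.coeff_smul, inv_factorial_smul_smul,
    hasseDeriv_eq]

lemma expand_gU_some (i : Fin (n + 1)) (k : Fin n) :
    expand i (some k) (gU τ i) = (expSeries (pd τ k) (gU τ k) : LaurentSeries (Gam τ n)) := by
  have h := expand_pull_moved i k (gU τ k)
  rwa [pull_gU, moved_self] at h

/-- A primitive of the expansion of `℘(xᵢ)`. -/
def omegaSeries (τ : ℍ) : Option (Fin n) → LaurentSeries (Gam τ n)
  | none => -mapL (scal τ n) (zetaSeries τ)
  | some k => (primExp (pd τ k) (gU τ k) : LaurentSeries (Gam τ n))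

lemma derivative_omegaSeries (i : Fin (n + 1)) (s : Option (Fin n)) :
    LaurentSeries.derivative ℂ (omegaSeries τ s) = expand i s (gU τ i) := by
  rw [LaurentSeries.derivative_apply]
  rcases s with _ | k
  · rw [omegaSeries, LinearMap.map_neg, hasseDeriv_zetaSeries, neg_neg, expand_gU_none]
  · rw [omegaSeries, hasseDeriv_one_primExp, expand_gU_some]

/-- Expansion intertwines `∂ᵢ` with the derivative of series, and `omegaSeries` is a primitive of
the expansion of ℘, so ∂ʲ⁻¹℘/j! becomes its j-th Taylor coefficient. For `j = 0` this fails, since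
`primExp` has constant term zero. -/
lemma expand_primExp_coeff (i : Fin (n + 1)) (s : Option (Fin n)) {j : ℕ} (hj : j ≠ 0) (p : ℤ) :
    (expand i s (PowerSeries.coeff j (primExp (pd τ i) (gU τ i)))).coeff p =
      (LaurentSeries.hasseDeriv (Gam τ n) j (omegaSeries τ s)).coeff p := by
  obtain ⟨j, rfl⟩ := Nat.exists_eq_succ_of_ne_zero hj
  rw [primExp, PowerSeries.coeff_mk, if_neg hj, expand_smul_coeff, Nat.succ_sub_one,
    expand_pd_pow, ← derivative_omegaSeries i s, ← Function.iterate_succ_apply,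
    inv_factorial_smul_derivative]

lemma LL.ext {R : Type*} [CommRing R] {A B : LL R} (h : ∀ m < 0, A.coeff m = B.coeff m)
    (h' : ∀ (j : ℕ) (p : ℤ), (A.coeff j).coeff p = (B.coeff j).coeff p) : A = B := by
  refine HahnSeries.ext (funext fun m => ?_)
  rcases lt_or_ge m 0 with hm | hm
  · exact h m hm
  · obtain ⟨j, rfl⟩ := Int.eq_ofNat_of_zero_le hm
    exact HahnSeries.ext (funext fun p => h' j p)

lemma reflect_zetaSeries :
    reflect (mapL (scal τ n) (zetaSeries τ)) = -mapL (scal τ n) (zetaSeries τ) := by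
  refine HahnSeries.ext (funext fun m => ?_)
  rw [reflect_coeff, negOnePow_eq, mapL_coeff, HahnSeries.coeff_neg, mapL_coeff, ← map_mul,
    zetaSeries_odd, map_neg]

namespace TwoPoints

variable (P : TwoPoints n) (l : Option (Fin n))

/-- The expansion of `xᵢ` at the centre given by `l` and then of `xₖ` at the one given by `l'`. -/
def expandFree (l l' : Option (Fin n)) : Gam τ (n + 2) →+* LL (Gam τ n) :=
  (mapL (expand P.k' l')).comp (expand P.i (l.map P.k'.succAbove))

/-- The expansion of `xᵢ` at `xₖ` and then of `xₖ` at the centre given by `l`. -/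
def expandNested : Gam τ (n + 2) →+* LL (Gam τ n) :=
  (mapL (expand P.k' l)).comp (expand P.i (some P.k'))

lemma mapL_expand_pull_skip (i : Fin (n + 1)) (s : Option (Fin n)) (A : LaurentSeries (Gam τ n)) :
    mapL (expand i s) (mapL (pull τ (skip i) : Gam τ n →+* Gam τ (n + 1)) A) =
      mapL HahnSeries.C A := by
  refine HahnSeries.ext (funext fun m => ?_)
  exact expand_pull_skip i s _

lemma expandFree_skip_i (l' : Option (Fin n)) (g : Gam τ (n + 1)) :
    P.expandFree l l' (pull τ (skip P.i) g) = HahnSeries.C (expand P.k' l' g) := by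
  rw [expandFree, RingHom.comp_apply, expand_pull_skip, mapL_C]

lemma expandFree_skip_k (l' : Option (Fin n)) (h : Gam τ (n + 1)) :
    P.expandFree l l' (pull τ (skip P.k) h) = mapL HahnSeries.C (expand P.i' l h) := by
  have e := expand_pull (τ := τ) (ι := skip P.k) (ι' := skip P.k') P.hi
    (fun a => (P.comm a).symm) l h
  rw [expandFree, RingHom.comp_apply]
  exact (congrArg _ e).trans (mapL_expand_pull_skip _ _ _)

lemma expandNested_skip_i (g : Gam τ (n + 1)) :
    P.expandNested l (pull τ (skip P.i) g) = HahnSeries.C (expand P.k' l g) := by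
  rw [expandNested, RingHom.comp_apply, expand_pull_skip, mapL_C]

/-- With xᵢ = xₖ + u, Taylor's formula in `u` followed by the expansion H of the coefficients in `t`
gives H(t + u). -/
lemma expandNested_skip_k (h : Gam τ (n + 1)) :
    P.expandNested l (pull τ (skip P.k) h) = shiftL 1 (expand P.i' l h) := by
  have e : expand P.k' l (pull τ P.transfer h) = expand P.i' l h := by
    have := expand_pull (τ := τ) (ι := P.transfer) (ι' := Function.Embedding.refl _)
      P.transfer_self (fun a => P.transfer_succAbove a) l h
    rw [show l.map (Function.Embedding.refl (Fin n)) = l by cases l <;> rfl] at this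
    exact this
  rw [P.skip_eq, ← pull_pull, expandNested, RingHom.comp_apply, expand_pull_moved]
  refine LL.ext (fun m hm => ?_) (fun j p => ?_)
  · rw [shiftL_coeff_of_neg _ _ hm, mapL_coeff, powerSeries_coeff_of_neg _ hm, map_zero]
  · rw [shiftL_coeff, one_pow, one_smul, mapL_coeff, PowerSeries.coeff_coe, if_neg (by omega),
      Int.natAbs_natCast, expSeries, PowerSeries.coeff_mk, expand_smul_coeff, expand_pd_pow,
      inv_factorial_smul_derivative, e]

lemma mapL_expand_scal (i : Fin (n + 1)) (s : Option (Fin n)) (A : LaurentSeries ℂ) :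
    mapL (expand i s) (mapL (scal τ (n + 1)) A) = mapL HahnSeries.C (mapL (scal τ n) A) := by
  refine HahnSeries.ext (funext fun m => ?_)
  exact expand_scalar i s _

/-- Around the diagonal `phi` is ζ(u) plus the Taylor series, without its constant term, of a
primitive of ℘ at `xₖ`. Expanded further this is ζ(u) + ω(t + u) - ω(t), in which the choice of the
primitive cancels. -/
lemma expandNested_gPhi :
    P.expandNested l (gPhi τ P.i P.k P.ne) = mapL HahnSeries.C (mapL (scal τ n) (zetaSeries τ)) +
      shiftL 1 (omegaSeries τ l) - HahnSeries.C (omegaSeries τ l) := by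
  have e := expand_gPhi_some (τ := τ) P.i P.k'
  simp only [P.hk] at e
  rw [expandNested, RingHom.comp_apply, e, RingHom.map_add, mapL_expand_scal, add_sub_assoc]
  congr 1
  refine LL.ext (fun m hm => ?_) (fun j p => ?_)
  · rw [HahnSeries.coeff_sub, shiftL_coeff_of_neg _ _ hm, mapL_coeff,
      powerSeries_coeff_of_neg _ hm, map_zero, C_coeff_of_ne _ hm.ne, sub_zero]
  · rw [mapL_coeff, PowerSeries.coeff_coe, if_neg (by omega), Int.natAbs_natCast,
      HahnSeries.coeff_sub, shiftL_coeff, one_pow, one_smul]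
    rcases Nat.eq_zero_or_pos j with rfl | hj
    · rw [primExp, PowerSeries.coeff_mk, if_pos rfl, map_zero, LaurentSeries.hasseDeriv_zero]
      simp
    · rw [expand_primExp_coeff _ _ hj.ne', C_coeff_of_ne _ (by omega), sub_zero]

lemma mapD_neg {R : Type*} [CommRing R] [Algebra ℂ R] (D : R →ₗ[ℂ] R) (A : LaurentSeries R) :
    mapD D (-A) = -mapD D A :=
  HahnSeries.ext (funext fun _ => map_neg D _)

lemma mapD_zsmul {R : Type*} [CommRing R] [Algebra ℂ R] (D : R →ₗ[ℂ] R) (z : ℤ)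
    (A : LaurentSeries R) : mapD D (z • A) = z • mapD D A :=
  HahnSeries.ext (funext fun _ => map_zsmul D _ _)

lemma mapD_derivative_iterate {R : Type*} [CommRing R] [Algebra ℂ R] (D : R →ₗ[ℂ] R) (j : ℕ)
    (A : LaurentSeries R) : mapD D ((LaurentSeries.derivative ℂ)^[j] A) =
      (LaurentSeries.derivative ℂ)^[j] (mapD D A) := by
  induction j with
  | zero => rfl
  | succ j ih =>
    rw [Function.iterate_succ_apply', Function.iterate_succ_apply', ← ih]
    refine HahnSeries.ext (funext fun m => ?_)
    rw [mapD_coeff, LaurentSeries.derivative_apply, LaurentSeries.derivative_apply,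
      hasseDeriv_coeff_one, hasseDeriv_coeff_one, map_zsmul, mapD_coeff]

lemma hasseDeriv_one_C {R : Type*} [CommRing R] [Algebra ℂ R] (r : R) :
    LaurentSeries.hasseDeriv ℂ 1 (HahnSeries.C r : LaurentSeries R) = 0 := by
  refine HahnSeries.ext (funext fun m => ?_)
  rw [hasseDeriv_coeff_one, HahnSeries.coeff_zero]
  by_cases h : m + 1 = 0
  · rw [h, zero_smul]
  · rw [C_coeff_of_ne _ h, smul_zero]

/-- Moving the centre with `xₖ` fixed also changes the coordinate t = xₖ - c; the second term
accounts for that. -/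
lemma expand_pd_gPhi (k : Fin (n + 1)) (l : Fin n) (f : Gam τ (n + 1)) :
    expand k (some l) (pd τ (k.succAbove l) f) =
      mapD (pd τ l) (expand k (some l) f) - LaurentSeries.hasseDeriv ℂ 1 (expand k (some l) f) := by
  rw [← expand_pdCenter, ← expand_pd_self, ← map_sub, pdCenter, if_pos rfl, add_sub_cancel_right]

/-- On ζ(t) every step is -d/dt. On `primExp` the first step gives (exp(t∂)g - g) - exp(t∂)g = -g
with g = ℘, a series constant in t, and after that only its coefficient is differentiated. -/
lemma expand_pd_pow_gPhi (k : Fin (n + 1)) (l : Fin n) (j : ℕ) :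
    expand k (some l) ((pd τ (k.succAbove l) ^ j)
        (gPhi τ k (k.succAbove l) (Fin.ne_succAbove k l))) =
      (-1 : ℤ) ^ j • (LaurentSeries.derivative ℂ)^[j] (mapL (scal τ n) (zetaSeries τ)) +
        if j = 0 then (omegaSeries τ (some l)) else
          -HahnSeries.C ((pd τ l ^ (j - 1)) (gU τ l)) := by
  induction j with
  | zero =>
    rw [pow_zero (-1 : ℤ), one_smul ℤ, if_pos rfl]
    exact expand_gPhi_some k l
  | succ j ih =>
    have hZ : mapD (pd τ l) ((-1 : ℤ) ^ j • (LaurentSeries.derivative ℂ)^[j]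
        (mapL (scal τ n) (zetaSeries τ))) = 0 := by
      rw [mapD_zsmul, mapD_derivative_iterate, mapD_scal, iterate_map_zero, smul_zero]
    have hZ' : LaurentSeries.hasseDeriv ℂ 1 ((-1 : ℤ) ^ j • (LaurentSeries.derivative ℂ)^[j]
        (mapL (scal τ n) (zetaSeries τ))) = -((-1 : ℤ) ^ (j + 1) •
          (LaurentSeries.derivative ℂ)^[j + 1] (mapL (scal τ n) (zetaSeries τ))) := by
      rw [map_zsmul, Function.iterate_succ_apply', ← LaurentSeries.derivative_apply, pow_succ,
        mul_neg_one, neg_smul, neg_neg]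
    rw [pow_succ', Module.End.mul_apply, expand_pd_gPhi, ih, mapD_add, LinearMap.map_add, hZ, hZ',
      if_neg j.succ_ne_zero, Nat.add_sub_cancel, zero_add, sub_add_eq_sub_sub, sub_neg_eq_add,
      add_comm (_ : LaurentSeries (Gam τ n)) ((-1 : ℤ) ^ (j + 1) • _), add_sub_assoc]
    congr 1
    rcases Nat.eq_zero_or_pos j with rfl | hj
    · rw [if_pos rfl, omegaSeries, mapD_primExp, hasseDeriv_one_primExp, pow_zero]
      exact sub_sub_cancel_left _ _
    · obtain ⟨j, rfl⟩ := Nat.exists_eq_succ_of_ne_zero hj.ne'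
      rw [if_neg j.succ_ne_zero, mapD_neg, mapD_C, LinearMap.map_neg, hasseDeriv_one_C,
        Nat.succ_sub_one, pow_succ', Module.End.mul_apply, neg_zero, sub_zero]

lemma shiftL_neg_one_reflect_zetaSeries_coeff (j : ℕ) (p : ℤ) :
    ((shiftL (-1) (reflect (mapL (scal τ n) (zetaSeries τ)))).coeff j).coeff p =
      -((-1 : ℤ) ^ j • (LaurentSeries.hasseDeriv (Gam τ n) j
        (mapL (scal τ n) (zetaSeries τ))).coeff p) := by
  rw [reflect_zetaSeries, shiftL_coeff, LinearMap.map_neg, smul_neg, HahnSeries.coeff_neg,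
    HahnSeries.coeff_smul]

/-- The coefficients ∂ʲ⁻¹℘(xₖ)/j! of the first expansion turn into Taylor coefficients of -ζ, so
that they sum to the expansion of ζ(s - t) for |s| < |t|. The constant term of that expansion is
compensated by the last summand. -/
lemma expandFree_self_gPhi_none :
    P.expandFree none none (gPhi τ P.i P.k P.ne) =
      shiftL (-1) (reflect (mapL (scal τ n) (zetaSeries τ))) +
      mapL HahnSeries.C (omegaSeries τ none) - HahnSeries.C (omegaSeries τ none) := by
  have e := expand_gPhi_none (τ := τ) P.i P.k'
  simp only [P.hk] at e
  rw [expandFree, RingHom.comp_apply, Option.map_none, e, RingHom.map_add, RingHom.map_neg,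
    mapL_expand_scal, add_comm, add_sub_right_comm, omegaSeries, RingHom.map_neg, RingHom.map_neg]
  congr 1
  refine LL.ext (fun m hm => ?_) (fun j p => ?_)
  · rw [HahnSeries.coeff_sub, shiftL_coeff_of_neg _ _ hm, mapL_coeff,
      powerSeries_coeff_of_neg _ hm, map_zero, HahnSeries.coeff_neg, C_coeff_of_ne _ hm.ne, neg_zero,
      sub_zero]
  · rw [HahnSeries.coeff_sub, HahnSeries.coeff_sub, shiftL_neg_one_reflect_zetaSeries_coeff,
      mapL_coeff, PowerSeries.coeff_coe, if_neg (by omega), Int.natAbs_natCast,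
      negT, PowerSeries.coeff_rescale]
    rcases Nat.eq_zero_or_pos j with rfl | hj
    · rw [primExp, PowerSeries.coeff_mk, if_pos rfl, mul_zero, map_zero,
        LaurentSeries.hasseDeriv_zero]
      simp
    · rw [HahnSeries.coeff_neg, C_coeff_of_ne _ (by omega), neg_zero, HahnSeries.coeff_zero,
        sub_zero, ← smul_neg, ← HahnSeries.coeff_neg, ← LinearMap.map_neg]
      have h := expand_primExp_coeff P.k' (none : Option (Fin n)) (τ := τ) hj.ne' p
      rw [omegaSeries] at h
      rw [← h]
      have e1 : ∀ c : Gam τ (n + 1), (-1) ^ j * c = (-1 : ℂ) ^ j • c := fun c => by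
        rw [Algebra.smul_def, map_pow, map_neg, map_one]
      rw [e1, expand_smul_coeff, ← Int.cast_smul_eq_zsmul ℂ, Int.cast_pow, Int.cast_neg,
        Int.cast_one]

/-- By antisymmetry `phi xᵢ xₖ` is obtained from minus `phi xₖ xₗ` by putting `xᵢ` in place of the
centre `xₗ`. Taylor's formula in `xᵢ` thus reduces the claim to expansions of the iterated
derivatives of `phi` in its centre. -/
lemma expandFree_self_gPhi_some (l : Fin n) :
    P.expandFree (some l) (some l) (gPhi τ P.i P.k P.ne) =
      shiftL (-1) (reflect (mapL (scal τ n) (zetaSeries τ))) +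
      mapL HahnSeries.C (omegaSeries τ (some l)) - HahnSeries.C (omegaSeries τ (some l)) := by
  have e0 : gPhi τ P.i P.k P.ne = pull τ (moved P.i (P.k'.succAbove l))
      (-gPhi τ P.k' (P.k'.succAbove l) (Fin.ne_succAbove _ _)) := by
    rw [← gPhi_antisymm, pull_gPhi]
    simp only [moved_self, moved_of_ne _ (Fin.ne_succAbove P.k' l), P.hk]
  rw [e0, expandFree, RingHom.comp_apply, Option.map_some, expand_pull_moved]
  refine LL.ext (fun m hm => ?_) (fun j p => ?_)
  · rw [HahnSeries.coeff_sub, HahnSeries.coeff_add, shiftL_coeff_of_neg _ _ hm, mapL_coeff,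
      powerSeries_coeff_of_neg _ hm, map_zero, C_coeff_of_ne _ hm.ne, mapL_coeff, omegaSeries,
      powerSeries_coeff_of_neg _ hm, map_zero, add_zero, sub_zero]
  · rw [HahnSeries.coeff_sub, HahnSeries.coeff_sub, HahnSeries.coeff_add, HahnSeries.coeff_add,
      shiftL_neg_one_reflect_zetaSeries_coeff, mapL_coeff, mapL_coeff, omegaSeries,
      PowerSeries.coeff_coe, PowerSeries.coeff_coe, if_neg (by omega), if_neg (by omega),
      Int.natAbs_natCast, expSeries, PowerSeries.coeff_mk, expand_smul_coeff, LinearMap.map_neg,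
      RingHom.map_neg, HahnSeries.coeff_neg, expand_pd_pow_gPhi, smul_neg, HahnSeries.coeff_add,
      smul_add, HahnSeries.coeff_smul, smul_comm, inv_factorial_smul_derivative, neg_add, add_sub_assoc]
    congr 1
    rcases Nat.eq_zero_or_pos j with rfl | hj
    · rw [primExp, PowerSeries.coeff_mk, if_pos rfl, if_pos rfl, omegaSeries, primExp]
      simp
    · have hj' : (j : ℤ) ≠ 0 := by exact_mod_cast hj.ne'
      rw [if_neg hj.ne', C_coeff_of_ne _ hj', HahnSeries.coeff_zero, sub_zero, primExp,
        PowerSeries.coeff_mk, if_neg hj.ne', HahnSeries.coeff_neg, smul_neg, neg_neg,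
        HahnSeries.C_apply, HahnSeries.C_apply, HahnSeries.coeff_single, HahnSeries.coeff_single]
      split_ifs
      · rfl
      · exact smul_zero _

lemma expandFree_self_gPhi :
    P.expandFree l l (gPhi τ P.i P.k P.ne) = shiftL (-1) (reflect (mapL (scal τ n) (zetaSeries τ))) +
      mapL HahnSeries.C (omegaSeries τ l) - HahnSeries.C (omegaSeries τ l) := by
  cases l
  · exact P.expandFree_self_gPhi_none
  · exact P.expandFree_self_gPhi_some _

/-- The three iterated expansions at the centre given by `l`. -/
def expandTriple : Gam τ (n + 2) →+* Triple (Gam τ n) :=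
  (P.expandFree l l).prod ((P.swap.expandFree l l).prod (P.expandNested l))

lemma expandTriple_apply (f : Gam τ (n + 2)) : P.expandTriple l f =
    (P.expandFree l l f, P.swap.expandFree l l f, P.expandNested l f) := rfl

/-- A function missing `xᵢ` gives a series in t, one missing `xₖ` a series in s, and `phi` gives
ω(s) - ω(t) + ζ(s - t). In each case the three components are expansions of the same expression, and
`PolClosure` is closed under sums and products. -/
lemma expandTriple_mem (f : Gam τ (n + 2)) : P.expandTriple l f ∈ PolClosure (Gam τ n) := by
  refine Gam.induction_pair (p := fun f => P.expandTriple l f ∈ PolClosure (Gam τ n)) τ P.i P.k P.ne (skip P.i) (skip P.k)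
      (fun l => mem_range_skip) (fun l => mem_range_skip) (fun g => ?_) (fun g => ?_) ?_
      (fun f g hf hg => ?_) (fun f g hf hg => ?_) f
  · have e : P.expandTriple l (pull τ (skip P.i) g) = tripleT (expand P.k' l g) := by
      rw [expandTriple_apply, tripleT_apply, expandFree_skip_i, expandNested_skip_i]
      exact congrArg (fun x => (_, x, _)) (P.swap.expandFree_skip_k l l g)
    rw [e]
    exact tripleT_mem _
  · have e : P.expandTriple l (pull τ (skip P.k) g) = tripleS (expand P.i' l g) := by
      rw [expandTriple_apply, tripleS_apply, expandFree_skip_k, expandNested_skip_k]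
      exact congrArg (fun x => (_, x, _)) (P.swap.expandFree_skip_i l l g)
    rw [e]
    exact tripleS_mem _
  · have e : P.expandTriple l (gPhi τ P.i P.k P.ne) = tripleS (omegaSeries τ l) -
        tripleT (omegaSeries τ l) + tripleST (mapL (scal τ n) (zetaSeries τ)) := by
      have e2 : P.swap.expandFree l l (gPhi τ P.i P.k P.ne) =
          -P.swap.expandFree l l (gPhi τ P.k P.i P.ne.symm) := by
        rw [← map_neg, ← gPhi_antisymm]
      have e3 := P.swap.expandFree_self_gPhi (τ := τ) l
      rw [expandTriple_apply, expandFree_self_gPhi, expandNested_gPhi, e2, tripleS_apply, tripleT_apply,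
        tripleST_apply]
      refine Prod.ext ?_ (Prod.ext ?_ ?_)
      · exact (add_sub_assoc _ _ _).trans (add_comm _ _)
      · refine (congrArg Neg.neg e3).trans ?_
        rw [reflect_zetaSeries, map_neg]
        change -(-shiftL (-1) _ + _ - _) = _ - _ + _
        abel
      · exact (add_sub_assoc _ _ _).trans (add_comm _ _)
    rw [e]
    exact add_mem (sub_mem (tripleS_mem _) (tripleT_mem _)) (tripleST_mem _)
  · rw [map_add]
    exact add_mem hf hg
  · rw [map_mul]
    exact PolClosure.mul hf hg

end TwoPoints

end IteratedExpansions
end ChiralHomology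
namespace ChiralHomology

/-! ### Iterated expansions at different centres -/

section Swapped

variable {R : Type*} [CommRing R]

/-- The series `A` in `s`, with coefficients in the series in `t`, and `B` in `t`, with coefficients
in the series in `s`, have the same coefficients, with finitely many polar terms. -/
def Swapped (A B : LL R) : Prop :=
  (∀ m p : ℤ, (A.coeff m).coeff p = (B.coeff p).coeff m) ∧
    ∃ M : ℤ, ∀ m p : ℤ, m < M ∨ p < M → (A.coeff m).coeff p = 0

lemma Swapped.trans_eq {A B B' : LL R} (h : Swapped A B) (e : B = B') : Swapped A B' := e ▸ h

namespace Swapped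

variable {A A' B B' : LL R}

lemma symm (h : Swapped A B) : Swapped B A := by
  obtain ⟨h, M, hM⟩ := h
  exact ⟨fun m p => (h p m).symm, M, fun m p hmp => (h p m).symm.trans (hM p m hmp.symm)⟩

lemma coeff_eq_zero {M : ℤ} (h : ∀ m p : ℤ, m < M ∨ p < M → (A.coeff m).coeff p = 0) {m : ℤ}
    (hm : m < M) : A.coeff m = 0 :=
  HahnSeries.ext (funext fun p => h m p (Or.inl hm))

lemma add (h : Swapped A B) (h' : Swapped A' B') : Swapped (A + A') (B + B') := by
  obtain ⟨h, M, hM⟩ := h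
  obtain ⟨h', M', hM'⟩ := h'
  refine ⟨fun m p => ?_, min M M', fun m p hmp => ?_⟩
  · rw [HahnSeries.coeff_add, HahnSeries.coeff_add, HahnSeries.coeff_add, HahnSeries.coeff_add, h,
      h']
  · rw [HahnSeries.coeff_add, HahnSeries.coeff_add, hM m p (by omega), hM' m p (by omega), add_zero]

lemma coeff_mul {M M' : ℤ} (hM : ∀ m p : ℤ, m < M ∨ p < M → (A.coeff m).coeff p = 0)
    (hM' : ∀ m p : ℤ, m < M' ∨ p < M' → (A'.coeff m).coeff p = 0) (m p : ℤ) :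
    ((A * A').coeff m).coeff p = ∑ j ∈ Finset.Icc M (m - M'), ∑ q ∈ Finset.Icc M (p - M'),
      (A.coeff j).coeff q * (A'.coeff (m - j)).coeff (p - q) := by
  rw [coeff_mul_Icc (fun m hm => coeff_eq_zero hM hm) (fun m hm => coeff_eq_zero hM' hm),
    HahnSeries.coeff_sum]
  exact Finset.sum_congr rfl fun j _ =>
    coeff_mul_Icc (fun q hq => hM _ _ (Or.inr hq)) (fun q hq => hM' _ _ (Or.inr hq)) _

/-- A common lower bound for both indices makes the coefficients of a product finite double sums,
which are symmetric in the two variables. This is why `Swapped` includes the bound. -/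
lemma mul (h : Swapped A B) (h' : Swapped A' B') : Swapped (A * A') (B * B') := by
  obtain ⟨-, N, hN⟩ := h.symm
  obtain ⟨-, N', hN'⟩ := h'.symm
  obtain ⟨h, M, hM⟩ := h
  obtain ⟨h', M', hM'⟩ := h'
  have hM2 : ∀ m p : ℤ, m < M ∨ p < M → (B.coeff m).coeff p = 0 :=
    fun m p hmp => (h p m).symm.trans (hM p m hmp.symm)
  have hM2' : ∀ m p : ℤ, m < M' ∨ p < M' → (B'.coeff m).coeff p = 0 :=
    fun m p hmp => (h' p m).symm.trans (hM' p m hmp.symm)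
  refine ⟨fun m p => ?_, M + M', fun m p hmp => ?_⟩
  · rw [coeff_mul hM hM', coeff_mul hM2 hM2', Finset.sum_comm]
    exact Finset.sum_congr rfl fun q _ => Finset.sum_congr rfl fun j _ => by rw [h, h']
  · rw [coeff_mul hM hM']
    refine Finset.sum_eq_zero fun j hj => Finset.sum_eq_zero fun q hq => ?_
    rw [Finset.mem_Icc] at hj hq
    omega

lemma C_mapL_C (H : LaurentSeries R) : Swapped (HahnSeries.C H) (mapL HahnSeries.C H) := by
  have key : ∀ m p : ℤ, ((HahnSeries.C H : LL R).coeff m).coeff p =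
      ((mapL HahnSeries.C H : LL R).coeff p).coeff m := by
    intro m p
    rw [mapL_coeff, HahnSeries.C_apply, HahnSeries.C_apply, HahnSeries.coeff_single,
      HahnSeries.coeff_single]
    split_ifs <;> rfl
  obtain ⟨M, hM⟩ := exists_coeff_eq_zero H
  refine ⟨key, min M 0, fun m p hmp => ?_⟩
  rcases hmp with hm | hp
  · rw [C_coeff_of_ne _ (by omega), HahnSeries.coeff_zero]
  · rw [key, mapL_coeff, hM p (by omega), map_zero, HahnSeries.coeff_zero]

end Swapped

end Swapped

namespace TwoPoints

variable {τ : ℍ} {n : ℕ} (P : TwoPoints n)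

variable (l l' : Option (Fin n))

lemma expand_pd_pow_of_ne {k : Fin (n + 1)} {l : Fin n} {l' : Option (Fin n)} (h : l' ≠ some l)
    (j : ℕ) (p : ℤ) (g : Gam τ (n + 1)) :
    (expand k l' ((pd τ (k.succAbove l) ^ j) g)).coeff p =
      (pd τ l ^ j) ((expand k l' g).coeff p) := by
  induction j generalizing p with
  | zero => rfl
  | succ j ih =>
    rw [pow_succ', pow_succ', Module.End.mul_apply, Module.End.mul_apply, ← ih, ← mapD_coeff,
      ← expand_pdCenter, pdCenter, if_neg h, add_zero]

/-- If `xᵢ` is expanded first, one gets the Taylor coefficients ∂ₗʲg/j!, and expanding `xₖ` at `l' ≠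
l` commutes with ∂ₗ. In the other order, the expansion of `xₖ` commutes with the substitution of
`xᵢ` for `xₗ`, and Taylor's formula is applied to each coefficient. -/
lemma swapped_moved (l : Fin n) (h : l' ≠ some l) (g : Gam τ (n + 1)) :
    Swapped (P.expandFree (some l) l' (pull τ (moved P.i (P.k'.succAbove l)) g))
      (P.swap.expandFree l' (some l) (pull τ (moved P.i (P.k'.succAbove l)) g)) := by
  have eA : P.expandFree (some l) l' (pull τ (moved P.i (P.k'.succAbove l)) g) =
      mapL (expand P.k' l') (expSeries (pd τ (P.k'.succAbove l)) g : LaurentSeries _) := by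
    rw [expandFree, RingHom.comp_apply, Option.map_some, expand_pull_moved]
  have eB : P.swap.expandFree l' (some l) (pull τ (moved P.i (P.k'.succAbove l)) g) =
      mapL (expand P.i' (some l)) (mapL (pull τ (moved P.i' l) : Gam τ n →+* Gam τ (n + 1))
        (expand P.k' l' g)) := by
    have e := expand_pull (τ := τ) (i := P.k') (i' := P.k) (ι := moved P.i (P.k'.succAbove l))
      (ι' := moved P.i' l) (by rw [moved_of_ne _ (Fin.ne_succAbove _ _), P.hk]) (fun a => by
        by_cases ha : a = l
        · rw [ha, moved_self, moved_self, P.hi]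
        · rw [moved_of_ne _ ha, moved_of_ne _ (fun e => ha (Fin.succAbove_right_injective e)),
            P.comm]) l' g
    have e' : l'.map (moved P.i' l) = l'.map P.i'.succAbove := by
      rcases l' with _ | a
      · rfl
      · rw [Option.map_some, Option.map_some, moved_of_ne _ fun e => h (congrArg some e)]
    rw [e'] at e
    rw [← e]
    rfl
  have hA : ∀ (j : ℕ) (p : ℤ), ((P.expandFree (some l) l'
      (pull τ (moved P.i (P.k'.succAbove l)) g)).coeff j).coeff p =
        (j.factorial : ℂ)⁻¹ • (pd τ l ^ j) ((expand P.k' l' g).coeff p) := by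
    intro j p
    rw [eA, mapL_coeff, PowerSeries.coeff_coe, if_neg (by omega), Int.natAbs_natCast, expSeries,
      PowerSeries.coeff_mk, expand_smul_coeff, expand_pd_pow_of_ne h]
  have hA' : ∀ (m p : ℤ), m < 0 → ((P.expandFree (some l) l'
      (pull τ (moved P.i (P.k'.succAbove l)) g)).coeff m).coeff p = 0 := by
    intro m p hm
    rw [eA, mapL_coeff, powerSeries_coeff_of_neg _ hm, map_zero, HahnSeries.coeff_zero]
  obtain ⟨M, hM⟩ := exists_coeff_eq_zero (expand P.k' l' g)
  refine ⟨fun m p => ?_, min M 0, fun m p hmp => ?_⟩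
  · have hB : ((P.swap.expandFree l' (some l)
        (pull τ (moved P.i (P.k'.succAbove l)) g)).coeff p) =
          (expSeries (pd τ l) ((expand P.k' l' g).coeff p) : LaurentSeries _) := by
      rw [eB, mapL_coeff, mapL_coeff]
      exact expand_pull_moved _ _ _
    rw [hB]
    rcases lt_or_ge m 0 with hm | hm
    · rw [hA' m p hm, powerSeries_coeff_of_neg _ hm]
    · obtain ⟨j, rfl⟩ := Int.eq_ofNat_of_zero_le hm
      rw [hA, PowerSeries.coeff_coe, if_neg (by omega), Int.natAbs_natCast, expSeries,
        PowerSeries.coeff_mk]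
  · rcases lt_or_ge m 0 with hm | hm
    · exact hA' m p hm
    · obtain ⟨j, rfl⟩ := Int.eq_ofNat_of_zero_le hm
      rw [hA, hM p (by omega), map_zero, smul_zero]

/-- The induction uses the pair formed by `xᵢ` and its centre: functions missing `xᵢ` are immediate,
those missing the centre are `swapped_moved`, and `phi` of this pair does not involve `xₖ`. -/
lemma swapped_some (l : Fin n) (h : l' ≠ some l) (f : Gam τ (n + 2)) :
    Swapped (P.expandFree (some l) l' f) (P.swap.expandFree l' (some l) f) := by
  refine Gam.induction_pair
    (p := fun f => Swapped (P.expandFree (some l) l' f) (P.swap.expandFree l' (some l) f)) τ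
    P.i (P.i.succAbove (P.k'.succAbove l)) (Fin.ne_succAbove _ _) (skip P.i)
    (moved P.i (P.k'.succAbove l)) (fun l => mem_range_skip) (mem_range_moved P.i _)
    (fun g => ?_) (fun g => P.swapped_moved l' l h g) ?_ (fun f g hf hg => ?_)
    (fun f g hf hg => ?_) f
  · rw [expandFree_skip_i]
    have e := P.swap.expandFree_skip_k l' (some l) g
    exact (Swapped.C_mapL_C _).trans_eq e.symm
  · have e : gPhi τ P.i (P.i.succAbove (P.k'.succAbove l)) (Fin.ne_succAbove _ _) =
        pull τ (skip P.k) (gPhi τ P.i' (P.i'.succAbove l) (Fin.ne_succAbove _ _)) := by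
      rw [pull_gPhi]
      simp only [skip, Fin.coe_succAboveEmb, P.hi, P.comm]
    rw [e, expandFree_skip_k]
    have e2 := P.swap.expandFree_skip_i l' (some l)
      (gPhi τ P.i' (P.i'.succAbove l) (Fin.ne_succAbove _ _))
    exact (Swapped.C_mapL_C _).symm.trans_eq e2.symm
  · rw [RingHom.map_add, RingHom.map_add]
    exact hf.add hg
  · rw [RingHom.map_mul, RingHom.map_mul]
    exact hf.mul hg

/-- Expansions of two variables at different centres commute. -/
theorem swapped (h : l ≠ l') (f : Gam τ (n + 2)) :
    Swapped (P.expandFree l l' f) (P.swap.expandFree l' l f) := by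
  -- Two distinct centres cannot both be the origin, so up to symmetry the first one is a point.
  rcases l with _ | l
  · obtain ⟨l', rfl⟩ := Option.ne_none_iff_exists'.mp h.symm
    exact (P.swap.swapped_some none l' h f).symm
  · exact P.swapped_some l' l h.symm f

end TwoPoints

end ChiralHomology
namespace ChiralHomology

/-! ### Contraction of tensor factors -/

section UpdateOption

variable {V : Type*} {n : ℕ}

lemma update_some_comp_map (i : Fin (n + 1)) (c : Option (Fin (n + 1)) → V) (x : V) :
    Function.update c (some i) x ∘ Option.map i.succAbove = c ∘ Option.map i.succAbove := by
  funext o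
  rcases o with _ | o
  · simp
  · simp [Fin.succAbove_ne]

lemma update_map_comp_map (i : Fin (n + 1)) (c : Option (Fin (n + 1)) → V) (t : Option (Fin n))
    (x : V) : Function.update c (t.map i.succAbove) x ∘ Option.map i.succAbove =
      Function.update (c ∘ Option.map i.succAbove) t x :=
  Function.update_comp_eq_of_injective _ (Option.map_injective Fin.succAbove_right_injective) _ _

lemma some_ne_map_succAbove (i : Fin (n + 1)) (t : Option (Fin n)) :
    some i ≠ t.map i.succAbove := by
  rcases t with _ | t
  · simp
  · simp [Fin.ne_succAbove]

lemma eq_some_or_eq_map (i : Fin (n + 1)) (o : Option (Fin (n + 1))) :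
    o = some i ∨ ∃ t : Option (Fin n), o = t.map i.succAbove := by
  rcases o with _ | o
  · exact Or.inr ⟨none, rfl⟩
  · rcases Fin.eq_self_or_eq_succAbove i o with rfl | ⟨t, rfl⟩
    · exact Or.inl rfl
    · exact Or.inr ⟨some t, rfl⟩

end UpdateOption

section Tensors

variable {V : Type*} [AddCommGroup V] [Module ℂ V] {n : ℕ}

/-- The pure tensor with the given factors; the last factor has the index `none`. -/
def pt (c : Option (Fin n) → V) : Tens V n :=
  PiTensorProduct.tprod ℂ (fun k => c (some k)) ⊗ₜ[ℂ] c none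

lemma pt_update_none (c : Option (Fin n) → V) (x : V) : pt (Function.update c none x) =
    PiTensorProduct.tprod ℂ (fun k => c (some k)) ⊗ₜ[ℂ] x := by
  rw [pt, Function.update_self]
  congr 2

lemma pt_update_some (c : Option (Fin n) → V) (j : Fin n) (x : V) :
    pt (Function.update c (some j) x) =
      PiTensorProduct.tprod ℂ (Function.update (fun k => c (some k)) j x) ⊗ₜ[ℂ] c none := by
  rw [pt, Function.update_of_ne (by simp)]
  congr 2
  funext k
  by_cases h : k = j
  · subst h; simp
  · rw [Function.update_of_ne h, Function.update_of_ne (by simpa using h)]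

/-- The pure tensor as a function of one of its factors. -/
def slot (c : Option (Fin n) → V) (s : Option (Fin n)) : V →ₗ[ℂ] Tens V n where
  toFun x := pt (Function.update c s x)
  map_add' x y := by
    rcases s with _ | s
    · rw [pt_update_none, pt_update_none, pt_update_none, TensorProduct.tmul_add]
    · rw [pt_update_some, pt_update_some, pt_update_some, MultilinearMap.map_update_add,
        TensorProduct.add_tmul]
  map_smul' r x := by
    rcases s with _ | s
    · rw [pt_update_none, pt_update_none, TensorProduct.tmul_smul, RingHom.id_apply]
    · rw [pt_update_some, pt_update_some, MultilinearMap.map_update_smul, TensorProduct.smul_tmul',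
        RingHom.id_apply]

lemma slot_apply (c : Option (Fin n) → V) (s : Option (Fin n)) (x : V) :
    slot c s x = pt (Function.update c s x) := rfl

lemma slot_update (c : Option (Fin n) → V) (s : Option (Fin n)) (x : V) :
    slot (Function.update c s x) s = slot c s :=
  LinearMap.ext fun y => by rw [slot_apply, slot_apply, Function.update_idem]

/-- The linear map on `V^{⊗ n + 1}` given by a multilinear map. -/
def liftTens {W : Type*} [AddCommGroup W] [Module ℂ W]
    (φ : MultilinearMap ℂ (fun _ : Option (Fin n) => V) W) : Tens V n →ₗ[ℂ] W :=
  TensorProduct.lift (PiTensorProduct.lift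
    { toFun := fun a =>
        { toFun := fun b => φ fun o => o.elim b a
          map_add' := fun x y => by
            have e : ∀ z : V, (fun o : Option (Fin n) => o.elim z a) =
                Function.update (fun o : Option (Fin n) => o.elim 0 a) none z := fun z => by
              funext o; cases o <;> simp
            rw [e (x + y), e x, e y, MultilinearMap.map_update_add]
          map_smul' := fun r x => by
            have e : ∀ z : V, (fun o : Option (Fin n) => o.elim z a) =
                Function.update (fun o : Option (Fin n) => o.elim 0 a) none z := fun z => by
              funext o; cases o <;> simp
            rw [e (r • x), e x, MultilinearMap.map_update_smul, RingHom.id_apply] }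
      map_update_add' := fun a k x y => by
        refine LinearMap.ext fun b => ?_
        have e : ∀ z : V, (fun o : Option (Fin n) => o.elim b (Function.update a k z)) =
            Function.update (fun o : Option (Fin n) => o.elim b a) (some k) z := fun z => by
          funext o
          rcases o with _ | o
          · simp
          · by_cases h : o = k
            · subst h; simp
            · simp [h]
        change φ _ = φ _ + φ _
        rw [e (x + y), e x, e y, MultilinearMap.map_update_add]
      map_update_smul' := fun a k r x => by
        refine LinearMap.ext fun b => ?_
        have e : ∀ z : V, (fun o : Option (Fin n) => o.elim b (Function.update a k z)) =
            Function.update (fun o : Option (Fin n) => o.elim b a) (some k) z := fun z => by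
          funext o
          rcases o with _ | o
          · simp
          · by_cases h : o = k
            · subst h; simp
            · simp [h]
        change φ _ = r • φ _
        rw [e (r • x), e x, MultilinearMap.map_update_smul] })

lemma liftTens_pt {W : Type*} [AddCommGroup W] [Module ℂ W]
    (φ : MultilinearMap ℂ (fun _ : Option (Fin n) => V) W) (c : Option (Fin n) → V) :
    liftTens φ (pt c) = φ c := by
  rw [liftTens, pt, TensorProduct.lift.tmul, PiTensorProduct.lift.tprod]
  change φ _ = _
  congr 1
  funext o
  cases o <;> rfl

lemma Tens.induction {p : Tens V n → Prop} (hpt : ∀ (r : ℂ) c, p (r • pt c))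
    (hadd : ∀ x y, p x → p y → p (x + y)) (x : Tens V n) : p x := by
  have h0 : p 0 := by
    rw [← zero_smul ℂ (pt fun _ => 0)]
    exact hpt _ _
  refine TensorProduct.induction_on x h0 (fun a b => ?_) hadd
  refine PiTensorProduct.induction_on a (fun r c => ?_) (fun x y hx hy => ?_)
  · rw [← TensorProduct.smul_tmul']
    exact hpt r fun o => o.elim b c
  · rw [TensorProduct.add_tmul]
    exact hadd _ _ hx hy

lemma hom_ext_pt {τ : ℍ} {W : Type*} [AddCommGroup W] [Module ℂ W] {A B : CTilde V τ n →ₗ[ℂ] W}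
    (h : ∀ (f : Gam τ n) c, A (f ⊗ₜ pt c) = B (f ⊗ₜ pt c)) : A = B :=
  hom_ext_elt fun f a b => h f fun o => o.elim b a

variable (𝒱 : GradedVertexAlgebra V)

/-- The removal of the `i`-th factor `a` of a pure tensor, and the replacement of the factor `x` at
`s` by `a_(m) x`. -/
def contractFun (i : Fin (n + 1)) (s : Option (Fin n)) (m : ℤ) (c : Option (Fin (n + 1)) → V) :
    Option (Fin n) → V :=
  Function.update (c ∘ Option.map i.succAbove) s
    (𝒱.prod m (c (some i)) (c (s.map i.succAbove)))

/-- The value of `contract` on pure tensors. -/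
def contractValue (i : Fin (n + 1)) (s : Option (Fin n)) (m : ℤ) (c : Option (Fin (n + 1)) → V) :
    Tens V n :=
  slot (c ∘ Option.map i.succAbove) s (𝒱.prod m (c (some i)) (c (s.map i.succAbove)))

lemma contractValue_update_some (i : Fin (n + 1)) (s : Option (Fin n)) (m : ℤ)
    (c : Option (Fin (n + 1)) → V) (x : V) :
    contractValue 𝒱 i s m (Function.update c (some i) x) =
      slot (c ∘ Option.map i.succAbove) s (𝒱.prod m x (c (s.map i.succAbove))) := by
  rw [contractValue, update_some_comp_map, Function.update_self,
    Function.update_of_ne (some_ne_map_succAbove i s).symm]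

lemma contractValue_update_self (i : Fin (n + 1)) (s : Option (Fin n)) (m : ℤ)
    (c : Option (Fin (n + 1)) → V) (x : V) :
    contractValue 𝒱 i s m (Function.update c (s.map i.succAbove) x) =
      slot (c ∘ Option.map i.succAbove) s (𝒱.prod m (c (some i)) x) := by
  rw [contractValue, update_map_comp_map, Function.update_self, slot_update,
    Function.update_of_ne (some_ne_map_succAbove i s)]

lemma contractValue_update_of_ne (i : Fin (n + 1)) {s t : Option (Fin n)} (h : t ≠ s) (m : ℤ)
    (c : Option (Fin (n + 1)) → V) (x : V) :
    contractValue 𝒱 i s m (Function.update c (t.map i.succAbove) x) =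
      slot (contractFun 𝒱 i s m c) t x := by
  have h' : s.map i.succAbove ≠ t.map i.succAbove := fun e =>
    h (Option.map_injective Fin.succAbove_right_injective e.symm)
  rw [contractValue, update_map_comp_map, Function.update_of_ne h',
    Function.update_of_ne (some_ne_map_succAbove i t), slot_apply, slot_apply, contractFun,
    Function.update_comm h]

/-- The multilinear map underlying `contract`. -/
def contractMultilinear (i : Fin (n + 1)) (s : Option (Fin n)) (m : ℤ) :
    MultilinearMap ℂ (fun _ : Option (Fin (n + 1)) => V) (Tens V n) where
  toFun := contractValue 𝒱 i s m
  map_update_add' := fun {inst} c o x y => by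
    rw [Subsingleton.elim inst Option.instDecidableEq]
    rcases eq_some_or_eq_map i o with rfl | ⟨t, rfl⟩
    · simp only [contractValue_update_some, map_add, LinearMap.add_apply]
    · by_cases h : t = s
      · subst h
        simp only [contractValue_update_self, map_add]
      · simp only [contractValue_update_of_ne _ _ h, map_add]
  map_update_smul' := fun {inst} c o r x => by
    rw [Subsingleton.elim inst Option.instDecidableEq]
    rcases eq_some_or_eq_map i o with rfl | ⟨t, rfl⟩
    · simp only [contractValue_update_some, map_smul, LinearMap.smul_apply]
    · by_cases h : t = s
      · subst h
        simp only [contractValue_update_self, map_smul]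
      · simp only [contractValue_update_of_ne _ _ h, map_smul]

/-- The removal of the `i`-th factor `a` of a tensor, and the replacement of the factor `x` at `s` by
`a_(m) x`. -/
def contract (i : Fin (n + 1)) (s : Option (Fin n)) (m : ℤ) : Tens V (n + 1) →ₗ[ℂ] Tens V n :=
  liftTens (contractMultilinear 𝒱 i s m)

lemma contract_pt (i : Fin (n + 1)) (s : Option (Fin n)) (m : ℤ) (c : Option (Fin (n + 1)) → V) :
    contract 𝒱 i s m (pt c) =
      slot (c ∘ Option.map i.succAbove) s (𝒱.prod m (c (some i)) (c (s.map i.succAbove))) :=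
  liftTens_pt _ _

lemma contract_pt' (i : Fin (n + 1)) (s : Option (Fin n)) (m : ℤ)
    (c : Option (Fin (n + 1)) → V) : contract 𝒱 i s m (pt c) = pt (contractFun 𝒱 i s m c) :=
  liftTens_pt _ _

/-- The field property for pure tensors, extended to sums; it makes the residue of an arbitrary
tensor a finite sum. -/
lemma eventuallyZero_contract (i : Fin (n + 1)) (s : Option (Fin n)) (t : Tens V (n + 1)) :
    EventuallyZero fun m => contract 𝒱 i s m t := by
  refine Tens.induction (p := fun t => EventuallyZero fun m => contract 𝒱 i s m t) (fun r c => ?_) (fun x y hx hy => ?_) t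
  · obtain ⟨N, hN⟩ := 𝒱.field_property (c (some i)) (c (s.map i.succAbove))
    exact ⟨N, fun m hm => by beta_reduce; rw [map_smul, contract_pt, hN m hm, map_zero, smul_zero]⟩
  · obtain ⟨N, hN⟩ := hx
    obtain ⟨N', hN'⟩ := hy
    exact ⟨max N N', fun m hm => by
      beta_reduce at hN hN' ⊢
      rw [map_add, hN m (le_trans (le_max_left _ _) hm), hN' m (le_trans (le_max_right _ _) hm),
        add_zero]⟩

variable {τ : ℍ}

lemma pairL_add_right {R : Type*} [CommRing R] [Algebra ℂ R] {M : Type*} [AddCommGroup M]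
    [Module ℂ M] (A : LaurentSeries R) {v w : ℤ → M} (hv : EventuallyZero v)
    (hw : EventuallyZero w) : pairL A (fun m => v m + w m) = pairL A v + pairL A w := by
  rw [pairL, pairL, pairL,
    ← finsum_add_distrib (finite_support_pairL A hv) (finite_support_pairL A hw)]
  exact finsum_congr fun m => TensorProduct.tmul_add _ _ _

/-- The residue `f ⊗ t ↦ ∑ₘ f⁽ᵐ⁾ ⊗ tₘ`, where `f⁽ᵐ⁾` is the `m`-th coefficient of `f` in `xᵢ` at the
centre given by `s`, and the `i`-th factor acts on the one at `s` by its `m`-th product in `tₘ`. -/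
def resid (i : Fin (n + 1)) (s : Option (Fin n)) : CTilde V τ (n + 1) →ₗ[ℂ] CTilde V τ n :=
  TensorProduct.lift (LinearMap.mk₂ ℂ
    (fun f t => pairL (expand i s f) fun m => contract 𝒱 i s m t)
    (fun f g t => by rw [RingHom.map_add, pairL_add _ _ (eventuallyZero_contract 𝒱 i s t)])
    (fun r f t => by
      rw [pairL, pairL, smul_finsum' _ (finite_support_pairL _ (eventuallyZero_contract 𝒱 i s t))]
      exact finsum_congr fun m => by rw [expand_smul_coeff, TensorProduct.smul_tmul'])
    (fun f t t' => by
      rw [← pairL_add_right _ (eventuallyZero_contract 𝒱 i s t) (eventuallyZero_contract 𝒱 i s t')]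
      exact finsum_congr fun m => congrArg _ (LinearMap.map_add _ _ _))
    (fun r f t => by
      rw [pairL, pairL, smul_finsum' _ (finite_support_pairL _ (eventuallyZero_contract 𝒱 i s t))]
      exact finsum_congr fun m =>
        (congrArg _ (LinearMap.map_smul _ _ _)).trans (TensorProduct.tmul_smul _ _ _)))

lemma resid_tmul (i : Fin (n + 1)) (s : Option (Fin n)) (f : Gam τ (n + 1)) (t : Tens V (n + 1)) :
    resid 𝒱 i s (f ⊗ₜ[ℂ] t) = pairL (expand i s f) fun m => contract 𝒱 i s m t :=
  rfl

end Tensors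
end ChiralHomology
namespace ChiralHomology

/-! ### The differential -/

section ExistsUnique

variable {V : Type*} [AddCommGroup V] [Module ℂ V] (𝒱 : GradedVertexAlgebra V) {τ : ℍ} {n : ℕ}

/-- Tensoring over a field is exact. Hence a map into `C̃ₙ` may be specified by its values in the
tensor product with all functions. -/
lemma incl_injective : Function.Injective (incl V τ n) :=
  Module.Flat.rTensor_preserves_injective_linearMap (M := Tens V n) (Gam τ n).val.toLinearMap
    Subtype.val_injective

/-- The weight `1` or `0` of the residue of `xᵢ` at the centre given by `s`, which is present in the
differential at the origin and at the points with a larger index. -/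
def weight (i : Fin (n + 1)) (s : Option (Fin n)) : ℂ :=
  s.elim 1 fun k => if i < i.succAbove k then 1 else 0

/-- The differential `C̃ₙ₊₁ → C̃ₙ`. -/
def diff (τ : ℍ) (n : ℕ) : CTilde V τ (n + 1) →ₗ[ℂ] CTilde V τ n :=
  ∑ i : Fin (n + 1), ∑ s : Option (Fin n),
    ((-1 : ℂ) ^ (n - (i : ℕ)) * weight i s) • (resid 𝒱 i s : CTilde V τ (n + 1) →ₗ[ℂ] CTilde V τ n)

lemma incl_resid (i : Fin (n + 1)) (s : Option (Fin n)) (f : Gam τ (n + 1))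
    (t : Tens V (n + 1)) : incl V τ n (resid 𝒱 i s (f ⊗ₜ t)) =
      ∑ᶠ m : ℤ, laurentCoeff τ f.1 i s m ⊗ₜ[ℂ] contract 𝒱 i s m t := by
  rw [resid_tmul, pairL]
  refine ((incl V τ n).toAddMonoidHom.map_finsum
    (finite_support_pairL _ (eventuallyZero_contract 𝒱 i s t))).trans (finsum_congr fun m => ?_)
  rw [laurentCoeff_eq]
  rfl

lemma incl_resid_some (i : Fin (n + 1)) (k : Fin n) (f : Gam τ (n + 1)) (a : Fin (n + 1) → V)
    (b : V) : incl V τ n (resid 𝒱 i (some k) (elt f a b)) = dTerm 𝒱 τ f a b i k := by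
  refine (incl_resid 𝒱 i (some k) f _).trans (finsum_congr fun m => ?_)
  congr 1
  exact (contract_pt 𝒱 i (some k) m fun o => o.elim b a).trans (pt_update_some _ _ _)

lemma incl_resid_none (i : Fin (n + 1)) (f : Gam τ (n + 1)) (a : Fin (n + 1) → V)
    (b : V) : incl V τ n (resid 𝒱 i none (elt f a b)) = pTerm 𝒱 τ f a b i := by
  refine (incl_resid 𝒱 i none f _).trans (finsum_congr fun m => ?_)
  congr 1
  exact (contract_pt 𝒱 i none m fun o => o.elim b a).trans (pt_update_none _ _)

lemma isDifferential_diff : IsDifferential 𝒱 τ (diff 𝒱 τ n) := by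
  intro f a b
  rw [diff, LinearMap.sum_apply, map_sum]
  refine Eq.trans ?_ (add_comm _ _)
  rw [← Finset.sum_add_distrib]
  refine Finset.sum_congr rfl fun i _ => ?_
  rw [LinearMap.sum_apply, map_sum, Fintype.sum_option]
  congr 1
  · rw [LinearMap.smul_apply, LinearMap.map_smul, incl_resid_none, weight, Option.elim_none, mul_one]
  · rw [Finset.sum_filter]
    refine Finset.sum_congr rfl fun k _ => ?_
    rw [LinearMap.smul_apply, LinearMap.map_smul, incl_resid_some, weight, Option.elim_some]
    split_ifs
    · rw [mul_one]
    · rw [mul_zero, zero_smul]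

lemma IsDifferential.eq_diff {D : CTilde V τ (n + 1) →ₗ[ℂ] CTilde V τ n}
    (h : IsDifferential 𝒱 τ D) : D = diff 𝒱 τ n :=
  hom_ext_elt fun f a b => incl_injective ((h f a b).trans (isDifferential_diff 𝒱 f a b).symm)

end ExistsUnique

/-! ### The residues and the total derivatives -/

section TotalDerivatives

variable {V : Type*} [AddCommGroup V] [Module ℂ V] (𝒱 : GradedVertexAlgebra V) {τ : ℍ} {n : ℕ}

lemma totalDeriv_pt (i : Fin n) (f : Gam τ n) (c : Option (Fin n) → V) :
    totalDeriv 𝒱 τ i (f ⊗ₜ pt c) =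
      pd τ i f ⊗ₜ pt c + f ⊗ₜ slot c (some i) (𝒱.translation (c (some i))) := by
  refine (totalDeriv_elt 𝒱 τ i f (fun k => c (some k)) (c none)).trans ?_
  rw [slot_apply, pt_update_some]
  rfl

/-- The residue of a derivative is zero. -/
lemma resid_totalDeriv_self (i : Fin (n + 1)) (s : Option (Fin n)) :
    resid 𝒱 i s ∘ₗ totalDeriv 𝒱 τ i = 0 := by
  refine hom_ext_pt fun f c => ?_
  have h1 : ∀ m, contract 𝒱 i s m (slot c (some i) (𝒱.translation (c (some i)))) =
      (-m : ℂ) • contract 𝒱 i s (m - 1) (pt c) := by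
    intro m
    rw [slot_apply, contract_pt, contract_pt, update_some_comp_map, Function.update_self,
      Function.update_of_ne (some_ne_map_succAbove i s).symm, 𝒱.prod_translation, map_smul]
  have hA := finite_support_pairL (expand i s (pd τ i f)) (eventuallyZero_contract 𝒱 i s (pt c))
  have hB := finite_support_pairL (expand i s f) (eventuallyZero_contract 𝒱 i s
    (slot c (some i) (𝒱.translation (c (some i)))))
  -- After shifting the first sum by one, the coefficient m f⁽ᵐ⁾ of ∂f at `m - 1` meets (Ta)_(m) =
  -- -m a_(m-1), and the terms cancel in pairs.
  rw [LinearMap.comp_apply, totalDeriv_pt, map_add, resid_tmul, resid_tmul, LinearMap.zero_apply,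
    pairL, pairL, ← finsum_comp_equiv (Equiv.addRight (-1 : ℤ)), ← finsum_add_distrib ?_ hB]
  · refine finsum_eq_zero_of_forall_eq_zero fun m => ?_
    rw [h1, expand_pd_self, hasseDeriv_coeff_one, Equiv.coe_addRight]
    beta_reduce
    rw [neg_add_cancel_right, ← sub_eq_add_neg, TensorProduct.tmul_smul, TensorProduct.smul_tmul', ← TensorProduct.add_tmul,
      ← Int.cast_smul_eq_zsmul ℂ, ← add_smul, add_neg_cancel, zero_smul, TensorProduct.zero_tmul]
  · exact hA.preimage (Equiv.injective _).injOn

lemma pairL_mapD {R : Type*} [CommRing R] [Algebra ℂ R] {M : Type*} [AddCommGroup M] [Module ℂ M]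
    (D : R →ₗ[ℂ] R) (A : LaurentSeries R) {v : ℤ → M} (hv : EventuallyZero v) :
    pairL (mapD D A) v = TensorProduct.map D LinearMap.id (pairL A v) := by
  exact ((TensorProduct.map D LinearMap.id).toAddMonoidHom.map_finsum
    (finite_support_pairL A hv)).symm

lemma pairL_map {R : Type*} [CommRing R] [Algebra ℂ R] {M N : Type*} [AddCommGroup M] [Module ℂ M]
    [AddCommGroup N] [Module ℂ N] (φ : M →ₗ[ℂ] N) (A : LaurentSeries R) {v : ℤ → M}
    (hv : EventuallyZero v) :
    pairL A (fun m => φ (v m)) = TensorProduct.map LinearMap.id φ (pairL A v) := by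
  exact ((TensorProduct.map LinearMap.id φ).toAddMonoidHom.map_finsum
    (finite_support_pairL A hv)).symm

/-- The operator `Tⱼ` on `V^{⊗ n + 1}`. -/
def transl (j : Fin n) : Tens V n →ₗ[ℂ] Tens V n := TensorProduct.map
  (PiTensorProduct.map (Function.update (fun _ => LinearMap.id) j 𝒱.translation)) LinearMap.id

lemma transl_pt (j : Fin n) (c : Option (Fin n) → V) :
    transl 𝒱 j (pt c) = slot c (some j) (𝒱.translation (c (some j))) := by
  have e : (fun k => (Function.update (fun _ => LinearMap.id) j 𝒱.translation :
      Fin n → V →ₗ[ℂ] V) k (c (some k))) =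
        Function.update (fun k => c (some k)) j (𝒱.translation (c (some j))) := by
    funext k
    by_cases hk : k = j
    · subst hk; simp
    · simp [hk]
  rw [transl, slot_apply, pt_update_some, pt, TensorProduct.map_tmul, PiTensorProduct.map_tprod, e,
    LinearMap.id_apply]

lemma transl_contract_of_ne (i : Fin (n + 1)) {s : Option (Fin n)} {j : Fin n} (h : s ≠ some j)
    (m : ℤ) (t : Tens V (n + 1)) : transl 𝒱 j (contract 𝒱 i s m t) =
      contract 𝒱 i s m (transl 𝒱 (i.succAbove j) t) := by
  refine Tens.induction (p := fun t => transl 𝒱 j (contract 𝒱 i s m t) =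
    contract 𝒱 i s m (transl 𝒱 (i.succAbove j) t)) (fun r c => ?_) (fun x y hx hy => ?_) t
  · rw [map_smul, map_smul, map_smul, map_smul, contract_pt', transl_pt, transl_pt, slot_apply _ (some (i.succAbove j))]
    congr 1
    have := contractValue_update_of_ne 𝒱 i h.symm m c (𝒱.translation (c (some (i.succAbove j))))
    refine Eq.trans ?_ ((liftTens_pt _ _).trans this).symm
    rw [contractFun, Function.update_of_ne h.symm]
    rfl
  · rw [map_add, map_add, map_add, map_add, hx, hy]

/-- This is the derivation property of `T`: it acts on both factors of the product that sits at the
centre. -/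
lemma transl_contract_self (i : Fin (n + 1)) (j : Fin n)
    (m : ℤ) (t : Tens V (n + 1)) : transl 𝒱 j (contract 𝒱 i (some j) m t) =
      contract 𝒱 i (some j) m (transl 𝒱 (i.succAbove j) t) +
        contract 𝒱 i (some j) m (transl 𝒱 i t) := by
  refine Tens.induction (p := fun t => transl 𝒱 j (contract 𝒱 i (some j) m t) =
      contract 𝒱 i (some j) m (transl 𝒱 (i.succAbove j) t) +
        contract 𝒱 i (some j) m (transl 𝒱 i t)) (fun r c => ?_) (fun x y hx hy => ?_) t
  · rw [map_smul, map_smul, map_smul, map_smul, map_smul, map_smul, contract_pt', transl_pt,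
      transl_pt, transl_pt, slot_apply _ (some (i.succAbove j)), slot_apply _ (some i), ← smul_add]
    congr 1
    have h1 := contractValue_update_self 𝒱 i (some j) m c (𝒱.translation (c (some (i.succAbove j))))
    have h2 := contractValue_update_some 𝒱 i (some j) m c (𝒱.translation (c (some i)))
    refine Eq.trans ?_ (congrArg₂ _ ((liftTens_pt _ _).trans h1) ((liftTens_pt _ _).trans h2)).symm
    rw [contractFun, Function.update_self, slot_update, 𝒱.translation_prod, map_add, add_comm]
    rfl
  · rw [map_add, map_add, map_add, map_add, map_add, map_add, hx, hy]
    abel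

lemma totalDeriv_apply (j : Fin n) (A : CTilde V τ n) : totalDeriv 𝒱 τ j A =
    TensorProduct.map (pd τ j) LinearMap.id A + TensorProduct.map LinearMap.id (transl 𝒱 j) A := rfl

lemma totalDeriv_tmul (j : Fin n) (f : Gam τ n) (t : Tens V n) :
    totalDeriv 𝒱 τ j (f ⊗ₜ t) = pd τ j f ⊗ₜ t + f ⊗ₜ transl 𝒱 j t := rfl

lemma totalDeriv_resid_of_ne (i : Fin (n + 1)) {s : Option (Fin n)} {j : Fin n} (h : s ≠ some j)
    (A : CTilde V τ (n + 1)) :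
    totalDeriv 𝒱 τ j (resid 𝒱 i s A) = resid 𝒱 i s (totalDeriv 𝒱 τ (i.succAbove j) A) := by
  refine LinearMap.congr_fun (f := totalDeriv 𝒱 τ j ∘ₗ resid 𝒱 i s)
    (g := resid 𝒱 i s ∘ₗ totalDeriv 𝒱 τ (i.succAbove j)) (TensorProduct.ext' fun f t => ?_) A
  have hv := eventuallyZero_contract 𝒱 i s t
  rw [LinearMap.comp_apply, LinearMap.comp_apply, totalDeriv_tmul, LinearMap.map_add, resid_tmul, resid_tmul,
    resid_tmul, totalDeriv_apply, ← pairL_mapD _ _ hv, ← pairL_map _ _ hv, ← expand_pdCenter,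
    pdCenter, if_neg h, add_zero]
  congr 1
  exact congrArg _ (funext fun m => transl_contract_of_ne 𝒱 i h m t)

/-- When `xⱼ` is the centre, its total derivative lifts to the sum of those in the centre and in the
integrated variable, and the latter has zero residue. -/
lemma totalDeriv_resid_self (i : Fin (n + 1)) (j : Fin n) (A : CTilde V τ (n + 1)) :
    totalDeriv 𝒱 τ j (resid 𝒱 i (some j) A) =
      resid 𝒱 i (some j) (totalDeriv 𝒱 τ (i.succAbove j) A) := by
  refine LinearMap.congr_fun (f := totalDeriv 𝒱 τ j ∘ₗ resid 𝒱 i (some j))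
    (g := resid 𝒱 i (some j) ∘ₗ totalDeriv 𝒱 τ (i.succAbove j)) (TensorProduct.ext' fun f t => ?_) A
  have hv := eventuallyZero_contract 𝒱 i (some j) t
  have h0 := LinearMap.congr_fun (resid_totalDeriv_self 𝒱 i (some j)) (f ⊗ₜ t)
  rw [LinearMap.comp_apply, totalDeriv_tmul, LinearMap.map_add, resid_tmul, resid_tmul,
    LinearMap.zero_apply] at h0
  rw [LinearMap.comp_apply, LinearMap.comp_apply, totalDeriv_tmul, LinearMap.map_add, resid_tmul, resid_tmul,
    resid_tmul, totalDeriv_apply, ← pairL_mapD _ _ hv, ← pairL_map _ _ hv, ← expand_pdCenter,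
    pdCenter, if_pos rfl, RingHom.map_add, pairL_add _ _ hv, funext (fun m => transl_contract_self 𝒱 i j m t),
    pairL_add_right _ (eventuallyZero_contract 𝒱 i _ _) (eventuallyZero_contract 𝒱 i _ _),
    add_add_add_comm, h0, add_zero]

lemma resid_mem_totalDerivs (i : Fin (n + 1)) (s : Option (Fin n)) {A : CTilde V τ (n + 1)}
    (hA : A ∈ totalDerivs 𝒱 τ (n + 1)) : resid 𝒱 i s A ∈ totalDerivs 𝒱 τ n := by
  suffices h : totalDerivs 𝒱 τ (n + 1) ≤ (totalDerivs 𝒱 τ n).comap (resid 𝒱 i s) from h hA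
  refine iSup_le fun k => ?_
  rintro _ ⟨A, rfl⟩
  rw [Submodule.mem_comap]
  rcases Fin.eq_self_or_eq_succAbove i k with rfl | ⟨j, rfl⟩
  · rw [← LinearMap.comp_apply, resid_totalDeriv_self]
    exact zero_mem _
  · have h : resid 𝒱 i s (totalDeriv 𝒱 τ (i.succAbove j) A) = totalDeriv 𝒱 τ j (resid 𝒱 i s A) := by
      by_cases h : s = some j
      · subst h
        exact (totalDeriv_resid_self 𝒱 i j A).symm
      · exact (totalDeriv_resid_of_ne 𝒱 i h A).symm
    rw [h]
    exact Submodule.mem_iSup_of_mem j ⟨_, rfl⟩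

lemma totalDerivs_le_comap_diff (n : ℕ) :
    totalDerivs 𝒱 τ (n + 1) ≤ (totalDerivs 𝒱 τ n).comap (diff 𝒱 τ n) := by
  intro A hA
  rw [Submodule.mem_comap, diff, LinearMap.sum_apply]
  refine Submodule.sum_mem _ fun i _ => ?_
  rw [LinearMap.sum_apply]
  exact Submodule.sum_mem _ fun s _ => Submodule.smul_mem _ _ (resid_mem_totalDerivs 𝒱 i s hA)

end TotalDerivatives
end ChiralHomology
namespace ChiralHomology

/-! ### Iterated residues -/

section PairLL

variable {R : Type*} [CommRing R] [Algebra ℂ R] {M N : Type*} [AddCommGroup M] [Module ℂ M]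
  [AddCommGroup N] [Module ℂ N]

lemma pairLL_map (φ : M →ₗ[ℂ] N) (A : LL R) {B : ℤ → ℤ → M} (hB : Pairable B) :
    pairLL A (fun m p => φ (B m p)) = TensorProduct.map LinearMap.id φ (pairLL A B) := by
  refine Eq.trans (finsum_congr fun m => pairL_map φ (A.coeff m) (hB.2 m))
    ((TensorProduct.map LinearMap.id φ).toAddMonoidHom.map_finsum
      (finite_support_pairLL A hB)).symm

lemma pairLL_eq_sum {A : LL R} {F : ℤ → ℤ → M} {a b : ℤ}
    (hA : ∀ m p : ℤ, m < a ∨ p < a → (A.coeff m).coeff p = 0)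
    (hF : ∀ m p : ℤ, b ≤ m ∨ b ≤ p → F m p = 0) :
    pairLL A F = ∑ m ∈ Finset.Ico a b, ∑ p ∈ Finset.Ico a b,
      (A.coeff m).coeff p ⊗ₜ[ℂ] F m p := by
  have key : ∀ m p : ℤ, (A.coeff m).coeff p ⊗ₜ[ℂ] F m p ≠ 0 →
      m ∈ Finset.Ico a b ∧ p ∈ Finset.Ico a b := by
    intro m p h
    rw [Finset.mem_Ico, Finset.mem_Ico]
    by_contra hn
    by_cases h1 : m < a ∨ p < a
    · exact h (by rw [hA m p h1, TensorProduct.zero_tmul])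
    · exact h (by rw [hF m p (by omega), TensorProduct.tmul_zero])
  have h1 : ∀ m, pairL (A.coeff m) (F m) = ∑ p ∈ Finset.Ico a b, (A.coeff m).coeff p ⊗ₜ[ℂ] F m p :=
    fun m => finsum_eq_sum_of_support_subset _ fun p hp => (key m p hp).2
  rw [pairLL, finsum_congr h1]
  refine finsum_eq_sum_of_support_subset _ fun m hm => ?_
  obtain ⟨p, -, hp⟩ := Finset.exists_ne_zero_of_sum_ne_zero hm
  exact (key m p hp).1

lemma Swapped.pairLL_eq {A B : LL R} (h : Swapped A B) {F : ℤ → ℤ → M} {b : ℤ}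
    (hF : ∀ m p : ℤ, b ≤ m ∨ b ≤ p → F m p = 0) :
    pairLL A F = pairLL B fun p m => F m p := by
  obtain ⟨h, a, ha⟩ := h
  rw [pairLL_eq_sum ha hF, pairLL_eq_sum (fun p m hmp => (h m p).symm.trans (ha m p hmp.symm))
    (fun p m hmp => hF m p hmp.symm), Finset.sum_comm]
  exact Finset.sum_congr rfl fun p _ => Finset.sum_congr rfl fun m _ => by rw [h]

end PairLL

namespace TwoPoints

variable {V : Type*} [AddCommGroup V] [Module ℂ V] (𝒱 : GradedVertexAlgebra V) {τ : ℍ} {n : ℕ}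
  (P : TwoPoints n)

lemma resid_resid (i : Fin (n + 2)) (s : Option (Fin (n + 1))) (k : Fin (n + 1))
    (l : Option (Fin n)) (f : Gam τ (n + 2)) (t : Tens V (n + 2)) :
    resid 𝒱 k l (resid 𝒱 i s (f ⊗ₜ t)) = pairLL (mapL (expand k l) (expand i s f))
      fun m p => contract 𝒱 k l p (contract 𝒱 i s m t) := by
  rw [resid_tmul]
  exact ((resid 𝒱 k l).toAddMonoidHom.map_finsum
    (finite_support_pairL _ (eventuallyZero_contract 𝒱 i s t))).trans
      (finsum_congr fun m => resid_tmul 𝒱 k l _ _)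

/-- The factors of a pure tensor which do not belong to the two points. -/
def rest (c : Option (Fin (n + 2)) → V) : Option (Fin n) → V :=
  (c ∘ Option.map P.i.succAbove) ∘ Option.map P.k'.succAbove

lemma rest_swap {V : Type*} (P : TwoPoints n) (c : Option (Fin (n + 2)) → V) : P.swap.rest c = P.rest c := by
  funext o
  rcases o with _ | o
  · rfl
  · exact congrArg (fun x => c (some x)) (P.comm o).symm

lemma contract_contract (l l' : Option (Fin n)) (m p : ℤ) (c : Option (Fin (n + 2)) → V) :
    contract 𝒱 P.k' l' p (contract 𝒱 P.i (l.map P.k'.succAbove) m (pt c)) =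
      slot (Function.update (P.rest c) l (𝒱.prod m (c (some P.i)) (P.rest c l))) l'
        (𝒱.prod p (c (some P.k))
          (Function.update (P.rest c) l (𝒱.prod m (c (some P.i)) (P.rest c l)) l')) := by
  have e : contractFun 𝒱 P.i (l.map P.k'.succAbove) m c ∘ Option.map P.k'.succAbove =
      Function.update (P.rest c) l (𝒱.prod m (c (some P.i)) (P.rest c l)) := by
    rw [contractFun, update_map_comp_map]
    rfl
  have e' : contractFun 𝒱 P.i (l.map P.k'.succAbove) m c (some P.k') = c (some P.k) := by
    rw [contractFun, Function.update_of_ne (some_ne_map_succAbove _ _), ← P.hk]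
    rfl
  rw [contract_pt', contract_pt, e, e', ← e]
  rfl

lemma contract_contract_self (l : Option (Fin n)) (m p : ℤ) (c : Option (Fin (n + 2)) → V) :
    contract 𝒱 P.k' l p (contract 𝒱 P.i (l.map P.k'.succAbove) m (pt c)) =
      slot (P.rest c) l (𝒱.prod p (c (some P.k)) (𝒱.prod m (c (some P.i)) (P.rest c l))) := by
  rw [contract_contract, Function.update_self, slot_update]

lemma contract_contract_of_ne {l l' : Option (Fin n)} (h : l ≠ l') (m p : ℤ)
    (c : Option (Fin (n + 2)) → V) :
    contract 𝒱 P.k' l' p (contract 𝒱 P.i (l.map P.k'.succAbove) m (pt c)) =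
      pt (Function.update (Function.update (P.rest c) l (𝒱.prod m (c (some P.i)) (P.rest c l))) l'
        (𝒱.prod p (c (some P.k)) (P.rest c l'))) := by
  rw [contract_contract, Function.update_of_ne h.symm, slot_apply]

lemma contract_contract_nested (l : Option (Fin n)) (m p : ℤ) (c : Option (Fin (n + 2)) → V) :
    contract 𝒱 P.k' l p (contract 𝒱 P.i (some P.k') m (pt c)) =
      slot (P.rest c) l (𝒱.prod p (𝒱.prod m (c (some P.i)) (c (some P.k))) (P.rest c l)) := by
  have e : contractFun 𝒱 P.i (some P.k') m c ∘ Option.map P.k'.succAbove = P.rest c := by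
    rw [contractFun, update_some_comp_map]
    rfl
  have e' : contractFun 𝒱 P.i (some P.k') m c (some P.k') =
      𝒱.prod m (c (some P.i)) (c (some P.k)) := by
    rw [contractFun, Function.update_self, Option.map_some, P.hk]
  rw [contract_pt', contract_pt, e, e', ← e]
  rfl

/-- The Jacobi identity for iterated residues at the same centre. -/
lemma resid_jacobi (l : Option (Fin n)) (A : CTilde V τ (n + 2)) :
    resid 𝒱 P.k' l (resid 𝒱 P.i (l.map P.k'.succAbove) A) +
      resid 𝒱 P.k' l (resid 𝒱 P.i (some P.k') A) =
        resid 𝒱 P.i' l (resid 𝒱 P.k (l.map P.i'.succAbove) A) := by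
  refine LinearMap.congr_fun
    (f := resid 𝒱 P.k' l ∘ₗ resid 𝒱 P.i (l.map P.k'.succAbove) +
      resid 𝒱 P.k' l ∘ₗ resid 𝒱 P.i (some P.k'))
    (g := resid 𝒱 P.i' l ∘ₗ resid 𝒱 P.k (l.map P.i'.succAbove)) (hom_ext_pt fun f c => ?_) A
  -- The three iterated residues pair the three components of `expandTriple` with the three nested
  -- products in slot `l`.
  have hJ := jacobi_eq_zero 𝒱 (c (some P.i)) (c (some P.k)) (P.rest c l) (P.expandTriple_mem l f)
  have h1 := P.contract_contract_self 𝒱 l (c := c)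
  have h2 := P.swap.contract_contract_self 𝒱 l (c := c)
  have h3 := P.contract_contract_nested 𝒱 l (c := c)
  rw [rest_swap] at h2
  have hJ' := congrArg (TensorProduct.map LinearMap.id (slot (P.rest c) l)) hJ
  rw [jacobi, map_add, map_sub, map_zero, ← pairLL_map _ _ (pairable_left _ _ _ _),
    ← pairLL_map _ _ (pairable_left _ _ _ _), ← pairLL_map _ _ (pairable_right _ _ _ _)] at hJ'
  rw [LinearMap.add_apply, LinearMap.comp_apply, LinearMap.comp_apply, LinearMap.comp_apply,
    resid_resid, resid_resid, resid_resid]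
  have e1 := congrArg (pairLL (P.expandFree l l f)) (funext fun m => funext fun p => h1 m p)
  have e2 := congrArg (pairLL (P.swap.expandFree l l f)) (funext fun m => funext fun p => h2 m p)
  have e3 := congrArg (pairLL (P.expandNested l f)) (funext fun m => funext fun p => h3 m p)
  refine (congrArg₂ _ e1 e3).trans (Eq.trans ?_ e2.symm)
  rw [sub_add_eq_add_sub, sub_eq_zero] at hJ'
  exact hJ'

/-- Iterated residues at different centres commute. -/
lemma resid_comm {l l' : Option (Fin n)} (h : l ≠ l') (A : CTilde V τ (n + 2)) :
    resid 𝒱 P.k' l' (resid 𝒱 P.i (l.map P.k'.succAbove) A) =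
      resid 𝒱 P.i' l (resid 𝒱 P.k (l'.map P.i'.succAbove) A) := by
  refine LinearMap.congr_fun (f := resid 𝒱 P.k' l' ∘ₗ resid 𝒱 P.i (l.map P.k'.succAbove))
    (g := resid 𝒱 P.i' l ∘ₗ resid 𝒱 P.k (l'.map P.i'.succAbove)) (hom_ext_pt fun f c => ?_) A
  have h1 := P.contract_contract_of_ne 𝒱 h (c := c)
  have h2 := P.swap.contract_contract_of_ne 𝒱 h.symm (c := c)
  rw [rest_swap] at h2
  rw [LinearMap.comp_apply, LinearMap.comp_apply, resid_resid, resid_resid]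
  have e1 := congrArg (pairLL (P.expandFree l l' f)) (funext fun m => funext fun p => h1 m p)
  have e2 := congrArg (pairLL (P.swap.expandFree l' l f)) (funext fun m => funext fun p => h2 m p)
  refine e1.trans (Eq.trans ?_ e2.symm)
  obtain ⟨N, hN⟩ := 𝒱.field_property (c (some P.i)) (P.rest c l)
  obtain ⟨N', hN'⟩ := 𝒱.field_property (c (some P.k)) (P.rest c l')
  -- The two products act in different slots, and each vanishes when its own index is large. So the
  -- double sum is finite and its order can be exchanged along with that of the expansions.
  refine ((P.swapped l l' h f).pairLL_eq (b := max N N') fun m p hmp => ?_).trans ?_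
  · rcases hmp with hm | hp
    · rw [hN m (le_trans (le_max_left _ _) hm), Function.update_comm h, ← slot_apply, map_zero]
    · rw [hN' p (le_trans (le_max_right _ _) hp), ← slot_apply, map_zero]
  · exact congrArg _ (funext fun m => funext fun p => congrArg pt (Function.update_comm h _ _ _))

/-- The two points with the indices `i` and `i.succAbove k'`. -/
def of (i : Fin (n + 2)) (k' : Fin (n + 1)) : TwoPoints n where
  i := i
  k := i.succAbove k'
  i' := k'.predAbove i
  k' := k'
  hk := rfl
  hi := Fin.succAbove_succAbove_predAbove i k'
  comm a := (Fin.succAbove_succAbove_succAbove_predAbove i k' a).symm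

end TwoPoints

end ChiralHomology
namespace ChiralHomology

/-! ### The square of the differential -/

namespace TwoPoints

variable {n : ℕ}

lemma ext_of_eq {P Q : TwoPoints n} (h : P.i = Q.i) (h' : P.k' = Q.k') : P = Q := by
  obtain ⟨i, k, i', k', hk, hi, c⟩ := P
  obtain ⟨j, l, j', l', hk', hi', c'⟩ := Q
  dsimp only at h h'
  subst h h' hk hk'
  obtain rfl : i' = j' := Fin.succAbove_right_injective (hi.trans hi'.symm)
  rfl

/-- Weights depend only on relative order, which removing a third index preserves. -/
lemma weight_map (P : TwoPoints n) (l : Option (Fin n)) :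
    weight P.k' l = weight P.k (l.map P.i'.succAbove) := by
  rcases l with _ | a
  · rfl
  · have h : P.k' < P.k'.succAbove a ↔ P.k < P.k.succAbove (P.i'.succAbove a) := by
      rw [← P.comm, ← P.hk, Fin.succAbove_lt_succAbove_iff]
    rw [Option.map_some, weight, weight, Option.elim_some, Option.elim_some]
    exact if_congr h rfl rfl

lemma weight_some (P : TwoPoints n) : weight P.i (some P.k') = if P.i < P.k then 1 else 0 := by
  rw [weight, Option.elim_some, P.hk]

/-- By transitivity: if `i` precedes `k` and `k` precedes the centre, then `i` precedes the centre;
at the origin both weights are 1. -/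
lemma weight_mul (P : TwoPoints n) (h : P.i < P.k) (l : Option (Fin n)) :
    weight P.k' l * weight P.i (l.map P.k'.succAbove) = weight P.k' l := by
  rcases l with _ | a
  · exact mul_one _
  · have h' : weight P.k' (some a) = if P.k < P.i.succAbove (P.k'.succAbove a) then 1 else 0 := by
      rw [weight_map, Option.map_some, weight, Option.elim_some, P.comm]
    rw [h', Option.map_some, weight, Option.elim_some]
    split_ifs with h1 h2
    · exact mul_one _
    · exact absurd (h.trans h1) h2
    · exact zero_mul _
    · exact zero_mul _

variable {V : Type*} [AddCommGroup V] [Module ℂ V] (𝒱 : GradedVertexAlgebra V) {τ : ℍ}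
  (P : TwoPoints n)

/-- The sum of the iterated residues, first of `xᵢ` and then of `xₖ`. -/
def iteratedResid (A : CTilde V τ (n + 2)) : CTilde V τ n :=
  ∑ l : Option (Fin n), ∑ s : Option (Fin (n + 1)),
    (weight P.k' l * weight P.i s) • resid 𝒱 P.k' l (resid 𝒱 P.i s A)

lemma sum_option_succAbove {M : Type*} [AddCommMonoid M] (k : Fin (n + 1))
    (g : Option (Fin (n + 1)) → M) :
    ∑ s, g s = g (some k) + ∑ l : Option (Fin n), g (l.map k.succAbove) := by
  rw [Fintype.sum_option, Fintype.sum_option, Fin.sum_univ_succAbove _ k, add_left_comm]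
  rfl

lemma iteratedResid_eq (A : CTilde V τ (n + 2)) : P.iteratedResid 𝒱 A =
    ∑ l : Option (Fin n), ((weight P.k' l * weight P.i (some P.k')) •
      resid 𝒱 P.k' l (resid 𝒱 P.i (some P.k') A) +
        ∑ l' : Option (Fin n), (weight P.k' l * weight P.i (l'.map P.k'.succAbove)) •
          resid 𝒱 P.k' l (resid 𝒱 P.i (l'.map P.k'.succAbove) A)) :=
  Finset.sum_congr rfl fun _ _ => sum_option_succAbove P.k' _

/-- The nested residue of `xᵢ` at `xₖ` occurs only on the side where the smaller index is integrated
first. Terms with two different centres agree by `resid_comm`. For a common centre, `resid_jacobi`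
says that the nested term is the difference of the two orders, and the weights agree by
`weight_mul`. -/
lemma iteratedResid_swap_of_lt (h : P.i < P.k) (A : CTilde V τ (n + 2)) :
    P.iteratedResid 𝒱 A = P.swap.iteratedResid 𝒱 A := by
  rw [iteratedResid_eq, iteratedResid_eq, Finset.sum_add_distrib, Finset.sum_add_distrib,
    weight_some, weight_some, if_pos h, 
    if_neg (show ¬P.swap.i < P.swap.k from not_lt_of_gt h)]
  simp only [mul_one, mul_zero, zero_smul, Finset.sum_const_zero, zero_add]
  rw [Finset.sum_comm (s := Finset.univ) (t := Finset.univ)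
    (f := fun l l' : Option (Fin n) => (weight P.swap.k' l *
      weight P.swap.i (l'.map P.swap.k'.succAbove)) •
        resid 𝒱 P.swap.k' l (resid 𝒱 P.swap.i (l'.map P.swap.k'.succAbove) A)),
    ← Finset.sum_add_distrib]
  refine Finset.sum_congr rfl fun l _ => ?_
  rw [← eq_sub_iff_add_eq, ← Finset.sum_sub_distrib, Finset.sum_eq_single l]
  · have e1 := P.resid_jacobi 𝒱 l A
    have e2 := P.swap.weight_map l
    have e3 := P.weight_map l
    have e4 := P.weight_mul h l
    change _ = (weight P.i' l * weight P.k (l.map P.i'.succAbove)) •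
      resid 𝒱 P.i' l (resid 𝒱 P.k (l.map P.i'.succAbove) A) - _
    change weight P.i' l = weight P.i (l.map P.k'.succAbove) at e2
    rw [← e1, e2, ← e3, mul_comm (weight P.i _), ← smul_sub, add_sub_cancel_left, e4]
  · intro l' _ hl
    have e1 := P.resid_comm 𝒱 hl A
    have e2 := P.swap.weight_map l'
    have e3 := P.weight_map l
    change (weight P.i' l' * weight P.k (l.map P.i'.succAbove)) •
      resid 𝒱 P.i' l' (resid 𝒱 P.k (l.map P.i'.succAbove) A) - _ = 0
    change weight P.i' l' = weight P.i (l'.map P.k'.succAbove) at e2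
    rw [← e1, e2, ← e3, mul_comm (weight P.i _), sub_self]
  · exact fun h => absurd (Finset.mem_univ _) h

lemma iteratedResid_swap (A : CTilde V τ (n + 2)) :
    P.swap.iteratedResid 𝒱 A = P.iteratedResid 𝒱 A := by
  rcases lt_or_gt_of_ne P.ne with h | h
  · exact (P.iteratedResid_swap_of_lt 𝒱 h A).symm
  · exact P.swap.iteratedResid_swap_of_lt 𝒱 h A

end TwoPoints

section Square

variable {V : Type*} [AddCommGroup V] [Module ℂ V] (𝒱 : GradedVertexAlgebra V) {τ : ℍ} {n : ℕ}

lemma neg_one_pow_sub {k : ℕ} (h : k ≤ n) : (-1 : ℂ) ^ (n - k) = (-1) ^ (n + k) := by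
  obtain ⟨m, rfl⟩ := Nat.exists_eq_add_of_le h
  rw [Nat.add_sub_cancel_left, add_right_comm, pow_add, Even.neg_one_pow ⟨k, rfl⟩, one_mul]

/-- The sign of the iterated residue, first of the `i`-th variable and then of the `k`-th one of the
remaining variables. -/
def iteratedSign (x : Fin (n + 2) × Fin (n + 1)) : ℂ :=
  (-1) ^ (n - (x.2 : ℕ)) * (-1) ^ (n + 1 - (x.1 : ℕ))

lemma iteratedSign_eq (i : Fin (n + 2)) (k : Fin (n + 1)) :
    iteratedSign (i, k) = -(-1) ^ (i + k : ℕ) := by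
  rw [iteratedSign, neg_one_pow_sub (Nat.lt_succ_iff.mp k.2), neg_one_pow_sub (Nat.lt_succ_iff.mp i.2),
    ← pow_add, show n + (k : ℕ) + (n + 1 + i) = (n + n) + ((i + k) + 1) by ring, pow_add,
    Even.neg_one_pow ⟨n, rfl⟩, one_mul, pow_succ, mul_neg_one]

lemma diff_apply (A : CTilde V τ (n + 1)) : diff 𝒱 τ n A = ∑ i : Fin (n + 1),
    ∑ s : Option (Fin n), ((-1 : ℂ) ^ (n - (i : ℕ)) * weight i s) • resid 𝒱 i s A := by
  rw [diff, LinearMap.sum_apply]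
  refine Finset.sum_congr rfl fun i _ => ?_
  rw [LinearMap.sum_apply]
  rfl

lemma diff_diff_apply (A : CTilde V τ (n + 2)) : diff 𝒱 τ n (diff 𝒱 τ (n + 1) A) =
    ∑ x : Fin (n + 2) × Fin (n + 1),
      iteratedSign x • (TwoPoints.of x.1 x.2).iteratedResid 𝒱 A := by
  rw [Fintype.sum_prod_type_right, diff_apply, diff_apply]
  refine Finset.sum_congr rfl fun k _ => ?_
  have h : ∀ i : Fin (n + 2), iteratedSign (i, k) • (TwoPoints.of i k).iteratedResid 𝒱 A =
      ∑ l : Option (Fin n), ∑ s : Option (Fin (n + 1)), (iteratedSign (i, k) *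
        (weight k l * weight i s)) • resid 𝒱 k l (resid 𝒱 i s A) := by
    intro i
    rw [TwoPoints.iteratedResid, Finset.smul_sum]
    refine Finset.sum_congr rfl fun l _ => ?_
    rw [Finset.smul_sum]
    exact Finset.sum_congr rfl fun s _ => smul_smul _ _ _
  refine Eq.trans ?_ (Finset.sum_congr rfl fun i _ => h i).symm
  refine Eq.trans ?_ Finset.sum_comm
  refine Finset.sum_congr rfl fun l _ => ?_
  rw [map_sum, Finset.smul_sum]
  refine Finset.sum_congr rfl fun i _ => ?_
  rw [map_sum, Finset.smul_sum]
  refine Finset.sum_congr rfl fun s _ => ?_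
  rw [LinearMap.map_smul, smul_smul, iteratedSign]
  congr 1
  ring

theorem diff_diff (A : CTilde V τ (n + 2)) : diff 𝒱 τ n (diff 𝒱 τ (n + 1) A) = 0 := by
  rw [diff_diff_apply]
  have hof : ∀ x : Fin (n + 2) × Fin (n + 1),
      TwoPoints.of (x.1.succAbove x.2) (x.2.predAbove x.1) = (TwoPoints.of x.1 x.2).swap :=
    fun x => TwoPoints.ext_of_eq rfl rfl
  -- Integrating the same two points in the other order gives the same iterated residue with the
  -- opposite sign.
  refine Finset.sum_involution
    (fun (x : Fin (n + 2) × Fin (n + 1)) _ => (x.1.succAbove x.2, x.2.predAbove x.1))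
    (fun x _ => ?_) (fun x _ _ h => ?_) (fun _ _ => Finset.mem_univ _) (fun x _ => ?_)
  · obtain ⟨i, k⟩ := x
    have h := hof (i, k)
    dsimp only at h ⊢
    rw [h, TwoPoints.iteratedResid_swap, iteratedSign_eq, iteratedSign_eq,
      Fin.neg_one_pow_succAbove_add_predAbove, neg_neg, ← add_smul, neg_add_cancel, zero_smul]
  · exact Fin.succAbove_ne _ _ (congrArg Prod.fst h)
  · exact Prod.ext (congrArg TwoPoints.k (hof x)) (congrArg TwoPoints.i' (hof x))

end Square
end ChiralHomology
namespace ChiralHomology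

/-! ### The residues and the permutations -/

section Permutations

variable {V : Type*} [AddCommGroup V] [Module ℂ V] (𝒱 : GradedVertexAlgebra V) {τ : ℍ} {n : ℕ}

/-- The sign of a permutation as a complex number. -/
def signC (σ : Equiv.Perm (Fin n)) : ℂ := ((Equiv.Perm.sign σ : ℤ) : ℂ)

lemma signC_mul_self (σ : Equiv.Perm (Fin n)) : signC σ * signC σ = 1 := by
  rw [signC, ← Int.cast_mul, ← Units.val_mul, Int.units_mul_self, Units.val_one, Int.cast_one]

lemma permTilde_pt (σ : Equiv.Perm (Fin n)) (f : Gam τ n) (c : Option (Fin n) → V) :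
    permTilde V τ σ (f ⊗ₜ pt c) =
      signC σ • (pull τ σ.toEmbedding f ⊗ₜ[ℂ] pt (c ∘ Option.map σ.symm)) :=
  permTilde_elt τ σ f (fun k => c (some k)) (c none)

/-- Relabelling carries the integrated point, its centre and the other points along. Only the signs
of `σ` and of the permutation it induces on the remaining indices have to be compared. -/
lemma resid_permTilde {σ : Equiv.Perm (Fin (n + 1))} {σ' : Equiv.Perm (Fin n)}
    {i i' : Fin (n + 1)} (hi : σ i = i') (h : ∀ a, σ (i.succAbove a) = i'.succAbove (σ' a))
    (s : Option (Fin n)) (A : CTilde V τ (n + 1)) :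
    resid 𝒱 i' (s.map σ') (permTilde V τ σ A) =
      (signC σ * signC σ') • permTilde V τ σ' (resid 𝒱 i s A) := by
  refine LinearMap.congr_fun (f := resid 𝒱 i' (s.map σ') ∘ₗ permTilde V τ σ)
    (g := (signC σ * signC σ') • (permTilde V τ σ' ∘ₗ resid 𝒱 i s))
    (hom_ext_pt fun f c => ?_) A
  have hsymm : ∀ a, σ.symm (i'.succAbove a) = i.succAbove (σ'.symm a) := fun a => by
    rw [Equiv.symm_apply_eq, h, Equiv.apply_symm_apply]
  have hsymm' : ∀ o : Option (Fin n), (o.map i'.succAbove).map σ.symm =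
      (o.map σ'.symm).map i.succAbove := fun o => by
    rcases o with _ | a
    · rfl
    · exact congrArg some (hsymm a)
  have hs : (s.map σ').map σ'.symm = s := by
    rcases s with _ | a
    · rfl
    · exact congrArg some (σ'.symm_apply_apply a)
  have hinj : Function.Injective (Option.map σ'.symm) := Option.map_injective σ'.symm.injective
  have e1 : ∀ m, contract 𝒱 i' (s.map σ') m (pt (c ∘ Option.map σ.symm)) =
      pt (contractFun 𝒱 i s m c ∘ Option.map σ'.symm) := by
    intro m
    rw [contract_pt', contractFun, contractFun]
    congr 1
    have e2 : (c ∘ Option.map σ.symm) ∘ Option.map i'.succAbove =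
        (c ∘ Option.map i.succAbove) ∘ Option.map σ'.symm := funext fun o => congrArg c (hsymm' o)
    have e3 : (c ∘ Option.map σ.symm) (some i') = c (some i) := by
      rw [Function.comp_apply, Option.map_some, ← hi, Equiv.symm_apply_apply]
    have e4 : (c ∘ Option.map σ.symm) ((s.map σ').map i'.succAbove) = c (s.map i.succAbove) := by
      rw [Function.comp_apply, hsymm', hs]
    rw [e2, e3, e4]
    have e7 := Function.update_comp_eq_of_injective (c ∘ Option.map i.succAbove) hinj (s.map σ')
      (𝒱.prod m (c (some i)) (c (s.map i.succAbove)))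
    rw [hs] at e7
    exact e7.symm
  have e5 : expand i' (s.map σ') (pull τ σ.toEmbedding f) =
      mapL (pull τ σ'.toEmbedding : Gam τ n →+* Gam τ n) (expand i s f) :=
    expand_pull (ι := σ.toEmbedding) (ι' := σ'.toEmbedding) hi h s f
  have hfin := finite_support_pairL (expand i s f) (eventuallyZero_contract 𝒱 i s (pt c))
  rw [LinearMap.comp_apply, LinearMap.smul_apply, LinearMap.comp_apply, permTilde_pt,
    LinearMap.map_smul, resid_tmul, resid_tmul, e5, mul_smul]
  congr 1
  refine Eq.trans ?_ (congrArg _ ((permTilde V τ σ').toAddMonoidHom.map_finsum hfin).symm)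
  have e6 : ∀ m, permTilde V τ σ' ((expand i s f).coeff m ⊗ₜ contract 𝒱 i s m (pt c)) =
      signC σ' • ((mapL (pull τ σ'.toEmbedding : Gam τ n →+* Gam τ n) (expand i s f)).coeff m ⊗ₜ
        contract 𝒱 i' (s.map σ') m (pt (c ∘ Option.map σ.symm))) := fun m => by
    rw [contract_pt', permTilde_pt, e1]
    rfl
  refine Eq.trans ?_ (congrArg _ (finsum_congr e6).symm)
  rw [← smul_finsum' _ (finite_support_pairL _ (eventuallyZero_contract 𝒱 i' _ _)), smul_smul,
    signC_mul_self, one_smul]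
  rfl

end Permutations

/-! ### Skew symmetry of the residues -/

section SkewSymmetry

variable {V : Type*} [AddCommGroup V] [Module ℂ V] (𝒱 : GradedVertexAlgebra V) {τ : ℍ} {n : ℕ}

/-- The class of `f ⊗ t` modulo the total derivatives, where the factor of `t` at `i` varies. -/
def slotClass (c : Option (Fin n) → V) (i : Fin n) (f : Gam τ n) : V →ₗ[ℂ] Chain 𝒱 τ n :=
  (totalDerivs 𝒱 τ n).mkQ ∘ₗ TensorProduct.mk ℂ _ _ f ∘ₗ slot c (some i)

lemma slotClass_apply (c : Option (Fin n) → V) (i : Fin n) (f : Gam τ n) (x : V) :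
    slotClass 𝒱 c i f x = (totalDerivs 𝒱 τ n).mkQ (f ⊗ₜ slot c (some i) x) := rfl

lemma slotClass_smul (c : Option (Fin n) → V) (i : Fin n) (r : ℂ) (f : Gam τ n) (x : V) :
    slotClass 𝒱 c i (r • f) x = r • slotClass 𝒱 c i f x := by
  rw [slotClass_apply, slotClass_apply, ← TensorProduct.smul_tmul', map_smul]

lemma slotClass_zero (c : Option (Fin n) → V) (i : Fin n) (x : V) :
    slotClass 𝒱 c i (0 : Gam τ n) x = 0 := by
  rw [slotClass_apply, TensorProduct.zero_tmul, map_zero]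

lemma slotClass_sum {ι : Type*} (c : Option (Fin n) → V) (i : Fin n) (S : Finset ι)
    (f : ι → Gam τ n) (x : V) :
    slotClass 𝒱 c i (∑ m ∈ S, f m) x = ∑ m ∈ S, slotClass 𝒱 c i (f m) x := by
  simp only [slotClass_apply, TensorProduct.sum_tmul, map_sum]

/-- Integration by parts in the quotient: a derivative of the function becomes minus the translation
operator on the factor. -/
lemma slotClass_pd (c : Option (Fin n) → V) (i : Fin n) (f : Gam τ n) (x : V) :
    slotClass 𝒱 c i (pd τ i f) x = -slotClass 𝒱 c i f (𝒱.translation x) := by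
  have h : (totalDerivs 𝒱 τ n).mkQ
      (totalDeriv 𝒱 τ i (f ⊗ₜ pt (Function.update c (some i) x))) = 0 :=
    (Submodule.Quotient.mk_eq_zero _).mpr (Submodule.mem_iSup_of_mem i ⟨_, rfl⟩)
  rw [totalDeriv_pt, map_add, Function.update_self, slot_update] at h
  exact eq_neg_of_add_eq_zero_left h

lemma slotClass_pd_pow (c : Option (Fin n) → V) (i : Fin n) (j : ℕ) (f : Gam τ n) (x : V) :
    slotClass 𝒱 c i ((pd τ i ^ j) f) x =
      (-1 : ℂ) ^ j • slotClass 𝒱 c i f ((𝒱.translation ^ j) x) := by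
  induction j generalizing x with
  | zero => rw [pow_zero, pow_zero, pow_zero, one_smul]; rfl
  | succ j ih =>
    rw [pow_succ', Module.End.mul_apply, slotClass_pd, ih, pow_succ (𝒱.translation), pow_succ' (-1 : ℂ),
      Module.End.mul_apply, neg_one_mul, neg_smul]

lemma slotClass_divPow (c : Option (Fin n) → V) (i : Fin n) (j : ℕ) (f : Gam τ n) (x : V) :
    slotClass 𝒱 c i (divPow (pd τ i) j f) x =
      slotClass 𝒱 c i f (((-1 : ℂ) ^ j * (j.factorial : ℂ)⁻¹) • (𝒱.translation ^ j) x) := by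
  rw [divPow_natCast, LinearMap.smul_apply, slotClass_smul, slotClass_pd_pow, LinearMap.map_smul,
    smul_smul, mul_comm]

/-- The form of skew symmetry `∑ₖ (D^{k - m} f / (k - m)!) ⊗ b_(k) a ≡ -(-1)ᵐ f ⊗ a_(m) b`. -/
lemma sum_slotClass_divPow (c : Option (Fin n) → V) (i : Fin n) (f : Gam τ n) (a b : V) {M N m : ℤ}
    (hm : M ≤ m) (hN : ∀ k, N ≤ k → 𝒱.prod k b a = 0) :
    ∑ k ∈ Finset.Ico M N, slotClass 𝒱 c i ((-1 : ℂ) ^ m • divPow (pd τ i) (k - m) f)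
      (𝒱.prod k b a) = -slotClass 𝒱 c i f (𝒱.prod m a b) := by
  have h0 : ∀ k, k < m → divPow (pd τ i) (k - m) f = 0 := fun k hk => by
    rw [divPow_of_neg _ (by omega), LinearMap.zero_apply]
  have hfin : (Function.support fun j : ℕ => ((-1 : ℂ) ^ j * (j.factorial : ℂ)⁻¹) •
      (𝒱.translation ^ j) (𝒱.prod (m + j) b a)).Finite := by
    refine (Set.finite_Iio (N - m).toNat).subset fun j hj => ?_
    rw [Set.mem_Iio]
    by_contra h
    exact hj (by beta_reduce; rw [hN _ (by omega), map_zero, smul_zero])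
  -- Integrating by parts k - m times turns the divided powers of ∂ into those of -T, and the sum
  -- over k ≥ m is the series in the skew-symmetry formula.
  have e : ∑ k ∈ Finset.Ico M N, slotClass 𝒱 c i (divPow (pd τ i) (k - m) f) (𝒱.prod k b a) =
      slotClass 𝒱 c i f (∑ᶠ j : ℕ, ((-1 : ℂ) ^ j * (j.factorial : ℂ)⁻¹) •
        (𝒱.translation ^ j) (𝒱.prod (m + j) b a)) := by
    refine Eq.trans ?_ ((slotClass 𝒱 c i f).toAddMonoidHom.map_finsum hfin).symm
    rw [← finsum_eq_sum_of_support_subset, finsum_shift _ m]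
    · refine finsum_congr fun j => ?_
      rw [add_sub_cancel_left, slotClass_divPow]
      rfl
    · intro k hk
      rw [h0 k hk, slotClass_zero]
    · intro k hk
      rw [Finset.coe_Ico, Set.mem_Ico]
      by_contra h
      rw [not_and_or, not_le, not_lt] at h
      refine hk ?_
      beta_reduce
      rcases h with h | h
      · rw [h0 k (by omega), slotClass_zero]
      · rw [hN k h, map_zero]
  simp only [slotClass_smul]
  rw [← Finset.smul_sum, e, 𝒱.prod_skew, map_neg, map_smul, neg_neg]

lemma slot_congr {c c' : Option (Fin n) → V} {s : Option (Fin n)} (h : ∀ o, o ≠ s → c o = c' o) :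
    slot c s = slot c' s := by
  refine LinearMap.ext fun x => congrArg pt (funext fun o => ?_)
  by_cases ho : o = s
  · subst ho
    rw [Function.update_self, Function.update_self]
  · rw [Function.update_of_ne ho, Function.update_of_ne ho, h o ho]

lemma slot_succ (i : Fin (n + 1)) (c : Option (Fin (n + 2)) → V) :
    slot (c ∘ Option.map i.succ.succAbove) (some i) =
      slot (c ∘ Option.map i.castSucc.succAbove) (some i) := by
  refine slot_congr fun o ho => ?_
  rcases o with _ | a
  · rfl
  · have ha : a ≠ i := fun e => ho (congrArg some e)
    have h : i.succ.succAbove a = i.castSucc.succAbove a := by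
      rw [← moved_of_ne i.succ ha, ← skip_castSucc, Fin.coe_succAboveEmb]
    rw [Function.comp_apply, Function.comp_apply, Option.map_some, Option.map_some, h]

lemma mkQ_pairL {i : Fin n} {c : Option (Fin n) → V} (A : LaurentSeries (Gam τ n)) (v : ℤ → V)
    {M N : ℤ} (hM : ∀ m < M, A.coeff m = 0) (hN : ∀ m, N ≤ m → v m = 0) :
    (totalDerivs 𝒱 τ n).mkQ (pairL A fun m => slot c (some i) (v m)) =
      ∑ m ∈ Finset.Ico M N, slotClass 𝒱 c i (A.coeff m) (v m) := by
  rw [pairL, finsum_eq_sum_of_support_subset (s := Finset.Ico M N), map_sum]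
  · rfl
  · intro m hm
    rw [Finset.coe_Ico, Set.mem_Ico]
    by_contra h
    rw [not_and_or, not_le, not_lt] at h
    refine hm ?_
    rcases h with h | h
    · beta_reduce
      rw [hM m h, TensorProduct.zero_tmul]
    · beta_reduce
      rw [hN m h, map_zero, TensorProduct.tmul_zero]

lemma castSucc_succAbove_self (i : Fin n) : i.castSucc.succAbove i = i.succ :=
  Fin.ext (by rw [val_succAbove, Fin.val_castSucc, if_neg (lt_irrefl _), Fin.val_succ])

lemma succ_succAbove_self (i : Fin n) : i.succ.succAbove i = i.castSucc :=
  Fin.ext (by rw [val_succAbove, Fin.val_succ, if_pos (Nat.lt_succ_self _), Fin.val_castSucc])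

/-- Up to total derivatives, the residue of `xᵢ` at `xᵢ₊₁` is minus the residue of `xᵢ₊₁` at `xᵢ`. -/
theorem mkQ_resid_succ (i : Fin (n + 1)) (A : CTilde V τ (n + 2)) :
    (totalDerivs 𝒱 τ (n + 1)).mkQ (resid 𝒱 i.succ (some i) A) =
      -(totalDerivs 𝒱 τ (n + 1)).mkQ (resid 𝒱 i.castSucc (some i) A) := by
  refine LinearMap.congr_fun (f := (totalDerivs 𝒱 τ (n + 1)).mkQ ∘ₗ resid 𝒱 i.succ (some i))
    (g := -((totalDerivs 𝒱 τ (n + 1)).mkQ ∘ₗ resid 𝒱 i.castSucc (some i)))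
    (hom_ext_pt fun f c => ?_) A
  have ha : i.succ.succAbove i = i.castSucc := succ_succAbove_self i
  have hb : i.castSucc.succAbove i = i.succ := castSucc_succAbove_self i
  have h1 : ∀ m, contract 𝒱 i.castSucc (some i) m (pt c) =
      slot (c ∘ Option.map i.castSucc.succAbove) (some i)
        (𝒱.prod m (c (some i.castSucc)) (c (some i.succ))) := fun m => by
    rw [contract_pt, Option.map_some, hb]
  have h2 : ∀ m, contract 𝒱 i.succ (some i) m (pt c) =
      slot (c ∘ Option.map i.castSucc.succAbove) (some i)
        (𝒱.prod m (c (some i.succ)) (c (some i.castSucc))) := fun m => by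
    rw [contract_pt, Option.map_some, ha, slot_succ]
  obtain ⟨M, hM⟩ := exists_coeff_eq_zero (expand i.castSucc (some i) f)
  obtain ⟨N, hN⟩ := 𝒱.field_property (c (some i.castSucc)) (c (some i.succ))
  obtain ⟨N', hN'⟩ := 𝒱.field_property (c (some i.succ)) (c (some i.castSucc))
  have hN1 : ∀ k, max N N' ≤ k → 𝒱.prod k (c (some i.castSucc)) (c (some i.succ)) = 0 :=
    fun k hk => hN k (le_trans (le_max_left _ _) hk)
  have hN2 : ∀ k, max N N' ≤ k → 𝒱.prod k (c (some i.succ)) (c (some i.castSucc)) = 0 :=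
    fun k hk => hN' k (le_trans (le_max_right _ _) hk)
  -- Both residues are expressed by the coefficients of one expansion. For each fixed coefficient,
  -- the sum over k is then evaluated by skew-symmetry.
  have hB : ∀ k, (expand i.succ (some i) f).coeff k = ∑ m ∈ Finset.Icc M k,
      ((-1 : ℂ) ^ m) • divPow (pd τ i) (k - m) ((expand i.castSucc (some i) f).coeff m) :=
    fun k => (expand_succ_eq_skewSum i f k).trans (skewSum_eq _ hM k)
  have hM' : ∀ k < M, (expand i.succ (some i) f).coeff k = 0 := fun k hk => by
    rw [hB, Finset.Icc_eq_empty (by omega), Finset.sum_empty]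
  -- The range is enlarged to one independent of `k`, so that the two sums can be interchanged; the
  -- additional terms are divided powers of negative order, hence zero.
  have hB' : ∀ k ∈ Finset.Ico M (max N N'), (expand i.succ (some i) f).coeff k =
      ∑ m ∈ Finset.Ico M (max N N'),
        ((-1 : ℂ) ^ m) • divPow (pd τ i) (k - m) ((expand i.castSucc (some i) f).coeff m) := by
    intro k hk
    rw [Finset.mem_Ico] at hk
    rw [hB]
    refine Finset.sum_subset (fun m hm => ?_) fun m hm hm' => ?_
    · rw [Finset.mem_Icc] at hm
      exact Finset.mem_Ico.mpr (by omega)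
    · rw [Finset.mem_Icc] at hm'
      rw [Finset.mem_Ico] at hm
      rw [divPow_of_neg _ (by omega), LinearMap.zero_apply, smul_zero]
  rw [LinearMap.neg_apply, LinearMap.comp_apply, LinearMap.comp_apply, resid_tmul, resid_tmul,
    funext h1, funext h2, mkQ_pairL 𝒱 _ _ hM hN1, mkQ_pairL 𝒱 _ _ hM' hN2, ← Finset.sum_neg_distrib,
    Finset.sum_congr rfl fun k hk => by rw [hB' k hk, slotClass_sum], Finset.sum_comm]
  exact Finset.sum_congr rfl fun m hm =>
    sum_slotClass_divPow 𝒱 _ i _ _ _ (Finset.mem_Ico.mp hm).1 hN2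

end SkewSymmetry
end ChiralHomology
namespace ChiralHomology

/-! ### The differential on the coinvariants -/

section Coinvariance

variable {V : Type*} [AddCommGroup V] [Module ℂ V] (𝒱 : GradedVertexAlgebra V) {τ : ℍ} {n : ℕ}

/-- The quotient map from `C̃ₙ` to the coinvariants `Qₙ`. -/
def toUnordered (τ : ℍ) (n : ℕ) : CTilde V τ n →ₗ[ℂ] Unordered 𝒱 τ n :=
  Representation.Coinvariants.mk (rep 𝒱 τ n) ∘ₗ (totalDerivs 𝒱 τ n).mkQ

lemma toUnordered_permTilde (σ : Equiv.Perm (Fin n)) (A : CTilde V τ n) :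
    toUnordered 𝒱 τ n (permTilde V τ σ A) = toUnordered 𝒱 τ n A :=
  Representation.Coinvariants.mk_self_apply (rep 𝒱 τ n) σ ((totalDerivs 𝒱 τ n).mkQ A)

lemma toUnordered_resid_succ (i : Fin (n + 1)) (A : CTilde V τ (n + 2)) :
    toUnordered 𝒱 τ (n + 1) (resid 𝒱 i.succ (some i) A) =
      -toUnordered 𝒱 τ (n + 1) (resid 𝒱 i.castSucc (some i) A) := by
  rw [toUnordered, LinearMap.comp_apply, mkQ_resid_succ, map_neg]
  rfl

lemma signC_swap {i j : Fin n} (h : i ≠ j) : signC (Equiv.swap i j) = -1 := by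
  rw [signC, Equiv.Perm.sign_swap h, Units.val_neg, Units.val_one, Int.cast_neg, Int.cast_one]

lemma signC_one : signC (1 : Equiv.Perm (Fin n)) = 1 := by
  rw [signC, Equiv.Perm.sign_one, Units.val_one, Int.cast_one]

lemma swap_succAbove_castSucc (j a : Fin n) :
    Equiv.swap j.castSucc j.succ (j.castSucc.succAbove a) = j.succ.succAbove a := by
  rw [Equiv.swap_apply_def]
  have h1 := val_succAbove j.castSucc a
  have h2 := val_succAbove j.succ a
  rw [Fin.val_castSucc] at h1
  rw [Fin.val_succ] at h2
  simp only [Fin.ext_iff, h1, Fin.val_castSucc, Fin.val_succ]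
  split_ifs at * <;> (try simp only [Fin.val_castSucc, Fin.val_succ]) <;> omega

/-- The permutation of the remaining indices which is induced by the transposition of two adjacent
indices. -/
lemma exists_induced_perm (j : Fin n) (i : Fin (n + 1)) : ∃ σ' : Equiv.Perm (Fin n),
    (∀ a, Equiv.swap j.castSucc j.succ (i.succAbove a) =
      (Equiv.swap j.castSucc j.succ i).succAbove (σ' a)) ∧
    (-1 : ℂ) ^ (n - (Equiv.swap j.castSucc j.succ i : ℕ)) *
      (signC (Equiv.swap j.castSucc j.succ) * signC σ') = (-1) ^ (n - (i : ℕ)) := by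
  have hne : j.castSucc ≠ j.succ := (Fin.castSucc_lt_succ).ne
  have hpow : (-1 : ℂ) ^ (n - (j.castSucc : ℕ)) = -(-1) ^ (n - (j.succ : ℕ)) := by
    rw [Fin.val_castSucc, Fin.val_succ, show n - (j : ℕ) = (n - (j + 1)) + 1 by omega, pow_succ,
      mul_neg_one]
  by_cases h1 : i = j.castSucc
  · subst h1
    refine ⟨1, fun a => ?_, ?_⟩
    · rw [Equiv.swap_apply_left, swap_succAbove_castSucc, Equiv.Perm.one_apply]
    · rw [Equiv.swap_apply_left, signC_swap hne, signC_one, hpow]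
      ring
  by_cases h2 : i = j.succ
  · subst h2
    refine ⟨1, fun a => ?_, ?_⟩
    · rw [Equiv.swap_apply_right, ← swap_succAbove_castSucc, Equiv.swap_apply_self,
        Equiv.Perm.one_apply]
    · rw [Equiv.swap_apply_right, signC_swap hne, signC_one, hpow]
      ring
  obtain ⟨a, ha⟩ := Fin.exists_succAbove_eq (Ne.symm h1)
  obtain ⟨b, hb⟩ := Fin.exists_succAbove_eq (Ne.symm h2)
  have hab : a ≠ b := fun e => hne (by rw [← ha, ← hb, e])
  refine ⟨Equiv.swap a b, fun c => ?_, ?_⟩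
  · rw [Equiv.swap_apply_of_ne_of_ne h1 h2, ← ha, ← hb,
      Fin.succAbove_right_injective.swap_apply]
  · rw [Equiv.swap_apply_of_ne_of_ne h1 h2, signC_swap hne, signC_swap hab]
    ring

/-- Exchanging two adjacent indices reverses the order of no pair other than these two. -/
lemma weight_swap {σ' : Equiv.Perm (Fin n)} {j : Fin n} {i : Fin (n + 1)}
    (h : ∀ a, Equiv.swap j.castSucc j.succ (i.succAbove a) =
      (Equiv.swap j.castSucc j.succ i).succAbove (σ' a)) (s : Option (Fin n))
    (h1 : ¬(i = j.castSucc ∧ s = some j)) (h2 : ¬(i = j.succ ∧ s = some j)) :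
    weight (Equiv.swap j.castSucc j.succ i) (s.map σ') = weight i s := by
  rcases s with _ | a
  · rfl
  rw [Option.map_some, weight, weight, Option.elim_some, Option.elim_some, ← h]
  refine if_congr ?_ rfl rfl
  rw [Option.some_inj] at h1 h2
  have hv := val_succAbove i a
  rw [Equiv.swap_apply_def, Equiv.swap_apply_def]
  simp only [Fin.ext_iff, Fin.lt_def, Fin.val_castSucc, Fin.val_succ, hv] at h1 h2 ⊢
  split_ifs at * <;> simp only [Fin.val_castSucc, Fin.val_succ, hv] <;> omega

/-- In the coinvariants the transposition acts on residues by relabelling alone, with signs that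
match those of the differential. Only the weights of the two residues between the exchanged points
change, and these two changes cancel by skew-symmetry. -/
lemma toUnordered_diff_swap (j : Fin n) (A : CTilde V τ (n + 1)) :
    toUnordered 𝒱 τ n (diff 𝒱 τ n (permTilde V τ (Equiv.swap j.castSucc j.succ) A)) =
      toUnordered 𝒱 τ n (diff 𝒱 τ n A) := by
  choose σ' hσ hsign using exists_induced_perm j
  have hdiff : ∀ B : CTilde V τ (n + 1), toUnordered 𝒱 τ n (diff 𝒱 τ n B) =
      ∑ i : Fin (n + 1), ∑ s : Option (Fin n), ((-1 : ℂ) ^ (n - (i : ℕ)) * weight i s) •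
        toUnordered 𝒱 τ n (resid 𝒱 i s B) := by
    intro B
    rw [diff_apply, map_sum]
    refine Finset.sum_congr rfl fun i _ => ?_
    rw [map_sum]
    exact Finset.sum_congr rfl fun s _ => LinearMap.map_smul _ _ _
  have h1 : toUnordered 𝒱 τ n (diff 𝒱 τ n (permTilde V τ (Equiv.swap j.castSucc j.succ) A)) =
      ∑ i : Fin (n + 1), ∑ s : Option (Fin n), ((-1 : ℂ) ^ (n - (i : ℕ)) *
        weight (Equiv.swap j.castSucc j.succ i) (s.map (σ' i))) •
          toUnordered 𝒱 τ n (resid 𝒱 i s A) := by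
    rw [hdiff, ← Equiv.sum_comp (Equiv.swap j.castSucc j.succ)]
    refine Finset.sum_congr rfl fun i _ => ?_
    rw [← Equiv.sum_comp (Equiv.optionCongr (σ' i))]
    refine Finset.sum_congr rfl fun s _ => ?_
    rw [Equiv.optionCongr_apply, resid_permTilde 𝒱 rfl (hσ i), LinearMap.map_smul,
      toUnordered_permTilde, smul_smul, ← hsign i]
    congr 1
    ring
  rw [h1, hdiff, ← sub_eq_zero, ← Finset.sum_sub_distrib]
  have h2 : ∀ i : Fin (n + 1), ∀ s : Option (Fin n), (((-1 : ℂ) ^ (n - (i : ℕ)) *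
        weight (Equiv.swap j.castSucc j.succ i) (s.map (σ' i))) •
          toUnordered 𝒱 τ n (resid 𝒱 i s A) -
        ((-1 : ℂ) ^ (n - (i : ℕ)) * weight i s) • toUnordered 𝒱 τ n (resid 𝒱 i s A)) =
      ((-1 : ℂ) ^ (n - (i : ℕ)) * (weight (Equiv.swap j.castSucc j.succ i) (s.map (σ' i)) -
        weight i s)) • toUnordered 𝒱 τ n (resid 𝒱 i s A) := fun i s => by
    rw [← sub_smul, mul_sub]
  simp only [← Finset.sum_sub_distrib, h2]
  have hne : j.castSucc ≠ j.succ := (Fin.castSucc_lt_succ).ne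
  have hl : j.castSucc.succAbove j = j.succ := castSucc_succAbove_self j
  have hr : j.succ.succAbove j = j.castSucc := succ_succAbove_self j
  have w1 : weight j.castSucc (some j) = 1 := by
    rw [weight, Option.elim_some, hl, if_pos Fin.castSucc_lt_succ]
  have w2 : weight j.succ (some j) = 0 := by
    rw [weight, Option.elim_some, hr, if_neg (not_lt_of_gt Fin.castSucc_lt_succ)]
  have w3 : weight (Equiv.swap j.castSucc j.succ j.castSucc)
      ((some j).map (σ' j.castSucc)) = 0 := by
    rw [Option.map_some, weight, Option.elim_some, ← hσ, hl, Equiv.swap_apply_left,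
      Equiv.swap_apply_right, if_neg (not_lt_of_gt Fin.castSucc_lt_succ)]
  have w4 : weight (Equiv.swap j.castSucc j.succ j.succ) ((some j).map (σ' j.succ)) = 1 := by
    rw [Option.map_some, weight, Option.elim_some, ← hσ, hr, Equiv.swap_apply_left,
      Equiv.swap_apply_right, if_pos Fin.castSucc_lt_succ]
  rw [Finset.sum_eq_add j.castSucc j.succ hne, Finset.sum_eq_single (some j),
    Finset.sum_eq_single (some j), w1, w2, w3, w4]
  -- The surviving terms have weight changes -1 and +1, position signs that are opposite, and
  -- residues that are opposite by `toUnordered_resid_succ`.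
  · obtain ⟨m, rfl⟩ : ∃ m, n = m + 1 := ⟨n - 1, by have := j.2; omega⟩
    rw [toUnordered_resid_succ, Fin.val_castSucc, Fin.val_succ,
      show m + 1 - (j : ℕ) = (m + 1 - (j + 1)) + 1 by omega, pow_succ, smul_neg,
      ← sub_eq_add_neg, sub_eq_zero]
    congr 1
    ring
  · intro s _ hs
    rw [weight_swap (hσ _) s (fun h => hs h.2) (fun h => hs h.2), sub_self, mul_zero, zero_smul]
  · exact fun h => absurd (Finset.mem_univ _) h
  · intro s _ hs
    rw [weight_swap (hσ _) s (fun h => hs h.2) (fun h => hs h.2), sub_self, mul_zero, zero_smul]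
  · exact fun h => absurd (Finset.mem_univ _) h
  · intro i _ hi
    refine Finset.sum_eq_zero fun s _ => ?_
    rw [weight_swap (hσ _) s (fun h => hi.1 h.1) (fun h => hi.2 h.1), sub_self, mul_zero, zero_smul]
  · exact fun h => absurd (Finset.mem_univ _) h
  · exact fun h => absurd (Finset.mem_univ _) h

/-- The permutations with this property for all chains form a submonoid, and adjacent transpositions
generate the symmetric group as a monoid. -/
lemma toUnordered_diff_permTilde (σ : Equiv.Perm (Fin (n + 1))) (A : CTilde V τ (n + 1)) :
    toUnordered 𝒱 τ n (diff 𝒱 τ n (permTilde V τ σ A)) = toUnordered 𝒱 τ n (diff 𝒱 τ n A) := by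
  let S : Submonoid (Equiv.Perm (Fin (n + 1))) :=
    { carrier := {σ | ∀ A : CTilde V τ (n + 1), toUnordered 𝒱 τ n (diff 𝒱 τ n (permTilde V τ σ A)) =
        toUnordered 𝒱 τ n (diff 𝒱 τ n A)}
      one_mem' := fun A => by
        rw [show permTilde V τ (1 : Equiv.Perm (Fin (n + 1))) = 1 from (repTilde V τ (n + 1)).map_one]
        rfl
      mul_mem' := fun {σ ρ} hσ hρ A => by
        rw [show permTilde V τ (σ * ρ) = permTilde V τ σ * permTilde V τ ρ from
          (repTilde V τ (n + 1)).map_mul σ ρ, Module.End.mul_apply, hσ, hρ] }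
  have hS : (⊤ : Submonoid (Equiv.Perm (Fin (n + 1)))) ≤ S := by
    rw [← Equiv.Perm.mclosure_swap_castSucc_succ, Submonoid.closure_le]
    rintro _ ⟨j, rfl⟩ A
    exact toUnordered_diff_swap 𝒱 j A
  exact hS (Submonoid.mem_top σ) A

/-- The differential `Cₙ₊₁ → Cₙ`. -/
def chainDiff (τ : ℍ) (n : ℕ) : Chain 𝒱 τ (n + 1) →ₗ[ℂ] Chain 𝒱 τ n :=
  (totalDerivs 𝒱 τ (n + 1)).mapQ (totalDerivs 𝒱 τ n) (diff 𝒱 τ n) (totalDerivs_le_comap_diff 𝒱 n)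

lemma chainDiff_comp_chainDiff (τ : ℍ) (n : ℕ) :
    chainDiff 𝒱 τ n ∘ₗ chainDiff 𝒱 τ (n + 1) = 0 := by
  refine Submodule.linearMap_qext _ (LinearMap.ext fun A => ?_)
  exact (congrArg (totalDerivs 𝒱 τ n).mkQ (diff_diff 𝒱 A)).trans (map_zero _)

lemma mk_comp_chainDiff_comp_rep (σ : Equiv.Perm (Fin (n + 1))) :
    (Representation.Coinvariants.mk (rep 𝒱 τ n) ∘ₗ chainDiff 𝒱 τ n) ∘ₗ rep 𝒱 τ (n + 1) σ =
      Representation.Coinvariants.mk (rep 𝒱 τ n) ∘ₗ chainDiff 𝒱 τ n :=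
  Submodule.linearMap_qext _ (LinearMap.ext fun A => toUnordered_diff_permTilde 𝒱 σ A)

/-- The differential `Qₙ₊₁ → Qₙ`. -/
def unorderedDiff (τ : ℍ) (n : ℕ) : Unordered 𝒱 τ (n + 1) →ₗ[ℂ] Unordered 𝒱 τ n :=
  Representation.Coinvariants.lift (rep 𝒱 τ (n + 1))
    (Representation.Coinvariants.mk (rep 𝒱 τ n) ∘ₗ chainDiff 𝒱 τ n) (mk_comp_chainDiff_comp_rep 𝒱)

lemma unorderedDiff_comp_unorderedDiff (τ : ℍ) (n : ℕ) :
    unorderedDiff 𝒱 τ n ∘ₗ unorderedDiff 𝒱 τ (n + 1) = 0 := by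
  refine Representation.Coinvariants.hom_ext (LinearMap.ext fun A => ?_)
  exact (congrArg (Representation.Coinvariants.mk (rep 𝒱 τ n))
    (LinearMap.congr_fun (chainDiff_comp_chainDiff 𝒱 τ n) A)).trans (map_zero _)

end Coinvariance
end ChiralHomology

theorem mainTheorem8 {V : Type*} [AddCommGroup V] [Module ℂ V]
    (𝒱 : ChiralHomology.GradedVertexAlgebra V) (τ : UpperHalfPlane) :
    (∀ (n : ℕ) (f : ChiralHomology.Gam τ (n + 1)), ChiralHomology.HasLaurentExpansions τ f) ∧
    (∀ n : ℕ, ∃! D : ChiralHomology.CTilde V τ (n + 1) →ₗ[ℂ] ChiralHomology.CTilde V τ n,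
      ChiralHomology.IsDifferential 𝒱 τ D) ∧
    ∀ D : ∀ n : ℕ, ChiralHomology.CTilde V τ (n + 1) →ₗ[ℂ] ChiralHomology.CTilde V τ n,
      (∀ n, ChiralHomology.IsDifferential 𝒱 τ (D n)) →
      ∃ d : ∀ n : ℕ, ChiralHomology.Chain 𝒱 τ (n + 1) →ₗ[ℂ] ChiralHomology.Chain 𝒱 τ n,
        (∀ n, d n ∘ₗ (ChiralHomology.totalDerivs 𝒱 τ (n + 1)).mkQ =
          (ChiralHomology.totalDerivs 𝒱 τ n).mkQ ∘ₗ D n) ∧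
        (∀ n, d n ∘ₗ d (n + 1) = 0) ∧
        ∃ dQ : ∀ n : ℕ,
            ChiralHomology.Unordered 𝒱 τ (n + 1) →ₗ[ℂ] ChiralHomology.Unordered 𝒱 τ n,
          (∀ n, dQ n ∘ₗ Representation.Coinvariants.mk (ChiralHomology.rep 𝒱 τ (n + 1)) =
            Representation.Coinvariants.mk (ChiralHomology.rep 𝒱 τ n) ∘ₗ d n) ∧
          ∀ n, dQ n ∘ₗ dQ (n + 1) = 0 := by
  refine ⟨fun n f => ChiralHomology.hasLaurentExpansions f, fun n => ⟨ChiralHomology.diff 𝒱 τ n,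
    ChiralHomology.isDifferential_diff 𝒱, fun D hD => hD.eq_diff⟩, fun D hD => ?_⟩
  obtain rfl : D = fun n => ChiralHomology.diff 𝒱 τ n := funext fun n => (hD n).eq_diff
  exact ⟨fun n => ChiralHomology.chainDiff 𝒱 τ n, fun n => rfl,
    fun n => ChiralHomology.chainDiff_comp_chainDiff 𝒱 τ n,
    fun n => ChiralHomology.unorderedDiff 𝒱 τ n, fun n => rfl,
    fun n => ChiralHomology.unorderedDiff_comp_unorderedDiff 𝒱 τ n⟩

end
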